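/- **Setting.** Let $V$ be a separable real Hilbert space, compactly (linearly, continuously, injectively) embedded in a real Banach space $Y$, and regard $\mathcal M=V$ as a manifold with metric $g_y(v,w)=g^c_y(v,w)+Q(v,w)$ ($y\in Y$, $v,w\in V$). The metric is *admissible*: $g^c$ maps $Y$ into the bounded bilinear forms on $Y$ (with the norm $\sup_{\|v\|_Y,\|w\|_Y\le1}|b(v,w)|$), $g^c_y$ is symmetric on $V$, $g^c_y(v,v)\le C^*\|v\|_Y^2$, and $g^c$ is twice differentiable with bounded first and second derivatives; $Q$ is a bounded symmetric positive semi-definite bilinear form on $V$; and $g_y(v,v)\ge c^*\|v\|_V^2$ for some $c^*>0$ and all $y\in Y$, $v\in V$. Let $\mathrm{dist}$ be the Riemannian distance of $g$ on $V$ (infimum of lengths of $C^1$ curves). Let $\mathcal W:V\times V\to[0,\infty)$ be *admissible*: $\mathcal W[y,\tilde y]=\mathcal W^c[y,\tilde y]+Q(y-\tilde y,y-\tilde y)$ with $\mathcal W^c\ge0$, where (i) there are $\varepsilon,C>0$ with $|\mathcal W[y,\tilde y]-\mathrm{dist}^2(y,\tilde y)|\le C\,\mathrm{dist}^3(y,\tilde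 y)$ whenever $\mathrm{dist}(y,\tilde y)\le\varepsilon$; (ii) $\mathcal W^c$ is four times continuously differentiable on $V\times V$, its derivatives of order $0,\dots,4$ being bounded on bounded sets; (iii) $\mathcal W^c$ is sequentially continuous for weak convergence in $V\times V$; (iv) $\mathcal W[y,\tilde y]\ge\gamma(\|y-\tilde y\|_V)$ for a strictly increasing continuous $\gamma$ on $[0,\infty)$ with $\gamma(0)=0$ and $\gamma(d)\to\infty$ as $d\to\infty$. Let $\sigma>0$, $I\ge1$, $0\le t_1<\dots<t_I\le1$, $\bar y_1,\dots,\bar y_I\in V$, and fix one of the boundary conditions: *natural* (nothing is imposed), *Hermite* ($\dot y(0)=v_0$, $\dot y(1)=v_1$ for given $v_0,v_1\in V$; here $t_1=0$ and $t_I=1$), *periodic* ($y(0)=y(1)$, $\dot y(0)=\dot y(1)$; here $t_1\ne0$ or $t_I\ne1$). **Continuous functional.** Define $\Gamma_y(v,w)\in V$ by $2g_y(\Gamma_y(v,w),z)=(D_yg_y)(w)(v,z)-(D_yg_y)(z)(v,w)+(D_yg_y)(v)(w,z)$ for all $z\in V$. For $y\in W^{2,2}((0,1);V)$ let $\frac{D}{dt}\dot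 y=\ddot y+\Gamma_y(\dot y,\dot y)$ and $$\mathcal F^\sigma[y]=\int_0^1 g_y\big(\tfrac{D}{dt}\dot y,\tfrac{D}{dt}\dot y\big)\,dt+\sigma\int_0^1 g_y(\dot y,\dot y)\,dt ,$$ and let $\mathcal I[y]=0$ if $y(t_i)=\bar y_i$ for all $i$ and $y$ satisfies the boundary condition, $\mathcal I[y]=\infty$ otherwise. **Discrete functionals.** Let $K\ge1$ be an integer such that all $Kt_i$ are integers, $\tau=1/K$ and $t^{s}=s\tau$. Put $\widehat K=K-1$ for natural and Hermite conditions, and $\widehat K=K$ and $y_{K+1}:=y_1$ for periodic ones. For each $(y_0,\dots,y_K)\in V^{K+1}$ choose (in an arbitrary but fixed way) $\tilde y_k\in\operatorname{argmin}_{y\in V}\big(\mathcal W[y_{k-1},y]+\mathcal W[y,y_{k+1}]\big)$, $k=1,\dots,\widehat K$, and set $$\mathbf F^{\sigma,K}[y_0,\dots,y_K]=4K^3\sum_{k=1}^{\widehat K}\mathcal W[y_k,\tilde y_k]+\sigma K\sum_{k=1}^K\mathcal W[y_{k-1},y_k].$$ Let $\mathbf I^K[y_0,\dots,y_K]=0$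 if $y_{Kt_i}=\bar y_i$ for all $i$ and the discrete boundary condition holds (natural: none; Hermite: $K(y_1-y_0)=v_0$ and $K(y_K-y_{K-1})=v_1$; periodic: $y_0=y_K$), and $\mathbf I^K=\infty$ otherwise. Let $\eta_{(y_0,\dots,y_K)}:[0,1]\to V$ be given on $[t^{k-1/2},t^{k+1/2}]$ by $$\tfrac{y_{k-1}+y_k}2+(y_k-y_{k-1})\tfrac{t-t^{k-1/2}}\tau+(y_{k+1}-2y_k+y_{k-1})\tfrac{(t-t^{k-1/2})^2}{2\tau^2},$$ where for natural and Hermite conditions $k=1,\dots,K-1$ and $\eta$ is affine on $[0,t^{1/2}]$ (equal to $y_0+(y_1-y_0)t/\tau$) and on $[t^{K-1/2},1]$ (equal to $y_{K-1}+(y_K-y_{K-1})(t-t^{K-1})/\tau$), while for periodic conditions $k=1,\dots,K$ and the last interval is understood modulo $1$, i.e. as $[t^{K-1/2},1]\cup[0,t^{1/2}]$. For $y\in W^{2,2}((0,1);V)$ let $\mathcal F^{\sigma,K}[y]=\mathbf F^{\sigma,K}[y_0,\dots,y_K]$ and $\mathcal I^K[y]=\mathbf I^K[y_0,\dots,y_K]$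 if $y=\eta_{(y_0,\dots,y_K)}$ for some $(y_0,\dots,y_K)\in V^{K+1}$, and $\mathcal F^{\sigma,K}[y]=\mathcal I^K[y]=\infty$ otherwise. **Theorem (Equicoercivity).** Let $K$ run through a sequence of positive integers tending to infinity such that all $Kt_i$ are integers. Then: 1. Any sequence $y^K$ in $W^{2,2}((0,1);V)$ for which $\mathcal F^{\sigma,K}[y^K]+\mathcal I^K[y^K]$ is uniformly bounded contains a subsequence converging weakly in $W^{2,2}((0,1);V)$. 2. Consequently, any sequence $y^K$ of minimizers of $\mathcal F^{\sigma,K}+\mathcal I^K$ over $W^{2,2}((0,1);V)$ contains a subsequence converging weakly in $W^{2,2}((0,1);V)$ to a minimizer of $\mathcal F^\sigma+\mathcal I$ over $W^{2,2}((0,1);V)$. -/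

import Mathlib

set_option maxSynthPendingDepth 3

open MeasureTheory Set Filter Topology
open scoped ENNReal ContDiff

namespace RiemSpline

noncomputable section

/-! ### Weak convergence and the Sobolev space `W^{2,2}((0,1);V)` -/

/-- Weak convergence of a sequence in a real normed space. -/
def WeaklyConverges {E : Type*} [NormedAddCommGroup E] [NormedSpace ℝ E]
    (u : ℕ → E) (l : E) : Prop :=
  ∀ f : E →L[ℝ] ℝ, Tendsto (fun n => f (u n)) atTop (𝓝 (f l))

/-- Lebesgue measure on the open unit interval. -/
abbrev unitMeasure : Measure ℝ := volume.restrict (Ioo (0 : ℝ) 1)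

/-- The Bochner space `L²((0,1);V)`. -/
abbrev L2 (V : Type*) [NormedAddCommGroup V] : Type _ := Lp V 2 unitMeasure

/-- `v` is the weak derivative of `u` on `(0,1)`. -/
def IsWeakDeriv {V : Type*} [NormedAddCommGroup V] [NormedSpace ℝ V] (u v : L2 V) : Prop :=
  ∀ φ : ℝ → ℝ, ContDiff ℝ ∞ φ → HasCompactSupport φ → tsupport φ ⊆ Ioo (0 : ℝ) 1 →
    ∫ s, deriv φ s • u s ∂unitMeasure = - ∫ s, φ s • v s ∂unitMeasure

theorem integrable_smul_L2 {V : Type*} [NormedAddCommGroup V] [NormedSpace ℝ V]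
    {φ : ℝ → ℝ} (hφ : Continuous φ) (hc : HasCompactSupport φ) (u : L2 V) :
    Integrable (fun s => φ s • u s) unitMeasure := by
  have hu : Integrable (u : ℝ → V) unitMeasure :=
    (Lp.memLp u).integrable (by norm_num)
  obtain ⟨C, hC⟩ := hφ.bounded_above_of_compact_support hc
  exact hu.bdd_smul C hφ.aestronglyMeasurable (Eventually.of_forall hC)

theorem IsWeakDeriv.add {V : Type*} [NormedAddCommGroup V] [NormedSpace ℝ V]
    {u v u' v' : L2 V} (h : IsWeakDeriv u v) (h' : IsWeakDeriv u' v') :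
    IsWeakDeriv (u + u') (v + v') := by
  intro φ h1 h2 h3
  have hd : Continuous (deriv φ) := h1.continuous_deriv (by simp)
  have e1 : ∫ s, deriv φ s • (u + u' : L2 V) s ∂unitMeasure
      = ∫ s, (deriv φ s • u s + deriv φ s • u' s) ∂unitMeasure := by
    refine integral_congr_ae ?_
    filter_upwards [Lp.coeFn_add u u'] with s hs
    rw [hs, Pi.add_apply, smul_add]
  have e2 : ∫ s, φ s • (v + v' : L2 V) s ∂unitMeasure
      = ∫ s, (φ s • v s + φ s • v' s) ∂unitMeasure := by
    refine integral_congr_ae ?_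
    filter_upwards [Lp.coeFn_add v v'] with s hs
    rw [hs, Pi.add_apply, smul_add]
  rw [e1, e2,
    integral_add (integrable_smul_L2 hd h2.deriv u) (integrable_smul_L2 hd h2.deriv u'),
    integral_add (integrable_smul_L2 h1.continuous h2 v) (integrable_smul_L2 h1.continuous h2 v'),
    h φ h1 h2 h3, h' φ h1 h2 h3]
  abel

theorem IsWeakDeriv.smul {V : Type*} [NormedAddCommGroup V] [NormedSpace ℝ V]
    {u v : L2 V} (c : ℝ) (h : IsWeakDeriv u v) : IsWeakDeriv (c • u) (c • v) := by
  intro φ h1 h2 h3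
  have e1 : ∫ s, deriv φ s • (c • u : L2 V) s ∂unitMeasure
      = ∫ s, c • (deriv φ s • u s) ∂unitMeasure := by
    refine integral_congr_ae ?_
    filter_upwards [Lp.coeFn_smul c u] with s hs
    rw [hs, Pi.smul_apply, smul_comm]
  have e2 : ∫ s, φ s • (c • v : L2 V) s ∂unitMeasure
      = ∫ s, c • (φ s • v s) ∂unitMeasure := by
    refine integral_congr_ae ?_
    filter_upwards [Lp.coeFn_smul c v] with s hs
    rw [hs, Pi.smul_apply, smul_comm]
  rw [e1, e2, integral_smul, integral_smul, h φ h1 h2 h3, smul_neg]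

theorem IsWeakDeriv.zero {V : Type*} [NormedAddCommGroup V] [NormedSpace ℝ V] :
    IsWeakDeriv (0 : L2 V) 0 := by
  intro φ _ _ _
  have e : ∀ ψ : ℝ → ℝ, ∫ s, ψ s • (0 : L2 V) s ∂unitMeasure = 0 := by
    intro ψ
    have : ∫ s, ψ s • (0 : L2 V) s ∂unitMeasure = ∫ _, (0 : V) ∂unitMeasure := by
      refine integral_congr_ae ?_
      filter_upwards [Lp.coeFn_zero V 2 unitMeasure] with s hs
      rw [hs, Pi.zero_apply, smul_zero]
    rw [this, integral_zero]
  rw [e, e, neg_zero]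

/-- The Sobolev space `W^{2,2}((0,1);V)`: triples `(u, u', u'')` of elements of `L²((0,1);V)`
in which each entry is the weak derivative of the previous one, with the norm
`(‖u‖² + ‖u'‖² + ‖u''‖²)^{1/2}`. -/
def W22 (V : Type*) [NormedAddCommGroup V] [NormedSpace ℝ V] :
    Submodule ℝ (PiLp 2 (fun _ : Fin 3 => L2 V)) where
  carrier := {u | IsWeakDeriv (u 0) (u 1) ∧ IsWeakDeriv (u 1) (u 2)}
  add_mem' h h' := ⟨h.1.add h'.1, h.2.add h'.2⟩
  zero_mem' := ⟨IsWeakDeriv.zero, IsWeakDeriv.zero⟩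
  smul_mem' c _ h := ⟨h.1.smul c, h.2.smul c⟩

section Curves

variable {V : Type*} [NormedAddCommGroup V] [NormedSpace ℝ V]

/-- The curve (as an a.e. class). -/
def pos (u : W22 V) : L2 V := u.1 0

/-- The weak velocity `ẏ`. -/
def vel (u : W22 V) : L2 V := u.1 1

/-- The weak second derivative `ÿ`. -/
def acc (u : W22 V) : L2 V := u.1 2

/-- `c` is the continuous representative on `[0,1]` of the a.e. class `f`. -/
def IsContRep (f : L2 V) (c : ℝ → V) : Prop :=
  ContinuousOn c (Icc (0 : ℝ) 1) ∧ f =ᵐ[unitMeasure] c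

/-! ### Interpolation data and boundary conditions -/

/-- The three kinds of boundary conditions. -/
inductive BoundaryCondition (V : Type*) where
  | natural : BoundaryCondition V
  | hermite (v₀ v₁ : V) : BoundaryCondition V
  | periodic : BoundaryCondition V

/-- Standing requirement relating boundary condition and interpolation times:
Hermite conditions come with `t₁ = 0` and `t_I = 1`, periodic ones with `t₁ ≠ 0` or `t_I ≠ 1`. -/
def BoundaryCondition.Compatible {N : ℕ} (bc : BoundaryCondition V) (t : Fin (N + 1) → ℝ) :
    Prop :=
  match bc with
  | .natural => True
  | .hermite _ _ => t 0 = 0 ∧ t (Fin.last N) = 1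
  | .periodic => t 0 ≠ 0 ∨ t (Fin.last N) ≠ 1

/-- The boundary condition for a curve. The natural condition is the variational one: nothing
is imposed on the competitors. -/
def BoundaryCondition.Holds (bc : BoundaryCondition V) (u : W22 V) : Prop :=
  match bc with
  | .natural => True
  | .hermite v₀ v₁ => ∃ d, IsContRep (vel u) d ∧ d 0 = v₀ ∧ d 1 = v₁
  | .periodic => ∃ c d, IsContRep (pos u) c ∧ IsContRep (vel u) d ∧ c 0 = c 1 ∧ d 0 = d 1

/-- `y(t_i) = ȳ_i` for all `i`. -/
def Interpolates {ι : Type*} (t : ι → ℝ) (ybar : ι → V) (u : W22 V) : Prop :=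
  ∃ c, IsContRep (pos u) c ∧ ∀ i, c (t i) = ybar i

open Classical in
/-- Indicator functional of the constraints for curves. -/
def constraint {ι : Type*} (t : ι → ℝ) (ybar : ι → V) (bc : BoundaryCondition V)
    (u : W22 V) : ℝ≥0∞ :=
  if Interpolates t ybar u ∧ bc.Holds u then 0 else ⊤

/-! ### Discrete curves -/

/-- `y_k` for a discrete curve `(y_0, …, y_K)`, with the convention `y_{K+1} = y_1` (which is
only used for periodic boundary conditions). -/
def node {K : ℕ} (p : Fin (K + 1) → V) (k : ℕ) : V :=
  p (Fin.ofNat (K + 1) (if k ≤ K then k else k - K))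

/-- The number `K̂` of midpoint constraints. -/
def BoundaryCondition.numMid (bc : BoundaryCondition V) (K : ℕ) : ℕ :=
  match bc with
  | .natural => K - 1
  | .hermite _ _ => K - 1
  | .periodic => K

/-- The boundary condition for a discrete curve. -/
def BoundaryCondition.HoldsDiscrete (bc : BoundaryCondition V) {K : ℕ} (p : Fin (K + 1) → V) :
    Prop :=
  match bc with
  | .natural => True
  | .hermite v₀ v₁ =>
      (K : ℝ) • (node p 1 - node p 0) = v₀ ∧ (K : ℝ) • (node p K - node p (K - 1)) = v₁
  | .periodic => node p 0 = node p K

/-- `K` is a positive integer such that all `K t_i` are nonnegative integers. -/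
def CompatibleSteps {ι : Type*} (t : ι → ℝ) (K : ℕ) : Prop :=
  0 < K ∧ ∀ i, ∃ k : ℕ, (k : ℝ) = K * t i

/-- `y_{K t_i} = ȳ_i` for all `i`. -/
def InterpolatesDiscrete {ι : Type*} (t : ι → ℝ) (ybar : ι → V) {K : ℕ}
    (p : Fin (K + 1) → V) : Prop :=
  ∀ i, ∃ k : ℕ, k ≤ K ∧ (k : ℝ) = K * t i ∧ node p k = ybar i

open Classical in
/-- Indicator functional of the constraints for discrete curves. -/
def constraintDiscrete {ι : Type*} (t : ι → ℝ) (ybar : ι → V) (bc : BoundaryCondition V)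
    {K : ℕ} (p : Fin (K + 1) → V) : ℝ≥0∞ :=
  if InterpolatesDiscrete t ybar p ∧ bc.HoldsDiscrete p then 0 else ⊤

/-- The quadratic Hermite piece of the interpolation on `[t^{k-1/2}, t^{k+1/2}]`, in the local
variable `r = (t - t^{k-1/2}) / τ ∈ [0,1]`. -/
def hermitePiece {K : ℕ} (p : Fin (K + 1) → V) (k : ℕ) (r : ℝ) : V :=
  (1 / 2 : ℝ) • (node p (k - 1) + node p k) + r • (node p k - node p (k - 1))
    + (r ^ 2 / 2) • (node p (k + 1) - (2 : ℝ) • node p k + node p (k - 1))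

/-- The interpolating curve `η_{(y_0,…,y_K)}` without periodicity: affine on `[0, τ/2]` and
`[1 - τ/2, 1]`, Hermite pieces in between. -/
def etaOpen {K : ℕ} (p : Fin (K + 1) → V) (s : ℝ) : V :=
  if K * s ≤ 1 / 2 then node p 0 + (K * s) • (node p 1 - node p 0)
  else if K * s < K - 1 / 2 then
    hermitePiece p ⌊K * s + 1 / 2⌋₊ (K * s - ((⌊K * s + 1 / 2⌋₊ : ℝ) - 1 / 2))
  else node p (K - 1) + (K * s - (K - 1)) • (node p K - node p (K - 1))

/-- The interpolating curve for periodic boundary conditions: Hermite pieces `k = 1, …, K`, the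
last of which lives on `[0, τ/2] ∪ [1 - τ/2, 1]`. -/
def etaPeriodic {K : ℕ} (p : Fin (K + 1) → V) (s : ℝ) : V :=
  if K * s < 1 / 2 then hermitePiece p K (K * s + 1 / 2)
  else hermitePiece p ⌊K * s + 1 / 2⌋₊ (K * s - ((⌊K * s + 1 / 2⌋₊ : ℝ) - 1 / 2))

/-- The interpolating curve `η_{(y_0,…,y_K)}` belonging to a boundary condition. -/
def BoundaryCondition.eta (bc : BoundaryCondition V) {K : ℕ} (p : Fin (K + 1) → V) : ℝ → V :=
  match bc with
  | .natural => etaOpen p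
  | .hermite _ _ => etaOpen p
  | .periodic => etaPeriodic p

/-- The functional on curves induced by a functional on discrete curves: its value at
`y = η_{(y_0,…,y_K)}` is the value at `(y_0,…,y_K)`, and it is `∞` at all other curves. (The
interpolation is injective, so the infimum is over at most one discrete curve.) -/
def liftDiscrete (bc : BoundaryCondition V) {K : ℕ} (G : (Fin (K + 1) → V) → ℝ≥0∞)
    (u : W22 V) : ℝ≥0∞ :=
  ⨅ (p : Fin (K + 1) → V) (_ : pos u =ᵐ[unitMeasure] bc.eta p), G p

/-- `c` minimizes `y ↦ W[a,y] + W[y,b]`. -/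
def IsMidpoint (W : V → V → ℝ) (a b c : V) : Prop :=
  ∀ y, W a c + W c b ≤ W a y + W y b

/-- `m` chooses, for every discrete curve `(y_0,…,y_K)`, auxiliary points
`ỹ_k ∈ argmin_y (W[y_{k-1},y] + W[y,y_{k+1}])`, `k = 1, …, K̂`. -/
def IsMidpointChoice (bc : BoundaryCondition V) (W : V → V → ℝ)
    (m : (K : ℕ) → (Fin (K + 1) → V) → ℕ → V) : Prop :=
  ∀ (K : ℕ) (p : Fin (K + 1) → V), ∀ k ∈ Finset.Icc 1 (bc.numMid K),
    IsMidpoint W (node p (k - 1)) (node p (k + 1)) (m K p k)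

/-- The discrete path energy. -/
def pathEnergyDiscrete (W : V → V → ℝ) {K : ℕ} (p : Fin (K + 1) → V) : ℝ :=
  K * ∑ k ∈ Finset.Icc 1 K, W (node p (k - 1)) (node p k)

/-- The discrete spline energy, for given auxiliary points `mid k`. -/
def splineEnergyDiscrete (bc : BoundaryCondition V) (W : V → V → ℝ) {K : ℕ}
    (p : Fin (K + 1) → V) (mid : ℕ → V) : ℝ :=
  4 * K ^ 3 * ∑ k ∈ Finset.Icc 1 (bc.numMid K), W (node p k) (mid k)

/-- The discrete regularized spline energy, as a functional on discrete curves. -/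
def regSplineEnergyDiscrete (bc : BoundaryCondition V) (W : V → V → ℝ) (σ : ℝ)
    (m : (K : ℕ) → (Fin (K + 1) → V) → ℕ → V) (K : ℕ) (p : Fin (K + 1) → V) : ℝ≥0∞ :=
  ENNReal.ofReal (splineEnergyDiscrete bc W p (m K p) + σ * pathEnergyDiscrete W p)

/-- The discrete functional including the constraints, as a functional on `W^{2,2}((0,1);V)`. -/
def discreteFunctional {ι : Type*} (t : ι → ℝ) (ybar : ι → V) (bc : BoundaryCondition V)
    (W : V → V → ℝ) (σ : ℝ) (m : (K : ℕ) → (Fin (K + 1) → V) → ℕ → V) (K : ℕ) (u : W22 V) :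
    ℝ≥0∞ :=
  liftDiscrete bc (regSplineEnergyDiscrete bc W σ m K) u
    + liftDiscrete bc (constraintDiscrete (K := K) t ybar bc) u

end Curves

/-! ### Admissible metrics and energies -/

section Metric

variable {V Y : Type*} [NormedAddCommGroup V] [NormedSpace ℝ V] [NormedAddCommGroup Y]
  [NormedSpace ℝ Y]

/-- The metric `g_y(v,w) = g^c_y(v,w) + Q(v,w)`. -/
def metric (ι : V →L[ℝ] Y) (gc : Y → Y →L[ℝ] Y →L[ℝ] ℝ) (Q : V →L[ℝ] V →L[ℝ] ℝ)
    (y : Y) (v w : V) : ℝ :=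
  gc y (ι v) (ι w) + Q v w

/-- Admissibility of the metric; `ι` is the embedding of `V` into `Y`. Boundedness of the
bilinear form `Q` is part of its type. -/
structure IsAdmissibleMetric (ι : V →L[ℝ] Y) (gc : Y → Y →L[ℝ] Y →L[ℝ] ℝ)
    (Q : V →L[ℝ] V →L[ℝ] ℝ) : Prop where
  symm : ∀ y v w, gc y (ι v) (ι w) = gc y (ι w) (ι v)
  bdd : ∃ C : ℝ, ∀ y v, gc y (ι v) (ι v) ≤ C * ‖ι v‖ ^ 2
  diff : Differentiable ℝ gc
  diff_two : Differentiable ℝ (fderiv ℝ gc)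
  bdd_deriv : ∃ C : ℝ, ∀ y, ‖fderiv ℝ gc y‖ ≤ C
  bdd_deriv_two : ∃ C : ℝ, ∀ y, ‖fderiv ℝ (fderiv ℝ gc) y‖ ≤ C
  Q_symm : ∀ v w, Q v w = Q w v
  Q_nonneg : ∀ v, 0 ≤ Q v v
  coercive : ∃ c : ℝ, 0 < c ∧ ∀ y v, c * ‖v‖ ^ 2 ≤ metric ι gc Q y v v

/-- The Riemannian distance: infimum of the lengths of `C¹` curves. -/
def riemDist (ι : V →L[ℝ] Y) (gc : Y → Y →L[ℝ] Y →L[ℝ] ℝ) (Q : V →L[ℝ] V →L[ℝ] ℝ)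
    (a b : V) : ℝ :=
  sInf {ℓ | ∃ γ : ℝ → V, ContDiff ℝ 1 γ ∧ γ 0 = a ∧ γ 1 = b ∧
    ℓ = ∫ s in (0 : ℝ)..1, √(metric ι gc Q (ι (γ s)) (deriv γ s) (deriv γ s))}

/-- Admissibility of `W = W^c + Q(· - ·, · - ·)` with `W^c` real-valued. The field
`bdd_deriv` says that the `C⁴` norm of `W^c` is finite on bounded sets. -/
structure IsAdmissibleEnergy (ι : V →L[ℝ] Y) (gc : Y → Y →L[ℝ] Y →L[ℝ] ℝ)
    (Q : V →L[ℝ] V →L[ℝ] ℝ) (Wc : V × V → ℝ) (W : V → V → ℝ) : Prop where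
  decomp : ∀ y z, W y z = Wc (y, z) + Q (y - z) (y - z)
  nonneg : ∀ p, 0 ≤ Wc p
  approx : ∃ ε C : ℝ, 0 < ε ∧ 0 < C ∧ ∀ y z, riemDist ι gc Q y z ≤ ε →
    |W y z - riemDist ι gc Q y z ^ 2| ≤ C * riemDist ι gc Q y z ^ 3
  contDiff : ContDiff ℝ 4 Wc
  bdd_deriv : ∀ R : ℝ, ∃ C : ℝ, ∀ p : V × V, ‖p‖ ≤ R → ∀ k : ℕ, k ≤ 4 →
    ‖iteratedFDeriv ℝ k Wc p‖ ≤ C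
  weakCont : ∀ (y z : ℕ → V) (y₀ z₀ : V), WeaklyConverges y y₀ → WeaklyConverges z z₀ →
    Tendsto (fun j => Wc (y j, z j)) atTop (𝓝 (Wc (y₀, z₀)))
  coercive : ∃ γ : ℝ → ℝ, StrictMonoOn γ (Ici 0) ∧ ContinuousOn γ (Ici 0) ∧ γ 0 = 0 ∧
    Tendsto γ atTop atTop ∧ ∀ y z, γ ‖y - z‖ ≤ W y z

/-! ### Christoffel operator and continuous energies -/

/-- `G = Γ_y(v,w)`, i.e. `2 g_y(G,z) = (D g_y)(w)(v,z) - (D g_y)(z)(v,w) + (D g_y)(v)(w,z)` for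
all `z`. -/
def IsChristoffel (ι : V →L[ℝ] Y) (gc : Y → Y →L[ℝ] Y →L[ℝ] ℝ) (Q : V →L[ℝ] V →L[ℝ] ℝ)
    (y v w G : V) : Prop :=
  ∀ z, 2 * metric ι gc Q (ι y) G z =
    fderiv ℝ gc (ι y) (ι w) (ι v) (ι z) - fderiv ℝ gc (ι y) (ι z) (ι v) (ι w)
      + fderiv ℝ gc (ι y) (ι v) (ι w) (ι z)

/-- The Christoffel operator `Γ_y(v,w)`. -/
def christoffel (ι : V →L[ℝ] Y) (gc : Y → Y →L[ℝ] Y →L[ℝ] ℝ) (Q : V →L[ℝ] V →L[ℝ] ℝ)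
    (y v w : V) : V :=
  Classical.epsilon (IsChristoffel ι gc Q y v w)

/-- On a Hilbert space with an admissible metric the Christoffel operator exists and is
uniquely determined. -/
theorem isChristoffel_iff {H : Type*} [NormedAddCommGroup H] [InnerProductSpace ℝ H]
    [CompleteSpace H] {ι : H →L[ℝ] Y} {gc : Y → Y →L[ℝ] Y →L[ℝ] ℝ} {Q : H →L[ℝ] H →L[ℝ] ℝ}
    (hg : IsAdmissibleMetric ι gc Q) (y v w G : H) :
    IsChristoffel ι gc Q y v w G ↔ G = christoffel ι gc Q y v w := by
  obtain ⟨c, hc, hcoer⟩ := hg.coercive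
  -- the metric at `y` as a continuous bilinear form
  let B : H →L[ℝ] H →L[ℝ] ℝ :=
    ((ContinuousLinearMap.compL ℝ H Y ℝ).flip ι) ∘L ((gc (ι y)) ∘L ι) + Q
  have hB : ∀ a b, B a b = metric ι gc Q (ι y) a b := fun a b => rfl
  have hBc : IsCoercive B := ⟨c, hc, fun u => by
    have := hcoer (ι y) u
    rw [hB]; nlinarith [this]⟩
  -- the right-hand side as a continuous linear form in `z`
  let D := fderiv ℝ gc (ι y)
  let L : H →L[ℝ] ℝ := ((D (ι w) (ι v)) ∘L ι) - ((((D.flip (ι v)).flip (ι w))) ∘L ι)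
    + ((D (ι v) (ι w)) ∘L ι)
  have hex : ∃ G, IsChristoffel ι gc Q y v w G := by
    let r : H := (InnerProductSpace.toDual ℝ H).symm L
    refine ⟨(1 / 2 : ℝ) • hBc.continuousLinearEquivOfBilin.symm r, fun z => ?_⟩
    have h1 : B (hBc.continuousLinearEquivOfBilin.symm r) z = L z := by
      rw [← hBc.continuousLinearEquivOfBilin_apply, ContinuousLinearEquiv.apply_symm_apply]
      exact InnerProductSpace.toDual_symm_apply
    rw [← hB, map_smul, smul_apply, h1, smul_eq_mul]
    change 2 * (1 / 2 * L z) = L z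
    ring
  have hun : ∀ G₁ G₂, IsChristoffel ι gc Q y v w G₁ → IsChristoffel ι gc Q y v w G₂ →
      G₁ = G₂ := by
    intro G₁ G₂ h₁ h₂
    have h := (h₁ (G₁ - G₂)).trans (h₂ (G₁ - G₂)).symm
    have h0 : B (G₁ - G₂) (G₁ - G₂) = 0 := by
      have h4 : B (G₁ - G₂) = B G₁ - B G₂ := map_sub B G₁ G₂
      rw [h4, sub_apply, hB, hB]
      linarith
    have h2 := hcoer (ι y) (G₁ - G₂)
    rw [← hB, h0] at h2
    have h3 : ‖G₁ - G₂‖ ^ 2 = 0 := le_antisymm (by nlinarith [h2]) (sq_nonneg _)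
    exact sub_eq_zero.1 (norm_eq_zero.1 (pow_eq_zero_iff (two_ne_zero) |>.1 h3))
  have hs : IsChristoffel ι gc Q y v w (christoffel ι gc Q y v w) :=
    Classical.epsilon_spec hex
  exact ⟨fun h => hun _ _ h hs, fun h => h ▸ hs⟩

/-- The covariant derivative of the velocity, `D/dt ẏ = ÿ + Γ_y(ẏ,ẏ)`. -/
def covAcc (ι : V →L[ℝ] Y) (gc : Y → Y →L[ℝ] Y →L[ℝ] ℝ) (Q : V →L[ℝ] V →L[ℝ] ℝ)
    (u : W22 V) (s : ℝ) : V :=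
  acc u s + christoffel ι gc Q (pos u s) (vel u s) (vel u s)

/-- The path energy `∫₀¹ g_y(ẏ,ẏ) dt`. -/
def pathEnergy (ι : V →L[ℝ] Y) (gc : Y → Y →L[ℝ] Y →L[ℝ] ℝ) (Q : V →L[ℝ] V →L[ℝ] ℝ)
    (u : W22 V) : ℝ≥0∞ :=
  ∫⁻ s, ENNReal.ofReal (metric ι gc Q (ι (pos u s)) (vel u s) (vel u s)) ∂unitMeasure

/-- The spline energy `∫₀¹ g_y(D/dt ẏ, D/dt ẏ) dt`. -/
def splineEnergy (ι : V →L[ℝ] Y) (gc : Y → Y →L[ℝ] Y →L[ℝ] ℝ) (Q : V →L[ℝ] V →L[ℝ] ℝ)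
    (u : W22 V) : ℝ≥0∞ :=
  ∫⁻ s, ENNReal.ofReal
    (metric ι gc Q (ι (pos u s)) (covAcc ι gc Q u s) (covAcc ι gc Q u s)) ∂unitMeasure

/-- The regularized spline energy plus the indicator of the constraints. -/
def continuousFunctional {J : Type*} (ι : V →L[ℝ] Y) (gc : Y → Y →L[ℝ] Y →L[ℝ] ℝ)
    (Q : V →L[ℝ] V →L[ℝ] ℝ) (σ : ℝ) (t : J → ℝ) (ybar : J → V) (bc : BoundaryCondition V)
    (u : W22 V) : ℝ≥0∞ :=
  (splineEnergy ι gc Q u + ENNReal.ofReal σ * pathEnergy ι gc Q u) + constraint t ybar bc u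

end Metric

/-- `x` minimizes `F` over the whole space. -/
def IsMinimizer {X : Type*} (F : X → ℝ≥0∞) (x : X) : Prop := ∀ z, F x ≤ F z

end

end RiemSpline

namespace RiemSpline

/-! ### Uniform bounds for the metric -/

section MetricEstimates

/-! The proof combines a discrete a priori estimate with a Γ-convergence argument. Write `τ = 1/K`,
`v_k = K (y_k - y_{k-1})` and `A_k = K² (y_{k+1} - 2 y_k + y_{k-1})`.

Why the discrete spline energy approximates the continuous one: `W` equals `dist²`, hence the
metric, up to cubic terms. Therefore `Wc` and its gradient vanish on the diagonal and its Hessian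
there is `2 gc`. Differentiating this identity along the diagonal and using the symmetry of third
derivatives produces the Christoffel operator (`fderiv_three_christoffel`). The Euler-Lagrange
equation of a midpoint, expanded to second order, then yields `2 (ỹ_k - y_k) = τ² (A_k + Γ(v_k,
v_k))` up to `O(τ^{5/2})` (`exists_midpoint_expansion`), and `4K³ W[y_k, ỹ_k]` becomes `τ g(A_k + Γ,
A_k + Γ)` with errors that vanish after summation (`splineEnergyDiscrete_consistent`). The
half-integer power appears because `A_k` is only bounded in the mean square, so that a single `A_k`
may have size `√K`.

Why bounded energy gives compactness: the path energy bounds the mean of `‖v_k‖²`, and the spline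
energy bounds the mean of `‖A_k‖²` by a constant plus fourth powers of velocities, which are only
linear in `S = max ‖v_k‖²`. A discrete Gagliardo-Nirenberg inequality bounds `S` by a small multiple
of the mean of `‖A_k‖²` plus a constant, so everything can be absorbed (`exists_isBoundedDiscrete`).
A curve is coded by its initial position, initial velocity and acceleration (`sobolevOf`); these
data are bounded in a separable Hilbert space, and a weakly convergent subsequence exists.

Why limits of minimizers minimize: weak convergence of the data makes positions and velocities
converge weakly in `V` at every time, hence strongly in `Y` because the embedding is compact. The
metric depends on the position, and the Christoffel operator on position and velocity, only through
`Y`; so the nonlinear terms converge, and the energy is convex in what converges only weakly. This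
is the liminf inequality (`eventually_curveEnergy_le`). For the limsup inequality
(`eventually_le_curveEnergy`) a feasible curve is sampled on the grid, with two nodes shifted to
meet Hermite conditions exactly; its interpolations converge in norm. Since a feasible curve exists
(`exists_feasible`), the minimal values stay bounded, and comparing the two inequalities finishes
the proof (`exists_subseq_minimizers`). -/

theorem abs_apply₂_le {E F : Type*} [NormedAddCommGroup E] [NormedSpace ℝ E]
    [NormedAddCommGroup F] [NormedSpace ℝ F] (T : E →L[ℝ] F →L[ℝ] ℝ) (a : E) (b : F) :
    |T a b| ≤ ‖T‖ * ‖a‖ * ‖b‖ := by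
  rw [← Real.norm_eq_abs]
  exact T.le_opNorm₂ a b

theorem abs_apply₃_le {E F G : Type*} [NormedAddCommGroup E] [NormedSpace ℝ E]
    [NormedAddCommGroup F] [NormedSpace ℝ F] [NormedAddCommGroup G] [NormedSpace ℝ G]
    (T : E →L[ℝ] F →L[ℝ] G →L[ℝ] ℝ) (a : E) (b : F) (c : G) :
    |T a b c| ≤ ‖T‖ * ‖a‖ * ‖b‖ * ‖c‖ := by
  refine (abs_apply₂_le (T a) b c).trans ?_
  gcongr
  exact T.le_opNorm a

theorem tendsto_clm_apply {E F : Type*} [NormedAddCommGroup E] [NormedSpace ℝ E]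
    [NormedAddCommGroup F] [NormedSpace ℝ F] {α : Type*} {l : Filter α} {T : α → E →L[ℝ] F}
    {T₀ : E →L[ℝ] F} {x : α → E} {x₀ : E} (hT : Tendsto T l (𝓝 T₀)) (hx : Tendsto x l (𝓝 x₀)) :
    Tendsto (fun i => T i (x i)) l (𝓝 (T₀ x₀)) :=
  ((isBoundedBilinearMap_apply (𝕜 := ℝ) (E := E) (F := F)).continuous.tendsto (T₀, x₀)).comp
    (hT.prodMk_nhds hx)

variable {V Y : Type*} [NormedAddCommGroup V] [NormedSpace ℝ V]
  [NormedAddCommGroup Y] [NormedSpace ℝ Y]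
  {ι : V →L[ℝ] Y} {gc : Y → Y →L[ℝ] Y →L[ℝ] ℝ} {Q : V →L[ℝ] V →L[ℝ] ℝ}

theorem metric_sub_left (y : Y) (u v w : V) :
    metric ι gc Q y (u - v) w = metric ι gc Q y u w - metric ι gc Q y v w := by
  simp [metric]; ring

theorem metric_sub_right (y : Y) (u v w : V) :
    metric ι gc Q y u (v - w) = metric ι gc Q y u v - metric ι gc Q y u w := by
  simp [metric]; ring

theorem metric_add_left (y : Y) (u v w : V) :
    metric ι gc Q y (u + v) w = metric ι gc Q y u w + metric ι gc Q y v w := by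
  simp [metric]; ring

theorem metric_add_right (y : Y) (u v w : V) :
    metric ι gc Q y u (v + w) = metric ι gc Q y u v + metric ι gc Q y u w := by
  simp [metric]; ring

theorem metric_smul_left (y : Y) (r : ℝ) (v w : V) :
    metric ι gc Q y (r • v) w = r * metric ι gc Q y v w := by
  simp [metric]; ring

theorem metric_smul_right (y : Y) (r : ℝ) (v w : V) :
    metric ι gc Q y v (r • w) = r * metric ι gc Q y v w := by
  simp [metric]; ring

variable (ι gc Q) in
/-- The metric at `y` as a continuous bilinear form on `V`. -/
noncomputable def metricForm (y : Y) : V →L[ℝ] V →L[ℝ] ℝ :=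
  ((ContinuousLinearMap.compL ℝ V Y ℝ).flip ι) ∘L ((gc y) ∘L ι) + Q

@[simp] theorem metricForm_apply (y : Y) (v w : V) :
    metricForm ι gc Q y v w = metric ι gc Q y v w := rfl

theorem continuous_metricForm (hgc : Continuous gc) : Continuous (metricForm ι gc Q) := by
  unfold metricForm
  fun_prop

namespace IsAdmissibleMetric

variable (hg : IsAdmissibleMetric ι gc Q)
include hg

theorem metric_comm (y : Y) (v w : V) : metric ι gc Q y v w = metric ι gc Q y w v := by
  simp only [metric, hg.symm y v w, hg.Q_symm v w]

theorem metric_self_nonneg (y : Y) (v : V) : 0 ≤ metric ι gc Q y v v := by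
  obtain ⟨c, hc, h⟩ := hg.coercive
  exact (by positivity : 0 ≤ c * ‖v‖ ^ 2).trans (h y v)

/-- Cauchy-Schwarz from nonnegativity on the diagonal alone: the polynomial `r ↦ g(v + r w, v + r
w)` is nonnegative, so its discriminant is not positive. -/
theorem metric_sq_le (y : Y) (v w : V) :
    metric ι gc Q y v w ^ 2 ≤ metric ι gc Q y v v * metric ι gc Q y w w := by
  have h : ∀ r : ℝ, 0 ≤ metric ι gc Q y w w * (r * r) + (2 * metric ι gc Q y v w) * r
      + metric ι gc Q y v v := fun r => by
    have := hg.metric_self_nonneg y (v + r • w)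
    rw [metric_add_left, metric_add_right, metric_add_right, metric_smul_left, metric_smul_left,
      metric_smul_right, metric_smul_right, hg.metric_comm y w v] at this
    linarith
  have := discrim_le_zero h
  rw [discrim] at this
  nlinarith

/-- Uniform coercivity, boundedness and Lipschitz constants of the metric. -/
theorem exists_bounds : ∃ c Λ L : ℝ, 0 < c ∧ 0 < Λ ∧ 0 < L ∧
    (∀ y v, c * ‖v‖ ^ 2 ≤ metric ι gc Q y v v) ∧
    (∀ y v w, |metric ι gc Q y v w| ≤ Λ * ‖v‖ * ‖w‖) ∧
    (∀ y y' v w, |metric ι gc Q y v w - metric ι gc Q y' v w| ≤ L * ‖y - y'‖ * ‖v‖ * ‖w‖) ∧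
    (∀ y, ‖fderiv ℝ gc y‖ ≤ L) ∧ (∀ y y', ‖fderiv ℝ gc y - fderiv ℝ gc y'‖ ≤ L * ‖y - y'‖) ∧
    ‖ι‖ ≤ L := by
  obtain ⟨c, hc, hcoer⟩ := hg.coercive
  obtain ⟨C, hC⟩ := hg.bdd
  obtain ⟨L₁, hL₁⟩ := hg.bdd_deriv
  obtain ⟨L₂, hL₂⟩ := hg.bdd_deriv_two
  have hL₁0 : 0 ≤ L₁ := (norm_nonneg _).trans (hL₁ 0)
  have hL₂0 : 0 ≤ L₂ := (norm_nonneg (fderiv ℝ (fderiv ℝ gc) 0)).trans (hL₂ 0)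
  -- `|C|` because the sign of the constant in `hg.bdd` is not prescribed; the summand `1` makes `Λ`
  -- positive.
  set Λ : ℝ := |C| * ‖ι‖ ^ 2 + ‖Q‖ + 1 with hΛ
  have hΛ0 : 0 < Λ := by positivity
  have hup : ∀ y v, metric ι gc Q y v v ≤ Λ * ‖v‖ ^ 2 := fun y v => by
    have h1 : gc y (ι v) (ι v) ≤ |C| * ‖ι‖ ^ 2 * ‖v‖ ^ 2 := by
      refine (hC y v).trans ?_
      calc C * ‖ι v‖ ^ 2 ≤ |C| * (‖ι‖ * ‖v‖) ^ 2 := by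
            gcongr
            · exact le_abs_self C
            · exact ι.le_opNorm v
        _ = _ := by ring
    have h2 : Q v v ≤ ‖Q‖ * ‖v‖ ^ 2 := by
      refine (le_abs_self _).trans ((abs_apply₂_le Q v v).trans (le_of_eq (by ring)))
    simp only [metric, hΛ]
    nlinarith [sq_nonneg ‖v‖]
  have hlip : ∀ y y', ‖gc y - gc y'‖ ≤ L₁ * ‖y - y'‖ := fun y y' =>
    convex_univ.norm_image_sub_le_of_norm_fderiv_le (fun z _ => hg.diff z) (fun z _ => hL₁ z)
      (mem_univ y') (mem_univ y)
  have hlip2 : ∀ y y', ‖fderiv ℝ gc y - fderiv ℝ gc y'‖ ≤ L₂ * ‖y - y'‖ := fun y y' =>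
    convex_univ.norm_image_sub_le_of_norm_fderiv_le (fun z _ => hg.diff_two z)
      (fun z _ => hL₂ z) (mem_univ y') (mem_univ y)
  -- A single `L` dominates both Lipschitz constants, the derivative bound and `‖ι‖`, so later
  -- estimates only carry powers of `L`.
  refine ⟨c, Λ, L₁ * ‖ι‖ ^ 2 + L₁ + L₂ + ‖ι‖ + 1, hc, hΛ0, by positivity, hcoer, ?_, ?_, ?_, ?_, ?_⟩
  · intro y v w
    -- Admissibility bounds the form from above only on the diagonal; Cauchy-Schwarz for `g` extends
    -- the bound to mixed arguments.
    refine abs_le_of_sq_le_sq ?_ (by positivity)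
    calc metric ι gc Q y v w ^ 2 ≤ metric ι gc Q y v v * metric ι gc Q y w w :=
          hg.metric_sq_le y v w
      _ ≤ (Λ * ‖v‖ ^ 2) * (Λ * ‖w‖ ^ 2) :=
          mul_le_mul (hup y v) (hup y w) (hg.metric_self_nonneg y w) (by positivity)
      _ = _ := by ring
  · intro y y' v w
    have e : metric ι gc Q y v w - metric ι gc Q y' v w = (gc y - gc y') (ι v) (ι w) := by
      simp [metric]
    rw [e]
    refine (abs_apply₂_le _ _ _).trans ?_
    calc ‖gc y - gc y'‖ * ‖ι v‖ * ‖ι w‖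
        ≤ (L₁ * ‖y - y'‖) * (‖ι‖ * ‖v‖) * (‖ι‖ * ‖w‖) := by
          gcongr
          · exact hlip y y'
          · exact ι.le_opNorm v
          · exact ι.le_opNorm w
      _ = (L₁ * ‖ι‖ ^ 2) * ‖y - y'‖ * ‖v‖ * ‖w‖ := by ring
      _ ≤ _ := by
          gcongr
          linarith [norm_nonneg ι]
  · intro y
    refine (hL₁ y).trans ?_
    nlinarith [norm_nonneg ι, sq_nonneg ‖ι‖, mul_nonneg hL₁0 (sq_nonneg ‖ι‖)]
  · intro y y'
    refine (hlip2 y y').trans ?_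
    gcongr
    nlinarith [norm_nonneg ι, sq_nonneg ‖ι‖, mul_nonneg hL₁0 (sq_nonneg ‖ι‖)]
  · nlinarith [norm_nonneg ι, sq_nonneg ‖ι‖, mul_nonneg hL₁0 (sq_nonneg ‖ι‖)]

/-- Linearization from below of the quadratic form of the metric. -/
theorem two_mul_metric_sub_le (y : Y) (v w : V) :
    2 * metric ι gc Q y v w - metric ι gc Q y w w ≤ metric ι gc Q y v v := by
  have := hg.metric_self_nonneg y (v - w)
  rw [metric_sub_left, metric_sub_right, metric_sub_right, hg.metric_comm y w v] at this
  linarith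

/-- Weighted Young inequality for the quadratic form of the metric. -/
theorem metric_add_self_le (y : Y) (v w : V) {δ : ℝ} (hδ : 0 < δ) :
    metric ι gc Q y (v + w) (v + w) ≤
      (1 + δ) * metric ι gc Q y v v + (1 + δ⁻¹) * metric ι gc Q y w w := by
  have h := hg.metric_self_nonneg y (δ • v - w)
  simp only [metric_sub_left, metric_sub_right, metric_smul_left, metric_smul_right,
    hg.metric_comm y w v] at h
  have h2 : 2 * metric ι gc Q y v w ≤ δ * metric ι gc Q y v v + δ⁻¹ * metric ι gc Q y w w := by
    have : δ⁻¹ * (δ * (δ * metric ι gc Q y v v) - δ * metric ι gc Q y v w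
      - (δ * metric ι gc Q y v w - metric ι gc Q y w w)) = δ * metric ι gc Q y v v
      - 2 * metric ι gc Q y v w + δ⁻¹ * metric ι gc Q y w w := by
      field_simp; ring
    have h3 := mul_nonneg (inv_pos.2 hδ).le h
    linarith
  simp only [metric_add_left, metric_add_right, hg.metric_comm y w v]
  linarith

end IsAdmissibleMetric

end MetricEstimates

/-! ### Size and continuity of the Christoffel operator -/

section Christoffel

variable {V Y : Type*} [NormedAddCommGroup V] [InnerProductSpace ℝ V] [CompleteSpace V]
  [NormedAddCommGroup Y] [NormedSpace ℝ Y]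
  {ι : V →L[ℝ] Y} {gc : Y → Y →L[ℝ] Y →L[ℝ] ℝ} {Q : V →L[ℝ] V →L[ℝ] ℝ}

namespace IsAdmissibleMetric

variable (hg : IsAdmissibleMetric ι gc Q)
include hg

theorem metric_christoffel (y v z : V) :
    2 * metric ι gc Q (ι y) (christoffel ι gc Q y v v) z =
      fderiv ℝ gc (ι y) (ι v) (ι v) (ι z) - fderiv ℝ gc (ι y) (ι z) (ι v) (ι v)
      + fderiv ℝ gc (ι y) (ι v) (ι v) (ι z) :=
  (isChristoffel_iff hg y v v _).2 rfl z

/-- Testing the defining equation with the Christoffel vector `G` itself bounds `2c‖G‖²` by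
`3L⁴‖v‖²‖G‖`; one factor `‖G‖` cancels. -/
theorem exists_norm_christoffel_le :
    ∃ C : ℝ, 0 < C ∧ ∀ y v : V, ‖christoffel ι gc Q y v v‖ ≤ C * ‖v‖ ^ 2 := by
  obtain ⟨c, Λ, L, hc, hΛ, hL, hcoer, -, -, hD, -, hι⟩ := hg.exists_bounds
  refine ⟨2 * L ^ 4 / c, by positivity, fun y v => ?_⟩
  set G := christoffel ι gc Q y v v
  have h1 := hg.metric_christoffel y v G
  have h2 := hcoer (ι y) G
  have hb : ∀ a b d : V, |fderiv ℝ gc (ι y) (ι a) (ι b) (ι d)| ≤ L ^ 4 * ‖a‖ * ‖b‖ * ‖d‖ := by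
    intro a b d
    have hn : ∀ x : V, ‖ι x‖ ≤ L * ‖x‖ := fun x =>
      (ι.le_opNorm x).trans (mul_le_mul_of_nonneg_right hι (norm_nonneg x))
    calc _ ≤ ‖fderiv ℝ gc (ι y)‖ * ‖ι a‖ * ‖ι b‖ * ‖ι d‖ := abs_apply₃_le _ _ _ _
      _ ≤ L * (L * ‖a‖) * (L * ‖b‖) * (L * ‖d‖) := by
        gcongr
        · exact hD _
        · exact hn a
        · exact hn b
        · exact hn d
      _ = _ := by ring
  have h3 := abs_le.1 (hb v v G)
  have h4 := abs_le.1 (hb G v v)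
  have h5 : 2 * c * ‖G‖ ^ 2 ≤ 3 * L ^ 4 * ‖v‖ ^ 2 * ‖G‖ := by nlinarith
  rcases (norm_nonneg G).eq_or_lt with h0 | h0
  · rw [← h0]; positivity
  · have h6 : 2 * c * ‖G‖ ≤ 3 * L ^ 4 * ‖v‖ ^ 2 := by
      refine le_of_mul_le_mul_right ?_ h0
      nlinarith
    rw [div_mul_eq_mul_div, le_div_iff₀ hc]
    nlinarith [mul_nonneg (pow_nonneg hL.le 4) (sq_nonneg ‖v‖)]

/-- The Christoffel operator is continuous with respect to the topology of `Y`. -/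
theorem tendsto_christoffel {α : Type*} {l : Filter α} {y v : α → V} {y₀ v₀ : V}
    (hy : Tendsto (fun i => ι (y i)) l (𝓝 (ι y₀))) (hv : Tendsto (fun i => ι (v i)) l (𝓝 (ι v₀))) :
    Tendsto (fun i => christoffel ι gc Q (y i) (v i) (v i)) l
      (𝓝 (christoffel ι gc Q y₀ v₀ v₀)) := by
  obtain ⟨c, Λ, L, hc, hΛ, hL, hcoer, -, hlip, -, -, -⟩ := hg.exists_bounds
  set G : α → V := fun i => christoffel ι gc Q (y i) (v i) (v i) with hG
  set G₀ := christoffel ι gc Q y₀ v₀ v₀ with hG₀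
  let D := fun i => fderiv ℝ gc (ι (y i))
  let D₀ := fderiv ℝ gc (ι y₀)
  have hD : Tendsto D l (𝓝 D₀) :=
    (hg.diff_two.continuous.tendsto (ι y₀)).comp hy
  -- The right-hand side of the defining equation as a functional on `Y`: its convergence only
  -- requires convergence of images under `ι`.
  let T : α → (Y →L[ℝ] ℝ) := fun i => (2 : ℝ) • D i (ι (v i)) (ι (v i)) - ((D i).flip (ι (v i))).flip (ι (v i))
  let T₀ : Y →L[ℝ] ℝ := (2 : ℝ) • D₀ (ι v₀) (ι v₀) - (D₀.flip (ι v₀)).flip (ι v₀)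
  have hT : Tendsto T l (𝓝 T₀) := by
    have h1 : Tendsto (fun i => D i (ι (v i)) (ι (v i))) l (𝓝 (D₀ (ι v₀) (ι v₀))) :=
      tendsto_clm_apply (tendsto_clm_apply hD hv) hv
    have hf : Tendsto (fun i => (D i).flip) l (𝓝 D₀.flip) :=
      ((ContinuousLinearMap.flipₗᵢ ℝ Y Y (Y →L[ℝ] ℝ)).continuous.tendsto D₀).comp hD
    have hf1 : Tendsto (fun i => (D i).flip (ι (v i))) l (𝓝 (D₀.flip (ι v₀))) := tendsto_clm_apply hf hv
    have hf2 : Tendsto (fun i => ((D i).flip (ι (v i))).flip) l (𝓝 (D₀.flip (ι v₀)).flip) :=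
      ((ContinuousLinearMap.flipₗᵢ ℝ Y Y ℝ).continuous.tendsto _).comp hf1
    exact (h1.const_smul 2).sub (tendsto_clm_apply hf2 hv)
  -- The two defining equations are tested with `G i - G₀`. Coercivity at the moving base point
  -- bounds the difference in the norm of `V` by the change of the right-hand side and the change of
  -- the metric acting on the fixed `G₀`.
  have key : ∀ i, ‖G i - G₀‖ ≤ c⁻¹ * (‖T i - T₀‖ * ‖ι‖ + L * ‖ι (y i) - ι y₀‖ * ‖G₀‖) := by
    intro i
    set z := G i - G₀ with hz
    have e1 : 2 * metric ι gc Q (ι (y i)) (G i) z = T i (ι z) := by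
      rw [hG]; dsimp only
      rw [hg.metric_christoffel]; simp [T, D]; ring
    have e2 : 2 * metric ι gc Q (ι y₀) G₀ z = T₀ (ι z) := by
      rw [hG₀, hg.metric_christoffel]; simp [T₀, D₀]; ring
    have e3 := hcoer (ι (y i)) z
    have e4 : metric ι gc Q (ι (y i)) z z = metric ι gc Q (ι (y i)) (G i) z
      - metric ι gc Q (ι (y i)) G₀ z := by rw [← metric_sub_left]
    have e5 := abs_le.1 (hlip (ι (y i)) (ι y₀) G₀ z)
    have e6 : |(T i - T₀) (ι z)| ≤ ‖T i - T₀‖ * ‖ι‖ * ‖z‖ := by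
      rw [← Real.norm_eq_abs, mul_assoc]
      exact ((T i - T₀).le_opNorm _).trans (by gcongr; exact ι.le_opNorm z)
    have e7 := (abs_le.1 e6).2
    have e7' := (abs_le.1 e6).1
    rw [sub_apply] at e7
    have e8 : c * ‖z‖ ^ 2 ≤ (‖T i - T₀‖ * ‖ι‖ + L * ‖ι (y i) - ι y₀‖ * ‖G₀‖) * ‖z‖ := by
      have : 0 ≤ ‖T i - T₀‖ * ‖ι‖ * ‖z‖ := by positivity
      linarith
    rcases (norm_nonneg z).eq_or_lt with h0 | h0
    · rw [← h0]; positivity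
    · rw [inv_mul_eq_div, le_div_iff₀ hc]
      refine le_of_mul_le_mul_right ?_ h0
      linarith
  rw [tendsto_iff_norm_sub_tendsto_zero]
  refine squeeze_zero (fun _ => norm_nonneg _) key ?_
  have h1 : Tendsto (fun i => ‖T i - T₀‖) l (𝓝 0) := tendsto_iff_norm_sub_tendsto_zero.1 hT
  have h2 : Tendsto (fun i => ‖ι (y i) - ι y₀‖) l (𝓝 0) := tendsto_iff_norm_sub_tendsto_zero.1 hy
  have := (((h1.mul_const ‖ι‖).add ((h2.const_mul L).mul_const ‖G₀‖)).const_mul c⁻¹)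
  simpa using this

theorem continuous_christoffel :
    Continuous (fun p : V × V => christoffel ι gc Q p.1 p.2 p.2) :=
  continuous_iff_continuousAt.2 fun p => hg.tendsto_christoffel
    ((ι.continuous.comp continuous_fst).tendsto p) ((ι.continuous.comp continuous_snd).tendsto p)

end IsAdmissibleMetric

end Christoffel

end RiemSpline

namespace RiemSpline

/-! ### The Riemannian distance to leading order -/

section RiemannianDistance

variable {V Y : Type*} [NormedAddCommGroup V] [NormedSpace ℝ V]
  [NormedAddCommGroup Y] [NormedSpace ℝ Y]
  {ι : V →L[ℝ] Y} {gc : Y → Y →L[ℝ] Y →L[ℝ] ℝ} {Q : V →L[ℝ] V →L[ℝ] ℝ}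

theorem IsAdmissibleMetric.continuous_metric (hg : IsAdmissibleMetric ι gc Q) {X : Type*} [TopologicalSpace X] {y : X → Y} {v w : X → V}
    (hy : Continuous y) (hv : Continuous v) (hw : Continuous w) :
    Continuous fun x => metric ι gc Q (y x) (v x) (w x) :=
  (((continuous_metricForm hg.diff.continuous).comp hy).clm_apply hv).clm_apply hw

/-- For a metric frozen at one point straight segments are shortest: `g(h, h)` is the integral of
`g(h, γ')`, and Cauchy-Schwarz applies under the integral. The true length is later compared with
the frozen one. -/
theorem IsAdmissibleMetric.sqrt_metric_sub_le_integral (hg : IsAdmissibleMetric ι gc Q) (y : Y) {γ : ℝ → V} (hγ : ContDiff ℝ 1 γ) :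
    √(metric ι gc Q y (γ 1 - γ 0) (γ 1 - γ 0)) ≤
      ∫ s in (0 : ℝ)..1, √(metric ι gc Q y (deriv γ s) (deriv γ s)) := by
  have hd : Continuous (deriv γ) := hγ.continuous_deriv (by simp)
  set h := γ 1 - γ 0 with hh
  have hg0 := hg.metric_self_nonneg y h
  have hc1 : Continuous fun s => metric ι gc Q y h (deriv γ s) :=
    hg.continuous_metric continuous_const continuous_const hd
  have hc2 : Continuous fun s => √(metric ι gc Q y (deriv γ s) (deriv γ s)) :=
    (hg.continuous_metric continuous_const hd hd).sqrt
  have h1 : ∫ s in (0 : ℝ)..1, metric ι gc Q y h (deriv γ s) = metric ι gc Q y h h := by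
    have : ∀ s ∈ uIcc (0 : ℝ) 1, HasDerivAt (fun s => metricForm ι gc Q y h (γ s))
        (metricForm ι gc Q y h (deriv γ s)) s := fun s _ =>
      (metricForm ι gc Q y h).hasFDerivAt.comp_hasDerivAt s
        (hγ.differentiable one_ne_zero).differentiableAt.hasDerivAt
    have := intervalIntegral.integral_eq_sub_of_hasDerivAt this (hc1.intervalIntegrable _ _)
    simp only [metricForm_apply] at this
    rw [this, ← metric_sub_right]
  have h2 : metric ι gc Q y h h ≤ √(metric ι gc Q y h h) *
      ∫ s in (0 : ℝ)..1, √(metric ι gc Q y (deriv γ s) (deriv γ s)) := by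
    rw [← intervalIntegral.integral_const_mul, ← h1]
    refine intervalIntegral.integral_mono_on zero_le_one (hc1.intervalIntegrable _ _)
      ((continuous_const.mul hc2).intervalIntegrable _ _) fun s _ => ?_
    rw [h1, ← Real.sqrt_mul hg0]
    exact Real.le_sqrt_of_sq_le (hg.metric_sq_le y h _)
  rcases (Real.sqrt_nonneg (metric ι gc Q y h h)).eq_or_lt with h0 | h0
  · rw [← h0]
    exact intervalIntegral.integral_nonneg zero_le_one fun _ _ => Real.sqrt_nonneg _
  · refine le_of_mul_le_mul_left ?_ h0
    rwa [Real.mul_self_sqrt hg0]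

variable [CompleteSpace V]

theorem norm_sub_le_integral_norm_deriv {γ : ℝ → V} (hγ : ContDiff ℝ 1 γ) {s : ℝ}
    (hs : s ∈ Icc (0 : ℝ) 1) : ‖γ s - γ 0‖ ≤ ∫ r in (0 : ℝ)..1, ‖deriv γ r‖ := by
  have hd : Continuous (deriv γ) := hγ.continuous_deriv (by simp)
  have h1 : ∫ r in (0 : ℝ)..s, deriv γ r = γ s - γ 0 :=
    intervalIntegral.integral_deriv_eq_sub
      (fun x _ => (hγ.differentiable one_ne_zero).differentiableAt)
      (hd.intervalIntegrable _ _)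
  rw [← h1]
  refine (intervalIntegral.norm_integral_le_integral_norm hs.1).trans ?_
  exact intervalIntegral.integral_mono_interval le_rfl hs.1 hs.2
    (Eventually.of_forall fun _ => norm_nonneg _) (hd.norm.intervalIntegrable _ _)

namespace IsAdmissibleMetric

variable (hg : IsAdmissibleMetric ι gc Q)
include hg

/-- The Riemannian distance agrees to leading order with the norm of the metric. -/
theorem exists_riemDist_bounds : ∃ c C : ℝ, 0 < c ∧ 0 < C ∧ ∀ y z : V,
    c * ‖z - y‖ ≤ riemDist ι gc Q y z ∧ riemDist ι gc Q y z ≤ C * ‖z - y‖ ∧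
    |riemDist ι gc Q y z ^ 2 - metric ι gc Q (ι y) (z - y) (z - y)| ≤ C * ‖z - y‖ ^ 3 := by
  obtain ⟨c, Λ, L, hc, hΛ, hL, hcoer, hbd, hlip, -, -, hι⟩ := hg.exists_bounds
  have hlen0 : ∀ γ : ℝ → V, 0 ≤ ∫ s in (0 : ℝ)..1,
      √(metric ι gc Q (ι (γ s)) (deriv γ s) (deriv γ s)) := fun γ =>
    intervalIntegral.integral_nonneg zero_le_one fun _ _ => Real.sqrt_nonneg _
  have hcont : ∀ γ : ℝ → V, ContDiff ℝ 1 γ →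
      Continuous fun s => √(metric ι gc Q (ι (γ s)) (deriv γ s) (deriv γ s)) := fun γ hγ =>
    (hg.continuous_metric (ι.continuous.comp hγ.continuous) (hγ.continuous_deriv (by simp))
      (hγ.continuous_deriv (by simp))).sqrt
  have hsqrt : ∀ y v, √c * ‖v‖ ≤ √(metric ι gc Q y v v) := fun y v => by
    refine Real.le_sqrt_of_sq_le ?_
    rw [mul_pow, Real.sq_sqrt hc.le]
    exact hcoer y v
  have hsqrtΛ : ∀ y v, √(metric ι gc Q y v v) ≤ √Λ * ‖v‖ := fun y v => by
    refine Real.sqrt_le_iff.2 ⟨by positivity, ?_⟩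
    rw [mul_pow, Real.sq_sqrt hΛ.le]
    refine (le_abs_self _).trans ((hbd y v v).trans (le_of_eq (by ring)))
  have hιn : ∀ x : V, ‖ι x‖ ≤ L * ‖x‖ := fun x =>
    (ι.le_opNorm x).trans (mul_le_mul_of_nonneg_right hι (norm_nonneg x))
  -- curves of bounded length stay close to their starting point
  have hclose : ∀ γ : ℝ → V, ContDiff ℝ 1 γ → ∀ s ∈ Icc (0 : ℝ) 1, √c * ‖γ s - γ 0‖ ≤
      ∫ s in (0 : ℝ)..1, √(metric ι gc Q (ι (γ s)) (deriv γ s) (deriv γ s)) := by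
    intro γ hγ s hs
    refine (mul_le_mul_of_nonneg_left (norm_sub_le_integral_norm_deriv hγ hs)
      (Real.sqrt_nonneg c)).trans ?_
    rw [← intervalIntegral.integral_const_mul]
    exact intervalIntegral.integral_mono_on zero_le_one
      ((continuous_const.mul (hγ.continuous_deriv (by simp)).norm).intervalIntegrable _ _)
      ((hcont γ hγ).intervalIntegrable _ _) fun r _ => hsqrt _ _
  -- `θ‖h‖` bounds the relative variation of the metric on the ball of radius `√Λ / √c * ‖h‖` around
  -- `y`: one `L` is the Lipschitz constant, the other bounds `‖ι‖`, and `c` converts `‖v‖²` into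
  -- the metric.
  set θ : ℝ := L ^ 2 * √Λ / (c * √c) with hθ
  have hsc : 0 < √c := Real.sqrt_pos.2 hc
  have hθ0 : 0 ≤ θ := by positivity
  refine ⟨√c, √Λ + θ * Λ + L ^ 2, hsc, by positivity, fun y z => ?_⟩
  set h := z - y with hh
  let S : Set ℝ := {ℓ | ∃ γ : ℝ → V, ContDiff ℝ 1 γ ∧ γ 0 = y ∧ γ 1 = z ∧
    ℓ = ∫ s in (0 : ℝ)..1, √(metric ι gc Q (ι (γ s)) (deriv γ s) (deriv γ s))}
  have hSd : riemDist ι gc Q y z = sInf S := rfl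
  have hbdd : BddBelow S := ⟨0, by rintro _ ⟨γ, -, -, -, rfl⟩; exact hlen0 γ⟩
  -- the segment
  let γ₀ : ℝ → V := fun s => y + s • h
  have hγ₀ : ContDiff ℝ 1 γ₀ := by fun_prop
  have hdγ₀ : ∀ s, deriv γ₀ s = h := fun s => by
    have : HasDerivAt γ₀ ((1 : ℝ) • h) s := ((hasDerivAt_id s).smul_const h).const_add y
    rw [this.deriv, one_smul]
  have hmem : (∫ s in (0 : ℝ)..1, √(metric ι gc Q (ι (γ₀ s)) (deriv γ₀ s) (deriv γ₀ s))) ∈ S :=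
    ⟨γ₀, hγ₀, by simp [γ₀], by simp [γ₀, hh], rfl⟩
  have hne : S.Nonempty := ⟨_, hmem⟩
  have hd0 : 0 ≤ riemDist ι gc Q y z := by
    rw [hSd]
    exact le_csInf hne (by rintro _ ⟨γ, -, -, -, rfl⟩; exact hlen0 γ)
  have hgh := hg.metric_self_nonneg (ι y) h
  have hgΛ : metric ι gc Q (ι y) h h ≤ Λ * ‖h‖ ^ 2 :=
    (le_abs_self _).trans ((hbd _ h h).trans (le_of_eq (by ring)))
  have hup : ∀ M : ℝ, (∀ s ∈ Icc (0 : ℝ) 1, √(metric ι gc Q (ι (γ₀ s)) h h) ≤ M) →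
      riemDist ι gc Q y z ≤ M := by
    intro M hM
    rw [hSd]
    refine (csInf_le hbdd hmem).trans ?_
    have := intervalIntegral.integral_mono_on zero_le_one
      ((hcont γ₀ hγ₀).intervalIntegrable 0 1)
      (continuous_const.intervalIntegrable (μ := volume) (0 : ℝ) 1 : IntervalIntegrable (fun _ => M) _ _ _)
      (fun s hs => by rw [hdγ₀]; exact hM s hs)
    simpa using this
  refine ⟨?_, ?_, ?_⟩
  · rw [hSd]
    refine le_csInf hne ?_
    rintro _ ⟨γ, hγ, h0, h1, rfl⟩
    have := hclose γ hγ 1 (by simp)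
    rwa [h0, h1] at this
  · refine (hup _ fun s _ => hsqrtΛ _ h).trans ?_
    gcongr
    nlinarith [mul_nonneg hθ0 hΛ.le, sq_nonneg L]
  -- The segment is a competitor, and along it the metric differs from the one at `y` by at most
  -- `L²‖h‖` times the squared norm.
  · have hupper : riemDist ι gc Q y z ^ 2 ≤ metric ι gc Q (ι y) h h + L ^ 2 * ‖h‖ ^ 3 := by
      have hpos : 0 ≤ metric ι gc Q (ι y) h h + L ^ 2 * ‖h‖ ^ 3 := by positivity
      have := hup (√(metric ι gc Q (ι y) h h + L ^ 2 * ‖h‖ ^ 3)) fun s hs => by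
        refine Real.sqrt_le_sqrt ?_
        have e1 := (abs_le.1 (hlip (ι (γ₀ s)) (ι y) h h)).2
        have e2 : ‖ι (γ₀ s) - ι y‖ ≤ L * ‖h‖ := by
          have : ι (γ₀ s) - ι y = s • ι h := by simp [γ₀]
          rw [this, norm_smul, Real.norm_of_nonneg hs.1]
          calc s * ‖ι h‖ ≤ 1 * ‖ι h‖ := by gcongr; exact hs.2
            _ ≤ L * ‖h‖ := by rw [one_mul]; exact hιn h
        have e3 : L * ‖ι (γ₀ s) - ι y‖ * ‖h‖ * ‖h‖ ≤ L * (L * ‖h‖) * ‖h‖ * ‖h‖ := by gcongr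
        nlinarith
      calc riemDist ι gc Q y z ^ 2 ≤ √(metric ι gc Q (ι y) h h + L ^ 2 * ‖h‖ ^ 3) ^ 2 := by gcongr
        _ = _ := Real.sq_sqrt hpos
    have hlower : metric ι gc Q (ι y) h h - θ * Λ * ‖h‖ ^ 3 ≤ riemDist ι gc Q y z ^ 2 := by
      -- Truncation at `0` covers large `h`, for which the lower bound is trivial.
      set m := max 0 (1 - θ * ‖h‖) with hm
      have hm0 : 0 ≤ m := le_max_left _ _
      have hm1 : m ≤ 1 := max_le zero_le_one (by nlinarith [norm_nonneg h])
      have : √(m * metric ι gc Q (ι y) h h) ≤ riemDist ι gc Q y z := by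
        rw [hSd]
        refine le_csInf hne ?_
        rintro _ ⟨γ, hγ, h0, h1, rfl⟩
        -- A curve at least as long as `√g_y(h, h)` satisfies the claim because `m ≤ 1`. A shorter
        -- one stays in the ball belonging to `θ`, where the metric is at least `m` times the frozen
        -- one.
        by_cases hℓ : √(metric ι gc Q (ι y) h h) ≤
            ∫ s in (0 : ℝ)..1, √(metric ι gc Q (ι (γ s)) (deriv γ s) (deriv γ s))
        · refine le_trans (Real.sqrt_le_sqrt ?_) hℓ
          nlinarith
        · push Not at hℓ
          have hball : ∀ s ∈ Icc (0 : ℝ) 1, ‖γ s - y‖ ≤ √Λ / √c * ‖h‖ := fun s hs => by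
            have e1 := hclose γ hγ s hs
            have e2 := hsqrtΛ (ι y) h
            rw [h0] at e1
            rw [div_mul_eq_mul_div, le_div_iff₀ hsc]
            linarith
          have hcomp : ∀ s ∈ Icc (0 : ℝ) 1, ∀ v, m * metric ι gc Q (ι y) v v ≤
              metric ι gc Q (ι (γ s)) v v := fun s hs v => by
            have e0 := hg.metric_self_nonneg (ι (γ s)) v
            rcases le_total (1 - θ * ‖h‖) 0 with hneg | hneg
            · rw [hm, max_eq_left hneg, zero_mul]; exact e0
            rw [hm, max_eq_right hneg]
            have e1 := (abs_le.1 (hlip (ι y) (ι (γ s)) v v)).2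
            have e2 : ‖ι y - ι (γ s)‖ ≤ L * (√Λ / √c * ‖h‖) := by
              rw [norm_sub_rev, ← map_sub]
              exact (hιn _).trans (by gcongr; exact hball s hs)
            have e3 : L * ‖ι y - ι (γ s)‖ * ‖v‖ * ‖v‖ ≤ L * (L * (√Λ / √c * ‖h‖)) * ‖v‖ * ‖v‖ := by
              gcongr
            have e4 : L * (L * (√Λ / √c * ‖h‖)) * ‖v‖ * ‖v‖ = θ * ‖h‖ * (c * ‖v‖ ^ 2) := by
              rw [hθ]; field_simp
            have e5 : θ * ‖h‖ * (c * ‖v‖ ^ 2) ≤ θ * ‖h‖ * metric ι gc Q (ι y) v v := by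
              gcongr; exact hcoer _ _
            nlinarith
          have e1 := hg.sqrt_metric_sub_le_integral (ι y) hγ
          rw [h0, h1, ← hh] at e1
          rw [Real.sqrt_mul hm0]
          refine (mul_le_mul_of_nonneg_left e1 (Real.sqrt_nonneg m)).trans ?_
          rw [← intervalIntegral.integral_const_mul]
          have hd : Continuous (deriv γ) := hγ.continuous_deriv (by simp)
          refine intervalIntegral.integral_mono_on zero_le_one
            ((continuous_const.mul (hg.continuous_metric continuous_const hd hd).sqrt).intervalIntegrable _ _)
            ((hcont γ hγ).intervalIntegrable _ _) fun s hs => ?_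
          rw [← Real.sqrt_mul hm0]
          exact Real.sqrt_le_sqrt (hcomp s hs _)
      have h2 : m * metric ι gc Q (ι y) h h ≤ riemDist ι gc Q y z ^ 2 := by
        rw [← Real.sq_sqrt (mul_nonneg hm0 hgh)]
        gcongr
      have h3 : (1 - θ * ‖h‖) * metric ι gc Q (ι y) h h ≤ m * metric ι gc Q (ι y) h h := by
        gcongr; exact le_max_right _ _
      have h4 : θ * ‖h‖ * metric ι gc Q (ι y) h h ≤ θ * ‖h‖ * (Λ * ‖h‖ ^ 2) := by gcongr
      nlinarith
    have hh3 : 0 ≤ ‖h‖ ^ 3 := by positivity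
    have hsΛ := Real.sqrt_nonneg Λ
    rw [abs_le]
    constructor
    · nlinarith [mul_nonneg hsΛ hh3, mul_nonneg (sq_nonneg L) hh3]
    · nlinarith [mul_nonneg hsΛ hh3, mul_nonneg (mul_nonneg hθ0 hΛ.le) hh3]

end IsAdmissibleMetric

end RiemannianDistance

/-! ### The energy near the diagonal -/

section EnergyNearDiagonal

variable {V Y : Type*} [NormedAddCommGroup V] [NormedSpace ℝ V]
  [NormedAddCommGroup Y] [NormedSpace ℝ Y]
  {ι : V →L[ℝ] Y} {gc : Y → Y →L[ℝ] Y →L[ℝ] ℝ} {Q : V →L[ℝ] V →L[ℝ] ℝ}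
  {Wc : V × V → ℝ} {W : V → V → ℝ}

namespace IsAdmissibleEnergy

variable (hW : IsAdmissibleEnergy ι gc Q Wc W)
include hW

theorem energy_nonneg (hg : IsAdmissibleMetric ι gc Q) (y z : V) : 0 ≤ W y z := by
  rw [hW.decomp]
  exact add_nonneg (hW.nonneg _) (hg.Q_nonneg _)

/-- The threshold is `γ r`, and strict monotonicity of `γ` inverts the coercivity estimate. -/
theorem norm_sub_le_of_energy_le {r : ℝ} (hr : 0 < r) :
    ∃ δ : ℝ, 0 < δ ∧ ∀ y z, W y z ≤ δ → ‖y - z‖ ≤ r := by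
  obtain ⟨γ, hmono, -, h0, -, hγ⟩ := hW.coercive
  refine ⟨γ r, ?_, fun y z h => ?_⟩
  · rw [← h0]; exact hmono (mem_Ici.2 le_rfl) (mem_Ici.2 hr.le) hr
  · by_contra! hlt
    have := hmono (mem_Ici.2 hr.le) (mem_Ici.2 (norm_nonneg (y - z))) hlt
    linarith [hγ y z]

variable [CompleteSpace V]

/-- Near the diagonal the energy is given by the metric up to cubic terms, uniformly in the base
point. -/
theorem exists_energy_sub_metric_le (hg : IsAdmissibleMetric ι gc Q) :
    ∃ δ C : ℝ, 0 < δ ∧ 0 < C ∧ ∀ y z : V, ‖z - y‖ ≤ δ →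
      |W y z - metric ι gc Q (ι y) (z - y) (z - y)| ≤ C * ‖z - y‖ ^ 3 := by
  obtain ⟨c, C, hc, hC, hd⟩ := hg.exists_riemDist_bounds
  obtain ⟨ε, C', hε, hC', hap⟩ := hW.approx
  refine ⟨ε / C, C' * C ^ 3 + C, by positivity, by positivity, fun y z h => ?_⟩
  obtain ⟨h1, h2, h3⟩ := hd y z
  have h0 : 0 ≤ riemDist ι gc Q y z := le_trans (by positivity) h1
  have h4 := hap y z (h2.trans (by rw [le_div_iff₀ hC] at h; linarith))
  have h5 : C' * riemDist ι gc Q y z ^ 3 ≤ C' * (C * ‖z - y‖) ^ 3 := by gcongr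
  calc _ ≤ |W y z - riemDist ι gc Q y z ^ 2|
      + |riemDist ι gc Q y z ^ 2 - metric ι gc Q (ι y) (z - y) (z - y)| := abs_sub_le _ _ _
    _ ≤ C' * (C * ‖z - y‖) ^ 3 + C * ‖z - y‖ ^ 3 := by linarith
    _ = _ := by ring

/-- Within distance `c / (2C)` the cubic error uses up at most half of the coercivity of the metric.
-/
theorem exists_energy_quadratic_bounds (hg : IsAdmissibleMetric ι gc Q) :
    ∃ δ c C : ℝ, 0 < δ ∧ 0 < c ∧ 0 < C ∧
      (∀ y z : V, ‖y - z‖ ≤ δ → c * ‖y - z‖ ^ 2 ≤ W y z) ∧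
      (∀ y z : V, ‖y - z‖ ≤ δ → W y z ≤ C * ‖y - z‖ ^ 2) := by
  obtain ⟨δ, C, hδ, hC, h⟩ := hW.exists_energy_sub_metric_le hg
  obtain ⟨c, Λ, L, hc, hΛ, hL, hcoer, hbd, -⟩ := hg.exists_bounds
  refine ⟨min δ (c / (2 * C)), c / 2, Λ + C * δ, by positivity, by positivity, by positivity,
    fun y z hyz => ?_, fun y z hyz => ?_⟩
  all_goals
    rw [norm_sub_rev] at hyz ⊢
    have hn := norm_nonneg (z - y)
    have h1 := abs_le.1 (h y z (hyz.trans (min_le_left _ _)))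
  · have h2 := hyz.trans (min_le_right _ _)
    rw [le_div_iff₀ (by positivity)] at h2
    have h3 := hcoer (ι y) (z - y)
    have h4 : C * ‖z - y‖ ^ 3 ≤ c / 2 * ‖z - y‖ ^ 2 := by nlinarith [sq_nonneg ‖z - y‖]
    linarith
  · have h2 := hyz.trans (min_le_left _ _)
    have h3 := (le_abs_self _).trans (hbd (ι y) (z - y) (z - y))
    have h4 : C * ‖z - y‖ ^ 3 ≤ C * δ * ‖z - y‖ ^ 2 := by
      have : C * ‖z - y‖ ^ 3 = C * ‖z - y‖ * ‖z - y‖ ^ 2 := by ring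
      rw [this]; gcongr
    nlinarith

end IsAdmissibleEnergy

end EnergyNearDiagonal

end RiemSpline

namespace RiemSpline

/-! ### Taylor estimates in normed spaces -/

section Taylor

variable {E F : Type*} [NormedAddCommGroup E] [NormedSpace ℝ E] [NormedAddCommGroup F]
  [NormedSpace ℝ F]

/-- Mean value inequality on the segment from `p₀` to `p`, where `‖q - p₀‖ ≤ ‖p - p₀‖`. Each use
raises the order of a remainder by one; factorials are given away. -/
theorem norm_le_pow_succ_of_norm_hasFDerivAt_le {f : E → F} {f' : E → E →L[ℝ] F} {s : Set E}
    (hs : Convex ℝ s) {p₀ : E} (hp₀ : p₀ ∈ s) (h0 : f p₀ = 0) {C : ℝ} (hC : 0 ≤ C) {n : ℕ}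
    (hd : ∀ p ∈ s, HasFDerivAt f (f' p) p) (hb : ∀ p ∈ s, ‖f' p‖ ≤ C * ‖p - p₀‖ ^ n) {p : E}
    (hp : p ∈ s) : ‖f p‖ ≤ C * ‖p - p₀‖ ^ (n + 1) := by
  have hsub : segment ℝ p₀ p ⊆ s := hs.segment_subset hp₀ hp
  have h := (convex_segment (𝕜 := ℝ) p₀ p).norm_image_sub_le_of_norm_hasFDerivWithin_le
    (f := f) (f' := f') (C := C * ‖p - p₀‖ ^ n)
    (fun q hq => (hd q (hsub hq)).hasFDerivWithinAt) (fun q hq => by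
      refine (hb q (hsub hq)).trans ?_
      have : ‖q - p₀‖ ≤ ‖p - p₀‖ := by
        obtain ⟨a, b, ha, hb, hab, rfl⟩ := hq
        have e : a • p₀ + b • p - p₀ = b • (p - p₀) := by
          rw [show a = 1 - b by linarith]; module
        rw [e, norm_smul, Real.norm_of_nonneg hb]
        exact mul_le_of_le_one_left (norm_nonneg _) (by linarith)
      gcongr) (left_mem_segment ℝ p₀ p) (right_mem_segment ℝ p₀ p)
  rw [h0, sub_zero] at h
  rw [pow_succ, ← mul_assoc]
  exact h

theorem taylor_one {f : E → F} (hf : ContDiff ℝ 2 f) {s : Set E} (hs : Convex ℝ s) {C : ℝ}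
    (hC : 0 ≤ C) (hb : ∀ p ∈ s, ‖fderiv ℝ (fderiv ℝ f) p‖ ≤ C) {p₀ p : E} (hp₀ : p₀ ∈ s)
    (hp : p ∈ s) : ‖f p - f p₀ - fderiv ℝ f p₀ (p - p₀)‖ ≤ C * ‖p - p₀‖ ^ 2 := by
  have hd1 : Differentiable ℝ f := hf.differentiable two_ne_zero
  have hd2 : Differentiable ℝ (fderiv ℝ f) :=
    (hf.fderiv_right (m := 1) (by norm_num)).differentiable one_ne_zero
  have h1 : ∀ p ∈ s, ‖fderiv ℝ f p - fderiv ℝ f p₀‖ ≤ C * ‖p - p₀‖ ^ 1 := fun p hp => by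
    rw [pow_one]
    exact hs.norm_image_sub_le_of_norm_fderiv_le (fun q _ => hd2 q) hb hp₀ hp
  refine norm_le_pow_succ_of_norm_hasFDerivAt_le (n := 1)
    (f := fun p => f p - f p₀ - fderiv ℝ f p₀ (p - p₀))
    (f' := fun p => fderiv ℝ f p - fderiv ℝ f p₀) hs hp₀ (by simp) hC (fun q _ => ?_) h1 hp
  exact ((hd1 q).hasFDerivAt.sub_const _).sub
    ((fderiv ℝ f p₀).hasFDerivAt.comp q ((hasFDerivAt_id q).sub_const p₀))

theorem taylor_two {f : E → F} (hf : ContDiff ℝ 3 f) {s : Set E} (hs : Convex ℝ s) {C : ℝ}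
    (hC : 0 ≤ C) (hb : ∀ p ∈ s, ‖fderiv ℝ (fderiv ℝ (fderiv ℝ f)) p‖ ≤ C) {p₀ p : E}
    (hp₀ : p₀ ∈ s) (hp : p ∈ s) :
    ‖f p - f p₀ - fderiv ℝ f p₀ (p - p₀) - (1 / 2 : ℝ) • fderiv ℝ (fderiv ℝ f) p₀ (p - p₀) (p - p₀)‖
      ≤ C * ‖p - p₀‖ ^ 3 := by
  have hd1 : Differentiable ℝ f := hf.differentiable three_ne_zero
  -- Symmetry is what makes `D (p - p₀)` the derivative of the quadratic Taylor term.
  have hsymm : IsSymmSndFDerivAt ℝ f p₀ :=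
    hf.contDiffAt.isSymmSndFDerivAt (by simp; norm_num)
  set D := fderiv ℝ (fderiv ℝ f) p₀ with hD
  refine norm_le_pow_succ_of_norm_hasFDerivAt_le (n := 2)
    (f := fun p => f p - f p₀ - fderiv ℝ f p₀ (p - p₀) - (1 / 2 : ℝ) • D (p - p₀) (p - p₀))
    (f' := fun p => fderiv ℝ f p - fderiv ℝ f p₀ - D (p - p₀)) hs hp₀ (by simp) hC
    (fun q _ => ?_) (fun q hq => taylor_one (hf.fderiv_right (by norm_num)) hs hC hb hp₀ hq) hp
  have hi : HasFDerivAt (fun p : E => p - p₀) (ContinuousLinearMap.id ℝ E) q :=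
    (hasFDerivAt_id q).sub_const p₀
  have h2 : HasFDerivAt (fun p => D (p - p₀) (p - p₀)) _ q :=
    (D.hasFDerivAt.comp q hi).clm_apply hi
  have h3 := (((hd1 q).hasFDerivAt.sub_const (f p₀)).sub
    ((fderiv ℝ f p₀).hasFDerivAt.comp q hi)).sub (h2.const_smul (1 / 2 : ℝ))
  refine h3.congr_fderiv ?_
  ext k
  have e : D k (q - p₀) = D (q - p₀) k := hsymm k (q - p₀)
  simp only [sub_apply, ContinuousLinearMap.comp_id, add_apply, smul_apply,
    ContinuousLinearMap.flip_apply, Function.comp, e]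
  module

end Taylor

/-! ### Derivatives of the energy on the diagonal -/

section EnergyDerivatives

variable {V Y : Type*} [NormedAddCommGroup V] [NormedSpace ℝ V] [CompleteSpace V]
  [NormedAddCommGroup Y] [NormedSpace ℝ Y]
  {ι : V →L[ℝ] Y} {gc : Y → Y →L[ℝ] Y →L[ℝ] ℝ} {Q : V →L[ℝ] V →L[ℝ] ℝ}
  {Wc : V × V → ℝ} {W : V → V → ℝ}

namespace IsAdmissibleEnergy

variable (hW : IsAdmissibleEnergy ι gc Q Wc W)
include hW

omit [CompleteSpace V] in
-- Translates the bounds on `iteratedFDeriv` into nested Fréchet derivatives, the form used by the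
-- Taylor estimates.
theorem exists_fderiv_bounds (R : ℝ) : ∃ C : ℝ, 0 < C ∧ ∀ p : V × V, ‖p‖ ≤ R →
    ‖fderiv ℝ (fderiv ℝ Wc) p‖ ≤ C ∧ ‖fderiv ℝ (fderiv ℝ (fderiv ℝ Wc)) p‖ ≤ C ∧
    ‖fderiv ℝ (fderiv ℝ (fderiv ℝ (fderiv ℝ Wc))) p‖ ≤ C := by
  obtain ⟨C, hC⟩ := hW.bdd_deriv R
  refine ⟨max C 1, by positivity, fun p hp => ⟨?_, ?_, ?_⟩⟩
  · have h := hC p hp 2 (by norm_num)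
    rw [← norm_iteratedFDeriv_fderiv, ← norm_iteratedFDeriv_fderiv, norm_iteratedFDeriv_zero] at h
    exact h.trans (le_max_left _ _)
  · have h := hC p hp 3 (by norm_num)
    rw [← norm_iteratedFDeriv_fderiv, ← norm_iteratedFDeriv_fderiv, ← norm_iteratedFDeriv_fderiv,
      norm_iteratedFDeriv_zero] at h
    exact h.trans (le_max_left _ _)
  · have h := hC p hp 4 (by norm_num)
    rw [← norm_iteratedFDeriv_fderiv, ← norm_iteratedFDeriv_fderiv, ← norm_iteratedFDeriv_fderiv,
      ← norm_iteratedFDeriv_fderiv, norm_iteratedFDeriv_zero] at h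
    exact h.trans (le_max_left _ _)

variable (hg : IsAdmissibleMetric ι gc Q)
include hg

theorem apply_diag (y : V) : Wc (y, y) = 0 := by
  obtain ⟨δ, C, hδ, hC, h⟩ := hW.exists_energy_sub_metric_le hg
  have := h y y (by simpa using hδ.le)
  simpa [hW.decomp, metric] using this

/-- `Wc` is nonnegative and vanishes on the diagonal, so every diagonal point is a minimum. -/
theorem fderiv_diag (y : V) : fderiv ℝ Wc (y, y) = 0 :=
  IsLocalMin.fderiv_eq_zero (Eventually.of_forall fun p => by
    rw [hW.apply_diag hg]; exact hW.nonneg p)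

/-- Along `(y, y) + s H` the Taylor expansion of `Wc` is compared with the metric at the base point
`y + s H.1`; `Q` occurs in both the energy and the metric and cancels. Moving the base point to `y`
also costs only `O(s³)`, so dividing by `s²` and letting `s → 0` identifies the quadratic forms. -/
theorem fderiv_two_diag_self (y : V) (H : V × V) :
    fderiv ℝ (fderiv ℝ Wc) (y, y) H H = 2 * gc (ι y) (ι (H.2 - H.1)) (ι (H.2 - H.1)) := by
  obtain ⟨δ, C, hδ, hC, h⟩ := hW.exists_energy_sub_metric_le hg
  obtain ⟨c, Λ, L, hc, hΛ, hL, -, -, hlip, -, -, hι⟩ := hg.exists_bounds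
  obtain ⟨B, hB, hbd⟩ := hW.exists_fderiv_bounds (‖(y, y)‖ + ‖H‖)
  have hT := fun p hp => taylor_two (hW.contDiff.of_le (by norm_num))
    (convex_closedBall (0 : V × V) (‖(y, y)‖ + ‖H‖)) hB.le
    (fun p hp => (hbd p (by simpa using hp)).2.1) (p₀ := (y, y)) (p := p)
    (by simp) hp
  rw [hW.fderiv_diag hg, hW.apply_diag hg] at hT
  set D := fderiv ℝ (fderiv ℝ Wc) (y, y) with hD
  set d := H.2 - H.1 with hd
  set A : ℝ := |1 / 2 * D H H - gc (ι y) (ι d) (ι d)| with hA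
  have key : ∀ s : ℝ, 0 < s → s ≤ 1 → s * ‖d‖ ≤ δ →
      A ≤ (B * ‖H‖ ^ 3 + C * ‖d‖ ^ 3 + L * (L * ‖H‖) * ‖d‖ * ‖d‖) * s := by
    intro s hs hs1 hsd
    have hmem : (y, y) + s • H ∈ Metric.closedBall (0 : V × V) (‖(y, y)‖ + ‖H‖) := by
      rw [mem_closedBall_zero_iff]
      refine (norm_add_le _ _).trans ?_
      gcongr
      rw [norm_smul, Real.norm_of_nonneg hs.le]
      exact mul_le_of_le_one_left (norm_nonneg _) hs1
    have h1 := hT _ hmem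
    simp only [add_sub_cancel_left, zero_apply, sub_zero, map_smul,
      smul_apply, smul_eq_mul, norm_smul, Real.norm_of_nonneg hs.le] at h1
    have hdiff : y + s • H.2 - (y + s • H.1) = s • d := by rw [hd]; module
    have h2 := h (y + s • H.1) (y + s • H.2) (by
      rw [hdiff, norm_smul, Real.norm_of_nonneg hs.le]; exact hsd)
    have hdiff' : y + s • H.1 - (y + s • H.2) = -(s • d) := by rw [← hdiff]; abel
    rw [hdiff, hW.decomp, hdiff', norm_smul, Real.norm_of_nonneg hs.le] at h2
    have h3 := hlip (ι (y + s • H.1)) (ι y) (s • d) (s • d)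
    have h4 : ‖ι (y + s • H.1) - ι y‖ ≤ s * (L * ‖H‖) := by
      rw [← map_sub, add_sub_cancel_left, map_smul, norm_smul, Real.norm_of_nonneg hs.le]
      gcongr
      exact (ι.le_opNorm _).trans (by gcongr; exact norm_fst_le H)
    rw [norm_smul, Real.norm_of_nonneg hs.le] at h3
    have h3' : L * ‖ι (y + s • H.1) - ι y‖ * (s * ‖d‖) * (s * ‖d‖) ≤
        L * (s * (L * ‖H‖)) * (s * ‖d‖) * (s * ‖d‖) := by gcongr
    simp only [metric, map_smul, map_neg, neg_apply, smul_apply,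
      smul_eq_mul] at h2 h3
    have e : ((y, y) + s • H : V × V) = (y + s • H.1, y + s • H.2) := rfl
    rw [e, Real.norm_eq_abs] at h1
    rw [abs_le] at h1 h2 h3
    have hA2 : A * s ^ 2 ≤ (B * ‖H‖ ^ 3 + C * ‖d‖ ^ 3 + L * (L * ‖H‖) * ‖d‖ * ‖d‖) * s * s ^ 2 := by
      have : A * s ^ 2 = |s ^ 2 * (1 / 2 * D H H - gc (ι y) (ι d) (ι d))| := by
        rw [abs_mul, abs_of_nonneg (by positivity : 0 ≤ s ^ 2), mul_comm]
      rw [this, abs_le]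
      constructor <;> nlinarith
    exact le_of_mul_le_mul_right hA2 (by positivity)
  have hlim : Tendsto (fun s : ℝ => (B * ‖H‖ ^ 3 + C * ‖d‖ ^ 3 + L * (L * ‖H‖) * ‖d‖ * ‖d‖) * s)
      (𝓝[>] 0) (𝓝 0) := by
    have : Continuous (fun s : ℝ => (B * ‖H‖ ^ 3 + C * ‖d‖ ^ 3 + L * (L * ‖H‖) * ‖d‖ * ‖d‖) * s) := by
      fun_prop
    have := this.tendsto 0
    rw [mul_zero] at this
    exact this.mono_left nhdsWithin_le_nhds
  have hev : ∀ᶠ s : ℝ in 𝓝[>] 0, s * ‖d‖ ≤ δ := by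
    have : Continuous (fun s : ℝ => s * ‖d‖) := by fun_prop
    have := (this.tendsto 0).mono_left (nhdsWithin_le_nhds (s := Ioi 0))
    rw [zero_mul] at this
    exact (this.eventually (gt_mem_nhds hδ)).mono fun _ h => h.le
  have h0 : A ≤ 0 := ge_of_tendsto hlim (by
    filter_upwards [hev, Ioo_mem_nhdsGT (zero_lt_one' ℝ)] with s h1 h2
    exact key s h2.1 h2.2.le h1)
  have := abs_eq_zero.1 (le_antisymm h0 (abs_nonneg _))
  linarith

/-- Polarization of the quadratic identity, both sides being symmetric. -/
theorem fderiv_two_diag (y : V) (H K : V × V) :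
    fderiv ℝ (fderiv ℝ Wc) (y, y) H K = 2 * gc (ι y) (ι (H.2 - H.1)) (ι (K.2 - K.1)) := by
  have hs : fderiv ℝ (fderiv ℝ Wc) (y, y) K H = fderiv ℝ (fderiv ℝ Wc) (y, y) H K :=
    hW.contDiff.contDiffAt.isSymmSndFDerivAt (by simp; norm_num) K H
  have h1 := hW.fderiv_two_diag_self hg y (H + K)
  have h2 := hW.fderiv_two_diag_self hg y H
  have h3 := hW.fderiv_two_diag_self hg y K
  have h4 := hg.symm (ι y) (K.2 - K.1) (H.2 - H.1)
  have e : (H + K).2 - (H + K).1 = (H.2 - H.1) + (K.2 - K.1) := by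
    simp only [Prod.snd_add, Prod.fst_add]; abel
  rw [e] at h1
  simp only [map_add, add_apply] at h1 h4
  linarith

/-- The Hessian identity holds at all diagonal points and may be differentiated along the diagonal.
This reaches only first arguments of the form `(u, u)`; symmetry of third derivatives must supply
the rest. -/
theorem fderiv_three_diag (y u : V) (H K : V × V) :
    fderiv ℝ (fderiv ℝ (fderiv ℝ Wc)) (y, y) (u, u) H K =
      2 * fderiv ℝ gc (ι y) (ι u) (ι (H.2 - H.1)) (ι (K.2 - K.1)) := by
  have hd : Differentiable ℝ (fderiv ℝ (fderiv ℝ Wc)) :=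
    ((hW.contDiff.fderiv_right (m := 3) (by norm_num)).fderiv_right (m := 2)
      (by norm_num)).differentiable two_ne_zero
  have hl : HasDerivAt (fun s : ℝ => ((y, y) : V × V) + s • ((u, u) : V × V)) (u, u) 0 := by
    simpa using ((hasDerivAt_id (0 : ℝ)).smul_const ((u, u) : V × V)).const_add ((y, y) : V × V)
  have hl2 : HasDerivAt (fun s : ℝ => ι y + s • ι u) (ι u) 0 := by
    simpa using ((hasDerivAt_id (0 : ℝ)).smul_const (ι u)).const_add (ι y)
  have h1 : HasDerivAt (fun s : ℝ => fderiv ℝ (fderiv ℝ Wc) ((y, y) + s • (u, u)) H K)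
      (fderiv ℝ (fderiv ℝ (fderiv ℝ Wc)) (y, y) (u, u) H K) 0 := by
    have a := ((hd ((y, y) + (0 : ℝ) • (u, u))).hasFDerivAt.comp_hasDerivAt (0 : ℝ) hl)
    rw [zero_smul, add_zero] at a
    have b := a.clm_apply (hasDerivAt_const (0 : ℝ) H)
    have c := b.clm_apply (hasDerivAt_const (0 : ℝ) K)
    simpa using c
  have h2 : HasDerivAt (fun s : ℝ => 2 * gc (ι y + s • ι u) (ι (H.2 - H.1)) (ι (K.2 - K.1)))
      (2 * fderiv ℝ gc (ι y) (ι u) (ι (H.2 - H.1)) (ι (K.2 - K.1))) 0 := by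
    have a := ((hg.diff (ι y + (0 : ℝ) • ι u)).hasFDerivAt.comp_hasDerivAt (0 : ℝ) hl2)
    rw [zero_smul, add_zero] at a
    have b := a.clm_apply (hasDerivAt_const (0 : ℝ) (ι (H.2 - H.1)))
    have c := (b.clm_apply (hasDerivAt_const (0 : ℝ) (ι (K.2 - K.1)))).const_mul 2
    simpa using c
  have he : (fun s : ℝ => fderiv ℝ (fderiv ℝ Wc) ((y, y) + s • (u, u)) H K) =
      fun s : ℝ => 2 * gc (ι y + s • ι u) (ι (H.2 - H.1)) (ι (K.2 - K.1)) := by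
    funext s
    have := hW.fderiv_two_diag hg (y + s • u) H K
    rw [map_add ι y, map_smul] at this
    exact this
  rw [he] at h1
  exact h1.unique h2

end IsAdmissibleEnergy
end EnergyDerivatives

end RiemSpline

namespace RiemSpline

/-! ### Euler-Lagrange equation and expansion of midpoints -/

section Midpoint

variable {V Y : Type*} [NormedAddCommGroup V] [InnerProductSpace ℝ V] [CompleteSpace V]
  [NormedAddCommGroup Y] [NormedSpace ℝ Y]
  {ι : V →L[ℝ] Y} {gc : Y → Y →L[ℝ] Y →L[ℝ] ℝ} {Q : V →L[ℝ] V →L[ℝ] ℝ}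
  {Wc : V × V → ℝ} {W : V → V → ℝ}

namespace IsAdmissibleEnergy

variable (hW : IsAdmissibleEnergy ι gc Q Wc W) (hg : IsAdmissibleMetric ι gc Q)
include hW hg

/-- The third derivative of the energy on the diagonal encodes the Christoffel operator. -/
theorem fderiv_three_christoffel (y v ψ : V) :
    fderiv ℝ (fderiv ℝ (fderiv ℝ Wc)) (y, y) (v, 0) (v, 0) (0, ψ)
      + fderiv ℝ (fderiv ℝ (fderiv ℝ Wc)) (y, y) (0, v) (0, v) (ψ, 0)
      = -4 * metric ι gc Q (ι y) (christoffel ι gc Q y v v) ψ := by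
  have hc1 : ContDiff ℝ 3 (fderiv ℝ Wc) := hW.contDiff.fderiv_right (by norm_num)
  have hc2 : ContDiff ℝ 2 (fderiv ℝ (fderiv ℝ Wc)) := hc1.fderiv_right (by norm_num)
  have hd : Differentiable ℝ (fderiv ℝ (fderiv ℝ Wc)) := hc2.differentiable two_ne_zero
  set T := fderiv ℝ (fderiv ℝ (fderiv ℝ Wc)) (y, y) with hT
  have h12 : ∀ a b c, T a b c = T b a c := fun a b c => by
    have : T a b = T b a := (hc1.of_le (by norm_num)).contDiffAt.isSymmSndFDerivAt (n := 2) (by simp) a b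
    rw [this]
  -- Obtained by differentiating the symmetry of the Hessian, whereas `h12` is the symmetry of the
  -- second derivative of `fderiv ℝ Wc`.
  have h23 : ∀ a b c, T a b c = T a c b := fun a b c => by
    have h1 : ∀ b c, HasFDerivAt (fun p => fderiv ℝ (fderiv ℝ Wc) p b c) ((T.flip b).flip c) (y, y) := by
      intro b c
      have := ((hd (y, y)).hasFDerivAt.clm_apply (hasFDerivAt_const b (y, y))).clm_apply
        (hasFDerivAt_const c (y, y))
      refine this.congr_fderiv ?_
      ext <;> simp [hT]
    have h2 : (fun p => fderiv ℝ (fderiv ℝ Wc) p b c) = fun p => fderiv ℝ (fderiv ℝ Wc) p c b := by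
      funext p
      exact hW.contDiff.contDiffAt.isSymmSndFDerivAt (by simp; norm_num) b c
    have h3 := h1 b c
    rw [h2] at h3
    have := congrArg (fun S => S a) (h3.unique (h1 c b))
    simpa using this
  have hsplit : ∀ u : V, ((u, u) : V × V) = (u, 0) + (0, u) := fun u => by simp
  have s1 := hW.fderiv_three_diag hg y v (v, 0) (0, ψ)
  have s2 := hW.fderiv_three_diag hg y v (0, v) (ψ, 0)
  have s3 := hW.fderiv_three_diag hg y ψ (v, 0) (0, v)
  rw [← hT, hsplit, map_add, add_apply, add_apply] at s1 s2 s3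
  -- Splitting `(v, v)` in `s1` and `s2` leaves one unwanted mixed term each. By symmetry their sum
  -- is the left side of `s3`, which contributes the derivative of the metric in direction `ψ`.
  have e1 : T (0, v) (v, 0) (0, ψ) = T (0, ψ) (v, 0) (0, v) := by
    rw [h23, h12, h23]
  have e2 : T (v, 0) (0, v) (ψ, 0) = T (ψ, 0) (v, 0) (0, v) := by
    rw [h23, h12]
  have hΓ := hg.metric_christoffel y v ψ
  simp only [zero_sub, sub_zero, map_neg, neg_apply] at s1 s2 s3
  linarith

omit hW hg [CompleteSpace V] in
theorem hasDerivAt_quadratic (hQ : ∀ v w, Q v w = Q w v) (x ψ : V) :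
    HasDerivAt (fun s : ℝ => Q (x + s • ψ) (x + s • ψ)) (2 * Q x ψ) 0 := by
  have e : (fun s : ℝ => Q (x + s • ψ) (x + s • ψ)) =
      fun s => Q x x + s * (2 * Q x ψ) + s ^ 2 * Q ψ ψ := by
    funext s
    simp only [map_add, map_smul, add_apply, smul_apply, smul_eq_mul, hQ ψ x]
    ring
  rw [e]
  have h1 := ((hasDerivAt_id (0 : ℝ)).mul_const (2 * Q x ψ)).const_add (Q x x)
  have h2 := ((hasDerivAt_id (0 : ℝ)).pow 2).mul_const (Q ψ ψ)
  exact HasDerivAt.congr_deriv (h1.add h2) (by simp)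

omit [CompleteSpace V] in
/-- Optimality condition of a midpoint. -/
theorem midpoint_eulerLagrange {a b c : V} (hm : IsMidpoint W a b c) (ψ : V) :
    fderiv ℝ Wc (a, c) (0, ψ) + fderiv ℝ Wc (c, b) (ψ, 0) + 2 * Q (2 • c - a - b) ψ = 0 := by
  have hd : Differentiable ℝ Wc := hW.contDiff.differentiable (by norm_num)
  have hl : HasDerivAt (fun s : ℝ => c + s • ψ) ψ 0 := by
    simpa using ((hasDerivAt_id (0 : ℝ)).smul_const ψ).const_add c
  have h1 : HasDerivAt (fun s : ℝ => Wc (a, c + s • ψ)) (fderiv ℝ Wc (a, c) (0, ψ)) 0 := by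
    have := (hd (a, c + (0 : ℝ) • ψ)).hasFDerivAt.comp_hasDerivAt (0 : ℝ)
      ((hasDerivAt_const (0 : ℝ) a).prodMk hl)
    simpa [Function.comp_def] using this
  have h2 : HasDerivAt (fun s : ℝ => Wc (c + s • ψ, b)) (fderiv ℝ Wc (c, b) (ψ, 0)) 0 := by
    have := (hd (c + (0 : ℝ) • ψ, b)).hasFDerivAt.comp_hasDerivAt (0 : ℝ)
      (hl.prodMk (hasDerivAt_const (0 : ℝ) b))
    simpa [Function.comp_def] using this
  have h3 := hasDerivAt_quadratic hg.Q_symm (a - c) (-ψ)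
  have h4 := hasDerivAt_quadratic hg.Q_symm (c - b) ψ
  have h5 := (h1.add h3).add (h2.add h4)
  have hmin : IsLocalMin (fun s : ℝ => W a (c + s • ψ) + W (c + s • ψ) b) 0 :=
    Eventually.of_forall fun s => by simpa using hm (c + s • ψ)
  have h6 := hmin.hasDerivAt_eq_zero (h5.congr_of_eventuallyEq (Eventually.of_forall fun s => by
    simp only [hW.decomp, Pi.add_apply]
    rw [show a - (c + s • ψ) = a - c + s • (-ψ) by module,
      show c + s • ψ - b = c - b + s • ψ by module]))
  have e1 : Q (2 • c - a - b) ψ = -Q (a - c) ψ + Q (c - b) ψ := by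
    rw [show 2 • c - a - b = -(a - c) + (c - b) by module]
    simp
  rw [map_neg] at h6
  rw [e1]
  linarith

/-- A midpoint deviates at most quadratically from the linear midpoint. -/
theorem exists_midpoint_sub_le (R : ℝ) : ∃ C : ℝ, 0 < C ∧ ∀ a b c : V, ‖a‖ ≤ R → ‖b‖ ≤ R →
    ‖c‖ ≤ R → IsMidpoint W a b c → ‖2 • c - a - b‖ ≤ C * (‖c - a‖ ^ 2 + ‖b - c‖ ^ 2) := by
  obtain ⟨B, hB, hbd⟩ := hW.exists_fderiv_bounds R
  obtain ⟨k, Λ, L, hk, hΛ, hL, hcoer, -⟩ := hg.exists_bounds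
  have hT := fun p₀ p (hp₀ : ‖p₀‖ ≤ R) (hp : ‖p‖ ≤ R) =>
    taylor_one (hW.contDiff.fderiv_right (by norm_num))
    (convex_closedBall (0 : V × V) R) hB.le
    (fun p hp => (hbd p (by simpa using hp)).2.1) (p₀ := p₀) (p := p)
    (by simpa using hp₀) (by simpa using hp)
  refine ⟨B / k, by positivity, fun a b c ha hb hc hm => ?_⟩
  -- The deviation is its own test vector: linearized at `(c, c)`, the optimality condition
  -- contributes exactly `2 g_c(ψ, ψ)`, the part `Q` included, and the rest is a Taylor remainder
  -- times `‖ψ‖`.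
  set ψ := 2 • c - a - b with hψ
  have h0 := hW.midpoint_eulerLagrange hg hm ψ
  have h1 := hT (c, c) (a, c) (by simp [hc]) (by simp [ha, hc])
  have h2 := hT (c, c) (c, b) (by simp [hc]) (by simp [hb, hc])
  rw [hW.fderiv_diag hg] at h1 h2
  have a1 := (ContinuousLinearMap.le_opNorm _ ((0, ψ) : V × V)).trans
    (mul_le_mul_of_nonneg_right h1 (norm_nonneg _))
  have a2 := (ContinuousLinearMap.le_opNorm _ ((ψ, 0) : V × V)).trans
    (mul_le_mul_of_nonneg_right h2 (norm_nonneg _))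
  have n1 : ‖((a, c) : V × V) - (c, c)‖ = ‖c - a‖ := by
    rw [Prod.mk_sub_mk, sub_self, Prod.norm_mk, norm_zero, max_eq_left (norm_nonneg _), norm_sub_rev]
  have n2 : ‖((c, b) : V × V) - (c, c)‖ = ‖b - c‖ := by
    rw [Prod.mk_sub_mk, sub_self, Prod.norm_mk, norm_zero, max_eq_right (norm_nonneg _)]
  have n3 : ‖((0, ψ) : V × V)‖ = ‖ψ‖ := by simp
  have n4 : ‖((ψ, 0) : V × V)‖ = ‖ψ‖ := by simp
  rw [n1, n3, sub_apply, sub_apply, zero_apply, sub_zero, hW.fderiv_two_diag hg, Real.norm_eq_abs] at a1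
  rw [n2, n4, sub_apply, sub_apply, zero_apply, sub_zero, hW.fderiv_two_diag hg, Real.norm_eq_abs] at a2
  have e : gc (ι c) (ι ((((a, c) : V × V) - (c, c)).2 - (((a, c) : V × V) - (c, c)).1)) (ι (ψ - 0))
      + gc (ι c) (ι ((((c, b) : V × V) - (c, c)).2 - (((c, b) : V × V) - (c, c)).1)) (ι (0 - ψ))
      = gc (ι c) (ι ψ) (ι ψ) := by
    have : gc (ι c) (ι ψ) = gc (ι c) (ι (c - a)) - gc (ι c) (ι (b - c)) := by
      rw [← map_sub, ← map_sub, hψ]; congr 2; module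
    rw [this]
    simp only [Prod.mk_sub_mk, sub_self, zero_sub, sub_zero, map_neg, neg_sub, sub_apply]
    ring
  have hc' := hcoer (ι c) ψ
  rw [metric] at hc'
  simp only at e a1 a2
  rw [abs_le] at a1 a2
  have h3 : 2 * (k * ‖ψ‖ ^ 2) ≤ B * (‖c - a‖ ^ 2 + ‖b - c‖ ^ 2) * ‖ψ‖ := by linarith
  rcases (norm_nonneg ψ).eq_or_lt with hz | hz
  · rw [← hz]; positivity
  · rw [div_mul_eq_mul_div, le_div_iff₀ hk]
    refine le_of_mul_le_mul_right ?_ hz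
    have : 0 ≤ k * ‖ψ‖ ^ 2 := by positivity
    nlinarith

/-- A priori estimate for the distance of a midpoint of two nearby nodes to the node between
them. -/
theorem exists_norm_midpoint_sub_le {R : ℝ} (hR : 0 < R) : ∃ C ρ₀ : ℝ, 0 < C ∧ 0 < ρ₀ ∧ ρ₀ ≤ 1 ∧
    ∀ (ρ : ℝ) (y v e c : V), 0 < ρ → ρ ≤ ρ₀ → ‖y‖ ≤ R → ‖v‖ ≤ R → ‖e‖ ≤ R * ρ ^ 3 →
      IsMidpoint W (y - ρ ^ 2 • v) (y + ρ ^ 2 • v + e) c → ‖c - y‖ ≤ C * ρ ^ 3 := by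
  obtain ⟨δ, κ, M, hδ, hκ, hM, hlow, hupp⟩ := hW.exists_energy_quadratic_bounds hg
  obtain ⟨δ', hδ', hsmall⟩ := hW.norm_sub_le_of_energy_le hδ
  obtain ⟨C₁, hC₁, hmid⟩ := hW.exists_midpoint_sub_le hg (R + 2 * R + δ)
  -- `M₁ ρ²` will bound the distances from the midpoint to both ends; the factor `5 = 1 + 2²` comes
  -- from the two distances `R ρ²` and `2 R ρ²` of the competitor `y`.
  set M₁ : ℝ := √(5 * M * R ^ 2 / κ) with hM₁
  set M₂ : ℝ := C₁ * (2 * M₁ ^ 2) + R with hM₂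
  have hM₂0 : 0 < M₂ := by positivity
  refine ⟨M₂, min 1 (min (√(δ / (2 * R))) (√(δ' / (5 * M * R ^ 2)))), by positivity,
    by positivity, min_le_left _ _, ?_⟩
  intro ρ y v e c hρ hρ0 hy hv he hm
  have hρ1 : ρ ≤ 1 := hρ0.trans (min_le_left _ _)
  have hρδ : 2 * R * ρ ^ 2 ≤ δ := by
    have := (hρ0.trans (min_le_right _ _)).trans (min_le_left _ _)
    have := (Real.le_sqrt hρ.le (by positivity)).1 this
    rw [le_div_iff₀ (by positivity)] at this; linarith
  have hρδ' : 5 * M * R ^ 2 * ρ ^ 4 ≤ δ' := by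
    have := (hρ0.trans (min_le_right _ _)).trans (min_le_right _ _)
    have h1 := (Real.le_sqrt hρ.le (by positivity)).1 this
    rw [le_div_iff₀ (by positivity)] at h1
    have h2 : ρ ^ 4 ≤ ρ ^ 2 := pow_le_pow_of_le_one hρ.le hρ1 (by norm_num)
    nlinarith [mul_pos hM (pow_pos hR 2)]
  have hρ32 : ρ ^ 3 ≤ ρ ^ 2 := pow_le_pow_of_le_one hρ.le hρ1 (by norm_num)
  have hρ21 : ρ ^ 2 ≤ 1 := pow_le_one₀ hρ.le hρ1
  set a := y - ρ ^ 2 • v with ha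
  set b := y + ρ ^ 2 • v + e with hb
  have hay : ‖a - y‖ ≤ R * ρ ^ 2 := by
    rw [ha, sub_sub_cancel_left, norm_neg, norm_smul, Real.norm_of_nonneg (by positivity), mul_comm]
    gcongr
  have hby : ‖y - b‖ ≤ 2 * R * ρ ^ 2 := by
    rw [hb, norm_sub_rev, show y + ρ ^ 2 • v + e - y = ρ ^ 2 • v + e by abel]
    refine (norm_add_le _ _).trans ?_
    rw [norm_smul, Real.norm_of_nonneg (by positivity)]
    nlinarith [mul_le_mul_of_nonneg_left hv (sq_nonneg ρ), mul_le_mul_of_nonneg_left hρ32 hR.le]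
  have hsum : W a c + W c b ≤ 5 * M * R ^ 2 * ρ ^ 4 := by
    refine (hm y).trans ?_
    have h1 := hupp a y (hay.trans (by nlinarith [mul_pos hR (pow_pos hρ 2)]))
    have h2 := hupp y b (hby.trans hρδ)
    have h3 : M * ‖a - y‖ ^ 2 ≤ M * (R * ρ ^ 2) ^ 2 := by gcongr
    have h4 : M * ‖y - b‖ ^ 2 ≤ M * (2 * R * ρ ^ 2) ^ 2 := by gcongr
    calc _ ≤ M * (R * ρ ^ 2) ^ 2 + M * (2 * R * ρ ^ 2) ^ 2 := by linarith
      _ = _ := by ring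
  have hWac := hW.energy_nonneg hg a c
  have hWcb := hW.energy_nonneg hg c b
  -- Small energy first puts the pair into the quadratic regime, through the growth of `W`; only
  -- there does the energy bound yield the rate `ρ²`.
  have hest : ∀ p q : V, W p q ≤ 5 * M * R ^ 2 * ρ ^ 4 → ‖p - q‖ ≤ δ ∧ ‖p - q‖ ≤ M₁ * ρ ^ 2 := by
    intro p q h
    have h1 := hsmall p q (h.trans hρδ')
    refine ⟨h1, ?_⟩
    have h2 := (hlow p q h1).trans h
    refine abs_le_of_sq_le_sq' ?_ (by positivity) |>.2
    rw [mul_pow, hM₁, Real.sq_sqrt (by positivity), div_mul_eq_mul_div, le_div_iff₀ hκ]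
    calc _ = κ * ‖p - q‖ ^ 2 := by ring
      _ ≤ _ := h2
      _ = _ := by ring
  obtain ⟨hac, hac'⟩ := hest a c (by linarith)
  obtain ⟨hcb, hcb'⟩ := hest c b (by linarith)
  have hRa : ‖a‖ ≤ R + 2 * R := by
    have : ‖a‖ ≤ ‖a - y‖ + ‖y‖ := norm_le_norm_sub_add a y
    nlinarith
  have hRb : ‖b‖ ≤ R + 2 * R := by
    have : ‖b‖ ≤ ‖b - y‖ + ‖y‖ := norm_le_norm_sub_add b y
    rw [norm_sub_rev] at this
    nlinarith
  have hRc : ‖c‖ ≤ R + 2 * R + δ := by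
    have : ‖c‖ ≤ ‖c - a‖ + ‖a‖ := norm_le_norm_sub_add c a
    rw [norm_sub_rev] at this
    linarith
  have hζ := hmid a b c (by linarith) (by linarith) hRc hm
  set β := c - y with hβ
  have hβe : 2 • c - a - b = 2 • β - e := by rw [hβ, ha, hb]; module
  have hβ1 : ‖β‖ ≤ M₂ * ρ ^ 3 := by
    -- The deviation is in fact `O(ρ⁴)`; it is relaxed to `ρ³`, the order of `e`.
    have h1 : ‖2 • β - e‖ ≤ C₁ * (2 * M₁ ^ 2) * ρ ^ 3 := by
      rw [← hβe]
      refine hζ.trans ?_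
      have h2 : ‖c - a‖ ^ 2 + ‖b - c‖ ^ 2 ≤ 2 * M₁ ^ 2 * ρ ^ 3 := by
        rw [norm_sub_rev c a, norm_sub_rev b c]
        have i1 : ‖a - c‖ ^ 2 ≤ (M₁ * ρ ^ 2) ^ 2 := by gcongr
        have i2 : ‖c - b‖ ^ 2 ≤ (M₁ * ρ ^ 2) ^ 2 := by gcongr
        have i3 : ρ ^ 4 ≤ ρ ^ 3 := pow_le_pow_of_le_one hρ.le hρ1 (by norm_num)
        have i4 : M₁ ^ 2 * ρ ^ 4 ≤ M₁ ^ 2 * ρ ^ 3 := by gcongr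
        calc _ ≤ 2 * (M₁ ^ 2 * ρ ^ 4) := by rw [mul_pow, ← pow_mul] at i1 i2; norm_num at i1 i2; linarith
          _ ≤ _ := by linarith
      calc _ ≤ C₁ * (2 * M₁ ^ 2 * ρ ^ 3) := by gcongr
        _ = _ := by ring
    have h2 : ‖2 • β‖ ≤ ‖2 • β - e‖ + ‖e‖ := norm_le_norm_sub_add _ _
    have h3 : ‖2 • β‖ = 2 * ‖β‖ := by
      rw [← Nat.cast_smul_eq_nsmul ℝ, norm_smul]; norm_num
    have : 0 ≤ C₁ * (2 * M₁ ^ 2) * ρ ^ 3 := by positivity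
    have : 0 ≤ R * ρ ^ 3 := by positivity
    rw [hM₂, add_mul]
    linarith
  exact hβ1

/-- Second order expansion of a midpoint: for the nodes `a = y - ρ² v`, `b = y + ρ² v + e` with
`e = O(ρ³)` the midpoint is `y + (e + ρ⁴ Γ_y(v,v)) / 2 + O(ρ⁵)`. -/
theorem exists_midpoint_expansion {R : ℝ} (hR : 0 < R) : ∃ C ρ₀ : ℝ, 0 < C ∧ 0 < ρ₀ ∧ ρ₀ ≤ 1 ∧
    ∀ (ρ : ℝ) (y v e c : V), 0 < ρ → ρ ≤ ρ₀ → ‖y‖ ≤ R → ‖v‖ ≤ R → ‖e‖ ≤ R * ρ ^ 3 →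
      IsMidpoint W (y - ρ ^ 2 • v) (y + ρ ^ 2 • v + e) c →
      ‖(2 : ℝ) • (c - y) - (e + ρ ^ 4 • christoffel ι gc Q y v v)‖ ≤ C * ρ ^ 5 ∧
      ‖c - y‖ ≤ C * ρ ^ 3 := by
  obtain ⟨k, Λ, L, hk, hΛ, hL, hcoer, -⟩ := hg.exists_bounds
  obtain ⟨M, ρ₀, hM, hρ₀, hρ₀1, hap⟩ := hW.exists_norm_midpoint_sub_le hg hR
  obtain ⟨B, hB, hbd⟩ := hW.exists_fderiv_bounds (R + 2 * R + M)
  have hT := fun p₀ p (hp₀ : ‖p₀‖ ≤ R + 2 * R + M) (hp : ‖p‖ ≤ R + 2 * R + M) =>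
    taylor_two (hW.contDiff.fderiv_right (by norm_num))
    (convex_closedBall (0 : V × V) (R + 2 * R + M)) hB.le
    (fun p hp => (hbd p (by simpa using hp)).2.2) (p₀ := p₀) (p := p)
    (by simpa using hp₀) (by simpa using hp)
  set N : ℝ := M + R with hN
  have hN0 : 0 < N := by positivity
  set C₂ : ℝ := B * (N + R) ^ 3 + B * (R * N + N ^ 2) with hC₂
  have hC₂0 : 0 < C₂ := by positivity
  refine ⟨C₂ / k + M, ρ₀, by positivity, hρ₀, hρ₀1, ?_⟩
  intro ρ y v e c hρ hρ0 hy hv he hm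
  have hβ1 := hap ρ y v e c hρ hρ0 hy hv he hm
  refine ⟨?_, hβ1.trans (by gcongr; rw [le_add_iff_nonneg_left]; positivity)⟩
  have hρ1 : ρ ≤ 1 := hρ0.trans hρ₀1
  have hρ32 : ρ ^ 3 ≤ ρ ^ 2 := pow_le_pow_of_le_one hρ.le hρ1 (by norm_num)
  have hρ21 : ρ ^ 2 ≤ 1 := pow_le_one₀ hρ.le hρ1
  have hρ31 : ρ ^ 3 ≤ 1 := pow_le_one₀ hρ.le hρ1
  set a := y - ρ ^ 2 • v with ha
  set b := y + ρ ^ 2 • v + e with hb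
  set β := c - y with hβ
  have hvn : ‖ρ ^ 2 • v‖ ≤ R := by
    rw [norm_smul, Real.norm_of_nonneg (by positivity)]
    calc ρ ^ 2 * ‖v‖ ≤ 1 * R := by gcongr
      _ = R := one_mul R
  have hen : ‖e‖ ≤ R := he.trans (mul_le_of_le_one_right hR.le hρ31)
  have hRa : ‖a‖ ≤ R + 2 * R + M := (norm_sub_le _ _).trans (by linarith)
  have hRb : ‖b‖ ≤ R + 2 * R + M := (norm_add₃_le).trans (by linarith)
  have hRc : ‖c‖ ≤ R + 2 * R + M := by
    have : ‖c‖ ≤ ‖c - y‖ + ‖y‖ := norm_le_norm_sub_add c y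
    have : M * ρ ^ 3 ≤ M := mul_le_of_le_one_right hM.le hρ31
    linarith
  set Γ := christoffel ι gc Q y v v with hΓ
  -- The residual of the claimed expansion serves as test vector; after the terms with `Γ` cancel,
  -- `2 g(ψ, ψ)` faces errors of size `O(ρ⁵) ‖ψ‖`.
  set ψ := (2 : ℝ) • β - (e + ρ ^ 4 • Γ) with hψ
  have h0 := hW.midpoint_eulerLagrange hg hm ψ
  have h1 := hT (y, y) (a, c) (by simp; linarith) (by simp; exact ⟨by linarith, hRc⟩)
  have h2 := hT (y, y) (c, b) (by simp; linarith) (by simp; exact ⟨hRc, by linarith⟩)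
  rw [hW.fderiv_diag hg] at h1 h2
  have a1 := (ContinuousLinearMap.le_opNorm _ ((0, ψ) : V × V)).trans
    (mul_le_mul_of_nonneg_right h1 (norm_nonneg _))
  have a2 := (ContinuousLinearMap.le_opNorm _ ((ψ, 0) : V × V)).trans
    (mul_le_mul_of_nonneg_right h2 (norm_nonneg _))
  have n3 : ‖((0, ψ) : V × V)‖ = ‖ψ‖ := by simp
  have n4 : ‖((ψ, 0) : V × V)‖ = ‖ψ‖ := by simp
  set T := fderiv ℝ (fderiv ℝ (fderiv ℝ Wc)) (y, y) with hTd
  have hTn : ‖T‖ ≤ B := (hbd (y, y) (by simp; linarith)).2.1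
  -- The increments from `(y, y)` consist of main parts of order `ρ²` and remainders `r₁`, `r₂` of
  -- order `ρ³`. In the quadratic Taylor term only the main parts matter, as mixed products have
  -- order `ρ⁵`.
  set w₁ : V × V := -(ρ ^ 2 • (v, 0)) with hw₁
  set w₂ : V × V := ρ ^ 2 • (0, v) with hw₂
  set r₁ : V × V := (0, β) with hr₁
  set r₂ : V × V := (β, e) with hr₂
  have d1 : ((a, c) : V × V) - (y, y) = w₁ + r₁ := by
    rw [hw₁, hr₁, ha, hβ]; ext <;> simp
  have d2 : ((c, b) : V × V) - (y, y) = w₂ + r₂ := by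
    rw [hw₂, hr₂, hb, hβ]; ext <;> simp; abel
  have nw₁ : ‖w₁‖ ≤ R * ρ ^ 2 := by
    rw [hw₁, norm_neg, norm_smul, Real.norm_of_nonneg (by positivity), mul_comm]
    gcongr; simpa using hv
  have nw₂ : ‖w₂‖ ≤ R * ρ ^ 2 := by
    rw [hw₂, norm_smul, Real.norm_of_nonneg (by positivity), mul_comm]
    gcongr; simpa using hv
  have nr₁ : ‖r₁‖ ≤ N * ρ ^ 3 := by
    rw [hr₁]; simp only [Prod.norm_mk, norm_zero]
    refine max_le (by positivity) (hβ1.trans ?_)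
    gcongr; rw [hN]; linarith
  have nr₂ : ‖r₂‖ ≤ N * ρ ^ 3 := by
    rw [hr₂]; simp only [Prod.norm_mk]
    refine max_le (hβ1.trans ?_) (he.trans ?_) <;> gcongr <;> rw [hN] <;> linarith
  have hquad : ∀ w r x : V × V, ‖w‖ ≤ R * ρ ^ 2 → ‖r‖ ≤ N * ρ ^ 3 →
      |T (w + r) (w + r) x - T w w x| ≤ 2 * (B * (R * N + N ^ 2)) * ρ ^ 5 * ‖x‖ := by
    intro w r x hw hr
    have e : T (w + r) (w + r) x - T w w x = T w r x + T r w x + T r r x := by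
      simp only [map_add, add_apply]; ring
    have b1 : ∀ p q : V × V, ∀ P' Q' : ℝ, ‖p‖ ≤ P' → ‖q‖ ≤ Q' → |T p q x| ≤ B * P' * Q' * ‖x‖ :=
      fun p q P' Q' hp hq => (abs_apply₃_le T p q x).trans (by
        have := (norm_nonneg p).trans hp
        gcongr)
    have i5 : ρ ^ 6 ≤ ρ ^ 5 := pow_le_pow_of_le_one hρ.le hρ1 (by norm_num)
    have c1 := abs_le.1 (b1 w r _ _ hw hr)
    have c2 := abs_le.1 (b1 r w _ _ hr hw)
    have c3 := abs_le.1 (b1 r r _ _ hr hr)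
    have c4 : B * (N * ρ ^ 3) * (N * ρ ^ 3) * ‖x‖ ≤ B * N ^ 2 * ρ ^ 5 * ‖x‖ := by
      calc _ = B * N ^ 2 * ρ ^ 6 * ‖x‖ := by ring
        _ ≤ _ := by gcongr
    have c5 : B * (R * ρ ^ 2) * (N * ρ ^ 3) * ‖x‖ = B * (R * N) * ρ ^ 5 * ‖x‖ := by ring
    have c6 : B * (N * ρ ^ 3) * (R * ρ ^ 2) * ‖x‖ = B * (R * N) * ρ ^ 5 * ‖x‖ := by ring
    have c7 : 0 ≤ B * N ^ 2 * ρ ^ 5 * ‖x‖ := by positivity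
    rw [e, abs_le]
    constructor <;> linarith
  have q1 := hquad w₁ r₁ (0, ψ) nw₁ nr₁
  have q2 := hquad w₂ r₂ (ψ, 0) nw₂ nr₂
  -- With the Taylor factor `1/2` this cancels the term `2 ρ⁴ g(Γ, ψ)` arising from the linear part
  -- in `e3`.
  have hTw : T w₁ w₁ (0, ψ) + T w₂ w₂ (ψ, 0) = -4 * ρ ^ 4 * metric ι gc Q (ι y) Γ ψ := by
    have := hW.fderiv_three_christoffel hg y v ψ
    simp only [hw₁, hw₂, map_neg, neg_apply, map_smul, smul_apply, smul_eq_mul]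
    linear_combination ρ ^ 4 * this
  have ninc : ∀ w r : V × V, ‖w‖ ≤ R * ρ ^ 2 → ‖r‖ ≤ N * ρ ^ 3 →
      B * ‖w + r‖ ^ 3 ≤ B * (N + R) ^ 3 * ρ ^ 5 := by
    intro w r hw hr
    have i1 : ‖w + r‖ ≤ (N + R) * ρ ^ 2 := (norm_add_le _ _).trans (by
      have : N * ρ ^ 3 ≤ N * ρ ^ 2 := by gcongr
      linarith)
    have i2 : ρ ^ 6 ≤ ρ ^ 5 := pow_le_pow_of_le_one hρ.le hρ1 (by norm_num)
    calc B * ‖w + r‖ ^ 3 ≤ B * ((N + R) * ρ ^ 2) ^ 3 := by gcongr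
      _ = B * (N + R) ^ 3 * ρ ^ 6 := by ring
      _ ≤ _ := by gcongr
  have j1 := ninc w₁ r₁ nw₁ nr₁
  have j2 := ninc w₂ r₂ nw₂ nr₂
  rw [d1, n3] at a1
  rw [d2, n4] at a2
  have j1' := mul_le_mul_of_nonneg_right j1 (norm_nonneg ψ)
  have j2' := mul_le_mul_of_nonneg_right j2 (norm_nonneg ψ)
  simp only [sub_apply, sub_zero, smul_apply, smul_eq_mul, Real.norm_eq_abs] at a1 a2
  have g1 := hW.fderiv_two_diag hg y (w₁ + r₁) (0, ψ)
  have g2 := hW.fderiv_two_diag hg y (w₂ + r₂) (ψ, 0)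
  have e1 : (w₁ + r₁).2 - (w₁ + r₁).1 = β + ρ ^ 2 • v := by simp [hw₁, hr₁]
  have e2 : (w₂ + r₂).2 - (w₂ + r₂).1 = ρ ^ 2 • v + e - β := by simp [hw₂, hr₂]
  rw [e1] at g1
  rw [e2] at g2
  simp only [zero_sub, sub_zero, map_neg] at g1 g2
  have e3 : gc (ι y) (ι (β + ρ ^ 2 • v)) (ι ψ) - gc (ι y) (ι (ρ ^ 2 • v + e - β)) (ι ψ)
      + Q (2 • c - a - b) ψ = metric ι gc Q (ι y) ψ ψ + ρ ^ 4 * metric ι gc Q (ι y) Γ ψ := by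
    have e4 : (2 • c - a - b : V) = (2 : ℝ) • β - e := by rw [hβ, ha, hb]; module
    have e5 : (2 : ℝ) • β - e = ψ + ρ ^ 4 • Γ := by rw [hψ]; module
    have e6 : (2 : ℝ) • β - e = (β + ρ ^ 2 • v) - (ρ ^ 2 • v + e - β) := by module
    rw [e4, ← metric_smul_left, ← metric_add_left, ← e5, metric]
    rw [show gc (ι y) (ι ((2 : ℝ) • β - e)) = gc (ι y) (ι (β + ρ ^ 2 • v))
      - gc (ι y) (ι (ρ ^ 2 • v + e - β)) by rw [e6, map_sub, map_sub], sub_apply]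
  have hψk := hcoer (ι y) ψ
  rw [abs_le] at a1 a2 q1 q2
  rw [n3] at q1
  rw [n4] at q2
  have hfin : 2 * (k * ‖ψ‖ ^ 2) ≤ 2 * C₂ * ρ ^ 5 * ‖ψ‖ := by
    rw [hC₂]
    linarith
  have hfin2 : k * ‖ψ‖ ≤ C₂ * ρ ^ 5 := by
    rcases (norm_nonneg ψ).eq_or_lt with hz | hz
    · rw [← hz]; simp only [mul_zero]; positivity
    · exact le_of_mul_le_mul_right (by linarith) hz
  have hfin3 : ‖ψ‖ ≤ C₂ / k * ρ ^ 5 := by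
    rw [div_mul_eq_mul_div, le_div_iff₀ hk]; linarith
  refine hfin3.trans ?_
  gcongr
  linarith

end IsAdmissibleEnergy
end Midpoint

end RiemSpline

namespace RiemSpline

/-! ### Sums and differences of finite sequences -/

section DiscreteSequences

theorem sum_Icc_one_eq_sum_range {M : Type*} [AddCommMonoid M] (f : ℕ → M) (n : ℕ) :
    ∑ k ∈ Finset.Icc 1 n, f k = ∑ k ∈ Finset.range n, f (k + 1) := by
  induction n with
  | zero => simp
  | succ n ih => rw [Finset.sum_Icc_succ_top (by omega), ih, Finset.sum_range_succ]

theorem dist_le_sum_Icc_norm_sub {E : Type*} [NormedAddCommGroup E] (f : ℕ → E) {n i j : ℕ}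
    (hi : i ≤ n) (hj : j ≤ n) : ‖f i - f j‖ ≤ ∑ k ∈ Finset.Icc 1 n, ‖f k - f (k - 1)‖ := by
  wlog hij : i ≤ j generalizing i j
  · rw [norm_sub_rev]; exact this hj hi (le_of_not_ge hij)
  rw [sum_Icc_one_eq_sum_range, ← dist_eq_norm]
  refine (dist_le_Ico_sum_dist f hij).trans ?_
  simp only [dist_eq_norm, Nat.add_sub_cancel]
  refine (Finset.sum_le_sum fun k _ => (norm_sub_rev _ _).le).trans ?_
  exact Finset.sum_le_sum_of_subset_of_nonneg (fun k hk => by simp at hk ⊢; omega)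
    fun _ _ _ => norm_nonneg _

/-- Discrete Gagliardo-Nirenberg inequality. -/
theorem norm_sq_le_of_sum_le {E : Type*} [NormedAddCommGroup E] [NormedSpace ℝ E] (v : ℕ → E)
    {K : ℕ} (hK : 0 < K) {C η : ℝ} (hη : 0 < η)
    (hC : (K : ℝ)⁻¹ * ∑ k ∈ Finset.Icc 1 K, ‖v k‖ ^ 2 ≤ C) {j : ℕ} (hj : j ∈ Finset.Icc 1 K) :
    ‖v j‖ ^ 2 ≤ C + C / η + η *
      ((K : ℝ)⁻¹ * ∑ k ∈ Finset.Icc 1 (K - 1), ‖(K : ℝ) • (v (k + 1) - v k)‖ ^ 2) := by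
  have hK' : (0 : ℝ) < K := by exact_mod_cast hK
  have hsum : ∑ k ∈ Finset.Icc 1 K, ‖v k‖ ^ 2 ≤ K * C := by
    rwa [inv_mul_le_iff₀ hK'] at hC
  -- Some entry does not exceed the mean; any other is reached from it by telescoping the squares.
  obtain ⟨i, hi, hiC⟩ : ∃ i ∈ Finset.Icc 1 K, ‖v i‖ ^ 2 ≤ C := by
    refine Finset.exists_le_of_sum_le ⟨j, hj⟩ (hsum.trans (le_of_eq ?_))
    simp
  have hdist : ‖v j‖ ^ 2 - ‖v i‖ ^ 2 ≤ ∑ k ∈ Finset.Icc 1 (K - 1), |‖v (k + 1)‖ ^ 2 - ‖v k‖ ^ 2| := by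
    have h := dist_le_sum_Icc_norm_sub (fun k => ‖v (k + 1)‖ ^ 2) (n := K - 1) (i := j - 1)
      (j := i - 1) (by simp at hj; omega) (by simp at hi; omega)
    simp only [Finset.mem_Icc] at hj hi
    rw [Nat.sub_add_cancel hj.1, Nat.sub_add_cancel hi.1] at h
    refine (le_abs_self _).trans (h.trans (Finset.sum_le_sum fun k hk => ?_))
    rw [Nat.sub_add_cancel (by simp at hk; omega), Real.norm_eq_abs]
  -- Young's inequality for `|a² - b²| ≤ d (a + b)`; the weight is chosen so that `d` appears as the
  -- difference quotient `K d` with factor `η`.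
  have hterm : ∀ k, |‖v (k + 1)‖ ^ 2 - ‖v k‖ ^ 2| ≤ η * ((K : ℝ)⁻¹ * ‖(K : ℝ) • (v (k + 1) - v k)‖ ^ 2)
      + (K : ℝ)⁻¹ * (‖v (k + 1)‖ ^ 2 + ‖v k‖ ^ 2) / (2 * η) := by
    intro k
    set d := ‖v (k + 1) - v k‖
    set a := ‖v (k + 1)‖
    set b := ‖v k‖
    have h1 : |a - b| ≤ d := abs_norm_sub_norm_le _ _
    have ha : 0 ≤ a := norm_nonneg _
    have hb : 0 ≤ b := norm_nonneg _
    have h2 : |a ^ 2 - b ^ 2| ≤ d * (a + b) := by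
      rw [show a ^ 2 - b ^ 2 = (a - b) * (a + b) by ring, abs_mul, abs_of_nonneg (add_nonneg ha hb)]
      gcongr
    refine h2.trans ?_
    rw [norm_smul, Real.norm_of_nonneg hK'.le]
    have e : η * ((K : ℝ)⁻¹ * ((K : ℝ) * d) ^ 2) + (K : ℝ)⁻¹ * (a ^ 2 + b ^ 2) / (2 * η)
        - d * (a + b) = (4 * (K * η * d - (a + b) / 2) ^ 2 + (a - b) ^ 2) / (4 * η * K) := by
      field_simp; ring
    have : 0 ≤ (4 * (K * η * d - (a + b) / 2) ^ 2 + (a - b) ^ 2) / (4 * η * K) := by positivity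
    linarith
  have hs1 : ∑ k ∈ Finset.Icc 1 (K - 1), ‖v k‖ ^ 2 ≤ K * C :=
    (Finset.sum_le_sum_of_subset_of_nonneg (Finset.Icc_subset_Icc le_rfl (by omega))
      fun _ _ _ => sq_nonneg _).trans hsum
  have hs2 : ∑ k ∈ Finset.Icc 1 (K - 1), ‖v (k + 1)‖ ^ 2 ≤ K * C := by
    refine le_trans ?_ hsum
    rw [sum_Icc_one_eq_sum_range, sum_Icc_one_eq_sum_range]
    obtain ⟨n, rfl⟩ : ∃ n, K = n + 1 := ⟨K - 1, by omega⟩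
    rw [Nat.add_sub_cancel, Finset.sum_range_succ' (fun k => ‖v (k + 1)‖ ^ 2)]
    exact le_add_of_nonneg_right (sq_nonneg _)
  have hall := hdist.trans (Finset.sum_le_sum fun k _ => hterm k)
  rw [Finset.sum_add_distrib, ← Finset.mul_sum, ← Finset.mul_sum, ← Finset.sum_div, ← Finset.mul_sum,
    Finset.sum_add_distrib] at hall
  have hlast : (K : ℝ)⁻¹ * (∑ k ∈ Finset.Icc 1 (K - 1), ‖v (k + 1)‖ ^ 2 +
      ∑ k ∈ Finset.Icc 1 (K - 1), ‖v k‖ ^ 2) / (2 * η) ≤ C / η := by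
    rw [div_le_div_iff₀ (by positivity) hη, inv_mul_eq_div, div_mul_eq_mul_div, div_le_iff₀ hK']
    nlinarith
  linarith

end DiscreteSequences

/-! ### Consistency and coercivity of the discrete energies -/

section DiscreteEnergy

variable {V Y : Type*} [NormedAddCommGroup V] [InnerProductSpace ℝ V]
  [NormedAddCommGroup Y] [NormedSpace ℝ Y]

/-- The difference quotient `K (y_k - y_{k-1})`. -/
noncomputable def velNode {K : ℕ} (p : Fin (K + 1) → V) (k : ℕ) : V :=
  (K : ℝ) • (node p k - node p (k - 1))

/-- The second difference quotient `K² (y_{k+1} - 2 y_k + y_{k-1})`. -/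
noncomputable def accNode {K : ℕ} (p : Fin (K + 1) → V) (k : ℕ) : V :=
  (K : ℝ) ^ 2 • (node p (k + 1) - (2 : ℝ) • node p k + node p (k - 1))

theorem accNode_eq {K : ℕ} (p : Fin (K + 1) → V) (k : ℕ) :
    accNode p k = (K : ℝ) • (velNode p (k + 1) - velNode p k) := by
  simp only [accNode, velNode, Nat.add_sub_cancel]
  module

omit [NormedAddCommGroup V] [InnerProductSpace ℝ V] in
theorem BoundaryCondition.numMid_le (bc : BoundaryCondition V) (K : ℕ) : bc.numMid K ≤ K := by
  cases bc <;> simp [BoundaryCondition.numMid]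

omit [NormedAddCommGroup V] [InnerProductSpace ℝ V] in
theorem BoundaryCondition.sub_one_le_numMid (bc : BoundaryCondition V) (K : ℕ) :
    K - 1 ≤ bc.numMid K := by
  cases bc <;> simp [BoundaryCondition.numMid]

omit [NormedAddCommGroup V] [InnerProductSpace ℝ V] in
theorem node_succ_self {K : ℕ} (hK : 0 < K) (p : Fin (K + 1) → V) :
    node p (K + 1) = node p 1 := by
  simp [node, Nat.succ_le_iff.2 hK]

/-- A priori bounds for a discrete curve. -/
structure IsBoundedDiscrete (bc : BoundaryCondition V) (M : ℝ) {K : ℕ} (p : Fin (K + 1) → V) :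
    Prop where
  node_le : ∀ k ≤ K, ‖node p k‖ ≤ M
  vel_le : ∀ k ∈ Finset.Icc 1 K, ‖velNode p k‖ ≤ M
  acc_le : (K : ℝ)⁻¹ * ∑ k ∈ Finset.Icc 1 (bc.numMid K), ‖accNode p k‖ ^ 2 ≤ M

/-- The discrete approximation `A_k + Γ(v_k, v_k)` of the covariant acceleration. -/
noncomputable def covAccNode (ι : V →L[ℝ] Y) (gc : Y → Y →L[ℝ] Y →L[ℝ] ℝ) (Q : V →L[ℝ] V →L[ℝ] ℝ)
    {K : ℕ} (p : Fin (K + 1) → V) (k : ℕ) : V :=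
  accNode p k + christoffel ι gc Q (node p k) (velNode p k) (velNode p k)

/-- The quadrature of the continuous spline energy along a discrete curve. -/
noncomputable def splineQuadrature (ι : V →L[ℝ] Y) (gc : Y → Y →L[ℝ] Y →L[ℝ] ℝ)
    (Q : V →L[ℝ] V →L[ℝ] ℝ) (bc : BoundaryCondition V) {K : ℕ} (p : Fin (K + 1) → V) : ℝ :=
  (K : ℝ)⁻¹ * ∑ k ∈ Finset.Icc 1 (bc.numMid K),
    metric ι gc Q (ι (node p k)) (covAccNode ι gc Q p k) (covAccNode ι gc Q p k)

/-- The quadrature of the continuous path energy along a discrete curve. -/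
noncomputable def pathQuadrature (ι : V →L[ℝ] Y) (gc : Y → Y →L[ℝ] Y →L[ℝ] ℝ)
    (Q : V →L[ℝ] V →L[ℝ] ℝ) {K : ℕ} (p : Fin (K + 1) → V) : ℝ :=
  (K : ℝ)⁻¹ * ∑ k ∈ Finset.Icc 1 K,
    metric ι gc Q (ι (node p (k - 1))) (velNode p k) (velNode p k)

variable [CompleteSpace V]
  {ι : V →L[ℝ] Y} {gc : Y → Y →L[ℝ] Y →L[ℝ] ℝ} {Q : V →L[ℝ] V →L[ℝ] ℝ}
  {Wc : V × V → ℝ} {W : V → V → ℝ}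

namespace IsAdmissibleEnergy

variable (hW : IsAdmissibleEnergy ι gc Q Wc W) (hg : IsAdmissibleMetric ι gc Q)
include hW hg

omit [CompleteSpace V] in
theorem pathEnergyDiscrete_nonneg {K : ℕ} (p : Fin (K + 1) → V) : 0 ≤ pathEnergyDiscrete W p :=
  mul_nonneg (Nat.cast_nonneg K) (Finset.sum_nonneg fun _ _ => hW.energy_nonneg hg _ _)

omit [CompleteSpace V] in
theorem splineEnergyDiscrete_nonneg (bc : BoundaryCondition V) {K : ℕ} (p : Fin (K + 1) → V)
    (mid : ℕ → V) : 0 ≤ splineEnergyDiscrete bc W p mid :=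
  mul_nonneg (by positivity) (Finset.sum_nonneg fun _ _ => hW.energy_nonneg hg _ _)

/-- Consistency of the discrete path energy. -/
theorem pathEnergyDiscrete_consistent {M : ℝ} (hM : 0 < M) {ε : ℝ} (hε : 0 < ε) :
    ∃ K₀ : ℕ, ∀ K ≥ K₀, ∀ (bc : BoundaryCondition V) (p : Fin (K + 1) → V),
      IsBoundedDiscrete bc M p → |pathEnergyDiscrete W p - pathQuadrature ι gc Q p| ≤ ε := by
  obtain ⟨δ, C, hδ, hC, h⟩ := hW.exists_energy_sub_metric_le hg
  obtain ⟨K₀, hK₀⟩ := exists_nat_gt (max 1 (max (M / δ) (C * M ^ 3 / ε)))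
  refine ⟨K₀, fun K hK bc p hp => ?_⟩
  have hKr : max 1 (max (M / δ) (C * M ^ 3 / ε)) < K := hK₀.trans_le (by exact_mod_cast hK)
  have hK1 : (1 : ℝ) ≤ K := (le_max_left _ _).trans hKr.le
  have hK0 : (0 : ℝ) < K := by linarith
  have hKδ : M ≤ δ * K := by
    have := ((le_max_left _ _).trans (le_max_right _ _)).trans hKr.le
    rwa [div_le_iff₀' hδ] at this
  have hKε : C * M ^ 3 ≤ ε * K := by
    have := ((le_max_right _ _).trans (le_max_right _ _)).trans hKr.le
    rwa [div_le_iff₀' hε] at this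
  -- Neighbouring nodes are within `M / K`, so the cubic error of a summand is `C M³ / K²`, and `K`
  -- of them add up to `O(1/K)`.
  have hterm : ∀ k ∈ Finset.Icc 1 K, |K * W (node p (k - 1)) (node p k) - (K : ℝ)⁻¹ *
      metric ι gc Q (ι (node p (k - 1))) (velNode p k) (velNode p k)| ≤ C * M ^ 3 / K ^ 2 := by
    intro k hk
    have hv := hp.vel_le k hk
    set d := node p k - node p (k - 1) with hd
    have hdv : ‖d‖ ≤ M / K := by
      rw [velNode, norm_smul, Real.norm_of_nonneg hK0.le] at hv
      rw [le_div_iff₀ hK0]; linarith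
    have h1 := h (node p (k - 1)) (node p k) (hdv.trans (by rwa [div_le_iff₀ hK0]))
    have e : (K : ℝ)⁻¹ * metric ι gc Q (ι (node p (k - 1))) (velNode p k) (velNode p k)
        = K * metric ι gc Q (ι (node p (k - 1))) d d := by
      rw [velNode, ← hd, metric_smul_left, metric_smul_right]; field_simp
    rw [e, ← mul_sub, abs_mul, abs_of_nonneg hK0.le]
    calc K * |W (node p (k - 1)) (node p k) - metric ι gc Q (ι (node p (k - 1))) d d|
        ≤ K * (C * (M / K) ^ 3) := by
          gcongr
          exact h1.trans (by gcongr)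
      _ = C * M ^ 3 / K ^ 2 := by field_simp
  rw [pathEnergyDiscrete, pathQuadrature, Finset.mul_sum, Finset.mul_sum, ← Finset.sum_sub_distrib]
  refine (Finset.abs_sum_le_sum_abs _ _).trans ((Finset.sum_le_sum hterm).trans ?_)
  rw [Finset.sum_const, Nat.card_Icc, nsmul_eq_mul, Nat.add_sub_cancel]
  rw [show (K : ℝ) * (C * M ^ 3 / K ^ 2) = C * M ^ 3 / K by field_simp, div_le_iff₀ hK0]
  exact hKε

/-- Consistency of a single summand of the discrete spline energy. -/
theorem exists_energy_midpoint_expansion {M : ℝ} (hM : 0 < M) : ∃ D ρ₀ : ℝ, 0 < D ∧ 0 < ρ₀ ∧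
    ρ₀ ≤ 1 ∧ ∀ (κ ρ : ℝ) (y v A c : V), 0 < ρ → ρ ≤ ρ₀ → κ * ρ ^ 2 = 1 → ‖y‖ ≤ M → ‖v‖ ≤ M →
      ρ * ‖A‖ ≤ M + 1 → IsMidpoint W (y - ρ ^ 2 • v) (y + ρ ^ 2 • v + ρ ^ 4 • A) c →
      |4 * κ ^ 3 * W y c - κ⁻¹ * metric ι gc Q (ι y) (A + christoffel ι gc Q y v v)
        (A + christoffel ι gc Q y v v)| ≤ κ⁻¹ * (D * ρ * (1 + ‖A‖ ^ 2)) := by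
  obtain ⟨δ, C, hδ, hC, h⟩ := hW.exists_energy_sub_metric_le hg
  -- Here `κ` is the number of steps and `ρ = κ^{-1/2}`. As `ρ ‖A‖ ≤ M + 1`, the perturbation `e =
  -- ρ⁴ A` has size `(M + 1) ρ³`.
  obtain ⟨B, ρ₀, hB, hρ₀, hρ₀1, hexp⟩ := hW.exists_midpoint_expansion hg (R := M + 1) (by linarith)
  obtain ⟨c, Λ, L, hc, hΛ, hL, hcoer, hbd, -⟩ := hg.exists_bounds
  obtain ⟨G, hG, hΓ⟩ := hg.exists_norm_christoffel_le
  refine ⟨(Λ * (B + B ^ 2) + 4 * C * B ^ 3) * (2 + 2 * G ^ 2 * M ^ 4), min ρ₀ (δ / B),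
    by positivity, by positivity, (min_le_left _ _).trans hρ₀1, ?_⟩
  intro κ ρ y v A c hρ hρs hκρ hy hv hA hm
  have hρ₀' : ρ ≤ ρ₀ := hρs.trans (min_le_left _ _)
  have hρ1 : ρ ≤ 1 := hρ₀'.trans hρ₀1
  have hρδ : B * ρ ≤ δ := by
    have := hρs.trans (min_le_right _ _)
    rwa [le_div_iff₀' hB] at this
  have hκ : κ = (ρ ^ 2)⁻¹ := eq_inv_of_mul_eq_one_left hκρ
  have hκ0 : 0 < κ := by rw [hκ]; positivity
  obtain ⟨h1, h2⟩ := hexp ρ y v (ρ ^ 4 • A) c hρ hρ₀' (by linarith) (by linarith) (by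
    rw [norm_smul, Real.norm_of_nonneg (by positivity)]
    calc ρ ^ 4 * ‖A‖ = ρ ^ 3 * (ρ * ‖A‖) := by ring
      _ ≤ ρ ^ 3 * (M + 1) := by gcongr
      _ = _ := mul_comm _ _) hm
  have h3 := h y c (h2.trans (by
    have : ρ ^ 3 ≤ ρ := pow_le_of_le_one hρ.le hρ1 (by norm_num)
    nlinarith))
  have hΓn := hΓ y v
  generalize christoffel ι gc Q y v v = Γ at *
  generalize c - y = β at *
  generalize W y c = w at *
  generalize hX : A + Γ = X at *
  have hcub : 4 * κ ^ 3 * (C * ‖β‖ ^ 3) ≤ κ⁻¹ * (4 * C * B ^ 3 * ρ) := by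
    calc 4 * κ ^ 3 * (C * ‖β‖ ^ 3) ≤ 4 * κ ^ 3 * (C * (B * ρ ^ 3) ^ 3) := by gcongr
      _ = _ := by rw [hκ]; field_simp
  -- `2κ²(c - y)` approximates the covariant acceleration `X` up to `O(ρ)`, and the prefactor of the
  -- energy is `4κ³ = κ⁻¹ (2κ²)²`.
  obtain ⟨R, hR⟩ : ∃ R, R = (2 * κ ^ 2) • β - X := ⟨_, rfl⟩
  have hRn : ‖R‖ ≤ B * ρ := by
    have e : R = κ ^ 2 • ((2 : ℝ) • β - (ρ ^ 4 • A + ρ ^ 4 • Γ)) := by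
      have h4 : κ ^ 2 * ρ ^ 4 = 1 := by rw [hκ]; field_simp
      rw [hR, ← hX, smul_sub (κ ^ 2), smul_add (κ ^ 2), smul_smul, smul_smul, smul_smul, h4,
        one_smul, one_smul, mul_comm]
    rw [e, norm_smul, Real.norm_of_nonneg (by positivity)]
    calc κ ^ 2 * _ ≤ κ ^ 2 * (B * ρ ^ 5) := by gcongr
      _ = B * ρ := by rw [hκ]; field_simp
  have hmet : 4 * κ ^ 3 * metric ι gc Q (ι y) β β =
      κ⁻¹ * metric ι gc Q (ι y) (X + R) (X + R) := by
    have hβX : X + R = (2 * κ ^ 2) • β := by rw [hR]; abel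
    rw [hβX, metric_smul_left, metric_smul_right]; field_simp; ring
  have hXn : ‖X‖ ^ 2 ≤ 2 * ‖A‖ ^ 2 + 2 * G ^ 2 * M ^ 4 := by
    have i1 : ‖Γ‖ ≤ G * M ^ 2 := hΓn.trans (by gcongr)
    have i2 : ‖X‖ ≤ ‖A‖ + G * M ^ 2 := by rw [← hX]; exact (norm_add_le _ _).trans (by linarith)
    calc ‖X‖ ^ 2 ≤ (‖A‖ + G * M ^ 2) ^ 2 := by gcongr
      _ ≤ _ := by nlinarith [sq_nonneg (‖A‖ - G * M ^ 2)]
  have hdiff : |metric ι gc Q (ι y) (X + R) (X + R) - metric ι gc Q (ι y) X X| ≤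
      Λ * (B + B ^ 2) * ρ * (1 + ‖X‖ ^ 2) := by
    have e : metric ι gc Q (ι y) (X + R) (X + R) - metric ι gc Q (ι y) X X =
        2 * metric ι gc Q (ι y) X R + metric ι gc Q (ι y) R R := by
      simp only [metric_add_left, metric_add_right, hg.metric_comm (ι y) R X]; ring
    have j1 : |metric ι gc Q (ι y) X R| ≤ Λ * ‖X‖ * (B * ρ) := (hbd _ _ _).trans (by gcongr)
    have j2 : |metric ι gc Q (ι y) R R| ≤ Λ * (B * ρ) * (B * ρ) := (hbd _ _ _).trans (by gcongr)
    rw [e]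
    refine (abs_add_le _ _).trans ?_
    rw [abs_mul, abs_two]
    have j3 : 2 * (Λ * ‖X‖ * (B * ρ)) ≤ Λ * B * ρ * (1 + ‖X‖ ^ 2) := by
      have : 0 ≤ Λ * B * ρ * (‖X‖ - 1) ^ 2 := by positivity
      linarith
    have j4 : Λ * (B * ρ) * (B * ρ) ≤ Λ * B ^ 2 * ρ * (1 + ‖X‖ ^ 2) := by
      have i1 : ρ * ρ ≤ ρ := mul_le_of_le_one_right hρ.le hρ1
      have i2 : Λ * B ^ 2 * (ρ * ρ) ≤ Λ * B ^ 2 * ρ := by gcongr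
      have i3 : 0 ≤ Λ * B ^ 2 * ρ * ‖X‖ ^ 2 := by positivity
      linarith
    linarith
  have e : 4 * κ ^ 3 * w - κ⁻¹ * metric ι gc Q (ι y) X X =
      4 * κ ^ 3 * (w - metric ι gc Q (ι y) β β) + κ⁻¹ *
      (metric ι gc Q (ι y) (X + R) (X + R) - metric ι gc Q (ι y) X X) := by
    linear_combination hmet
  rw [e]
  refine (abs_add_le _ _).trans ?_
  rw [abs_mul (4 * κ ^ 3), abs_mul κ⁻¹, abs_of_nonneg (by positivity : 0 ≤ 4 * κ ^ 3),
    abs_of_nonneg (by positivity : 0 ≤ κ⁻¹)]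
  have hfin1 : 4 * κ ^ 3 * |w - metric ι gc Q (ι y) β β| ≤ κ⁻¹ * (4 * C * B ^ 3 * ρ) := by
    refine le_trans ?_ hcub
    gcongr
  have hfin2 := mul_le_mul_of_nonneg_left hdiff (inv_nonneg.2 hκ0.le)
  refine (add_le_add hfin1 hfin2).trans ?_
  rw [← mul_add]
  gcongr
  have i1 : Λ * (B + B ^ 2) * ρ * (1 + ‖X‖ ^ 2) ≤
      Λ * (B + B ^ 2) * ρ * (1 + (2 * ‖A‖ ^ 2 + 2 * G ^ 2 * M ^ 4)) := by gcongr
  have i2 : 1 + (2 * ‖A‖ ^ 2 + 2 * G ^ 2 * M ^ 4) ≤ (2 + 2 * G ^ 2 * M ^ 4) * (1 + ‖A‖ ^ 2) := by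
    have : 0 ≤ 2 * G ^ 2 * M ^ 4 * ‖A‖ ^ 2 := by positivity
    linarith
  have i3 : Λ * (B + B ^ 2) * ρ * (1 + (2 * ‖A‖ ^ 2 + 2 * G ^ 2 * M ^ 4)) ≤
      Λ * (B + B ^ 2) * ρ * ((2 + 2 * G ^ 2 * M ^ 4) * (1 + ‖A‖ ^ 2)) := by gcongr
  have i4 : 4 * C * B ^ 3 * ρ * 1 ≤ 4 * C * B ^ 3 * ρ * ((2 + 2 * G ^ 2 * M ^ 4) * (1 + ‖A‖ ^ 2)) := by
    gcongr
    refine le_trans ?_ i2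
    have : 0 ≤ 2 * ‖A‖ ^ 2 + 2 * G ^ 2 * M ^ 4 := by positivity
    linarith
  linarith

/-- Consistency of the discrete spline energy. -/
theorem splineEnergyDiscrete_consistent {M : ℝ} (hM : 0 < M) {ε : ℝ} (hε : 0 < ε) :
    ∃ K₀ : ℕ, ∀ K ≥ K₀, ∀ (bc : BoundaryCondition V) (p : Fin (K + 1) → V) (mid : ℕ → V),
      IsBoundedDiscrete bc M p →
      (∀ k ∈ Finset.Icc 1 (bc.numMid K), IsMidpoint W (node p (k - 1)) (node p (k + 1)) (mid k)) →
      |splineEnergyDiscrete bc W p mid - splineQuadrature ι gc Q bc p| ≤ ε := by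
  obtain ⟨D, ρ₀, hD, hρ₀, hρ₀1, hexp⟩ := hW.exists_energy_midpoint_expansion hg hM
  set s : ℝ := min ρ₀ (ε / (D * (1 + M))) with hs
  have hs0 : 0 < s := by positivity
  obtain ⟨K₀, hK₀⟩ := exists_nat_gt (max 1 ((s ^ 2)⁻¹))
  refine ⟨K₀, fun K hK bc p mid hp hmid => ?_⟩
  have hKr : max 1 ((s ^ 2)⁻¹) < K := hK₀.trans_le (by exact_mod_cast hK)
  have hK1 : (1 : ℝ) ≤ K := (le_max_left _ _).trans hKr.le
  have hK0 : (0 : ℝ) < K := by linarith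
  set ρ : ℝ := √((K : ℝ)⁻¹) with hρd
  have hρ : 0 < ρ := Real.sqrt_pos.2 (inv_pos.2 hK0)
  have hρ2 : ρ ^ 2 = (K : ℝ)⁻¹ := Real.sq_sqrt (inv_pos.2 hK0).le
  have hKρ : (K : ℝ) * ρ ^ 2 = 1 := by rw [hρ2, mul_inv_cancel₀ hK0.ne']
  have hρs : ρ ≤ s := by
    refine abs_le_of_sq_le_sq' ?_ hs0.le |>.2
    rw [hρ2]
    exact inv_le_of_inv_le₀ (by positivity) ((le_max_right _ _).trans hKr.le)
  have hρε : D * (1 + M) * ρ ≤ ε := by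
    have := hρs.trans (min_le_right _ _)
    rwa [le_div_iff₀' (by positivity)] at this
  have hterm : ∀ k ∈ Finset.Icc 1 (bc.numMid K), |4 * K ^ 3 * W (node p k) (mid k) -
      (K : ℝ)⁻¹ * metric ι gc Q (ι (node p k)) (covAccNode ι gc Q p k) (covAccNode ι gc Q p k)| ≤
      (K : ℝ)⁻¹ * (D * ρ * (1 + ‖accNode p k‖ ^ 2)) := by
    intro k hk
    have hkK : k ∈ Finset.Icc 1 K := Finset.Icc_subset_Icc le_rfl (bc.numMid_le K) hk
    refine hexp K ρ (node p k) (velNode p k) (accNode p k) (mid k) hρ (hρs.trans (min_le_left _ _))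
      hKρ (hp.node_le k (Finset.mem_Icc.1 hkK).2) (hp.vel_le k hkK) ?_ ?_
    -- A single summand of the mean square bound already gives `ρ² ‖A_k‖² ≤ M`, which is all that is
    -- known about an individual acceleration.
    · have h1 : (K : ℝ)⁻¹ * ‖accNode p k‖ ^ 2 ≤ M := by
        refine le_trans ?_ hp.acc_le
        gcongr
        exact Finset.single_le_sum (f := fun k => ‖accNode p k‖ ^ 2) (fun _ _ => sq_nonneg _) hk
      rw [← hρ2, ← mul_pow] at h1
      nlinarith [sq_nonneg (ρ * ‖accNode p k‖ - 1)]
    · have h2 : ρ ^ 2 * (K : ℝ) = 1 := by linarith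
      have h4 : ρ ^ 4 * (K : ℝ) ^ 2 = 1 := by
        rw [show ρ ^ 4 * (K : ℝ) ^ 2 = (ρ ^ 2 * K) ^ 2 by ring, h2, one_pow]
      have ea : node p k - ρ ^ 2 • velNode p k = node p (k - 1) := by
        rw [velNode, smul_smul, h2]; module
      have eb : node p k + ρ ^ 2 • velNode p k + ρ ^ 4 • accNode p k = node p (k + 1) := by
        rw [velNode, accNode, smul_smul, smul_smul, h4, h2]; module
      rw [ea, eb]
      exact hmid k hk
  rw [splineEnergyDiscrete, splineQuadrature, Finset.mul_sum, Finset.mul_sum,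
    ← Finset.sum_sub_distrib]
  refine (Finset.abs_sum_le_sum_abs _ _).trans ((Finset.sum_le_sum hterm).trans ?_)
  rw [← Finset.mul_sum, ← Finset.mul_sum, Finset.sum_add_distrib,
    Finset.sum_const, Nat.card_Icc, nsmul_eq_mul, Nat.add_sub_cancel, mul_one]
  refine le_trans ?_ hρε
  have hn : (bc.numMid K : ℝ) ≤ K := by exact_mod_cast bc.numMid_le K
  have ha := hp.acc_le
  set S := ∑ k ∈ Finset.Icc 1 (bc.numMid K), ‖accNode p k‖ ^ 2
  have i1 : (K : ℝ)⁻¹ * (bc.numMid K : ℝ) ≤ 1 := by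
    rw [inv_mul_le_iff₀ hK0]; linarith
  calc (K : ℝ)⁻¹ * (D * ρ * ((bc.numMid K : ℝ) + S))
      = D * ρ * ((K : ℝ)⁻¹ * (bc.numMid K : ℝ) + (K : ℝ)⁻¹ * S) := by ring
    _ ≤ D * ρ * (1 + M) := by gcongr
    _ = _ := by ring

omit hW hg [CompleteSpace V] [InnerProductSpace ℝ V] in
-- By nonnegativity each summand is at most `B / κ ≤ a`, which places every pair where the quadratic
-- lower bound holds; then the bounds are summed.
theorem norm_sub_le_of_sum_energy {a c : ℝ} (ha : 0 < a)
    (hlow : ∀ y z : V, W y z ≤ a → c * ‖y - z‖ ^ 2 ≤ W y z) (hpos : ∀ y z, 0 ≤ W y z)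
    {s : Finset ℕ} {f g : ℕ → V} {B κ : ℝ} (hκ : B / a ≤ κ)
    (hB : κ * ∑ k ∈ s, W (f k) (g k) ≤ B) (hκ0 : 0 < κ) :
    (∀ k ∈ s, W (f k) (g k) ≤ a) ∧ c * (κ * ∑ k ∈ s, ‖f k - g k‖ ^ 2) ≤ B := by
  rw [div_le_iff₀ ha] at hκ
  have h1 : ∀ k ∈ s, W (f k) (g k) ≤ a := fun k hk => by
    have := Finset.single_le_sum (f := fun k => W (f k) (g k)) (fun _ _ => hpos _ _) hk
    refine le_of_mul_le_mul_left ?_ hκ0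
    exact (mul_le_mul_of_nonneg_left this hκ0.le).trans (hB.trans hκ)
  refine ⟨h1, le_trans ?_ hB⟩
  calc c * (κ * ∑ k ∈ s, ‖f k - g k‖ ^ 2) = κ * ∑ k ∈ s, c * ‖f k - g k‖ ^ 2 := by
        rw [← Finset.mul_sum]; ring
    _ ≤ _ := by
        gcongr with k hk
        exact hlow _ _ (h1 k hk)

/-- The growth of `W` is only qualitative; it serves to force pairs of small energy into the region
where `W` dominates the squared distance. -/
theorem exists_energy_coercive : ∃ a c δ : ℝ, 0 < a ∧ 0 < c ∧ 0 < δ ∧ δ ≤ 1 ∧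
    (∀ y z : V, W y z ≤ a → c * ‖y - z‖ ^ 2 ≤ W y z) ∧ ∀ y z : V, W y z ≤ a → ‖y - z‖ ≤ δ := by
  obtain ⟨δ, c, -, hδ, hc, -, hlow, -⟩ := hW.exists_energy_quadratic_bounds hg
  obtain ⟨a, ha, hsmall⟩ := hW.norm_sub_le_of_energy_le (r := min δ 1) (by positivity)
  exact ⟨a, c, min δ 1, ha, hc, by positivity, min_le_right _ _,
    fun y z h => hlow y z ((hsmall y z h).trans (min_le_left _ _)), hsmall⟩

/-- The second difference of three nodes is controlled by the distance of the middle one to the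
midpoint of the others. -/
theorem exists_norm_second_difference_le (R : ℝ) : ∃ C : ℝ, 0 < C ∧ ∀ a y b c : V, ‖a‖ ≤ R →
    ‖b‖ ≤ R → ‖c‖ ≤ R → IsMidpoint W a b c → ‖y - c‖ ≤ 1 →
    ‖b - (2 : ℝ) • y + a‖ ≤ C * (‖y - c‖ + ‖y - a‖ ^ 2 + ‖b - y‖ ^ 2) := by
  obtain ⟨C, hC, h⟩ := hW.exists_midpoint_sub_le hg R
  refine ⟨4 * C + 2, by positivity, fun a y b c ha hb hc hm hyc => ?_⟩
  have h1 := h a b c ha hb hc hm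
  have e : b - (2 : ℝ) • y + a = -(2 • c - a - b) - (2 : ℝ) • (y - c) := by module
  have i1 : ‖c - a‖ ≤ ‖y - c‖ + ‖y - a‖ := by
    rw [norm_sub_rev y c]; exact norm_sub_le_norm_sub_add_norm_sub _ _ _
  have i2 : ‖b - c‖ ≤ ‖b - y‖ + ‖y - c‖ := norm_sub_le_norm_sub_add_norm_sub _ _ _
  have i5 := norm_sub_le (-(2 • c - a - b)) ((2 : ℝ) • (y - c))
  rw [← e, norm_neg, norm_smul, Real.norm_of_nonneg zero_le_two] at i5
  have hβ : 0 ≤ ‖y - c‖ := norm_nonneg _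
  have hx : 0 ≤ ‖y - a‖ := norm_nonneg _
  have hz : 0 ≤ ‖b - y‖ := norm_nonneg _
  generalize ‖y - c‖ = β at *
  generalize ‖y - a‖ = x at *
  generalize ‖b - y‖ = z at *
  -- `β ≤ 1` is used in the form `β² ≤ β`, since a bound linear in the distance to the midpoint is
  -- needed.
  have i3 : ‖c - a‖ ^ 2 ≤ 2 * β + 2 * x ^ 2 := by
    calc _ ≤ (β + x) ^ 2 := by gcongr
      _ ≤ _ := by nlinarith [sq_nonneg (β - x)]
  have i4 : ‖b - c‖ ^ 2 ≤ 2 * β + 2 * z ^ 2 := by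
    calc _ ≤ (z + β) ^ 2 := by gcongr
      _ ≤ _ := by nlinarith [sq_nonneg (β - z)]
  have i6 : C * (‖c - a‖ ^ 2 + ‖b - c‖ ^ 2) ≤ C * (2 * β + 2 * x ^ 2 + (2 * β + 2 * z ^ 2)) := by
    gcongr
  have i7 := mul_nonneg hC.le (sq_nonneg x)
  have i8 := mul_nonneg hC.le (sq_nonneg z)
  nlinarith [sq_nonneg x, sq_nonneg z]

omit hW hg [CompleteSpace V] in
-- For periodic conditions the last midpoint involves `v_{K+1}`, which `y_{K+1} = y_1` and `y_0 =
-- y_K` identify with `v_1`; in all other cases the shifted index stays in range.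
theorem velNode_succ_eq_or_mem {bc : BoundaryCondition V} {K : ℕ} (hK : 0 < K)
    {p : Fin (K + 1) → V} (hbc : bc.HoldsDiscrete p) {k : ℕ}
    (hk : k ∈ Finset.Icc 1 (bc.numMid K)) :
    velNode p (k + 1) = velNode p 1 ∨ k + 1 ∈ Finset.Icc 1 K := by
  rcases ((Finset.mem_Icc.1 hk).2.trans (bc.numMid_le K)).eq_or_lt with h | h
  · left
    cases bc with
    | natural => simp [BoundaryCondition.numMid] at hk; omega
    | hermite _ _ => simp [BoundaryCondition.numMid] at hk; omega
    | periodic =>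
      have h0 : node p 0 = node p K := hbc
      simp only [velNode, h, Nat.add_sub_cancel, node_succ_self hK, Nat.sub_self, h0]
  · right; exact Finset.mem_Icc.2 ⟨by omega, h⟩

omit hW hg [CompleteSpace V] in
-- The factor `2` leaves room for a wrapped-around copy of `v_1` next to the shifted sum.
theorem sum_norm_velNode_succ_sq_le {bc : BoundaryCondition V} {K : ℕ} (hK : 0 < K)
    {p : Fin (K + 1) → V} (hbc : bc.HoldsDiscrete p) :
    ∑ k ∈ Finset.Icc 1 (bc.numMid K), ‖velNode p (k + 1)‖ ^ 2 ≤
      2 * ∑ k ∈ Finset.Icc 1 K, ‖velNode p k‖ ^ 2 := by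
  have hsub : Finset.Icc 1 (bc.numMid K) ⊆ Finset.Icc 1 K :=
    Finset.Icc_subset_Icc le_rfl (bc.numMid_le K)
  have h1 : ∑ k ∈ Finset.Icc 1 (bc.numMid K), ‖velNode p (k + 1)‖ ^ 2 ≤
      ∑ k ∈ Finset.Icc 1 K, (‖velNode p (if k + 1 ≤ K then k + 1 else 1)‖ ^ 2) := by
    refine (Finset.sum_le_sum fun k hk => ?_).trans
      (Finset.sum_le_sum_of_subset_of_nonneg hsub fun _ _ _ => sq_nonneg _)
    split_ifs with h
    · rfl
    · rcases velNode_succ_eq_or_mem hK hbc hk with h' | h'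
      · rw [h']
      · exact absurd (Finset.mem_Icc.1 h').2 h
  refine h1.trans ?_
  obtain ⟨n, rfl⟩ : ∃ n, K = n + 1 := ⟨K - 1, by omega⟩
  rw [Finset.sum_Icc_succ_top (by omega), if_neg (by omega)]
  have h3 : ∑ k ∈ Finset.Icc 1 n, ‖velNode p (if k + 1 ≤ n + 1 then k + 1 else 1)‖ ^ 2 ≤
      ∑ k ∈ Finset.Icc 1 (n + 1), ‖velNode p k‖ ^ 2 := by
    rw [sum_Icc_one_eq_sum_range, sum_Icc_one_eq_sum_range,
      Finset.sum_range_succ' (fun k => ‖velNode p (k + 1)‖ ^ 2)]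
    refine le_add_of_le_of_nonneg (Finset.sum_le_sum fun k hk => ?_) (sq_nonneg _)
    rw [if_pos (by simp at hk; omega)]
  have h4 : ‖velNode p 1‖ ^ 2 ≤ ∑ k ∈ Finset.Icc 1 (n + 1), ‖velNode p k‖ ^ 2 :=
    Finset.single_le_sum (f := fun k => ‖velNode p k‖ ^ 2) (fun _ _ => sq_nonneg _)
      (Finset.mem_Icc.2 ⟨le_rfl, hK⟩)
  linarith

omit hW hg [CompleteSpace V] in
-- Meant for squared velocities `y`, `z`: by `y² ≤ S y` one of two squares is traded for the
-- maximum, so that fourth powers enter only linearly in `S`. This linearity makes the later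
-- absorption possible.
theorem sum_sq_le_of_le_add {s : Finset ℕ} {a x y z : ℕ → ℝ} {C S : ℝ}
    (ha : ∀ k ∈ s, 0 ≤ a k) (h : ∀ k ∈ s, a k ≤ C * (x k + y k + z k))
    (hy : ∀ k ∈ s, 0 ≤ y k ∧ y k ≤ S) (hz : ∀ k ∈ s, 0 ≤ z k ∧ z k ≤ S) :
    ∑ k ∈ s, a k ^ 2 ≤ 3 * C ^ 2 * (∑ k ∈ s, x k ^ 2 + S * ∑ k ∈ s, y k + S * ∑ k ∈ s, z k) := by
  rw [Finset.mul_sum, Finset.mul_sum, ← Finset.sum_add_distrib, ← Finset.sum_add_distrib,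
    Finset.mul_sum]
  refine Finset.sum_le_sum fun k hk => ?_
  obtain ⟨hy0, hy1⟩ := hy k hk
  obtain ⟨hz0, hz1⟩ := hz k hk
  have h0 := ha k hk
  have h1 := h k hk
  generalize a k = a at *
  generalize x k = x at *
  generalize y k = y at *
  generalize z k = z at *
  calc a ^ 2 ≤ (C * (x + y + z)) ^ 2 := by gcongr
    _ ≤ 3 * C ^ 2 * (x ^ 2 + y ^ 2 + z ^ 2) := by
      have : 0 ≤ C ^ 2 * ((x - y) ^ 2 + (y - z) ^ 2 + (x - z) ^ 2) := by positivity
      linarith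
    _ ≤ 3 * C ^ 2 * (x ^ 2 + S * y + S * z) := by
      gcongr
      · rw [sq]; gcongr
      · rw [sq]; gcongr

omit hW hg [CompleteSpace V] in
theorem norm_sub_eq_norm_velNode_div {K : ℕ} (hK : 0 < K) (p : Fin (K + 1) → V) (k : ℕ) :
    ‖node p k - node p (k - 1)‖ = ‖velNode p k‖ / K := by
  have : (0 : ℝ) < K := by exact_mod_cast hK
  rw [velNode, norm_smul, Real.norm_of_nonneg this.le]; field_simp

/-- The discrete spline energy controls the second differences by the fourth powers of the
velocities. -/
theorem exists_sum_norm_accNode_sq_le (R : ℝ) : ∃ C : ℝ, 0 < C ∧ ∃ K₀ : ℕ,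
    ∀ K ≥ K₀, ∀ (bc : BoundaryCondition V) (p : Fin (K + 1) → V) (mid : ℕ → V) (S C₀ : ℝ),
      (∀ k ∈ Finset.Icc 1 (bc.numMid K), IsMidpoint W (node p (k - 1)) (node p (k + 1)) (mid k)) →
      bc.HoldsDiscrete p → (∀ k ≤ K, ‖node p k‖ ≤ R) →
      splineEnergyDiscrete bc W p mid ≤ R → (∀ k ∈ Finset.Icc 1 K, ‖velNode p k‖ ^ 2 ≤ S) →
      (K : ℝ)⁻¹ * ∑ k ∈ Finset.Icc 1 K, ‖velNode p k‖ ^ 2 ≤ C₀ →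
      (K : ℝ)⁻¹ * ∑ k ∈ Finset.Icc 1 (bc.numMid K), ‖accNode p k‖ ^ 2 ≤ C + C * C₀ * S := by
  obtain ⟨a, c, δ, ha, hc, hδ, hδ1, hlow, hsmall⟩ := hW.exists_energy_coercive hg
  obtain ⟨C₃, hC₃, hsec⟩ := hW.exists_norm_second_difference_le hg (R + 1)
  have hpos : ∀ y z, 0 ≤ W y z := hW.energy_nonneg hg
  -- The first summand stems from the distances to midpoints, controlled by the spline energy. In
  -- the second, `9 = 3 (1 + 2)` accounts for `v_k` and for the shifted `v_{k+1}`.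
  refine ⟨3 * C₃ ^ 2 * (|R| / c) + 9 * C₃ ^ 2, by positivity, ?_⟩
  obtain ⟨K₀, hK₀⟩ := exists_nat_gt (max 1 (R / a))
  refine ⟨K₀, fun K hK bc p mid S C₀ hm hbc hR hE hS hC₀ => ?_⟩
  have hKr : max 1 (R / a) < K := hK₀.trans_le (by exact_mod_cast hK)
  have hK1 : (1 : ℝ) ≤ K := (le_max_left _ _).trans hKr.le
  have hK0 : (0 : ℝ) < K := by linarith
  have hKn : 0 < K := by exact_mod_cast hK0
  have hKa : R / a ≤ 4 * (K : ℝ) ^ 3 := by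
    refine (le_max_right _ _).trans (hKr.le.trans ?_)
    have : (K : ℝ) ≤ K ^ 3 := le_self_pow₀ hK1 (by norm_num)
    linarith
  obtain ⟨hmida, hmids⟩ := norm_sub_le_of_sum_energy ha hlow hpos hKa hE (by positivity)
  have hsub : Finset.Icc 1 (bc.numMid K) ⊆ Finset.Icc 1 K :=
    Finset.Icc_subset_Icc le_rfl (bc.numMid_le K)
  have hacc : ∀ k ∈ Finset.Icc 1 (bc.numMid K), ‖accNode p k‖ ≤
      C₃ * ((K : ℝ) ^ 2 * ‖node p k - mid k‖ + ‖velNode p k‖ ^ 2 + ‖velNode p (k + 1)‖ ^ 2) := by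
    intro k hk
    have hkK := (Finset.mem_Icc.1 hk).2.trans (bc.numMid_le K)
    have hβ := (hsmall _ _ (hmida k hk)).trans hδ1
    have hn1 : ‖node p (k + 1)‖ ≤ R := by
      rcases hkK.eq_or_lt with h | h
      · rw [h, node_succ_self hKn]; exact hR 1 hKn
      · exact hR _ h
    have hcR : ‖mid k‖ ≤ R + 1 := by
      have : ‖mid k‖ ≤ ‖mid k - node p k‖ + ‖node p k‖ := norm_le_norm_sub_add _ _
      rw [norm_sub_rev] at this
      linarith [hR k hkK]
    have h1 := hsec _ _ _ _ ((hR (k - 1) (by omega)).trans (by linarith))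
      (hn1.trans (by linarith)) hcR (hm k hk) hβ
    have ev1 : ‖node p (k + 1) - node p k‖ = ‖velNode p (k + 1)‖ / K :=
      norm_sub_eq_norm_velNode_div hKn p (k + 1)
    rw [norm_sub_eq_norm_velNode_div hKn, ev1] at h1
    rw [accNode, norm_smul, Real.norm_of_nonneg (by positivity)]
    calc (K : ℝ) ^ 2 * _ ≤ (K : ℝ) ^ 2 * (C₃ * (‖node p k - mid k‖ + (‖velNode p k‖ / K) ^ 2 +
          (‖velNode p (k + 1)‖ / K) ^ 2)) := by gcongr
      _ = _ := by field_simp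
  have h2 := sum_sq_le_of_le_add (S := S) (fun k _ => norm_nonneg _) hacc
    (fun k hk => ⟨sq_nonneg _, hS k (hsub hk)⟩) (fun k hk => ⟨sq_nonneg _, by
      rcases velNode_succ_eq_or_mem hKn hbc hk with h | h
      · rw [h]; exact hS 1 (Finset.mem_Icc.2 ⟨le_rfl, hKn⟩)
      · exact hS _ h⟩)
  have hS0 : 0 ≤ S := (sq_nonneg _).trans (hS 1 (Finset.mem_Icc.2 ⟨le_rfl, hKn⟩))
  have hC₀0 : 0 ≤ C₀ := le_trans (by positivity) hC₀
  rw [inv_mul_le_iff₀ hK0] at hC₀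
  have hsum0 : ∑ k ∈ Finset.Icc 1 (bc.numMid K), ‖velNode p k‖ ^ 2 ≤ K * C₀ :=
    (Finset.sum_le_sum_of_subset_of_nonneg hsub fun _ _ _ => sq_nonneg _).trans hC₀
  have hsum1 := (sum_norm_velNode_succ_sq_le hKn hbc).trans
    (mul_le_mul_of_nonneg_left hC₀ zero_le_two)
  have hP1 : ∑ k ∈ Finset.Icc 1 (bc.numMid K), ((K : ℝ) ^ 2 * ‖node p k - mid k‖) ^ 2 ≤
      K * (|R| / c) := by
    simp only [mul_pow, ← Finset.mul_sum]
    have hP0 : 0 ≤ ∑ k ∈ Finset.Icc 1 (bc.numMid K), ‖node p k - mid k‖ ^ 2 :=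
      Finset.sum_nonneg fun _ _ => sq_nonneg _
    generalize ∑ k ∈ Finset.Icc 1 (bc.numMid K), ‖node p k - mid k‖ ^ 2 = P at *
    have : (K : ℝ) ^ 3 * P ≤ |R| / c := by
      rw [le_div_iff₀' hc]
      have : 0 ≤ c * ((K : ℝ) ^ 3 * P) := by positivity
      linarith [le_abs_self R]
    calc ((K : ℝ) ^ 2) ^ 2 * P = K * (K ^ 3 * P) := by ring
      _ ≤ _ := by gcongr
  rw [inv_mul_le_iff₀ hK0]
  refine h2.trans ?_
  calc _ ≤ 3 * C₃ ^ 2 * (K * (|R| / c) + S * (K * C₀) + S * (2 * (K * C₀))) := by gcongr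
    _ = K * (3 * C₃ ^ 2 * (|R| / c) + 9 * C₃ ^ 2 * C₀ * S) := by ring
    _ ≤ _ := by
      gcongr
      · exact le_add_of_nonneg_right (by positivity)
      · exact le_add_of_nonneg_left (by positivity)

/-- Coercivity of the discrete functional. -/
theorem exists_isBoundedDiscrete {σ : ℝ} (hσ : 0 < σ) (B : ℝ) : ∃ M : ℝ, 0 < M ∧ ∃ K₀ : ℕ,
    ∀ K ≥ K₀, ∀ (bc : BoundaryCondition V) (p : Fin (K + 1) → V) (mid : ℕ → V),
      (∀ k ∈ Finset.Icc 1 (bc.numMid K), IsMidpoint W (node p (k - 1)) (node p (k + 1)) (mid k)) →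
      bc.HoldsDiscrete p → (∃ j ≤ K, ‖node p j‖ ≤ B) →
      splineEnergyDiscrete bc W p mid + σ * pathEnergyDiscrete W p ≤ B →
      IsBoundedDiscrete bc M p := by
  obtain ⟨a, c, δ, ha, hc, hδ, hδ1, hlow, hsmall⟩ := hW.exists_energy_coercive hg
  have hpos : ∀ y z, 0 ≤ W y z := hW.energy_nonneg hg
  wlog hB : 0 < B generalizing B
  · obtain ⟨M, hM, K₀, h⟩ := this (max B 1) (by positivity)
    exact ⟨M, hM, K₀, fun K hK bc p mid h1 h2 ⟨j, hj, hj'⟩ h4 =>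
      h K hK bc p mid h1 h2 ⟨j, hj, hj'.trans (le_max_left _ _)⟩ (h4.trans (le_max_left _ _))⟩
  obtain ⟨C₀, hC₀⟩ : ∃ C₀, C₀ = B / σ / c := ⟨_, rfl⟩
  have hC₀0 : 0 < C₀ := by rw [hC₀]; positivity
  obtain ⟨R, hR⟩ : ∃ R, R = B + (C₀ + 1) := ⟨_, rfl⟩
  have hR0 : 0 < R := by rw [hR]; positivity
  obtain ⟨C, hC, K₁, haccK⟩ := hW.exists_sum_norm_accNode_sq_le hg R
  -- Ensures `η C C₀ ≤ 1/2`. With the acceleration bound `C + C C₀ S`, the interpolation inequality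
  -- for the largest squared velocity `S` reads `S ≤ S₀/2 + S/2`, where `S₀` is defined next.
  obtain ⟨η, hη⟩ : ∃ η, η = (2 * (C * C₀ + 1))⁻¹ := ⟨_, rfl⟩
  have hη0 : 0 < η := by rw [hη]; positivity
  obtain ⟨S₀, hS₀⟩ : ∃ S₀, S₀ = 2 * (C₀ + C₀ / η + η * C) := ⟨_, rfl⟩
  have hS₀0 : 0 < S₀ := by rw [hS₀]; positivity
  refine ⟨R + (S₀ + 1) + (C + C * C₀ * S₀), by positivity, ?_⟩
  obtain ⟨K₀, hK₀⟩ := exists_nat_gt (max 1 (B / σ / a))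
  refine ⟨max K₀ K₁, fun K hK bc p mid hm hbc ⟨j, hjK, hj⟩ hE => ?_⟩
  have hKr : max 1 (B / σ / a) < K := hK₀.trans_le (by exact_mod_cast (le_max_left _ _).trans hK)
  have hK0 : (0 : ℝ) < K := by linarith [(le_max_left _ _).trans hKr.le]
  have hKn : 0 < K := by exact_mod_cast hK0
  have hs0 := hW.splineEnergyDiscrete_nonneg hg bc p mid
  have hp0 := mul_nonneg hσ.le (hW.pathEnergyDiscrete_nonneg hg p)
  have hpath : K * ∑ k ∈ Finset.Icc 1 K, W (node p (k - 1)) (node p k) ≤ B / σ := by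
    rw [le_div_iff₀' hσ]
    rw [pathEnergyDiscrete] at hE
    linarith
  have hvel := (norm_sub_le_of_sum_energy ha hlow hpos ((le_max_right _ _).trans hKr.le)
    hpath hK0).2
  have ev : ∑ k ∈ Finset.Icc 1 K, ‖node p k - node p (k - 1)‖ ^ 2 =
      ((K : ℝ) ^ 2)⁻¹ * ∑ k ∈ Finset.Icc 1 K, ‖velNode p k‖ ^ 2 := by
    rw [Finset.mul_sum]
    refine Finset.sum_congr rfl fun k _ => ?_
    rw [norm_sub_eq_norm_velNode_div hKn]; field_simp
  have hvelsum : (K : ℝ)⁻¹ * ∑ k ∈ Finset.Icc 1 K, ‖velNode p k‖ ^ 2 ≤ C₀ := by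
    rw [hC₀, le_div_iff₀' hc]
    refine le_trans (le_of_eq ?_) hvel
    simp only [norm_sub_rev (node p (_ - 1))]
    rw [ev]
    field_simp
  -- Cauchy-Schwarz bounds the total variation of the nodes by the velocities, and one node is
  -- bounded by assumption.
  have hnode : ∀ k ≤ K, ‖node p k‖ ≤ R := by
    intro k hk
    have h1 := dist_le_sum_Icc_norm_sub (node p) hk hjK
    have h2 : (∑ k ∈ Finset.Icc 1 K, ‖node p k - node p (k - 1)‖) ^ 2 ≤ C₀ := by
      refine sq_sum_le_card_mul_sum_sq.trans ?_
      rw [Nat.card_Icc, Nat.add_sub_cancel, ev]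
      refine le_trans (le_of_eq ?_) hvelsum
      field_simp
    have h3 : ‖node p k‖ ≤ ‖node p k - node p j‖ + ‖node p j‖ := norm_le_norm_sub_add _ _
    generalize ∑ k ∈ Finset.Icc 1 K, ‖node p k - node p (k - 1)‖ = Z at *
    nlinarith [sq_nonneg (Z - 1)]
  obtain ⟨l, hl, hmax⟩ := Finset.exists_max_image (Finset.Icc 1 K) (fun k => ‖velNode p k‖ ^ 2)
    ⟨1, Finset.mem_Icc.2 ⟨le_rfl, hKn⟩⟩
  have haccsum := haccK K ((le_max_right _ _).trans hK) bc p mid _ C₀ hm hbc hnode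
    (by linarith) hmax hvelsum
  have h1 := norm_sq_le_of_sum_le (velNode p) hKn hη0 hvelsum hl
  have h2 : (K : ℝ)⁻¹ * ∑ k ∈ Finset.Icc 1 (K - 1),
      ‖(K : ℝ) • (velNode p (k + 1) - velNode p k)‖ ^ 2 ≤ C + C * C₀ * ‖velNode p l‖ ^ 2 := by
    refine le_trans ?_ haccsum
    simp only [accNode_eq]
    gcongr
    exact bc.sub_one_le_numMid K
  have hS0 : 0 ≤ ‖velNode p l‖ ^ 2 := sq_nonneg _
  generalize ‖velNode p l‖ ^ 2 = S at *
  have hSle : S ≤ S₀ := by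
    have h3 : η * (C * C₀) ≤ 1 / 2 := by
      rw [hη, inv_mul_le_iff₀ (by positivity)]; linarith
    have h4 := mul_le_mul_of_nonneg_left h2 hη0.le
    have h5 : η * (C * C₀) * S ≤ 1 / 2 * S := mul_le_mul_of_nonneg_right h3 hS0
    rw [hS₀]
    linarith
  have hCS : 0 ≤ C + C * C₀ * S₀ := by positivity
  refine ⟨fun k hk => (hnode k hk).trans (by linarith), fun k hk => ?_, haccsum.trans ?_⟩
  · have h1 : ‖velNode p k‖ ^ 2 ≤ S₀ := (hmax k hk).trans hSle
    have h2 : ‖velNode p k‖ ≤ S₀ + 1 := by nlinarith [sq_nonneg (‖velNode p k‖ - 1)]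
    linarith
  · have : C * C₀ * S ≤ C * C₀ * S₀ := by gcongr
    linarith

end IsAdmissibleEnergy

end DiscreteEnergy

end RiemSpline

namespace RiemSpline

/-! ### Curves as second primitives of square integrable accelerations -/

section SecondPrimitive

variable {V : Type*} [NormedAddCommGroup V] [InnerProductSpace ℝ V]

/-- The primitive with initial value `b` of a function on the unit interval. -/
noncomputable def curveVel (b : V) (w : ℝ → V) (t : ℝ) : V :=
  -- The indicator makes the primitive meaningful and continuous at every real `t`, although `w` is
  -- controlled only on the unit interval.
  b + ∫ s in (0 : ℝ)..t, (Ioo (0 : ℝ) 1).indicator w s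

/-- The curve with second derivative `w` on the unit interval and initial data `a`, `b`. -/
noncomputable def curvePos (a b : V) (w : ℝ → V) (t : ℝ) : V :=
  a + ∫ s in (0 : ℝ)..t, curveVel b w s

omit [InnerProductSpace ℝ V] in
theorem integrable_indicator_unit {w : ℝ → V} (hw : Integrable w unitMeasure) :
    Integrable ((Ioo (0 : ℝ) 1).indicator w) :=
  (integrable_indicator_iff measurableSet_Ioo).2 hw

omit [InnerProductSpace ℝ V] in
theorem intervalIntegrable_indicator_unit {w : ℝ → V} (hw : Integrable w unitMeasure)
    (s t : ℝ) : IntervalIntegrable ((Ioo (0 : ℝ) 1).indicator w) volume s t :=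
  (integrable_indicator_unit hw).intervalIntegrable

theorem continuous_curveVel (b : V) {w : ℝ → V} (hw : Integrable w unitMeasure) :
    Continuous (curveVel b w) :=
  continuous_const.add
    (intervalIntegral.continuous_primitive (intervalIntegrable_indicator_unit hw) 0)

theorem continuous_curvePos (a b : V) {w : ℝ → V} (hw : Integrable w unitMeasure) :
    Continuous (curvePos a b w) :=
  continuous_const.add (intervalIntegral.continuous_primitive
    (fun _ _ => (continuous_curveVel b hw).intervalIntegrable _ _) 0)

@[simp] theorem curveVel_zero (b : V) (w : ℝ → V) : curveVel b w 0 = b := by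
  simp [curveVel]

@[simp] theorem curvePos_zero (a b : V) (w : ℝ → V) : curvePos a b w 0 = a := by
  simp [curvePos]

theorem curveVel_sub (b : V) {w : ℝ → V} (hw : Integrable w unitMeasure) (s t : ℝ) :
    curveVel b w t - curveVel b w s = ∫ r in s..t, (Ioo (0 : ℝ) 1).indicator w r := by
  rw [curveVel, curveVel, add_sub_add_left_eq_sub, intervalIntegral.integral_interval_sub_left]
  all_goals exact intervalIntegrable_indicator_unit hw _ _

theorem curvePos_sub (a b : V) {w : ℝ → V} (hw : Integrable w unitMeasure) (s t : ℝ) :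
    curvePos a b w t - curvePos a b w s = ∫ r in s..t, curveVel b w r := by
  rw [curvePos, curvePos, add_sub_add_left_eq_sub, intervalIntegral.integral_interval_sub_left]
  all_goals exact (continuous_curveVel b hw).intervalIntegrable _ _

theorem curveVel_congr (b : V) {w w' : ℝ → V} (h : w =ᵐ[unitMeasure] w') :
    curveVel b w = curveVel b w' := by
  have h1 : (Ioo (0 : ℝ) 1).indicator w =ᵐ[volume] (Ioo (0 : ℝ) 1).indicator w' := by
    rw [Filter.EventuallyEq, ae_restrict_iff' measurableSet_Ioo] at h
    filter_upwards [h] with s hs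
    by_cases hm : s ∈ Ioo (0 : ℝ) 1
    · simp [hm, hs hm]
    · simp [hm]
  funext t
  rw [curveVel, curveVel, intervalIntegral.integral_congr_ae (h1.mono fun _ h _ => h)]

theorem curvePos_congr (a b : V) {w w' : ℝ → V} (h : w =ᵐ[unitMeasure] w') :
    curvePos a b w = curvePos a b w' := by
  funext t
  rw [curvePos, curvePos, curveVel_congr b h]

/-- The square of the norm of an integral is controlled by the integral of the squares. -/
theorem norm_integral_sq_le {α : Type*} [MeasurableSpace α] {μ : Measure α} [IsFiniteMeasure μ]
    {f : α → V} (hf : MemLp f 2 μ) :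
    ‖∫ x, f x ∂μ‖ ^ 2 ≤ μ.real univ * ∫ x, ‖f x‖ ^ 2 ∂μ := by
  have hi : Integrable (fun x => ‖f x‖) μ := (hf.integrable (by norm_num)).norm
  have hi2 : Integrable (fun x => ‖f x‖ ^ 2) μ := hf.integrable_norm_pow (by norm_num)
  have h1 : ‖∫ x, f x ∂μ‖ ≤ ∫ x, ‖f x‖ ∂μ := norm_integral_le_integral_norm _
  have hI : 0 ≤ ∫ x, ‖f x‖ ∂μ := integral_nonneg fun _ => norm_nonneg _
  have hm0 : 0 ≤ μ.real univ := measureReal_nonneg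
  generalize hIe : ∫ x, ‖f x‖ ∂μ = I at h1 hI
  have h2 : ‖∫ x, f x ∂μ‖ ^ 2 ≤ I ^ 2 := by gcongr
  refine h2.trans ?_
  -- The integral of `(‖f‖ - c)²` is nonnegative; the mean value of `‖f‖` is then the optimal `c`.
  have key : ∀ c : ℝ, 0 ≤ c ^ 2 * μ.real univ - 2 * c * I + ∫ x, ‖f x‖ ^ 2 ∂μ := by
    intro c
    have h : 0 ≤ ∫ x, (‖f x‖ ^ 2 - (2 * c * ‖f x‖ - c ^ 2)) ∂μ :=
      integral_nonneg fun x => by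
        have := sq_nonneg (‖f x‖ - c)
        simp only [Pi.zero_apply]
        nlinarith
    have h' : ∫ x, (‖f x‖ ^ 2 - (2 * c * ‖f x‖ - c ^ 2)) ∂μ
        = ∫ x, ‖f x‖ ^ 2 ∂μ - (∫ x, 2 * c * ‖f x‖ ∂μ - ∫ _, c ^ 2 ∂μ) := by
      have hj : Integrable (fun x => 2 * c * ‖f x‖) μ := hi.const_mul _
      have hk : Integrable (fun x => 2 * c * ‖f x‖ - c ^ 2) μ := hj.sub (integrable_const _)
      rw [← integral_sub hj (integrable_const _), ← integral_sub hi2 hk]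
    rw [h', integral_const_mul, hIe, integral_const, smul_eq_mul] at h
    linarith
  rcases hm0.eq_or_lt with h0 | h0
  · have hz : μ = 0 := by
      rw [eq_comm, measureReal_eq_zero_iff] at h0
      exact Measure.measure_univ_eq_zero.1 h0
    simp [hz] at hIe
    simp [← hIe, ← h0]
  · have h := key (I / μ.real univ)
    have h3 : (I / μ.real univ) ^ 2 * μ.real univ - 2 * (I / μ.real univ) * I
        = - (I ^ 2 / μ.real univ) := by field_simp; ring
    rw [h3] at h
    have h4 : I ^ 2 / μ.real univ ≤ ∫ x, ‖f x‖ ^ 2 ∂μ := by linarith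
    rwa [div_le_iff₀ h0, mul_comm] at h4

omit [InnerProductSpace ℝ V] in
theorem memLp_indicator_unit {w : ℝ → V} (hw : MemLp w 2 unitMeasure) :
    MemLp ((Ioo (0 : ℝ) 1).indicator w) 2 :=
  (memLp_indicator_iff_restrict measurableSet_Ioo).2 hw

theorem norm_intervalIntegral_sq_le {f : ℝ → V} {s t : ℝ} (hst : s ≤ t)
    (hf : MemLp f 2 (volume.restrict (Ioc s t))) :
    ‖∫ r in s..t, f r‖ ^ 2 ≤ (t - s) * ∫ r in s..t, ‖f r‖ ^ 2 := by
  rw [intervalIntegral.integral_of_le hst, intervalIntegral.integral_of_le hst]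
  refine (norm_integral_sq_le hf).trans_eq ?_
  congr 1
  simp [Measure.real, hst]

omit [InnerProductSpace ℝ V] in
theorem integral_norm_sq_indicator_le {w : ℝ → V} (hw : MemLp w 2 unitMeasure) {s t : ℝ}
    (hst : s ≤ t) :
    ∫ r in s..t, ‖(Ioo (0 : ℝ) 1).indicator w r‖ ^ 2 ≤ ∫ r, ‖w r‖ ^ 2 ∂unitMeasure := by
  have h1 : Integrable fun r => ‖(Ioo (0 : ℝ) 1).indicator w r‖ ^ 2 :=
    (memLp_indicator_unit hw).integrable_norm_pow (by norm_num)
  rw [intervalIntegral.integral_of_le hst]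
  refine (setIntegral_le_integral h1 (Eventually.of_forall fun _ => by positivity)).trans_eq ?_
  rw [← integral_indicator measurableSet_Ioo]
  refine integral_congr_ae (Eventually.of_forall fun r => ?_)
  by_cases hr : r ∈ Ioo (0 : ℝ) 1 <;> simp [hr]

theorem norm_curveVel_sub_sq_le (b : V) {w : ℝ → V} (hw : MemLp w 2 unitMeasure) {s t : ℝ}
    (hst : s ≤ t) :
    ‖curveVel b w t - curveVel b w s‖ ^ 2 ≤
      (t - s) * ∫ r in s..t, ‖(Ioo (0 : ℝ) 1).indicator w r‖ ^ 2 := by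
  rw [curveVel_sub b (hw.integrable (by norm_num))]
  exact norm_intervalIntegral_sq_le hst ((memLp_indicator_unit hw).mono_measure
    Measure.restrict_le_self)

theorem L2_norm_sq (w : L2 V) : ‖w‖ ^ 2 = ∫ s, ‖w s‖ ^ 2 ∂unitMeasure := by
  rw [← real_inner_self_eq_norm_sq, L2.inner_def]
  simp only [real_inner_self_eq_norm_sq]

omit [InnerProductSpace ℝ V] in
theorem L2_integrable (w : L2 V) : Integrable w unitMeasure :=
  (Lp.memLp w).integrable (by norm_num)

/-- `φ' ⊗ (primitive of w)` integrates to `-φ ⊗ w`. -/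
theorem integral_deriv_smul_curveVel [CompleteSpace V] (b : V) {w : ℝ → V}
    (hw : Integrable w unitMeasure)
    {φ : ℝ → ℝ} (h1 : ContDiff ℝ ∞ φ) (h2 : HasCompactSupport φ)
    (h3 : tsupport φ ⊆ Ioo (0 : ℝ) 1) :
    ∫ s, deriv φ s • curveVel b w s ∂unitMeasure = - ∫ s, φ s • w s ∂unitMeasure := by
  have hd : Continuous (deriv φ) := h1.continuous_deriv (by simp)
  have hφ0 : φ 0 = 0 := image_eq_zero_of_notMem_tsupport fun h => by simpa using h3 h
  have hφ1 : φ 1 = 0 := image_eq_zero_of_notMem_tsupport fun h => by simpa using h3 h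
  have hFTC : ∀ s t, ∫ r in s..t, deriv φ r = φ t - φ s := fun s t =>
    intervalIntegral.integral_deriv_eq_sub (fun x _ => h1.differentiable (by simp) x)
      (hd.intervalIntegrable _ _)
  have hw' := integrable_indicator_unit hw
  set v := (Ioo (0 : ℝ) 1).indicator w with hv
  have hdi : Integrable (deriv φ) unitMeasure :=
    (hd.integrable_of_hasCompactSupport h2.deriv).restrict
  have hunit : ∀ f : ℝ → V, ∫ s, f s ∂unitMeasure = ∫ s in (0 : ℝ)..1, f s := fun f => by
    rw [intervalIntegral.integral_of_le zero_le_one, integral_Ioc_eq_integral_Ioo]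
  have hprod : Integrable (fun z : ℝ × ℝ => deriv φ z.1 • v z.2)
      (unitMeasure.prod unitMeasure) := hdi.smul_prod (hw'.restrict)
  have hS : MeasurableSet {z : ℝ × ℝ | z.2 ≤ z.1} := measurableSet_le measurable_snd measurable_fst
  -- Integration by parts for an `L¹` density, by Fubini on the triangle `s ≤ t`: the inner integral
  -- of `φ'` over `[s, 1)` is `-φ(s)` because `φ` vanishes at `1`.
  have hswap := integral_integral_swap (f := fun t s =>
    {z : ℝ × ℝ | z.2 ≤ z.1}.indicator (fun z => deriv φ z.1 • v z.2) (t, s))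
    (hprod.indicator hS)
  have e1 : ∫ s, deriv φ s • curveVel b w s ∂unitMeasure
      = ∫ s, (deriv φ s • b + deriv φ s • ∫ r in (0 : ℝ)..s, v r) ∂unitMeasure := by
    simp only [curveVel, smul_add, hv]
  have e2 : ∫ s, deriv φ s • b ∂unitMeasure = 0 := by
    rw [hunit, intervalIntegral.integral_smul_const, hFTC, hφ0, hφ1, sub_zero, zero_smul]
  have hcont : Continuous fun s => deriv φ s • ∫ r in (0 : ℝ)..s, v r :=
    hd.smul (intervalIntegral.continuous_primitive (fun _ _ => hw'.intervalIntegrable) 0)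
  have i1 : Integrable (fun s => deriv φ s • b) unitMeasure := hdi.smul_const b
  have i2 : Integrable (fun s => deriv φ s • ∫ r in (0 : ℝ)..s, v r) unitMeasure :=
    (hcont.integrable_of_hasCompactSupport (h2.deriv.smul_right)).restrict
  rw [e1, integral_add i1 i2, e2, zero_add]
  have e3 : ∫ t, deriv φ t • (∫ r in (0 : ℝ)..t, v r) ∂unitMeasure = ∫ t, ∫ s,
      {z : ℝ × ℝ | z.2 ≤ z.1}.indicator (fun z => deriv φ z.1 • v z.2) (t, s)
        ∂unitMeasure ∂unitMeasure := by
    refine setIntegral_congr_fun measurableSet_Ioo fun t ht => ?_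
    have : ∀ s, {z : ℝ × ℝ | z.2 ≤ z.1}.indicator (fun z => deriv φ z.1 • v z.2) (t, s)
        = (Iic t).indicator (fun s => deriv φ t • v s) s := fun s => by
      by_cases h : s ≤ t <;> simp [indicator, h]
    simp only [this]
    rw [integral_indicator measurableSet_Iic, Measure.restrict_restrict measurableSet_Iic,
      integral_smul, intervalIntegral.integral_of_le ht.1.le]
    congr 2
    congr 1
    ext s
    simp only [mem_Ioc, mem_inter_iff, mem_Iic, mem_Ioo]
    constructor
    · rintro ⟨h, h'⟩; exact ⟨h', h, h'.trans_lt ht.2⟩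
    · rintro ⟨h, h', _⟩; exact ⟨h', h⟩
  have e4 : ∫ s, ∫ t,
      {z : ℝ × ℝ | z.2 ≤ z.1}.indicator (fun z => deriv φ z.1 • v z.2) (t, s)
        ∂unitMeasure ∂unitMeasure = ∫ s, - (φ s • w s) ∂unitMeasure := by
    refine setIntegral_congr_fun measurableSet_Ioo fun s hs => ?_
    have : ∀ t, {z : ℝ × ℝ | z.2 ≤ z.1}.indicator (fun z => deriv φ z.1 • v z.2) (t, s)
        = (Ici s).indicator (fun t => deriv φ t • v s) t := fun t => by
      by_cases h : s ≤ t <;> simp [indicator, h]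
    simp only [this]
    have hset : Ici s ∩ Ioo (0 : ℝ) 1 = Ico s 1 := by
      ext r
      simp only [mem_Ico, mem_inter_iff, mem_Ici, mem_Ioo]
      constructor
      · rintro ⟨h, _, h'⟩; exact ⟨h, h'⟩
      · rintro ⟨h, h'⟩; exact ⟨h, hs.1.trans_le h, h'⟩
    rw [integral_indicator measurableSet_Ici, Measure.restrict_restrict measurableSet_Ici,
      integral_smul_const, hset, integral_Ico_eq_integral_Ioc,
      ← intervalIntegral.integral_of_le hs.2.le, hFTC, hφ1, zero_sub, neg_smul, hv,
      indicator_of_mem hs]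
  rw [e3, hswap, e4, integral_neg]

end SecondPrimitive

end RiemSpline

namespace RiemSpline

/-! ### Elementary properties of weak convergence -/

section WeakConvergence

variable {E F : Type*} [NormedAddCommGroup E] [NormedSpace ℝ E] [NormedAddCommGroup F]
  [NormedSpace ℝ F]

theorem WeaklyConverges.map {u : ℕ → E} {l : E} (h : WeaklyConverges u l) (T : E →L[ℝ] F) :
    WeaklyConverges (fun n => T (u n)) (T l) := fun f => h (f ∘L T)

theorem WeaklyConverges.add {u v : ℕ → E} {l l' : E} (h : WeaklyConverges u l)
    (h' : WeaklyConverges v l') : WeaklyConverges (fun n => u n + v n) (l + l') := fun f => by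
  simpa only [map_add] using (h f).add (h' f)

theorem WeaklyConverges.prodMk {u : ℕ → E} {v : ℕ → F} {l : E} {l' : F}
    (h : WeaklyConverges u l) (h' : WeaklyConverges v l') :
    WeaklyConverges (fun n => (u n, v n)) (l, l') := by
  have := (h.map (ContinuousLinearMap.inl ℝ E F)).add (h'.map (ContinuousLinearMap.inr ℝ E F))
  simpa using this

theorem WeaklyConverges.comp_tendsto {u : ℕ → E} {l : E} (h : WeaklyConverges u l) {φ : ℕ → ℕ}
    (hφ : Tendsto φ atTop atTop) : WeaklyConverges (fun n => u (φ n)) l :=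
  fun f => (h f).comp hφ

end WeakConvergence

/-! ### From initial data and acceleration to `W^{2,2}` -/

section Sobolev

variable {V : Type*} [NormedAddCommGroup V] [InnerProductSpace ℝ V]

theorem L2_integral_norm_le (w : L2 V) : ∫ s, ‖w s‖ ∂unitMeasure ≤ ‖w‖ := by
  have h := norm_integral_sq_le (Lp.memLp w).norm
  have h0 : 0 ≤ ∫ s, ‖w s‖ ∂unitMeasure := integral_nonneg fun _ => norm_nonneg _
  simp only [norm_norm] at h
  rw [← L2_norm_sq, Real.norm_of_nonneg h0] at h
  have h1 : (unitMeasure).real univ = 1 := by simp [Measure.real]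
  rw [h1, one_mul] at h
  exact (pow_le_pow_iff_left₀ h0 (norm_nonneg _) two_ne_zero).1 h

theorem norm_integral_indicator_le (w : L2 V) (t : ℝ) :
    ‖∫ s in (0 : ℝ)..t, (Ioo (0 : ℝ) 1).indicator w s‖ ≤ ‖w‖ := by
  have hw := (integrable_indicator_unit (L2_integrable w)).norm
  refine (intervalIntegral.norm_integral_le_integral_norm_uIoc).trans ?_
  refine (setIntegral_le_integral hw (Eventually.of_forall fun _ => norm_nonneg _)).trans ?_
  refine le_trans (le_of_eq ?_) (L2_integral_norm_le w)
  rw [← integral_indicator measurableSet_Ioo]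
  refine integral_congr_ae (Eventually.of_forall fun r => ?_)
  by_cases hr : r ∈ Ioo (0 : ℝ) 1 <;> simp [hr]

theorem norm_curveVel_le (b : V) (w : L2 V) (t : ℝ) : ‖curveVel b w t‖ ≤ ‖b‖ + ‖w‖ :=
  (norm_add_le _ _).trans (by gcongr; exact norm_integral_indicator_le w t)

theorem norm_curvePos_le (a b : V) (w : L2 V) (t : ℝ) :
    ‖curvePos a b w t‖ ≤ ‖a‖ + (‖b‖ + ‖w‖) * |t| := by
  refine (norm_add_le _ _).trans ?_
  gcongr
  simpa using intervalIntegral.norm_integral_le_of_norm_le_const (a := 0) (b := t)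
    (f := curveVel b w) fun s _ => norm_curveVel_le b w s

theorem curveVel_add (b b' : V) (w w' : L2 V) (t : ℝ) :
    curveVel (b + b') (w + w' : L2 V) t = curveVel b w t + curveVel b' w' t := by
  rw [curveVel_congr _ (Lp.coeFn_add w w'), curveVel, indicator_add']
  simp only [Pi.add_apply]
  rw [intervalIntegral.integral_add (intervalIntegrable_indicator_unit (L2_integrable w) _ _)
    (intervalIntegrable_indicator_unit (L2_integrable w') _ _), curveVel, curveVel]
  abel

theorem curveVel_smul (r : ℝ) (b : V) (w : L2 V) (t : ℝ) :
    curveVel (r • b) (r • w : L2 V) t = r • curveVel b w t := by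
  rw [curveVel_congr _ (Lp.coeFn_smul r w), curveVel, curveVel, smul_add,
    ← intervalIntegral.integral_smul]
  congr 2
  funext s
  by_cases hs : s ∈ Ioo (0 : ℝ) 1 <;> simp [hs]

theorem curvePos_add (a a' b b' : V) (w w' : L2 V) (t : ℝ) :
    curvePos (a + a') (b + b') (w + w' : L2 V) t = curvePos a b w t + curvePos a' b' w' t := by
  simp only [curvePos, curveVel_add]
  rw [intervalIntegral.integral_add
    ((continuous_curveVel b (L2_integrable w)).intervalIntegrable _ _)
    ((continuous_curveVel b' (L2_integrable w')).intervalIntegrable _ _)]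
  abel

theorem curvePos_smul (r : ℝ) (a b : V) (w : L2 V) (t : ℝ) :
    curvePos (r • a) (r • b) (r • w : L2 V) t = r • curvePos a b w t := by
  simp only [curvePos, curveVel_smul, smul_add, intervalIntegral.integral_smul]

/-- Evaluation of the velocity at time `t` in terms of the data `(a, b, w)`. -/
noncomputable def evalVel (V : Type*) [NormedAddCommGroup V] [InnerProductSpace ℝ V] (t : ℝ) :
    V × V × L2 V →L[ℝ] V :=
  LinearMap.mkContinuous
    { toFun := fun x => curveVel x.2.1 x.2.2 t
      map_add' := fun x y => curveVel_add _ _ _ _ t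
      map_smul' := fun r x => curveVel_smul r _ _ t } 2 fun x => by
    have h1 : ‖x.2.1‖ ≤ ‖x‖ := (norm_fst_le _).trans (norm_snd_le x)
    have h2 : ‖x.2.2‖ ≤ ‖x‖ := (norm_snd_le _).trans (norm_snd_le x)
    refine (norm_curveVel_le x.2.1 x.2.2 t).trans (by linarith)

/-- Evaluation of the curve at time `t` in terms of the data `(a, b, w)`. -/
noncomputable def evalPos (V : Type*) [NormedAddCommGroup V] [InnerProductSpace ℝ V] (t : ℝ) :
    V × V × L2 V →L[ℝ] V :=
  LinearMap.mkContinuous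
    { toFun := fun x => curvePos x.1 x.2.1 x.2.2 t
      map_add' := fun x y => curvePos_add _ _ _ _ _ _ t
      map_smul' := fun r x => curvePos_smul r _ _ _ t } (1 + 2 * |t|) fun x => by
    have h0 : ‖x.1‖ ≤ ‖x‖ := norm_fst_le _
    have h1 : ‖x.2.1‖ ≤ ‖x‖ := (norm_fst_le _).trans (norm_snd_le x)
    have h2 : ‖x.2.2‖ ≤ ‖x‖ := (norm_snd_le _).trans (norm_snd_le x)
    have h3 : 0 ≤ |t| := abs_nonneg t
    refine (norm_curvePos_le x.1 x.2.1 x.2.2 t).trans ?_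
    nlinarith

@[simp] theorem evalVel_apply (t : ℝ) (x : V × V × L2 V) :
    evalVel V t x = curveVel x.2.1 x.2.2 t := rfl

@[simp] theorem evalPos_apply (t : ℝ) (x : V × V × L2 V) :
    evalPos V t x = curvePos x.1 x.2.1 x.2.2 t := rfl

omit [InnerProductSpace ℝ V] in
theorem memLp_of_continuous {c : ℝ → V} (hc : Continuous c) : MemLp c 2 unitMeasure := by
  obtain ⟨C, hC⟩ := isCompact_Icc.exists_bound_of_continuousOn (hc.continuousOn (s := Icc 0 1))
  refine MemLp.of_bound (f := c) ?_ C ?_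
  · exact hc.continuousOn.aestronglyMeasurable measurableSet_Ioo
  · rw [ae_restrict_iff' measurableSet_Ioo]
    exact Eventually.of_forall fun s hs => hC s (Ioo_subset_Icc_self hs)

theorem isWeakDeriv_congr_left {u v : L2 V} {c : ℝ → V} (hu : u =ᵐ[unitMeasure] c) :
    IsWeakDeriv u v ↔ ∀ φ : ℝ → ℝ, ContDiff ℝ ∞ φ → HasCompactSupport φ →
      tsupport φ ⊆ Ioo (0 : ℝ) 1 →
      ∫ s, deriv φ s • c s ∂unitMeasure = - ∫ s, φ s • v s ∂unitMeasure := by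
  have : ∀ φ : ℝ → ℝ, ∫ s, deriv φ s • u s ∂unitMeasure = ∫ s, deriv φ s • c s ∂unitMeasure :=
    fun φ => integral_congr_ae (hu.mono fun s hs => by simp only [hs])
  simp only [IsWeakDeriv, this]

/-- On the unit interval, the second primitive only depends on the values of the velocity there. -/
theorem curveVel_curveVel (a b : V) (w : ℝ → V) {t : ℝ} (ht : t ∈ Icc (0 : ℝ) 1) :
    curveVel a (curveVel b w) t = curvePos a b w t := by
  rw [curveVel, curvePos, intervalIntegral.integral_of_le ht.1, intervalIntegral.integral_of_le
    ht.1, integral_Ioc_eq_integral_Ioo, integral_Ioc_eq_integral_Ioo]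
  congr 1
  refine setIntegral_congr_fun measurableSet_Ioo fun s hs => ?_
  exact indicator_of_mem (mem_Ioo.2 ⟨hs.1, hs.2.trans_le ht.2⟩) _

variable [CompleteSpace V]

theorem isWeakDeriv_toLp_curveVel (b : V) {w : L2 V} {u : L2 V}
    (hu : u =ᵐ[unitMeasure] curveVel b w) : IsWeakDeriv u w :=
  (isWeakDeriv_congr_left hu).2 fun _ h1 h2 h3 =>
    integral_deriv_smul_curveVel b (L2_integrable w) h1 h2 h3

/-- The class of a continuous function in `L²((0,1);V)`. -/
noncomputable def toL2 (c : ℝ → V) (hc : Continuous c) : L2 V := (memLp_of_continuous hc).toLp c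

omit [CompleteSpace V] in
omit [InnerProductSpace ℝ V] in
theorem toL2_coe {c : ℝ → V} (hc : Continuous c) : toL2 c hc =ᵐ[unitMeasure] c :=
  MemLp.coeFn_toLp _

omit [CompleteSpace V] in
omit [InnerProductSpace ℝ V] in
theorem norm_toL2_le {c : ℝ → V} (hc : Continuous c) {C : ℝ} (hC : 0 ≤ C)
    (h : ∀ s ∈ Ioo (0 : ℝ) 1, ‖c s‖ ≤ C) : ‖toL2 c hc‖ ≤ C := by
  have := Lp.norm_le_of_ae_bound (f := toL2 c hc) hC (by
    filter_upwards [toL2_coe hc, ae_restrict_mem measurableSet_Ioo] with s h1 h2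
    rw [h1]
    exact h s h2)
  have h1 : measureUnivNNReal unitMeasure = 1 := by simp [measureUnivNNReal]
  simpa [h1] using this

/-- The element of `W^{2,2}((0,1);V)` with second derivative `w`, initial value `a` and initial
velocity `b`. -/
noncomputable def sobolevOf (x : V × V × L2 V) : W22 V :=
  ⟨WithLp.toLp 2 ![toL2 _ (continuous_curvePos x.1 x.2.1 (L2_integrable x.2.2)),
      toL2 _ (continuous_curveVel x.2.1 (L2_integrable x.2.2)), x.2.2], by
    constructor
    · refine isWeakDeriv_toLp_curveVel x.1 ?_
      filter_upwards [toL2_coe (continuous_curvePos x.1 x.2.1 (L2_integrable x.2.2)),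
        ae_restrict_mem measurableSet_Ioo] with s h1 h2
      refine Eq.trans h1 ?_
      rw [← curveVel_curveVel x.1 x.2.1 _ (Ioo_subset_Icc_self h2)]
      exact congrFun (curveVel_congr _
        (toL2_coe (continuous_curveVel x.2.1 (L2_integrable x.2.2))).symm) s
    · exact isWeakDeriv_toLp_curveVel x.2.1
        (toL2_coe (continuous_curveVel x.2.1 (L2_integrable x.2.2)))⟩

theorem pos_sobolevOf (x : V × V × L2 V) :
    pos (sobolevOf x) =ᵐ[unitMeasure] curvePos x.1 x.2.1 x.2.2 :=
  toL2_coe (continuous_curvePos x.1 x.2.1 (L2_integrable x.2.2))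

theorem vel_sobolevOf (x : V × V × L2 V) :
    vel (sobolevOf x) =ᵐ[unitMeasure] curveVel x.2.1 x.2.2 :=
  toL2_coe (continuous_curveVel x.2.1 (L2_integrable x.2.2))

theorem acc_sobolevOf (x : V × V × L2 V) : acc (sobolevOf x) = x.2.2 := rfl

theorem norm_sobolevOf_le (x : V × V × L2 V) : ‖sobolevOf x‖ ≤ 6 * ‖x‖ := by
  have h0 : ‖x.1‖ ≤ ‖x‖ := norm_fst_le _
  have h1 : ‖x.2.1‖ ≤ ‖x‖ := (norm_fst_le _).trans (norm_snd_le x)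
  have h2 : ‖x.2.2‖ ≤ ‖x‖ := (norm_snd_le _).trans (norm_snd_le x)
  have hx : 0 ≤ ‖x‖ := norm_nonneg x
  have e0 : ‖(sobolevOf x).1 0‖ ≤ 3 * ‖x‖ := norm_toL2_le
      (continuous_curvePos x.1 x.2.1 (L2_integrable x.2.2)) (by positivity) fun s hs => by
    refine (norm_curvePos_le _ _ _ _).trans ?_
    have : |s| ≤ 1 := by rw [abs_of_pos hs.1]; exact hs.2.le
    nlinarith [norm_nonneg x.2.1, norm_nonneg x.2.2]
  have e1 : ‖(sobolevOf x).1 1‖ ≤ 2 * ‖x‖ := norm_toL2_le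
      (continuous_curveVel x.2.1 (L2_integrable x.2.2)) (by positivity) fun s hs => by
    refine (norm_curveVel_le _ _ _).trans ?_
    linarith
  have e2 : ‖(sobolevOf x).1 2‖ ≤ ‖x‖ := h2
  -- `3² + 2² + 1² ≤ 6²`; only continuity of the linear map matters.
  have e : ‖(sobolevOf x).1‖ ^ 2 ≤ (6 * ‖x‖) ^ 2 := by
    rw [PiLp.norm_sq_eq_of_L2, Fin.sum_univ_three]
    have a0 := pow_le_pow_left₀ (norm_nonneg _) e0 2
    have a1 := pow_le_pow_left₀ (norm_nonneg _) e1 2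
    have a2 := pow_le_pow_left₀ (norm_nonneg _) e2 2
    nlinarith
  exact (pow_le_pow_iff_left₀ (norm_nonneg _) (by positivity) two_ne_zero).1 e

omit [CompleteSpace V] in
theorem W22_ext {u v : W22 V} (h0 : pos u = pos v) (h1 : vel u = vel v) (h2 : acc u = acc v) :
    u = v := by
  refine Subtype.ext (PiLp.ext fun i => ?_)
  fin_cases i
  · exact h0
  · exact h1
  · exact h2

/-- `sobolevOf` as a continuous linear map. -/
noncomputable def sobolevL (V : Type*) [NormedAddCommGroup V] [InnerProductSpace ℝ V]
    [CompleteSpace V] : V × V × L2 V →L[ℝ] W22 V :=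
  LinearMap.mkContinuous
    { toFun := sobolevOf
      map_add' := fun x y => by
        refine W22_ext (Lp.ext ?_) (Lp.ext ?_) rfl
        · filter_upwards [pos_sobolevOf (x + y), pos_sobolevOf x, pos_sobolevOf y,
            Lp.coeFn_add (pos (sobolevOf x)) (pos (sobolevOf y))] with s h1 h2 h3 h4
          rw [h1]
          refine Eq.trans ?_ h4.symm
          rw [Pi.add_apply, h2, h3]
          exact curvePos_add _ _ _ _ _ _ s
        · filter_upwards [vel_sobolevOf (x + y), vel_sobolevOf x, vel_sobolevOf y,
            Lp.coeFn_add (vel (sobolevOf x)) (vel (sobolevOf y))] with s h1 h2 h3 h4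
          rw [h1]
          refine Eq.trans ?_ h4.symm
          rw [Pi.add_apply, h2, h3]
          exact curveVel_add _ _ _ _ s
      map_smul' := fun r x => by
        refine W22_ext (Lp.ext ?_) (Lp.ext ?_) rfl
        · filter_upwards [pos_sobolevOf (r • x), pos_sobolevOf x,
            Lp.coeFn_smul r (pos (sobolevOf x))] with s h1 h2 h4
          rw [h1]
          refine Eq.trans ?_ h4.symm
          rw [Pi.smul_apply, h2]
          exact curvePos_smul _ _ _ _ s
        · filter_upwards [vel_sobolevOf (r • x), vel_sobolevOf x,
            Lp.coeFn_smul r (vel (sobolevOf x))] with s h1 h2 h4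
          rw [h1]
          refine Eq.trans ?_ h4.symm
          rw [Pi.smul_apply, h2]
          exact curveVel_smul _ _ _ s } 6 norm_sobolevOf_le

@[simp] theorem sobolevL_apply (x : V × V × L2 V) : sobolevL V x = sobolevOf x := rfl

end Sobolev

end RiemSpline

namespace RiemSpline

/-! ### Uniqueness of weak derivatives and the structure of `W^{2,2}` -/

section DuBoisReymond

variable {V : Type*} [NormedAddCommGroup V] [InnerProductSpace ℝ V] [CompleteSpace V]

/-- A test function on the unit interval with vanishing mean is the derivative of a test
function. -/
theorem exists_testFunction_deriv_eq {g : ℝ → ℝ} (h1 : ContDiff ℝ ∞ g) (h2 : HasCompactSupport g)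
    (h3 : tsupport g ⊆ Ioo (0 : ℝ) 1) (h0 : ∫ s in (0 : ℝ)..1, g s = 0) :
    ∃ φ : ℝ → ℝ, ContDiff ℝ ∞ φ ∧ HasCompactSupport φ ∧ tsupport φ ⊆ Ioo (0 : ℝ) 1 ∧
      deriv φ = g := by
  have hgc := h1.continuous
  -- The primitive from `0` vanishes to the left of the support trivially and to its right by the
  -- mean value condition, so it is again supported in `[α, β]`.
  obtain ⟨α, β, hα, hβ, hz⟩ : ∃ α β : ℝ, 0 < α ∧ β < 1 ∧
      ∀ s, s ∉ Icc α β → g s = 0 := by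
    rcases (tsupport g).eq_empty_or_nonempty with he | hne
    · exact ⟨1 / 2, 1 / 2, by norm_num, by norm_num,
        fun s _ => image_eq_zero_of_notMem_tsupport (by simp [he])⟩
    · have hc : IsCompact (tsupport g) := h2
      refine ⟨sInf (tsupport g), sSup (tsupport g), (h3 (hc.sInf_mem hne)).1,
        (h3 (hc.sSup_mem hne)).2, fun s hs => ?_⟩
      exact image_eq_zero_of_notMem_tsupport fun h =>
        hs ⟨csInf_le hc.bddBelow h, le_csSup hc.bddAbove h⟩
  have hder : ∀ t, HasDerivAt (fun t => ∫ s in (0 : ℝ)..t, g s) (g t) t := fun t =>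
    (hgc.integral_hasStrictDerivAt 0 t).hasDerivAt
  have hderiv : deriv (fun t => ∫ s in (0 : ℝ)..t, g s) = g := funext fun t => (hder t).deriv
  have hsm : ContDiff ℝ ∞ (fun t => ∫ s in (0 : ℝ)..t, g s) :=
    contDiff_infty_iff_deriv.2 ⟨fun t => (hder t).differentiableAt, by rwa [hderiv]⟩
  have hsub : ∀ s t, (∀ r ∈ uIoc s t, g r = 0) → ∫ r in s..t, g r = 0 := fun s t h => by
    rw [intervalIntegral.integral_congr_ae (g := fun _ => 0)
      (Eventually.of_forall fun r hr => h r hr)]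
    simp
  have hsupp : ∀ t, t ∉ Icc α β → ∫ s in (0 : ℝ)..t, g s = 0 := by
    intro t ht
    rw [mem_Icc, not_and_or, not_le, not_le] at ht
    rcases ht with ht | ht
    · refine hsub _ _ fun r hr => hz r fun hr' => ?_
      have : r ≤ max 0 t := hr.2
      rcases le_max_iff.1 this with h | h <;> linarith [hr'.1]
    · have h4 : ∫ s in (1 : ℝ)..t, g s = 0 := by
        refine hsub _ _ fun r hr => hz r fun hr' => ?_
        have : min 1 t < r := hr.1
        rcases min_lt_iff.1 this with h | h <;> linarith [hr'.2]
      rw [← intervalIntegral.integral_add_adjacent_intervals (hgc.intervalIntegrable 0 1)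
        (hgc.intervalIntegrable 1 t), h0, h4, add_zero]
  refine ⟨_, hsm, HasCompactSupport.intro isCompact_Icc hsupp, ?_, hderiv⟩
  refine (closure_minimal (fun t ht => ?_) isClosed_Icc).trans
    (fun t ht => ⟨hα.trans_le ht.1, ht.2.trans_lt hβ⟩ : Icc α β ⊆ Ioo (0 : ℝ) 1)
  by_contra h
  exact ht (hsupp t h)

theorem ae_eq_of_integral_testFunction_eq {f f' : ℝ → V} (hf : Integrable f unitMeasure)
    (hf' : Integrable f' unitMeasure)
    (h : ∀ φ : ℝ → ℝ, ContDiff ℝ ∞ φ → HasCompactSupport φ → tsupport φ ⊆ Ioo (0 : ℝ) 1 →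
      ∫ s, φ s • f s ∂unitMeasure = ∫ s, φ s • f' s ∂unitMeasure) : f =ᵐ[unitMeasure] f' := by
  have hint : ∀ {φ : ℝ → ℝ} {f : ℝ → V}, Integrable f unitMeasure → ContDiff ℝ ∞ φ →
      HasCompactSupport φ → Integrable (fun s => φ s • f s) unitMeasure := by
    intro φ f hf h1 h2
    obtain ⟨C, hC⟩ := h1.continuous.bounded_above_of_compact_support h2
    exact hf.bdd_smul C h1.continuous.aestronglyMeasurable (Eventually.of_forall hC)
  have := isOpen_Ioo.ae_eq_zero_of_integral_contDiff_smul_eq_zero (U := Ioo (0 : ℝ) 1)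
    (μ := unitMeasure) (f := fun s => f s - f' s)
    ((hf.sub hf').locallyIntegrable.locallyIntegrableOn _) fun φ h1 h2 h3 => by
      simp only [smul_sub]
      rw [integral_sub (hint hf h1 h2) (hint hf' h1 h2), h φ h1 h2 h3, sub_self]
  filter_upwards [this, ae_restrict_mem measurableSet_Ioo] with s h1 h2
  exact sub_eq_zero.1 (h1 h2)

theorem IsWeakDeriv.unique {u v v' : L2 V} (h : IsWeakDeriv u v) (h' : IsWeakDeriv u v') :
    v = v' := by
  refine Lp.ext (ae_eq_of_integral_testFunction_eq (L2_integrable v) (L2_integrable v')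
    fun φ h1 h2 h3 => ?_)
  have := (h φ h1 h2 h3).symm.trans (h' φ h1 h2 h3)
  exact neg_injective this

/-- The lemma of du Bois-Reymond: a function with a weak derivative is a primitive of it. -/
theorem IsWeakDeriv.exists_eq_curveVel {u v : L2 V} (h : IsWeakDeriv u v) :
    ∃ b, u =ᵐ[unitMeasure] curveVel b v := by
  -- A normalized bump supported in `[1/4, 3/4]`: subtracting `(∫ φ) ψ` from a test function `φ`
  -- makes its mean vanish, so that it becomes the derivative of a test function.
  let ψ₀ : ContDiffBump (1 / 2 : ℝ) := ⟨1 / 8, 1 / 4, by norm_num, by norm_num⟩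
  obtain ⟨ψ, hψ⟩ : ∃ ψ : ℝ → ℝ, ψ = ψ₀.normed volume := ⟨_, rfl⟩
  have p1 : ContDiff ℝ ∞ ψ := hψ ▸ ψ₀.contDiff_normed
  have p2 : HasCompactSupport ψ := hψ ▸ ψ₀.hasCompactSupport_normed
  have p3 : tsupport ψ ⊆ Ioo (0 : ℝ) 1 := by
    rw [hψ, ψ₀.tsupport_normed_eq, Real.closedBall_eq_Icc]
    intro s hs
    have h1 : (1 / 2 : ℝ) - 1 / 4 ≤ s := hs.1
    have h2 : s ≤ (1 / 2 : ℝ) + 1 / 4 := hs.2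
    constructor <;> linarith
  have hsuppint : ∀ φ : ℝ → ℝ, tsupport φ ⊆ Ioo (0 : ℝ) 1 →
      ∫ s in (0 : ℝ)..1, φ s = ∫ s, φ s := fun φ h => by
    rw [intervalIntegral.integral_of_le zero_le_one, integral_Ioc_eq_integral_Ioo]
    exact setIntegral_eq_integral_of_forall_compl_eq_zero fun x hx =>
      image_eq_zero_of_notMem_tsupport fun hx' => hx (h hx')
  have p0 : ∫ s in (0 : ℝ)..1, ψ s = 1 := by rw [hsuppint ψ p3, hψ, ψ₀.integral_normed]
  have hci := continuous_curveVel (0 : V) (L2_integrable v)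
  have hfi : Integrable (fun s => u s - curveVel 0 v s) unitMeasure :=
    (L2_integrable u).sub ((memLp_of_continuous hci).integrable (by norm_num))
  have hint : ∀ {φ : ℝ → ℝ} {f : ℝ → V}, Integrable f unitMeasure → ContDiff ℝ ∞ φ →
      HasCompactSupport φ → Integrable (fun s => φ s • f s) unitMeasure := by
    intro φ f hf h1 h2
    obtain ⟨C, hC⟩ := h1.continuous.bounded_above_of_compact_support h2
    exact hf.bdd_smul C h1.continuous.aestronglyMeasurable (Eventually.of_forall hC)
  have hder : ∀ φ : ℝ → ℝ, ContDiff ℝ ∞ φ → HasCompactSupport φ → tsupport φ ⊆ Ioo (0 : ℝ) 1 →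
      ∫ s, deriv φ s • (u s - curveVel 0 v s) ∂unitMeasure = 0 := fun φ h1 h2 h3 => by
    have hd : ContDiff ℝ ∞ (deriv φ) := (contDiff_infty_iff_deriv.1 h1).2
    simp only [smul_sub]
    rw [integral_sub (hint (L2_integrable u) hd h2.deriv)
      (hint ((memLp_of_continuous hci).integrable (by norm_num)) hd h2.deriv), h φ h1 h2 h3,
      integral_deriv_smul_curveVel 0 (L2_integrable v) h1 h2 h3, sub_self]
  obtain ⟨b, hb⟩ : ∃ b, b = ∫ s, ψ s • (u s - curveVel 0 v s) ∂unitMeasure := ⟨_, rfl⟩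
  refine ⟨b, ?_⟩
  have key : (fun s => u s - curveVel 0 v s) =ᵐ[unitMeasure] fun _ => b := by
    refine ae_eq_of_integral_testFunction_eq hfi (integrable_const b) fun φ h1 h2 h3 => ?_
    obtain ⟨r, hr⟩ : ∃ r, r = ∫ s in (0 : ℝ)..1, φ s := ⟨_, rfl⟩
    have q1 : ContDiff ℝ ∞ fun s => φ s - r * ψ s := h1.sub (contDiff_const.mul p1)
    have q3 : tsupport (fun s => φ s - r * ψ s) ⊆ tsupport φ ∪ tsupport ψ := by
      refine closure_minimal (fun s hs => ?_)
        ((isClosed_tsupport φ).union (isClosed_tsupport ψ))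
      by_contra hn
      rw [mem_union, not_or] at hn
      exact hs (by simp [image_eq_zero_of_notMem_tsupport hn.1,
        image_eq_zero_of_notMem_tsupport hn.2])
    have q2 : HasCompactSupport fun s => φ s - r * ψ s :=
      IsCompact.of_isClosed_subset (h2.union p2) (isClosed_tsupport _) q3
    have q0 : ∫ s in (0 : ℝ)..1, (φ s - r * ψ s) = 0 := by
      rw [intervalIntegral.integral_sub (h1.continuous.intervalIntegrable _ _)
        ((p1.continuous.intervalIntegrable _ _).const_mul r),
        intervalIntegral.integral_const_mul, p0, ← hr]
      ring
    obtain ⟨Φ, f1, f2, f3, f4⟩ := exists_testFunction_deriv_eq q1 q2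
      (q3.trans (union_subset h3 p3)) q0
    have e := hder Φ f1 f2 f3
    rw [f4] at e
    have e' : ∫ s, φ s • (u s - curveVel 0 v s) ∂unitMeasure
        - r • ∫ s, ψ s • (u s - curveVel 0 v s) ∂unitMeasure = 0 := by
      have hr' : Integrable (fun s => r • ψ s • (u s - curveVel 0 v s)) unitMeasure :=
        (hint hfi p1 p2).smul r
      rw [← integral_smul, ← integral_sub (hint hfi h1 h2) hr']
      refine Eq.trans ?_ e
      simp only [sub_smul, mul_smul]
    rw [sub_eq_zero.1 e', ← hb, integral_smul_const, hr,
      intervalIntegral.integral_of_le zero_le_one, integral_Ioc_eq_integral_Ioo]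
  filter_upwards [key] with s hs
  have : u s = b + curveVel 0 v s := sub_eq_iff_eq_add.1 hs
  rw [this]
  simp [curveVel]

/-- The discrete functionals constrain only the position of an element of `W^{2,2}`; uniqueness of
weak derivatives makes this enough to identify the whole element. -/
theorem W22_ext_pos {u v : W22 V} (h : pos u = pos v) : u = v := by
  have h1 : vel u = vel v := IsWeakDeriv.unique u.2.1 (h ▸ v.2.1 : IsWeakDeriv (pos u) _)
  have h2 : acc u = acc v := IsWeakDeriv.unique u.2.2 (h1 ▸ v.2.2 : IsWeakDeriv (vel u) _)
  exact W22_ext h h1 h2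

/-- Every element of `W^{2,2}((0,1);V)` is determined by its initial data and its second
derivative. -/
theorem exists_eq_sobolevOf (u : W22 V) : ∃ a b, u = sobolevOf (a, b, acc u) := by
  obtain ⟨b, hb⟩ := u.2.2.exists_eq_curveVel
  obtain ⟨a, ha⟩ := u.2.1.exists_eq_curveVel
  refine ⟨a, b, W22_ext_pos (Lp.ext ?_)⟩
  filter_upwards [ha, pos_sobolevOf (a, b, acc u), ae_restrict_mem measurableSet_Ioo]
    with s h1 h2 h3
  rw [h2]
  refine Eq.trans h1 ?_
  rw [← curveVel_curveVel a b _ (Ioo_subset_Icc_self h3)]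
  exact congrFun (curveVel_congr a hb) s

omit [InnerProductSpace ℝ V] [CompleteSpace V] in
theorem eqOn_Icc_of_ae_eq_unit {c c' : ℝ → V} (hc : ContinuousOn c (Icc 0 1))
    (hc' : ContinuousOn c' (Icc 0 1)) (h : c =ᵐ[unitMeasure] c') : EqOn c c' (Icc 0 1) := by
  refine Measure.eqOn_Icc_of_ae_eq volume zero_ne_one ?_ hc hc'
  rwa [unitMeasure, restrict_Ioo_eq_restrict_Icc] at h

omit [InnerProductSpace ℝ V] [CompleteSpace V] in
theorem IsContRep.eqOn {f : L2 V} {c c' : ℝ → V} (h : IsContRep f c) (h' : IsContRep f c') :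
    EqOn c c' (Icc 0 1) :=
  eqOn_Icc_of_ae_eq_unit h.1 h'.1 (h.2.symm.trans h'.2)

theorem isContRep_pos_sobolevOf (x : V × V × L2 V) :
    IsContRep (pos (sobolevOf x)) (curvePos x.1 x.2.1 x.2.2) :=
  ⟨(continuous_curvePos _ _ (L2_integrable _)).continuousOn, pos_sobolevOf x⟩

theorem isContRep_vel_sobolevOf (x : V × V × L2 V) :
    IsContRep (vel (sobolevOf x)) (curveVel x.2.1 x.2.2) :=
  ⟨(continuous_curveVel _ (L2_integrable _)).continuousOn, vel_sobolevOf x⟩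

/-- The boundary condition in terms of position and velocity. -/
def BoundaryCondition.HoldsFor (bc : BoundaryCondition V) (c d : ℝ → V) : Prop :=
  match bc with
  | .natural => True
  | .hermite v₀ v₁ => d 0 = v₀ ∧ d 1 = v₁
  | .periodic => c 0 = c 1 ∧ d 0 = d 1

theorem holds_sobolevOf_iff (bc : BoundaryCondition V) (x : V × V × L2 V) :
    bc.Holds (sobolevOf x) ↔ bc.HoldsFor (curvePos x.1 x.2.1 x.2.2) (curveVel x.2.1 x.2.2) := by
  have hc := isContRep_pos_sobolevOf x
  have hd := isContRep_vel_sobolevOf x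
  have h0 : (0 : ℝ) ∈ Icc (0 : ℝ) 1 := ⟨le_rfl, zero_le_one⟩
  have h1 : (1 : ℝ) ∈ Icc (0 : ℝ) 1 := ⟨zero_le_one, le_rfl⟩
  cases bc with
  | natural => simp [BoundaryCondition.Holds, BoundaryCondition.HoldsFor]
  | hermite v₀ v₁ =>
    refine ⟨?_, fun h => ⟨_, hd, h⟩⟩
    rintro ⟨d, h, e0, e1⟩
    exact ⟨(hd.eqOn h h0).trans e0, (hd.eqOn h h1).trans e1⟩
  | periodic =>
    refine ⟨?_, fun h => ⟨_, _, hc, hd, h⟩⟩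
    rintro ⟨c, d, h, h', e0, e1⟩
    exact ⟨(hc.eqOn h h0).trans (e0.trans (hc.eqOn h h1).symm),
      (hd.eqOn h' h0).trans (e1.trans (hd.eqOn h' h1).symm)⟩

theorem interpolates_sobolevOf_iff {J : Type*} {t : J → ℝ} (ht : ∀ i, t i ∈ Icc (0 : ℝ) 1)
    (ybar : J → V) (x : V × V × L2 V) :
    Interpolates t ybar (sobolevOf x) ↔ ∀ i, curvePos x.1 x.2.1 x.2.2 (t i) = ybar i := by
  have hc := isContRep_pos_sobolevOf x
  refine ⟨?_, fun h => ⟨_, hc, h⟩⟩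
  rintro ⟨c, h, e⟩ i
  exact (hc.eqOn h (ht i)).trans (e i)

end DuBoisReymond

end RiemSpline

namespace RiemSpline

/-! ### Step functions on the cells around the nodes -/

section StepFunctions

/-- The half node `t^{k-1/2}`. -/
noncomputable def halfNode (K k : ℕ) : ℝ := ((k : ℝ) - 1 / 2) / K

/-- The index `k` with `s ∈ [t^{k-1/2}, t^{k+1/2})`. -/
noncomputable def midIndex (K : ℕ) (s : ℝ) : ℕ := ⌊(K : ℝ) * s + 1 / 2⌋₊

theorem halfNode_succ_sub {K : ℕ} (hK : 0 < K) (k : ℕ) :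
    halfNode K (k + 1) - halfNode K k = (K : ℝ)⁻¹ := by
  have : (0 : ℝ) < K := by exact_mod_cast hK
  simp only [halfNode]; push_cast; field_simp; ring

theorem halfNode_one {K : ℕ} : halfNode K 1 = (2 * (K : ℝ))⁻¹ := by
  simp only [halfNode, mul_inv]; push_cast; ring

theorem one_sub_halfNode {K : ℕ} (hK : 0 < K) : 1 - halfNode K K = (2 * (K : ℝ))⁻¹ := by
  have : (0 : ℝ) < K := by exact_mod_cast hK
  simp only [halfNode]; field_simp; ring

theorem halfNode_mono {K i j : ℕ} (hij : i ≤ j) : halfNode K i ≤ halfNode K j := by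
  have : (i : ℝ) ≤ j := by exact_mod_cast hij
  simp only [halfNode]; gcongr

theorem midIndex_eq {K : ℕ} (hK : 0 < K) {k : ℕ} {s : ℝ} (hs : 0 ≤ s) (h1 : halfNode K k ≤ s)
    (h2 : s < halfNode K (k + 1)) : midIndex K s = k := by
  have hK0 : (0 : ℝ) < K := by exact_mod_cast hK
  rw [halfNode, div_le_iff₀ hK0] at h1
  rw [halfNode, lt_div_iff₀ hK0] at h2
  push_cast at h2
  rw [midIndex, Nat.floor_eq_iff (by positivity)]
  constructor <;> linarith

theorem halfNode_midIndex {K : ℕ} (hK : 0 < K) {s : ℝ} (hs : 0 ≤ s) :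
    halfNode K (midIndex K s) ≤ s ∧ s < halfNode K (midIndex K s + 1) := by
  have hK0 : (0 : ℝ) < K := by exact_mod_cast hK
  have h0 : 0 ≤ (K : ℝ) * s + 1 / 2 := by positivity
  have h1 := Nat.floor_le h0
  have h2 := Nat.lt_floor_add_one ((K : ℝ) * s + 1 / 2)
  rw [halfNode, halfNode, div_le_iff₀ hK0, lt_div_iff₀ hK0, midIndex]
  push_cast
  constructor <;> linarith

theorem midIndex_le {K : ℕ} {s : ℝ} (hs1 : s ≤ 1) : midIndex K s ≤ K := by
  have : (K : ℝ) * s ≤ K := by nlinarith [(Nat.cast_nonneg K : (0 : ℝ) ≤ K)]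
  refine Nat.lt_succ_iff.1 ((Nat.floor_lt' (by omega)).2 ?_)
  push_cast
  linarith

theorem measurable_midIndex (K : ℕ) : Measurable (midIndex K) :=
  Nat.measurable_floor.comp ((measurable_id.const_mul _).add_const _)

theorem integral_of_eqOn_Ioo {E : Type*} [NormedAddCommGroup E] [NormedSpace ℝ E]
    [CompleteSpace E] {g : ℝ → E} {A : E} {x y : ℝ} (hxy : x ≤ y) (h : ∀ s ∈ Ioo x y, g s = A) :
    IntervalIntegrable g volume x y ∧ ∫ s in x..y, g s = (y - x) • A := by
  constructor
  · rw [intervalIntegrable_iff_integrableOn_Ioo_of_le hxy]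
    refine (integrableOn_const (C := A) (by simp)).congr_fun (fun s hs => (h s hs).symm)
      measurableSet_Ioo
  · rw [intervalIntegral.integral_of_le hxy, integral_Ioc_eq_integral_Ioo,
      setIntegral_congr_fun measurableSet_Ioo h]
    simp [hxy]

theorem integral_unit_eq {E : Type*} [NormedAddCommGroup E] [NormedSpace ℝ E] (f : ℝ → E) :
    ∫ s, f s ∂unitMeasure = ∫ s in (0 : ℝ)..1, f s := by
  rw [intervalIntegral.integral_of_le zero_le_one, integral_Ioc_eq_integral_Ioo]

/-- Cells are centred at the nodes, so those of the indices `0` and `K` are cut in half by the ends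
of the unit interval. -/
theorem integral_midIndex {K : ℕ} (hK : 0 < K) (f : ℕ → ℝ) :
    ∫ s, f (midIndex K s) ∂unitMeasure =
      (K : ℝ)⁻¹ * (f 0 / 2 + ∑ k ∈ Finset.Icc 1 (K - 1), f k + f K / 2) := by
  have hK0 : (0 : ℝ) < K := by exact_mod_cast hK
  have h1 : 0 ≤ halfNode K 1 := by rw [halfNode_one]; positivity
  have hKK : halfNode K K ≤ 1 := by
    have := one_sub_halfNode hK
    have : (0 : ℝ) ≤ (2 * (K : ℝ))⁻¹ := by positivity
    linarith
  have p1 := integral_of_eqOn_Ioo (g := fun s => f (midIndex K s)) (A := f 0) h1 fun s hs => by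
    rw [midIndex_eq hK hs.1.le (k := 0) ?_ hs.2]
    refine le_trans ?_ hs.1.le
    simp only [halfNode]
    exact div_nonpos_of_nonpos_of_nonneg (by norm_num) hK0.le
  have p2 : ∀ k ∈ Ico 1 K, IntervalIntegrable (fun s => f (midIndex K s)) volume (halfNode K k)
      (halfNode K (k + 1)) ∧ ∫ s in halfNode K k..halfNode K (k + 1), f (midIndex K s)
        = (halfNode K (k + 1) - halfNode K k) • f k := fun k hk =>
    integral_of_eqOn_Ioo (halfNode_mono (Nat.le_succ k)) fun s hs => by
      rw [midIndex_eq hK ((h1.trans (halfNode_mono hk.1)).trans hs.1.le) hs.1.le hs.2]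
  have p3 := integral_of_eqOn_Ioo (g := fun s => f (midIndex K s)) (A := f K) hKK fun s hs => by
    rw [midIndex_eq hK ((h1.trans (halfNode_mono hK)).trans hs.1.le) hs.1.le]
    refine hs.2.trans_le ?_
    simp only [halfNode]
    rw [le_div_iff₀ hK0]
    push_cast
    linarith
  have p2i := IntervalIntegrable.trans_iterate_Ico (a := halfNode K) (m := 1) (n := K) hK
    fun k hk => (p2 k hk).1
  rw [integral_unit_eq, ← intervalIntegral.integral_add_adjacent_intervals (p1.1.trans p2i) p3.1,
    ← intervalIntegral.integral_add_adjacent_intervals p1.1 p2i,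
    ← intervalIntegral.sum_integral_adjacent_intervals_Ico (a := halfNode K) hK
      fun k hk => (p2 k hk).1, p1.2, p3.2,
    Finset.sum_congr rfl fun k hk => (p2 k (Finset.mem_Ico.1 hk)).2, one_sub_halfNode hK,
    sub_zero, halfNode_one]
  simp only [halfNode_succ_sub hK, smul_eq_mul, ← Finset.mul_sum]
  have : Finset.Ico 1 K = Finset.Icc 1 (K - 1) := by
    ext k; simp only [Finset.mem_Ico, Finset.mem_Icc]; omega
  rw [this, mul_inv]
  ring

/-- The value on `[t^{k-1/2}, t^{k+1/2})` of the step function with values `f k`, `1 ≤ k ≤ K̂`: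
without periodicity it vanishes on the two boundary half intervals, with periodicity the last
interval is understood modulo `1`. -/
def BoundaryCondition.extendMid {V E : Type*} [Zero E] (bc : BoundaryCondition V) (K : ℕ)
    (f : ℕ → E) (k : ℕ) : E :=
  match bc with
  | .natural => if 1 ≤ k ∧ k ≤ K - 1 then f k else 0
  | .hermite _ _ => if 1 ≤ k ∧ k ≤ K - 1 then f k else 0
  | .periodic => if k = 0 then f K else f k

variable {V : Type*}

theorem BoundaryCondition.extendMid_of_mem {E : Type*} [Zero E] (bc : BoundaryCondition V)
    {K k : ℕ} (f : ℕ → E) (h1 : 1 ≤ k) (h2 : k ≤ K - 1) : bc.extendMid K f k = f k := by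
  have : k ≠ 0 := by omega
  cases bc <;> simp [BoundaryCondition.extendMid, h1, h2, this]

/-- The index `j` is the same for all `f`; thus estimates over the midpoint indices transfer to the
step functions without repeating the distinction of boundary conditions. -/
theorem BoundaryCondition.extendMid_cases {E : Type*} [Zero E] (bc : BoundaryCondition V)
    {K k : ℕ} (hK : 0 < K) (hk : k ≤ K) :
    (∀ f : ℕ → E, bc.extendMid K f k = 0) ∨
      ∃ j ∈ Finset.Icc 1 (bc.numMid K), (j = k ∨ k = 0 ∧ j = K ∧ bc = .periodic) ∧
        ∀ f : ℕ → E, bc.extendMid K f k = f j := by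
  cases bc with
  | natural =>
    by_cases h : 1 ≤ k ∧ k ≤ K - 1
    · exact Or.inr ⟨k, Finset.mem_Icc.2 h, Or.inl rfl, fun f => if_pos h⟩
    · exact Or.inl fun f => if_neg h
  | hermite _ _ =>
    by_cases h : 1 ≤ k ∧ k ≤ K - 1
    · exact Or.inr ⟨k, Finset.mem_Icc.2 h, Or.inl rfl, fun f => if_pos h⟩
    · exact Or.inl fun f => if_neg h
  | periodic =>
    right
    by_cases h : k = 0
    · exact ⟨K, Finset.mem_Icc.2 ⟨hK, le_rfl⟩, Or.inr ⟨h, rfl, rfl⟩, fun f => if_pos h⟩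
    · exact ⟨k, Finset.mem_Icc.2 ⟨by omega, hk⟩, Or.inl rfl, fun f => if_neg h⟩

/-- In the periodic case both boundary half cells carry the value of index `K` and together make up
one full cell; otherwise they carry `0`. -/
theorem BoundaryCondition.integral_extendMid (bc : BoundaryCondition V) {K : ℕ} (hK : 0 < K)
    (f : ℕ → ℝ) :
    ∫ s, bc.extendMid K f (midIndex K s) ∂unitMeasure =
      (K : ℝ)⁻¹ * ∑ k ∈ Finset.Icc 1 (bc.numMid K), f k := by
  rw [integral_midIndex hK]
  have h : ∀ k ∈ Finset.Icc 1 (K - 1), bc.extendMid K f k = f k := fun k hk =>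
    bc.extendMid_of_mem f (Finset.mem_Icc.1 hk).1 (Finset.mem_Icc.1 hk).2
  rw [Finset.sum_congr rfl h]
  have hlast : ∑ k ∈ Finset.Icc 1 K, f k = ∑ k ∈ Finset.Icc 1 (K - 1), f k + f K := by
    obtain ⟨n, rfl⟩ := Nat.exists_eq_succ_of_ne_zero hK.ne'
    rw [Finset.sum_Icc_succ_top (by omega)]
    simp
  have hn : ¬ K ≤ K - 1 := by omega
  cases bc with
  | natural => simp [BoundaryCondition.extendMid, BoundaryCondition.numMid, hn]
  | hermite _ _ => simp [BoundaryCondition.extendMid, BoundaryCondition.numMid, hn]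
  | periodic =>
    simp only [BoundaryCondition.extendMid, BoundaryCondition.numMid, hlast, hK.ne', if_true,
      if_false]
    ring

theorem memLp_comp_midIndex {E : Type*} [NormedAddCommGroup E] (K : ℕ) (f : ℕ → E) :
    MemLp (fun s => f (midIndex K s)) 2 unitMeasure := by
  refine MemLp.of_bound (StronglyMeasurable.of_discrete (f := f).comp_measurable
    (measurable_midIndex K)).aestronglyMeasurable (∑ k ∈ Finset.range (K + 1), ‖f k‖) ?_
  filter_upwards [ae_restrict_mem measurableSet_Ioo] with s hs
  exact Finset.single_le_sum (f := fun k => ‖f k‖) (fun _ _ => norm_nonneg _)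
    (Finset.mem_range.2 (Nat.lt_succ_iff.2 (midIndex_le hs.2.le)))

end StepFunctions

/-! ### The interpolating curve -/

section Interpolation

variable {V : Type*} [NormedAddCommGroup V] [InnerProductSpace ℝ V] [CompleteSpace V]

theorem curve_of_eqOn_Ioo (a b : V) {w : ℝ → V} (hw : Integrable w unitMeasure) {A : V}
    {x y : ℝ} (hx : 0 ≤ x) (hy : y ≤ 1) (h : ∀ s ∈ Ioo x y, w s = A) {s : ℝ} (hs : s ∈ Icc x y) :
    curveVel b w s = curveVel b w x + (s - x) • A ∧
    curvePos a b w s = curvePos a b w x + (s - x) • curveVel b w x + ((s - x) ^ 2 / 2) • A := by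
  have hv : ∀ s ∈ Icc x y, curveVel b w s = curveVel b w x + (s - x) • A := fun s hs => by
    rw [← sub_eq_iff_eq_add', curveVel_sub b hw]
    refine (integral_of_eqOn_Ioo hs.1 fun r hr => ?_).2
    rw [indicator_of_mem (mem_Ioo.2 ⟨hx.trans_lt hr.1, (hr.2.trans_le hs.2).trans_le hy⟩)]
    exact h r ⟨hr.1, hr.2.trans_le hs.2⟩
  refine ⟨hv s hs, ?_⟩
  have h1 : curvePos a b w s - curvePos a b w x
      = ∫ r in x..s, (curveVel b w x + (r - x) • A) := by
    rw [curvePos_sub a b hw]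
    refine intervalIntegral.integral_congr fun r hr => ?_
    rw [uIcc_of_le hs.1] at hr
    exact hv r ⟨hr.1, hr.2.trans hs.2⟩
  have hc : Continuous fun r : ℝ => (r - x) • A := by fun_prop
  rw [intervalIntegral.integral_add (by simp) (hc.intervalIntegrable _ _),
    intervalIntegral.integral_const, intervalIntegral.integral_smul_const,
    intervalIntegral.integral_comp_sub_right (fun r => r), integral_id, sub_self] at h1
  rw [sub_eq_iff_eq_add'.1 h1, add_assoc]
  congr 3
  ring

namespace BoundaryCondition

/-- The second derivative of the interpolating curve. -/
noncomputable def etaAcc (bc : BoundaryCondition V) {K : ℕ} (p : Fin (K + 1) → V) (s : ℝ) : V :=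
  bc.extendMid K (accNode p) (midIndex K s)

/-- The initial value of the interpolating curve. -/
noncomputable def etaInit (bc : BoundaryCondition V) {K : ℕ} (p : Fin (K + 1) → V) : V :=
  match bc with
  | .natural => node p 0
  | .hermite _ _ => node p 0
  -- Modulo one, time `0` is the middle of the `K`-th cell.
  | .periodic => hermitePiece p K (1 / 2)

/-- The initial velocity of the interpolating curve. -/
noncomputable def etaVelInit (bc : BoundaryCondition V) {K : ℕ} (p : Fin (K + 1) → V) : V :=
  match bc with
  | .natural => velNode p 1
  | .hermite _ _ => velNode p 1
  -- The velocity is affine on a cell, hence equal to the mean of its end values in the middle.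
  | .periodic => (1 / 2 : ℝ) • (velNode p K + velNode p (K + 1))

variable (bc : BoundaryCondition V) {K : ℕ} (p : Fin (K + 1) → V)

omit [CompleteSpace V] in
theorem memLp_etaAcc : MemLp (bc.etaAcc p) 2 unitMeasure := memLp_comp_midIndex K _

omit [CompleteSpace V] in
theorem integrable_etaAcc : Integrable (bc.etaAcc p) unitMeasure :=
  (bc.memLp_etaAcc p).integrable (by norm_num)

/-- The continuous representative of the interpolating curve. -/
noncomputable def etaPos : ℝ → V := curvePos (bc.etaInit p) (bc.etaVelInit p) (bc.etaAcc p)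

/-- The velocity of the interpolating curve. -/
noncomputable def etaVel : ℝ → V := curveVel (bc.etaVelInit p) (bc.etaAcc p)

variable {bc p}

/-- The first half cell is special: the motion is affine for open curves, and it is the second half
of the `K`-th piece for periodic ones, where `y_0 = y_K` and `y_{K+1} = y_1` enter. Expanding the
velocity at the right end matches the form of the other cells. -/
theorem eta_first (hK : 0 < K) (hp : bc.HoldsDiscrete p) {s : ℝ} (h0 : 0 ≤ s)
    (h1 : s ≤ halfNode K 1) :
    bc.etaVel p s = velNode p 1 + (s - halfNode K 1) • bc.extendMid K (accNode p) 0 ∧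
    (s < halfNode K 1 → bc.etaPos p s = bc.eta p s) ∧ bc.etaPos p (halfNode K 1) =
      (1 / 2 : ℝ) • (node p 0 + node p 1) := by
  have hK0 : (0 : ℝ) < K := by exact_mod_cast hK
  have h10 : 0 ≤ halfNode K 1 := by rw [halfNode_one]; positivity
  have h11 : halfNode K 1 ≤ 1 := by
    rw [halfNode_one]
    refine inv_le_one_of_one_le₀ ?_
    have : (1 : ℝ) ≤ K := by exact_mod_cast hK
    linarith
  have hc : ∀ s ∈ Ioo 0 (halfNode K 1), bc.etaAcc p s = bc.extendMid K (accNode p) 0 :=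
    fun s hs => by
      rw [etaAcc, midIndex_eq hK hs.1.le (k := 0) ?_ hs.2]
      refine le_trans ?_ hs.1.le
      simp only [halfNode]
      exact div_nonpos_of_nonpos_of_nonneg (by norm_num) hK0.le
  have e := fun {s : ℝ} (hs : s ∈ Icc 0 (halfNode K 1)) => curve_of_eqOn_Ioo (bc.etaInit p)
    (bc.etaVelInit p) (bc.integrable_etaAcc p) le_rfl h11 hc hs
  have es := e ⟨h0, h1⟩
  have e1 := e ⟨h10, le_rfl⟩
  rw [curveVel_zero, curvePos_zero, sub_zero] at es e1
  rw [etaVel, etaPos, es.1, es.2, e1.2]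
  have hKs : s < 2⁻¹ * (K : ℝ)⁻¹ → (K : ℝ) * s < 1 / 2 := fun h1 => by
    calc (K : ℝ) * s < K * (2⁻¹ * (K : ℝ)⁻¹) := by gcongr
      _ = 1 / 2 := by field_simp
  rw [halfNode_one, mul_inv]
  cases bc with
  | natural =>
    refine ⟨?_, fun h => ?_, ?_⟩
    · simp [extendMid, etaVelInit]
    · simp only [BoundaryCondition.eta, etaOpen, if_pos (hKs h).le, extendMid, etaInit,
        etaVelInit, velNode, Nat.sub_self]
      simp
      module
    · simp only [extendMid, etaInit, etaVelInit, velNode, Nat.sub_self]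
      simp
      match_scalars <;> field_simp <;> ring
  | hermite _ _ =>
    refine ⟨?_, fun h => ?_, ?_⟩
    · simp [extendMid, etaVelInit]
    · simp only [BoundaryCondition.eta, etaOpen, if_pos (hKs h).le, extendMid, etaInit,
        etaVelInit, velNode, Nat.sub_self]
      simp
      module
    · simp only [extendMid, etaInit, etaVelInit, velNode, Nat.sub_self]
      simp
      match_scalars <;> field_simp <;> ring
  | periodic =>
    have hper : node p 0 = node p K := hp
    have hn := node_succ_self hK p
    refine ⟨?_, fun h => ?_, ?_⟩
    · simp only [extendMid, if_true, etaVelInit, velNode, accNode, Nat.add_sub_cancel,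
        Nat.sub_self, ← hn, hper]
      match_scalars <;> field_simp <;> ring
    · simp only [BoundaryCondition.eta, etaPeriodic, if_pos (hKs h), extendMid, if_true, etaInit,
        etaVelInit, hermitePiece, velNode, accNode, Nat.add_sub_cancel]
      match_scalars <;> field_simp <;> ring
    · simp only [extendMid, if_true, etaInit, etaVelInit, hermitePiece, velNode, accNode,
        Nat.add_sub_cancel, ← hn, hper]
      match_scalars <;> field_simp <;> ring

/-- Values of the interpolating curve at the half nodes. -/
theorem eta_halfNode (hK : 0 < K) (hp : bc.HoldsDiscrete p) {k : ℕ} (hk : 1 ≤ k) (hkK : k ≤ K) :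
    bc.etaVel p (halfNode K k) = velNode p k ∧
    bc.etaPos p (halfNode K k) = (1 / 2 : ℝ) • (node p (k - 1) + node p k) := by
  have hK0 : (0 : ℝ) < K := by exact_mod_cast hK
  have h10 : 0 ≤ halfNode K 1 := by rw [halfNode_one]; positivity
  induction k, hk using Nat.le_induction with
  | base =>
    have h := eta_first hK hp h10 le_rfl
    refine ⟨by rw [h.1]; simp, h.2.2⟩
  | succ k hk ih =>
    obtain ⟨ih1, ih2⟩ := ih (by omega)
    have hpos := h10.trans (halfNode_mono hk)
    have hlast : halfNode K (k + 1) ≤ 1 := (halfNode_mono hkK).trans (by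
      have := one_sub_halfNode hK
      have : (0 : ℝ) ≤ (2 * (K : ℝ))⁻¹ := by positivity
      linarith)
    have e := curve_of_eqOn_Ioo (bc.etaInit p) (bc.etaVelInit p) (bc.integrable_etaAcc p)
      hpos hlast (A := accNode p k) (fun s hs => by
        rw [etaAcc, midIndex_eq hK (hpos.trans hs.1.le) hs.1.le hs.2,
          bc.extendMid_of_mem _ hk (by omega)])
      (s := halfNode K (k + 1)) ⟨halfNode_mono (Nat.le_succ k), le_rfl⟩
    rw [← etaVel, ← etaPos, ih1, ih2, halfNode_succ_sub hK] at e
    rw [e.1, e.2]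
    simp only [velNode, accNode, Nat.add_sub_cancel]
    constructor <;> match_scalars <;> field_simp <;> ring

theorem eta_piece (hK : 0 < K) (hp : bc.HoldsDiscrete p) {k : ℕ} (hk : 1 ≤ k) (hkK : k ≤ K)
    {s : ℝ} (hs : halfNode K k ≤ s) (hs' : s ≤ halfNode K (k + 1)) (hs1 : s ≤ 1) :
    bc.etaVel p s = velNode p k + (s - halfNode K k) • bc.extendMid K (accNode p) k ∧
    bc.etaPos p s = (1 / 2 : ℝ) • (node p (k - 1) + node p k) + (s - halfNode K k) • velNode p k
      + ((s - halfNode K k) ^ 2 / 2) • bc.extendMid K (accNode p) k := by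
  have h10 : 0 ≤ halfNode K 1 := by rw [halfNode_one]; positivity
  have hpos := h10.trans (halfNode_mono hk)
  have h := eta_halfNode hK hp hk hkK
  have e := curve_of_eqOn_Ioo (bc.etaInit p) (bc.etaVelInit p) (bc.integrable_etaAcc p)
      hpos (min_le_right (halfNode K (k + 1)) 1) (A := bc.extendMid K (accNode p) k)
      (fun s hs => by
        rw [etaAcc, midIndex_eq hK (hpos.trans hs.1.le) hs.1.le
          (hs.2.trans_le (min_le_left _ _))])
      (s := s) ⟨hs, le_min hs' hs1⟩
  rwa [← etaVel, ← etaPos, h.1, h.2] at e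

omit [CompleteSpace V] in
theorem eta_eq_hermitePiece (bc : BoundaryCondition V) (p : Fin (K + 1) → V) (hK : 0 < K) {k : ℕ}
    (hk : 1 ≤ k) (hkK : k ≤ K - 1) {s : ℝ} (hs : halfNode K k < s) (hs' : s < halfNode K (k + 1)) :
    bc.eta p s = hermitePiece p k (K * (s - halfNode K k)) := by
  have hK0 : (0 : ℝ) < K := by exact_mod_cast hK
  have h10 : 0 ≤ halfNode K 1 := by rw [halfNode_one]; positivity
  have hpos := h10.trans (halfNode_mono hk)
  have hm := midIndex_eq hK (hpos.trans hs.le) hs.le hs'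
  rw [midIndex] at hm
  have e : (K : ℝ) * s - (k - 1 / 2) = K * (s - halfNode K k) := by
    rw [halfNode]; field_simp
  rw [halfNode, div_lt_iff₀ hK0] at hs
  rw [halfNode, lt_div_iff₀ hK0] at hs'
  have hk' : (1 : ℝ) ≤ k := by exact_mod_cast hk
  have hkK' : (k : ℝ) + 1 ≤ K := by exact_mod_cast (by omega : k + 1 ≤ K)
  push_cast at hs'
  have n1 : ¬ (K : ℝ) * s ≤ 1 / 2 := by linarith
  have n2 : (K : ℝ) * s < K - 1 / 2 := by linarith
  have n3 : ¬ (K : ℝ) * s < 1 / 2 := by linarith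
  cases bc with
  | natural => rw [BoundaryCondition.eta, etaOpen, if_neg n1, if_pos n2, hm, e]
  | hermite _ _ => rw [BoundaryCondition.eta, etaOpen, if_neg n1, if_pos n2, hm, e]
  | periodic => rw [BoundaryCondition.eta, etaPeriodic, if_neg n3, hm, e]

omit [CompleteSpace V] in
theorem eta_last (bc : BoundaryCondition V) (p : Fin (K + 1) → V) (hK : 0 < K) {s : ℝ}
    (hs : halfNode K K < s) (hs1 : s < 1) :
    bc.eta p s = (1 / 2 : ℝ) • (node p (K - 1) + node p K) + (s - halfNode K K) • velNode p K
      + ((s - halfNode K K) ^ 2 / 2) • bc.extendMid K (accNode p) K := by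
  have hK0 : (0 : ℝ) < K := by exact_mod_cast hK
  have hpos : 0 ≤ s := le_trans (by
    rw [halfNode]
    have : (1 : ℝ) ≤ K := by exact_mod_cast hK
    exact div_nonneg (by linarith) hK0.le) hs.le
  have hs2 : s < halfNode K (K + 1) := by
    refine hs1.trans_le ?_
    rw [halfNode, le_div_iff₀ hK0]; push_cast; linarith
  have hm := midIndex_eq hK hpos hs.le hs2
  rw [midIndex] at hm
  rw [halfNode, div_lt_iff₀ hK0] at hs
  have n3 : ¬ (K : ℝ) * s < K - 1 / 2 := by linarith
  have hk' : (1 : ℝ) ≤ K := by exact_mod_cast hK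
  have n1 : ¬ (K : ℝ) * s ≤ 1 / 2 := by linarith
  have n4 : ¬ (K : ℝ) * s < 1 / 2 := by linarith
  have hK' : ¬ K ≤ K - 1 := by omega
  cases bc with
  | natural =>
    simp only [BoundaryCondition.eta, etaOpen, if_neg n1, if_neg n3, extendMid, hK', and_false,
      if_false, velNode, halfNode]
    match_scalars <;> field_simp <;> ring
  | hermite _ _ =>
    simp only [BoundaryCondition.eta, etaOpen, if_neg n1, if_neg n3, extendMid, hK', and_false,
      if_false, velNode, halfNode]
    match_scalars <;> field_simp <;> ring
  | periodic =>
    simp only [BoundaryCondition.eta, etaPeriodic, if_neg n4, hm, extendMid, hK.ne', if_false,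
      hermitePiece, velNode, accNode, halfNode]
    match_scalars <;> field_simp

/-- The half nodes form a null set and are discarded, which avoids comparing branches where pieces
meet. -/
theorem eta_eq_etaPos (hK : 0 < K) (hp : bc.HoldsDiscrete p) :
    bc.eta p =ᵐ[unitMeasure] bc.etaPos p := by
  have hK0 : (0 : ℝ) < K := by exact_mod_cast hK
  have hnull : ∀ᵐ s ∂unitMeasure, s ∉ range (halfNode K) :=
    (Set.countable_range (halfNode K)).ae_notMem _
  filter_upwards [hnull, ae_restrict_mem measurableSet_Ioo] with s hs hs01
  have hne : ∀ k, halfNode K k ≠ s := fun k h => hs ⟨k, h⟩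
  obtain ⟨h1, h2⟩ := halfNode_midIndex hK hs01.1.le
  have hle : midIndex K s ≤ K := midIndex_le hs01.2.le
  generalize midIndex K s = k at h1 h2 hle
  have h1' := lt_of_le_of_ne h1 (hne k)
  rcases Nat.eq_zero_or_pos k with rfl | hk
  · exact ((eta_first hK hp hs01.1.le h2.le).2.1 h2).symm
  · rw [(eta_piece hK hp hk hle h1 h2.le hs01.2.le).2]
    rcases hle.eq_or_lt with rfl | hlt
    · exact eta_last bc p hK h1' hs01.2
    · rw [eta_eq_hermitePiece bc p hK hk (by omega) h1' h2, bc.extendMid_of_mem _ hk (by omega),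
        hermitePiece, velNode, accNode]
      match_scalars <;> field_simp

omit [CompleteSpace V] in
-- For `K ≥ 2` every node occurs in some interior piece `1 ≤ k ≤ K - 1`. Such a piece is quadratic,
-- and three of its values determine its three nodes.
theorem eta_injective (bc : BoundaryCondition V) (hK : 2 ≤ K) {p q : Fin (K + 1) → V}
    (h : bc.eta p =ᵐ[unitMeasure] bc.eta q) : p = q := by
  have hKp : 0 < K := by omega
  have hK0 : (0 : ℝ) < K := by exact_mod_cast hKp
  have hcont : ∀ (p : Fin (K + 1) → V) (k : ℕ),
      Continuous fun s : ℝ => hermitePiece p k (K * (s - halfNode K k)) := fun p k => by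
    simp only [hermitePiece]
    fun_prop
  have hpiece : ∀ k, 1 ≤ k → k ≤ K - 1 → ∀ r ∈ Ioo (0 : ℝ) 1,
      hermitePiece p k r = hermitePiece q k r := by
    intro k hk hkK r hr
    have h0 : 0 ≤ halfNode K k := le_trans (by rw [halfNode_one]; positivity) (halfNode_mono hk)
    have h1 : halfNode K (k + 1) ≤ 1 := (halfNode_mono (by omega : k + 1 ≤ K)).trans (by
      have := one_sub_halfNode hKp
      have : (0 : ℝ) ≤ (2 * (K : ℝ))⁻¹ := by positivity
      linarith)
    have hae : (fun s : ℝ => hermitePiece p k (K * (s - halfNode K k)))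
        =ᵐ[volume.restrict (Ioo (halfNode K k) (halfNode K (k + 1)))]
        fun s : ℝ => hermitePiece q k (K * (s - halfNode K k)) := by
      filter_upwards [ae_restrict_of_ae_restrict_of_subset (Ioo_subset_Ioo h0 h1) h,
        ae_restrict_mem measurableSet_Ioo] with s hs hsm
      rw [← eta_eq_hermitePiece bc p hKp hk hkK hsm.1 hsm.2,
        ← eta_eq_hermitePiece bc q hKp hk hkK hsm.1 hsm.2, hs]
    have := Measure.eqOn_Ioo_of_ae_eq volume hae (hcont p k).continuousOn (hcont q k).continuousOn
      (x := halfNode K k + r / K) ⟨by have := hr.1; linarith [div_pos this hK0], by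
        have h3 := halfNode_succ_sub hKp k
        have : r / K < (K : ℝ)⁻¹ := by
          rw [div_eq_mul_inv]; exact mul_lt_of_lt_one_left (by positivity) hr.2
        linarith⟩
    simpa [mul_div_cancel₀ _ hK0.ne'] using this
  have hnode : ∀ k, 1 ≤ k → k ≤ K - 1 → node p (k - 1) = node q (k - 1) ∧ node p k = node q k ∧
      node p (k + 1) = node q (k + 1) := by
    intro k hk hkK
    have h1 := hpiece k hk hkK (1 / 4) (by norm_num)
    have h2 := hpiece k hk hkK (1 / 2) (by norm_num)
    have h3 := hpiece k hk hkK (3 / 4) (by norm_num)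
    simp only [hermitePiece] at h1 h2 h3
    refine ⟨?_, ?_, ?_⟩
    -- The coefficients solve the three evaluations at `1/4`, `1/2`, `3/4` for the nodes.
    · linear_combination (norm := module) (8 : ℝ) • h1 - (11 : ℝ) • h2 + (4 : ℝ) • h3
    · linear_combination (norm := module) (-2 : ℝ) • h1 + (5 : ℝ) • h2 - (2 : ℝ) • h3
    · linear_combination (norm := module) (4 : ℝ) • h1 - (11 : ℝ) • h2 + (8 : ℝ) • h3
  have hall : ∀ k ≤ K, node p k = node q k := by
    intro k hk
    rcases Nat.eq_zero_or_pos k with rfl | hk0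
    · simpa using (hnode 1 le_rfl (by omega)).1
    · rcases hk.eq_or_lt with rfl | hlt
      · have := (hnode (k - 1) (by omega) le_rfl).2.2
        rwa [Nat.sub_add_cancel hk0] at this
      · exact (hnode k hk0 (by omega)).2.1
  funext i
  have hi : (i : ℕ) ≤ K := Nat.lt_succ_iff.1 i.2
  have := hall i hi
  simpa [node, hi, Fin.ofNat_eq_cast] using this

end BoundaryCondition

end Interpolation

end RiemSpline

namespace RiemSpline

/-! ### Weak compactness and compact operators -/

section WeakCompactness

variable {H : Type*} [NormedAddCommGroup H] [InnerProductSpace ℝ H] [CompleteSpace H]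

/-- Bounded sequences in separable Hilbert spaces have weakly convergent subsequences. -/
theorem exists_subseq_weaklyConverges [TopologicalSpace.SeparableSpace H] {u : ℕ → H} {R : ℝ}
    (hu : ∀ n, ‖u n‖ ≤ R) :
    ∃ φ : ℕ → ℕ, StrictMono φ ∧ ∃ l, WeaklyConverges (fun n => u (φ n)) l := by
  -- The Riesz isometry turns the sequence into functionals, to which the sequential Banach-Alaoglu
  -- theorem applies.
  obtain ⟨a, -, φ, hφ, ha⟩ := WeakDual.isSeqCompact_closedBall ℝ H 0 R
    (x := fun n => StrongDual.toWeakDual (InnerProductSpace.toDual ℝ H (u n))) fun n => by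
      change InnerProductSpace.toDual ℝ H (u n) ∈ Metric.closedBall 0 R
      simpa using hu n
  refine ⟨φ, hφ, (InnerProductSpace.toDual ℝ H).symm (WeakDual.toStrongDual a), fun f => ?_⟩
  obtain ⟨z, rfl⟩ := (InnerProductSpace.toDual ℝ H).surjective f
  have h := ((WeakDual.eval_continuous z).tendsto a).comp ha
  have e : ∀ v : H, InnerProductSpace.toDual ℝ H z v = InnerProductSpace.toDual ℝ H v z :=
    fun v => by simp [real_inner_comm]
  rw [e, LinearIsometryEquiv.apply_symm_apply]
  simp only [e]
  exact h

omit [CompleteSpace H] in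
/-- Compact operators map bounded weakly convergent sequences to convergent ones. -/
theorem WeaklyConverges.tendsto_of_isCompactOperator {Y : Type*} [NormedAddCommGroup Y]
    [NormedSpace ℝ Y] {ι : H →L[ℝ] Y} (hι : IsCompactOperator ι) {u : ℕ → H} {l : H}
    (h : WeaklyConverges u l) {R : ℝ} (hR : ∀ n, ‖u n‖ ≤ R) :
    Tendsto (fun n => ι (u n)) atTop (𝓝 (ι l)) := by
  refine tendsto_of_subseq_tendsto fun ns hns => ?_
  have hc := hι.isCompact_closure_image_closedBall R
  obtain ⟨y, -, φ, hφ, hy⟩ := hc.tendsto_subseq (x := fun n => ι (u (ns n))) fun n =>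
    subset_closure ⟨u (ns n), by simpa using hR _, rfl⟩
  refine ⟨φ, ?_⟩
  -- The norm limit of the extracted images is also their weak limit, hence does not depend on the
  -- extraction.
  have hyl : y = ι l := by
    refine (SeparatingDual.eq_iff_forall_dual_eq (R := ℝ)).2 fun f => ?_
    have h1 := (f.continuous.tendsto y).comp hy
    have h2 := ((h.map ι) f).comp (hns.comp hφ.tendsto_atTop)
    exact tendsto_nhds_unique h1 h2
  rw [← hyl]
  exact hy

omit [CompleteSpace H] in
/-- Pairing of a weakly and a strongly convergent sequence. -/
theorem WeaklyConverges.tendsto_inner {u v : ℕ → H} {l l' : H} (h : WeaklyConverges u l) {R : ℝ}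
    (hR : ∀ n, ‖u n‖ ≤ R) (hv : Tendsto v atTop (𝓝 l')) :
    Tendsto (fun n => inner ℝ (v n) (u n)) atTop (𝓝 (inner ℝ l' l)) := by
  have h1 : Tendsto (fun n => inner ℝ l' (u n)) atTop (𝓝 (inner ℝ l' l)) := h (innerSL ℝ l')
  have h2 : Tendsto (fun n => inner ℝ (v n - l') (u n)) atTop (𝓝 0) := by
    have hz : Tendsto (fun n => ‖v n - l'‖ * R) atTop (𝓝 0) := by
      have := (tendsto_iff_norm_sub_tendsto_zero.1 hv).mul_const R
      rwa [zero_mul] at this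
    refine squeeze_zero_norm (fun n => ?_) hz
    exact (norm_inner_le_norm _ _).trans (by gcongr; exact hR n)
  have h3 := h2.add h1
  rw [zero_add] at h3
  refine h3.congr fun n => ?_
  rw [inner_sub_left]; ring

omit [CompleteSpace H] in
theorem weaklyConverges_of_tendsto {u : ℕ → H} {l : H} (h : Tendsto u atTop (𝓝 l)) :
    WeaklyConverges u l := fun f => (f.continuous.tendsto l).comp h

theorem weaklyConverges_of_inner {u : ℕ → H} {l : H}
    (h : ∀ z, Tendsto (fun n => inner ℝ z (u n)) atTop (𝓝 (inner ℝ z l))) :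
    WeaklyConverges u l := fun f => by
  obtain ⟨z, rfl⟩ := (InnerProductSpace.toDual ℝ H).surjective f
  exact h z

end WeakCompactness

/-! ### Quadratic functionals with converging coefficients -/

section L2Convergence

variable {V : Type*} [NormedAddCommGroup V] [InnerProductSpace ℝ V]

/-- Dominated convergence for the squared distance, with majorant `4 h²`. -/
theorem tendsto_toLp_of_ae_tendsto {f : ℕ → ℝ → V} {F : ℝ → V} (hf : ∀ n, MemLp (f n) 2 unitMeasure)
    (hF : MemLp F 2 unitMeasure) {h : ℝ → ℝ} (hh : MemLp h 2 unitMeasure)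
    (hb : ∀ n, ∀ᵐ s ∂unitMeasure, ‖f n s‖ ≤ h s)
    (hlim : ∀ᵐ s ∂unitMeasure, Tendsto (fun n => f n s) atTop (𝓝 (F s))) :
    Tendsto (fun n => (hf n).toLp (f n)) atTop (𝓝 (hF.toLp F)) := by
  rw [tendsto_iff_norm_sub_tendsto_zero]
  have hsq : ∀ n, ‖(hf n).toLp (f n) - hF.toLp F‖ ^ 2 = ∫ s, ‖f n s - F s‖ ^ 2 ∂unitMeasure := by
    intro n
    rw [L2_norm_sq]
    refine integral_congr_ae ?_
    filter_upwards [Lp.coeFn_sub ((hf n).toLp (f n)) (hF.toLp F), (hf n).coeFn_toLp,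
      hF.coeFn_toLp] with s h1 h2 h3
    rw [h1, Pi.sub_apply, h2, h3]
  have hFb : ∀ᵐ s ∂unitMeasure, ‖F s‖ ≤ h s := by
    filter_upwards [hlim, ae_all_iff.2 hb] with s h1 h2
    exact le_of_tendsto' h1.norm h2
  have hlim2 : Tendsto (fun n => ∫ s, ‖f n s - F s‖ ^ 2 ∂unitMeasure) atTop (𝓝 0) := by
    have := tendsto_integral_of_dominated_convergence (μ := unitMeasure)
      (F := fun n s => ‖f n s - F s‖ ^ 2) (f := fun _ => 0) (fun s => 4 * h s ^ 2)
      (fun n => (((hf n).sub hF).aestronglyMeasurable.norm.pow 2))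
      (hh.integrable_sq.const_mul 4) (fun n => ?_) ?_
    · simpa using this
    · filter_upwards [hb n, hFb] with s h1 h2
      have h3 : ‖f n s - F s‖ ≤ 2 * h s := (norm_sub_le _ _).trans (by linarith)
      rw [Real.norm_of_nonneg (by positivity)]
      have := pow_le_pow_left₀ (norm_nonneg _) h3 2
      linarith
    · filter_upwards [hlim] with s hs
      have := (tendsto_iff_norm_sub_tendsto_zero.1 hs).pow 2
      simpa using this
  have h3 : Tendsto (fun n => √(‖(hf n).toLp (f n) - hF.toLp F‖ ^ 2)) atTop (𝓝 0) := by
    simp only [hsq]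
    have := (Real.continuous_sqrt.tendsto 0).comp hlim2
    rwa [Real.sqrt_zero] at this
  simpa only [Real.sqrt_sq (norm_nonneg _)] using h3

variable [CompleteSpace V] {Y : Type*} [NormedAddCommGroup Y] [NormedSpace ℝ Y]
  {ι : V →L[ℝ] Y} {gc : Y → Y →L[ℝ] Y →L[ℝ] ℝ} {Q : V →L[ℝ] V →L[ℝ] ℝ}

variable (ι gc Q) in
/-- The vector representing `g_y(v, ·)`. -/
noncomputable def metricRiesz (y : Y) (v : V) : V :=
  (InnerProductSpace.toDual ℝ V).symm (metricForm ι gc Q y v)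

theorem inner_metricRiesz (y : Y) (v z : V) :
    inner ℝ (metricRiesz ι gc Q y v) z = metric ι gc Q y v z :=
  InnerProductSpace.toDual_symm_apply

namespace IsAdmissibleMetric

variable (hg : IsAdmissibleMetric ι gc Q)
include hg

theorem continuous_metricRiesz : Continuous fun q : Y × V => metricRiesz ι gc Q q.1 q.2 :=
  (InnerProductSpace.toDual ℝ V).symm.continuous.comp
    (((continuous_metricForm hg.diff.continuous).comp continuous_fst).clm_apply continuous_snd)

attribute [irreducible] metricRiesz

theorem exists_norm_metricRiesz_le :
    ∃ Λ : ℝ, 0 < Λ ∧ ∀ y v, ‖metricRiesz ι gc Q y v‖ ≤ Λ * ‖v‖ := by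
  obtain ⟨c, Λ, L, hc, hΛ, hL, hcoer, hup, -⟩ := hg.exists_bounds
  refine ⟨Λ, hΛ, fun y v => ?_⟩
  have h := hup y v (metricRiesz ι gc Q y v)
  rw [← inner_metricRiesz, real_inner_self_eq_norm_sq, abs_of_nonneg (sq_nonneg _)] at h
  rcases (norm_nonneg (metricRiesz ι gc Q y v)).eq_or_lt with h0 | h0
  · rw [← h0]; positivity
  · nlinarith

omit [CompleteSpace V] in
theorem continuous_metric_coe :
    Continuous fun q : V × V × V => metric ι gc Q (ι q.1) q.2.1 q.2.2 :=
  hg.continuous_metric (ι.continuous.comp continuous_fst)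
    (continuous_fst.comp continuous_snd) (continuous_snd.comp continuous_snd)

omit [CompleteSpace V] in
theorem integrable_metric {y u v : ℝ → V} (hy : AEStronglyMeasurable y unitMeasure)
    (hu : MemLp u 2 unitMeasure) (hv : MemLp v 2 unitMeasure) :
    Integrable (fun s => metric ι gc Q (ι (y s)) (u s) (v s)) unitMeasure := by
  obtain ⟨c, Λ, L, hc, hΛ, hL, hcoer, hup, -⟩ := hg.exists_bounds
  have hdom : Integrable (fun s => Λ * (‖u s‖ * ‖v s‖)) unitMeasure :=
    (hu.norm.integrable_mul hv.norm).const_mul Λ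
  refine hdom.mono' ?_ (Eventually.of_forall fun s => ?_)
  · exact hg.continuous_metric_coe.comp_aestronglyMeasurable
      (hy.prodMk (hu.aestronglyMeasurable.prodMk hv.aestronglyMeasurable))
  · rw [Real.norm_eq_abs, ← mul_assoc]; exact hup _ _ _

theorem aestronglyMeasurable_metricRiesz {y v : ℝ → V} {μ : Measure ℝ}
    (hy : AEStronglyMeasurable y μ) (hv : AEStronglyMeasurable v μ) :
    AEStronglyMeasurable (fun s => metricRiesz ι gc Q (ι (y s)) (v s)) μ := by
  have h1 : Continuous fun q : V × V => (ι q.1, q.2) :=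
    (ι.continuous.comp continuous_fst).prodMk continuous_snd
  exact (hg.continuous_metricRiesz.comp h1).comp_aestronglyMeasurable (hy.prodMk hv)

theorem memLp_metricRiesz {y v : ℝ → V} (hy : AEStronglyMeasurable y unitMeasure)
    (hv : MemLp v 2 unitMeasure) :
    MemLp (fun s => metricRiesz ι gc Q (ι (y s)) (v s)) 2 unitMeasure := by
  obtain ⟨Λ, hΛ, hJn⟩ := hg.exists_norm_metricRiesz_le
  refine (hv.norm.const_mul Λ).mono (hg.aestronglyMeasurable_metricRiesz hy
    hv.aestronglyMeasurable) (Eventually.of_forall fun s => ?_)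
  rw [Real.norm_of_nonneg (by positivity)]
  exact hJn (ι (y s)) (v s)

omit hg in
theorem inner_toLp_metricRiesz {y v h : ℝ → V}
    (hG : MemLp (fun s => metricRiesz ι gc Q (ι (y s)) (v s)) 2 unitMeasure) {u : L2 V}
    (hu : u =ᵐ[unitMeasure] h) :
    inner ℝ (hG.toLp _) u = ∫ s, metric ι gc Q (ι (y s)) (v s) (h s) ∂unitMeasure := by
  rw [L2.inner_def]
  refine integral_congr_ae ?_
  filter_upwards [hG.coeFn_toLp, hu] with s h1 h2
  rw [h1, h2, inner_metricRiesz]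

omit [CompleteSpace V] in
-- A convex quadratic functional lies above its tangent at `v`. The tangent is affine in `u` and
-- therefore behaves well under weak convergence.
theorem two_mul_integral_metric_sub_le {y u v : ℝ → V} (hy : AEStronglyMeasurable y unitMeasure)
    (hu : MemLp u 2 unitMeasure) (hv : MemLp v 2 unitMeasure) :
    2 * ∫ s, metric ι gc Q (ι (y s)) (v s) (u s) ∂unitMeasure
      - ∫ s, metric ι gc Q (ι (y s)) (v s) (v s) ∂unitMeasure ≤
      ∫ s, metric ι gc Q (ι (y s)) (u s) (u s) ∂unitMeasure := by
  rw [← integral_const_mul, ← integral_sub ((hg.integrable_metric hy hv hu).const_mul 2)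
    (hg.integrable_metric hy hv hv)]
  refine integral_mono (((hg.integrable_metric hy hv hu).const_mul 2).sub
    (hg.integrable_metric hy hv hv)) (hg.integrable_metric hy hu hu) fun s => ?_
  have := hg.two_mul_metric_sub_le (ι (y s)) (u s) (v s)
  have hs := hg.metric_comm (ι (y s)) (u s) (v s)
  simp only
  linarith

/-- Weak lower semicontinuity of the quadratic functional with strongly converging coefficients. -/
theorem eventually_integral_metric_le
    {f : ℕ → ℝ → V} (hf : ∀ n, MemLp (f n) 2 unitMeasure) {F : L2 V}
    (hw : WeaklyConverges (fun n => (hf n).toLp (f n)) F) {R : ℝ}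
    (hR : ∀ n, ‖(hf n).toLp (f n)‖ ≤ R) {y : ℕ → ℝ → V} {y₀ : ℝ → V}
    (hy : ∀ n, AEStronglyMeasurable (y n) unitMeasure) (hy₀ : AEStronglyMeasurable y₀ unitMeasure)
    (hlim : ∀ᵐ s ∂unitMeasure, Tendsto (fun n => ι (y n s)) atTop (𝓝 (ι (y₀ s)))) {ε : ℝ}
    (hε : 0 < ε) :
    ∀ᶠ n in atTop, ∫ s, metric ι gc Q (ι (y₀ s)) (F s) (F s) ∂unitMeasure ≤
      ∫ s, metric ι gc Q (ι (y n s)) (f n s) (f n s) ∂unitMeasure + ε := by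
  obtain ⟨Λ, hΛ, hJn⟩ := hg.exists_norm_metricRiesz_le
  have hdom : MemLp (fun s => Λ * ‖F s‖) 2 unitMeasure := (Lp.memLp F).norm.const_mul Λ
  have hG : ∀ n, MemLp (fun s => metricRiesz ι gc Q (ι (y n s)) (F s)) 2 unitMeasure :=
    fun n => hg.memLp_metricRiesz (hy n) (Lp.memLp F)
  have hG₀ : MemLp (fun s => metricRiesz ι gc Q (ι (y₀ s)) (F s)) 2 unitMeasure :=
    hg.memLp_metricRiesz hy₀ (Lp.memLp F)
  -- With `F` fixed and only the base point moving, the vectors representing the metric converge in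
  -- norm; their pairings with the weakly convergent `f n` then converge.
  have hGlim : Tendsto (fun n => (hG n).toLp _) atTop (𝓝 (hG₀.toLp _)) := by
    refine tendsto_toLp_of_ae_tendsto hG hG₀ hdom
      (fun n => Eventually.of_forall fun s => hJn (ι (y n s)) (F s)) ?_
    filter_upwards [hlim] with s hs
    have h1 : Tendsto (fun n => (ι (y n s), F s)) atTop (𝓝 (ι (y₀ s), F s)) :=
      hs.prodMk_nhds tendsto_const_nhds
    exact (hg.continuous_metricRiesz.tendsto (ι (y₀ s), F s)).comp h1
  have l1 := hw.tendsto_inner hR hGlim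
  have l2 : Tendsto (fun n => inner ℝ ((hG n).toLp _) F) atTop
      (𝓝 (inner ℝ (hG₀.toLp _) F)) := hGlim.inner tendsto_const_nhds
  have l3 := (l1.const_mul 2).sub l2
  rw [inner_toLp_metricRiesz hG₀ (Filter.EventuallyEq.refl _ (F : ℝ → V))] at l3
  have hlt := l3.eventually (lt_mem_nhds (a := ∫ s, metric ι gc Q (ι (y₀ s)) (F s) (F s)
    ∂unitMeasure - ε) (by linarith))
  filter_upwards [hlt] with n hn
  rw [inner_toLp_metricRiesz (hG n) (hf n).coeFn_toLp,
    inner_toLp_metricRiesz (hG n) (Filter.EventuallyEq.refl _ (F : ℝ → V))] at hn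
  have := hg.two_mul_integral_metric_sub_le (hy n) (hf n) (Lp.memLp F)
  linarith

end IsAdmissibleMetric

end L2Convergence

end RiemSpline

namespace RiemSpline

/-! ### Step functions on the grid cells -/

section GridFloor

theorem measurable_floor_mul (K : ℕ) : Measurable fun s : ℝ => ⌊(K : ℝ) * s⌋₊ :=
  Nat.measurable_floor.comp (measurable_id.const_mul _)

theorem floor_mul_lt {K : ℕ} (hK : 0 < K) {s : ℝ} (hs1 : s < 1) : ⌊(K : ℝ) * s⌋₊ < K := by
  have hK0 : (0 : ℝ) < K := by exact_mod_cast hK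
  rw [Nat.floor_lt' hK.ne']
  nlinarith

theorem memLp_comp_floor {E : Type*} [NormedAddCommGroup E] {K : ℕ} (hK : 0 < K) (f : ℕ → E) :
    MemLp (fun s => f ⌊(K : ℝ) * s⌋₊) 2 unitMeasure := by
  refine MemLp.of_bound (StronglyMeasurable.of_discrete (f := f).comp_measurable
    (measurable_floor_mul K)).aestronglyMeasurable (∑ k ∈ Finset.range K, ‖f k‖) ?_
  filter_upwards [ae_restrict_mem measurableSet_Ioo] with s hs
  exact Finset.single_le_sum (f := fun k => ‖f k‖) (fun _ _ => norm_nonneg _)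
    (Finset.mem_range.2 (floor_mul_lt hK hs.2))

theorem integral_comp_floor {K : ℕ} (hK : 0 < K) (f : ℕ → ℝ) :
    ∫ s, f ⌊(K : ℝ) * s⌋₊ ∂unitMeasure = (K : ℝ)⁻¹ * ∑ k ∈ Finset.range K, f k := by
  have hK0 : (0 : ℝ) < K := by exact_mod_cast hK
  have p : ∀ k < K, IntervalIntegrable (fun s => f ⌊(K : ℝ) * s⌋₊) volume ((k : ℝ) / K)
      (((k + 1 : ℕ) : ℝ) / K) ∧ ∫ s in ((k : ℝ) / K)..(((k + 1 : ℕ) : ℝ) / K), f ⌊(K : ℝ) * s⌋₊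
        = (((k + 1 : ℕ) : ℝ) / K - (k : ℝ) / K) • f k := fun k hk =>
    integral_of_eqOn_Ioo (by gcongr; omega) fun s hs => by
      have h1 := (div_lt_iff₀ hK0).1 hs.1
      have h2 := (lt_div_iff₀ hK0).1 hs.2
      push_cast at h2
      congr 1
      rw [Nat.floor_eq_iff (by nlinarith [(Nat.cast_nonneg k : (0 : ℝ) ≤ k)])]
      constructor <;> linarith
  have h := intervalIntegral.sum_integral_adjacent_intervals (a := fun k : ℕ => (k : ℝ) / K)
    (n := K) (fun k hk => (p k hk).1)
  simp only [Nat.cast_zero, zero_div, div_self hK0.ne'] at h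
  rw [integral_unit_eq, ← h, Finset.mul_sum]
  refine Finset.sum_congr rfl fun k hk => ?_
  rw [(p k (Finset.mem_range.1 hk)).2, smul_eq_mul]
  congr 1
  push_cast
  field_simp
  ring

end GridFloor

/-! ### Distance between the interpolating curve and its nodes -/

section Estimates

variable {V : Type*} [NormedAddCommGroup V] [InnerProductSpace ℝ V] [CompleteSpace V]
  {bc : BoundaryCondition V} {K : ℕ} {p : Fin (K + 1) → V} {M : ℝ}

omit [CompleteSpace V] in
theorem BoundaryCondition.integral_norm_sq_etaAcc (bc : BoundaryCondition V)
    (p : Fin (K + 1) → V) (hK : 0 < K) :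
    ∫ s, ‖bc.etaAcc p s‖ ^ 2 ∂unitMeasure =
      (K : ℝ)⁻¹ * ∑ k ∈ Finset.Icc 1 (bc.numMid K), ‖accNode p k‖ ^ 2 := by
  rw [← bc.integral_extendMid hK (fun k => ‖accNode p k‖ ^ 2)]
  refine setIntegral_congr_fun measurableSet_Ioo fun s hs => ?_
  simp only [BoundaryCondition.etaAcc]
  have hle : midIndex K s ≤ K := midIndex_le hs.2.le
  generalize midIndex K s = k at hle
  cases bc <;> simp only [BoundaryCondition.extendMid] <;> split_ifs <;> simp

namespace IsBoundedDiscrete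

omit [CompleteSpace V] in
theorem nonneg (hK : 0 < K) (hb : IsBoundedDiscrete bc M p) : 0 ≤ M :=
  (norm_nonneg _).trans (hb.vel_le 1 (Finset.mem_Icc.2 ⟨le_rfl, hK⟩))

omit [CompleteSpace V] in
-- One summand of a sum bounded by `K M` is at most `K M = (√(M/K) K)²`.
theorem norm_extendMid_accNode_le (hK : 0 < K) (hb : IsBoundedDiscrete bc M p) {k : ℕ}
    (hk : k ≤ K) : ‖bc.extendMid K (accNode p) k‖ ≤ √(M / K) * K := by
  have hK0 : (0 : ℝ) < K := by exact_mod_cast hK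
  rcases bc.extendMid_cases (E := V) hK hk with h | ⟨j, hj, -, h⟩
  · rw [h, norm_zero]; positivity
  · rw [h]
    have h1 := hb.acc_le
    rw [inv_mul_le_iff₀ hK0] at h1
    have h2 : ‖accNode p j‖ ^ 2 ≤ (√(M / K) * K) ^ 2 := by
      rw [mul_pow, Real.sq_sqrt (div_nonneg (hb.nonneg hK) hK0.le)]
      refine (Finset.single_le_sum (f := fun k => ‖accNode p k‖ ^ 2)
        (fun _ _ => sq_nonneg _) hj).trans (h1.trans_eq ?_)
      field_simp
    exact (pow_le_pow_iff_left₀ (norm_nonneg _) (by positivity) two_ne_zero).1 h2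

omit [CompleteSpace V] in
theorem norm_smul_extendMid_le (hK : 0 < K) (hb : IsBoundedDiscrete bc M p) {k : ℕ}
    (hk : k ≤ K) {r : ℝ} (hr : |r| ≤ (K : ℝ)⁻¹) :
    ‖r • bc.extendMid K (accNode p) k‖ ≤ √(M / K) := by
  have hK0 : (0 : ℝ) < K := by exact_mod_cast hK
  rw [norm_smul, Real.norm_eq_abs]
  calc |r| * _ ≤ (K : ℝ)⁻¹ * (√(M / K) * K) := by
        gcongr; exact hb.norm_extendMid_accNode_le hK hk
    _ = √(M / K) := by field_simp

/-- On the `k`-th cell the velocity is affine with value `v_k` at the left and `v_{k+1}` at the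
right end, and over a time `1/K` it changes by at most `√(M/K)`. The side conditions exclude the
missing end of a boundary half cell. -/
theorem norm_etaVel_sub_velNode_le (hK : 0 < K) (hp : bc.HoldsDiscrete p)
    (hb : IsBoundedDiscrete bc M p) {s : ℝ} (h0 : 0 ≤ s) (h1 : s ≤ 1) :
    (1 ≤ midIndex K s → ‖bc.etaVel p s - velNode p (midIndex K s)‖ ≤ √(M / K)) ∧
    (midIndex K s + 1 ≤ K → ‖bc.etaVel p s - velNode p (midIndex K s + 1)‖ ≤ √(M / K)) := by
  obtain ⟨l1, l2⟩ := halfNode_midIndex hK h0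
  have hle : midIndex K s ≤ K := midIndex_le h1
  generalize midIndex K s = k at l1 l2 hle
  have hd := halfNode_succ_sub hK k
  constructor
  · intro hk
    rw [(BoundaryCondition.eta_piece hK hp hk hle l1 l2.le h1).1, add_sub_cancel_left]
    refine hb.norm_smul_extendMid_le hK hle ?_
    rw [abs_of_nonneg (by linarith)]; linarith
  · intro hk
    have e : bc.etaVel p s = velNode p (k + 1)
        + (s - halfNode K (k + 1)) • bc.extendMid K (accNode p) k := by
      rcases Nat.eq_zero_or_pos k with rfl | hk0
      · exact (BoundaryCondition.eta_first hK hp h0 l2.le).1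
      · have hlast : halfNode K (k + 1) ≤ 1 := (halfNode_mono hk).trans (by
          have := one_sub_halfNode hK
          have : (0 : ℝ) ≤ (2 * (K : ℝ))⁻¹ := by positivity
          linarith)
        have e1 := (BoundaryCondition.eta_piece hK hp hk0 hle l1 l2.le h1).1
        have e2 := (BoundaryCondition.eta_piece hK hp hk0 hle (l1.trans l2.le) le_rfl hlast).1
        rw [(BoundaryCondition.eta_halfNode hK hp (Nat.le_add_left 1 k) hk).1] at e2
        rw [e1, e2]
        module
    rw [e, add_sub_cancel_left]
    refine hb.norm_smul_extendMid_le hK hle ?_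
    rw [abs_le]; constructor <;> linarith

theorem norm_etaVel_le (hK : 0 < K) (hp : bc.HoldsDiscrete p)
    (hb : IsBoundedDiscrete bc M p) {s : ℝ} (h0 : 0 ≤ s) (h1 : s ≤ 1) :
    ‖bc.etaVel p s‖ ≤ M + √(M / K) := by
  have h := hb.norm_etaVel_sub_velNode_le hK hp h0 h1
  have hle : midIndex K s ≤ K := midIndex_le h1
  generalize midIndex K s = k at h hle
  rcases Nat.eq_zero_or_pos k with rfl | hk
  · have h3 := hb.vel_le (0 + 1) (Finset.mem_Icc.2 ⟨le_rfl, hK⟩)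
    have h2 := norm_le_norm_add_norm_sub' (bc.etaVel p s) (velNode p (0 + 1))
    linarith [h.2 hK]
  · have h3 := hb.vel_le k (Finset.mem_Icc.2 ⟨hk, hle⟩)
    have h2 := norm_le_norm_add_norm_sub' (bc.etaVel p s) (velNode p k)
    linarith [h.1 hk]

theorem norm_etaPos_sub_le (hK : 0 < K) (hp : bc.HoldsDiscrete p)
    (hb : IsBoundedDiscrete bc M p) {s t : ℝ} (hs : s ∈ Icc (0 : ℝ) 1) (ht : t ∈ Icc (0 : ℝ) 1) :
    ‖bc.etaPos p t - bc.etaPos p s‖ ≤ (M + √(M / K)) * |t - s| := by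
  rw [BoundaryCondition.etaPos, curvePos_sub _ _ (bc.integrable_etaAcc p)]
  refine intervalIntegral.norm_integral_le_of_norm_le_const fun r hr => ?_
  have hr' := uIoc_subset_uIcc hr
  have := uIcc_subset_Icc hs ht hr'
  exact hb.norm_etaVel_le hK hp this.1 this.2

/-- At a half node the curve passes through the mean of two neighbouring nodes; to this half step
the motion within one cell is added. -/
theorem norm_etaPos_sub_node_le (hK : 0 < K) (hp : bc.HoldsDiscrete p)
    (hb : IsBoundedDiscrete bc M p) {s : ℝ} (h0 : 0 ≤ s) (h1 : s ≤ 1) :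
    ‖bc.etaPos p s - node p (midIndex K s)‖ ≤ (2 * M + √(M / K)) / K := by
  have hK0 : (0 : ℝ) < K := by exact_mod_cast hK
  have hM := hb.nonneg hK
  obtain ⟨l1, l2⟩ := halfNode_midIndex hK h0
  have hle : midIndex K s ≤ K := midIndex_le h1
  generalize midIndex K s = k at l1 l2 hle
  have hd := halfNode_succ_sub hK k
  -- In the first half cell the nearest half node inside the interval is `t^{1/2}`, so `j = 1`
  -- although the node in question is `y_0`.
  obtain ⟨j, hj1, hjK, hjk, hjs⟩ : ∃ j, 1 ≤ j ∧ j ≤ K ∧ (j = k ∨ j - 1 = k) ∧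
      |s - halfNode K j| ≤ (K : ℝ)⁻¹ := by
    rcases Nat.eq_zero_or_pos k with rfl | hk
    · refine ⟨1, le_rfl, hK, Or.inr rfl, ?_⟩
      rw [zero_add] at l2 hd
      rw [abs_le]; constructor <;> linarith
    · refine ⟨k, hk, hle, Or.inl rfl, ?_⟩
      rw [abs_le]; constructor <;> linarith
  have hjm : halfNode K j ∈ Icc (0 : ℝ) 1 := by
    constructor
    · exact le_trans (by rw [halfNode_one]; positivity) (halfNode_mono hj1)
    · have := one_sub_halfNode hK
      have : (0 : ℝ) ≤ (2 * (K : ℝ))⁻¹ := by positivity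
      linarith [halfNode_mono (K := K) hjK]
  have e1 := hb.norm_etaPos_sub_le hK hp hjm ⟨h0, h1⟩
  have e2 : ‖bc.etaPos p (halfNode K j) - node p k‖ ≤ M / K := by
    rw [(BoundaryCondition.eta_halfNode hK hp hj1 hjK).2]
    have hv := hb.vel_le j (Finset.mem_Icc.2 ⟨hj1, hjK⟩)
    have hd := IsAdmissibleEnergy.norm_sub_eq_norm_velNode_div hK p j
    have hhalf : ‖(1 / 2 : ℝ) • (node p (j - 1) + node p j) - node p k‖
        = (1 / 2) * ‖node p j - node p (j - 1)‖ := by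
      rcases hjk with rfl | rfl
      · rw [norm_sub_rev (node p j), ← Real.norm_of_nonneg (by norm_num : (0 : ℝ) ≤ 1 / 2),
          ← norm_smul, Real.norm_of_nonneg (by norm_num)]
        congr 1
        module
      · rw [← Real.norm_of_nonneg (by norm_num : (0 : ℝ) ≤ 1 / 2),
          ← norm_smul, Real.norm_of_nonneg (by norm_num)]
        congr 1
        module
    rw [hhalf, hd]
    have : ‖velNode p j‖ / K ≤ M / K := by gcongr
    have : 0 ≤ ‖velNode p j‖ / K := by positivity
    linarith
  have e3 : (M + √(M / K)) * |s - halfNode K j| ≤ (M + √(M / K)) * (K : ℝ)⁻¹ := by gcongr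
  have e4 := norm_add_le (bc.etaPos p s - bc.etaPos p (halfNode K j))
    (bc.etaPos p (halfNode K j) - node p k)
  rw [sub_add_sub_cancel] at e4
  have : (2 * M + √(M / K)) / K = (M + √(M / K)) * (K : ℝ)⁻¹ + M / K := by ring
  linarith

/-- The path energy lives on the cells between nodes, the spline energy on the cells around nodes;
the two indexings differ by at most one. -/
theorem floor_mul_eq_or {K : ℕ} (hK : 0 < K) {s : ℝ} (h0 : 0 ≤ s) :
    ⌊(K : ℝ) * s⌋₊ = midIndex K s ∨ (1 ≤ midIndex K s ∧ ⌊(K : ℝ) * s⌋₊ = midIndex K s - 1) := by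
  have hK0 : (0 : ℝ) < K := by exact_mod_cast hK
  have hKs : 0 ≤ (K : ℝ) * s := by positivity
  have h1 := Nat.floor_le hKs
  have h2 := Nat.lt_floor_add_one ((K : ℝ) * s)
  have h3 := Nat.floor_le (show 0 ≤ (K : ℝ) * s + 1 / 2 by positivity)
  have h4 := Nat.lt_floor_add_one ((K : ℝ) * s + 1 / 2)
  rw [← midIndex] at h3 h4
  generalize ⌊(K : ℝ) * s⌋₊ = i at *
  generalize midIndex K s = k at *
  have a1 : (i : ℝ) < k + 1 := by linarith
  have a2 : (k : ℝ) < i + 2 := by linarith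
  have b1 : i < k + 1 := by exact_mod_cast a1
  have b2 : k < i + 2 := by exact_mod_cast a2
  omega

theorem norm_etaVel_sub_velNode_floor_le (hK : 0 < K) (hp : bc.HoldsDiscrete p)
    (hb : IsBoundedDiscrete bc M p) {s : ℝ} (h0 : 0 ≤ s) (h1 : s < 1) :
    ‖bc.etaVel p s - velNode p (⌊(K : ℝ) * s⌋₊ + 1)‖ ≤ √(M / K) := by
  have h := hb.norm_etaVel_sub_velNode_le hK hp h0 h1.le
  have hlt := floor_mul_lt hK h1
  rcases floor_mul_eq_or hK h0 with e | ⟨e1, e⟩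
  · rw [e] at hlt ⊢
    exact h.2 hlt
  · rw [e, Nat.sub_add_cancel e1]
    exact h.1 e1

theorem norm_etaPos_sub_node_floor_le (hK : 0 < K) (hp : bc.HoldsDiscrete p)
    (hb : IsBoundedDiscrete bc M p) {s : ℝ} (h0 : 0 ≤ s) (h1 : s < 1) :
    ‖bc.etaPos p s - node p ⌊(K : ℝ) * s⌋₊‖ ≤ (3 * M + √(M / K)) / K := by
  have hK0 : (0 : ℝ) < K := by exact_mod_cast hK
  have hM := hb.nonneg hK
  have h := hb.norm_etaPos_sub_node_le hK hp h0 h1.le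
  have e0 : (3 * M + √(M / K)) / K = (2 * M + √(M / K)) / K + M / K := by ring
  have hMK : 0 ≤ M / K := by positivity
  rcases floor_mul_eq_or hK h0 with e | ⟨e1, e⟩
  · rw [e, e0]; linarith
  · have hv := hb.vel_le (midIndex K s) (Finset.mem_Icc.2 ⟨e1, midIndex_le h1.le⟩)
    have hd := IsAdmissibleEnergy.norm_sub_eq_norm_velNode_div hK p (midIndex K s)
    have e4 := norm_add_le (bc.etaPos p s - node p (midIndex K s))
      (node p (midIndex K s) - node p (midIndex K s - 1))
    rw [sub_add_sub_cancel, hd] at e4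
    have : ‖velNode p (midIndex K s)‖ / K ≤ M / K := by gcongr
    rw [e, e0]
    linarith

theorem norm_etaPos_div_sub_node_le (hK : 0 < K) (hp : bc.HoldsDiscrete p)
    (hb : IsBoundedDiscrete bc M p) {k : ℕ} (hk : k ≤ K) :
    ‖bc.etaPos p (k / K) - node p k‖ ≤ (2 * M + √(M / K)) / K := by
  have hK0 : (0 : ℝ) < K := by exact_mod_cast hK
  have h := hb.norm_etaPos_sub_node_le hK hp (s := k / K) (by positivity)
    ((div_le_one hK0).2 (by exact_mod_cast hk))
  have e : midIndex K ((k : ℝ) / K) = k := by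
    rw [midIndex, mul_div_cancel₀ _ hK0.ne', Nat.floor_eq_iff (by positivity)]
    constructor <;> linarith
  rwa [e] at h

omit [CompleteSpace V] in
theorem integral_norm_sq_etaAcc_le (hK : 0 < K) (hb : IsBoundedDiscrete bc M p) :
    ∫ s, ‖bc.etaAcc p s‖ ^ 2 ∂unitMeasure ≤ M :=
  (bc.integral_norm_sq_etaAcc p hK).trans_le hb.acc_le

end IsBoundedDiscrete

/-- Initial position, initial velocity and second derivative of the interpolating curve. -/
noncomputable def BoundaryCondition.etaData (bc : BoundaryCondition V) (p : Fin (K + 1) → V) :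
    V × V × L2 V :=
  (bc.etaInit p, bc.etaVelInit p, (bc.memLp_etaAcc p).toLp _)

omit [CompleteSpace V] in
theorem BoundaryCondition.curvePos_etaData (bc : BoundaryCondition V) (p : Fin (K + 1) → V) :
    curvePos (bc.etaData p).1 (bc.etaData p).2.1 (bc.etaData p).2.2 = bc.etaPos p :=
  curvePos_congr _ _ (bc.memLp_etaAcc p).coeFn_toLp

omit [CompleteSpace V] in
theorem BoundaryCondition.curveVel_etaData (bc : BoundaryCondition V) (p : Fin (K + 1) → V) :
    curveVel (bc.etaData p).2.1 (bc.etaData p).2.2 = bc.etaVel p :=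
  curveVel_congr _ (bc.memLp_etaAcc p).coeFn_toLp

theorem BoundaryCondition.pos_sobolevOf_etaData (hK : 0 < K) (hp : bc.HoldsDiscrete p) :
    pos (sobolevOf (bc.etaData p)) =ᵐ[unitMeasure] bc.eta p := by
  have h := pos_sobolevOf (bc.etaData p)
  rw [bc.curvePos_etaData] at h
  exact h.trans (BoundaryCondition.eta_eq_etaPos hK hp).symm

theorem BoundaryCondition.eq_sobolevOf_etaData (hK : 0 < K) (hp : bc.HoldsDiscrete p)
    {u : W22 V} (hu : pos u =ᵐ[unitMeasure] bc.eta p) : u = sobolevOf (bc.etaData p) :=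
  W22_ext_pos (Lp.ext (hu.trans (BoundaryCondition.pos_sobolevOf_etaData hK hp).symm))

theorem IsBoundedDiscrete.norm_etaData_le (hK : 0 < K) (hp : bc.HoldsDiscrete p)
    (hb : IsBoundedDiscrete bc M p) :
    ‖(bc.etaData p).1‖ ≤ 3 * M + √M ∧ ‖(bc.etaData p).2.1‖ ≤ 3 * M + √M ∧
      ‖(bc.etaData p).2.2‖ ≤ 3 * M + √M := by
  have hK0 : (0 : ℝ) < K := by exact_mod_cast hK
  have hK1 : (1 : ℝ) ≤ K := by exact_mod_cast hK
  have hM := hb.nonneg hK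
  have hr : √(M / K) ≤ √M := Real.sqrt_le_sqrt (div_le_self hM hK1)
  refine ⟨?_, ?_, ?_⟩
  · have h := hb.norm_etaPos_sub_node_le hK hp le_rfl zero_le_one
    have h2 := hb.node_le (midIndex K 0) (midIndex_le zero_le_one)
    have h3 := norm_le_norm_add_norm_sub' (bc.etaPos p 0) (node p (midIndex K 0))
    have h4 : (2 * M + √(M / K)) / K ≤ 2 * M + √(M / K) := div_le_self (by positivity) hK1
    have h5 : (bc.etaData p).1 = bc.etaPos p 0 := by
      rw [BoundaryCondition.etaPos, curvePos_zero]; rfl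
    rw [h5]
    linarith
  · have h := hb.norm_etaVel_le hK hp le_rfl zero_le_one
    have h5 : (bc.etaData p).2.1 = bc.etaVel p 0 := by
      rw [BoundaryCondition.etaVel, curveVel_zero]; rfl
    rw [h5]
    linarith
  · have h := hb.integral_norm_sq_etaAcc_le hK
    have h1 : ‖(bc.etaData p).2.2‖ ^ 2 ≤ M := by
      rw [L2_norm_sq]
      refine le_trans (le_of_eq (integral_congr_ae ?_)) h
      filter_upwards [(bc.memLp_etaAcc p).coeFn_toLp] with s hs
      simp only [BoundaryCondition.etaData, hs]
    have := Real.le_sqrt_of_sq_le h1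
    linarith

end Estimates

end RiemSpline

namespace RiemSpline

/-! ### Weak limits of bounded sequences of discrete curves -/

section Limits

theorem WeaklyConverges.unique {E : Type*} [NormedAddCommGroup E] [NormedSpace ℝ E] {u : ℕ → E}
    {l l' : E} (h : WeaklyConverges u l) (h' : WeaklyConverges u l') : l = l' :=
  (SeparatingDual.eq_iff_forall_dual_eq (R := ℝ)).2 fun f => tendsto_nhds_unique (h f) (h' f)

theorem WeaklyConverges.congr_dist {E : Type*} [NormedAddCommGroup E] [NormedSpace ℝ E]
    {u v : ℕ → E} {l : E} (h : WeaklyConverges u l)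
    (h' : Tendsto (fun n => ‖u n - v n‖) atTop (𝓝 0)) : WeaklyConverges v l := fun f => by
  have h1 := (f.continuous.tendsto 0).comp (tendsto_zero_iff_norm_tendsto_zero.2 h')
  have h2 := (h f).sub h1
  rw [map_zero, sub_zero] at h2
  refine h2.congr fun n => ?_
  simp

variable {V : Type*} [NormedAddCommGroup V] [InnerProductSpace ℝ V] [CompleteSpace V]

/-- Discrete curves with step numbers tending to infinity, satisfying the boundary conditions and
a uniform discrete `W^{2,2}` bound. -/
structure IsBoundedSequence (bc : BoundaryCondition V) (M : ℝ) (K : ℕ → ℕ)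
    (p : ∀ n, Fin (K n + 1) → V) : Prop where
  tendsto : Tendsto K atTop atTop
  pos : ∀ n, 0 < K n
  holds : ∀ n, bc.HoldsDiscrete (p n)
  bdd : ∀ n, IsBoundedDiscrete bc M (p n)

namespace IsBoundedSequence

variable {bc : BoundaryCondition V} {M : ℝ} {K : ℕ → ℕ} {p : ∀ n, Fin (K n + 1) → V}

omit [CompleteSpace V] in
theorem comp (h : IsBoundedSequence bc M K p) {φ : ℕ → ℕ} (hφ : StrictMono φ) :
    IsBoundedSequence bc M (fun n => K (φ n)) (fun n => p (φ n)) :=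
  ⟨h.tendsto.comp hφ.tendsto_atTop, fun _ => h.pos _, fun _ => h.holds _, fun _ => h.bdd _⟩

/-- Three successive extractions, one for each component of the data; the `L²` space inherits
separability from `V`. -/
theorem exists_subseq [TopologicalSpace.SeparableSpace V] (h : IsBoundedSequence bc M K p) :
    ∃ φ : ℕ → ℕ, StrictMono φ ∧ ∃ x, WeaklyConverges (fun n => bc.etaData (p (φ n))) x := by
  have hb := fun n => (h.bdd n).norm_etaData_le (h.pos n) (h.holds n)
  have : Fact ((2 : ℝ≥0∞) ≠ ⊤) := ⟨by norm_num⟩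
  have : SecondCountableTopology (L2 V) := Lp.SecondCountableTopology
  obtain ⟨φ₁, h1, a, ha⟩ := exists_subseq_weaklyConverges fun n => (hb n).1
  obtain ⟨φ₂, h2, b, hb'⟩ := exists_subseq_weaklyConverges fun n => (hb (φ₁ n)).2.1
  obtain ⟨φ₃, h3, w, hw⟩ := exists_subseq_weaklyConverges fun n => (hb (φ₁ (φ₂ n))).2.2
  refine ⟨fun n => φ₁ (φ₂ (φ₃ n)), h1.comp (h2.comp h3), (a, b, w), ?_⟩
  exact (ha.comp_tendsto (h2.comp h3).tendsto_atTop).prodMk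
    ((hb'.comp_tendsto h3.tendsto_atTop).prodMk hw)

omit [CompleteSpace V] in
theorem tendsto_sqrt (h : IsBoundedSequence bc M K p) :
    Tendsto (fun n => √(M / K n)) atTop (𝓝 0) := by
  have h1 : Tendsto (fun n => M / (K n : ℝ)) atTop (𝓝 0) :=
    (tendsto_const_nhds.div_atTop tendsto_natCast_atTop_atTop).comp h.tendsto
  have := (Real.continuous_sqrt.tendsto 0).comp h1
  rwa [Real.sqrt_zero] at this

omit [CompleteSpace V] in
theorem tendsto_div (h : IsBoundedSequence bc M K p) (r : ℝ) :
    Tendsto (fun n => (r + √(M / K n)) / K n) atTop (𝓝 0) :=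
  (h.tendsto_sqrt.const_add r).div_atTop (tendsto_natCast_atTop_atTop.comp h.tendsto)

variable {x : V × V × L2 V}

omit [CompleteSpace V] in
-- Evaluation at a fixed time is bounded and linear in the data, so weak convergence holds at every
-- single time.
theorem weaklyConverges_etaPos (hx : WeaklyConverges (fun n => bc.etaData (p n)) x) (t : ℝ) :
    WeaklyConverges (fun n => bc.etaPos (p n) t) (curvePos x.1 x.2.1 x.2.2 t) := by
  have := hx.map (evalPos V t)
  simpa only [evalPos_apply, BoundaryCondition.curvePos_etaData] using this

omit [CompleteSpace V] in
theorem weaklyConverges_etaVel (hx : WeaklyConverges (fun n => bc.etaData (p n)) x) (t : ℝ) :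
    WeaklyConverges (fun n => bc.etaVel (p n) t) (curveVel x.2.1 x.2.2 t) := by
  have := hx.map (evalVel V t)
  simpa only [evalVel_apply, BoundaryCondition.curveVel_etaData] using this

variable (h : IsBoundedSequence bc M K p)
include h

omit [CompleteSpace V] in
theorem nonneg : 0 ≤ M := (h.bdd 0).nonneg (h.pos 0)

theorem weaklyConverges_node (hx : WeaklyConverges (fun n => bc.etaData (p n)) x) {s : ℝ}
    (h0 : 0 ≤ s) (h1 : s ≤ 1) :
    WeaklyConverges (fun n => node (p n) (midIndex (K n) s)) (curvePos x.1 x.2.1 x.2.2 s) :=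
  (weaklyConverges_etaPos hx s).congr_dist (squeeze_zero (fun _ => norm_nonneg _)
    (fun n => (h.bdd n).norm_etaPos_sub_node_le (h.pos n) (h.holds n) h0 h1) (h.tendsto_div _))

theorem weaklyConverges_node_floor (hx : WeaklyConverges (fun n => bc.etaData (p n)) x) {s : ℝ}
    (h0 : 0 ≤ s) (h1 : s < 1) :
    WeaklyConverges (fun n => node (p n) ⌊(K n : ℝ) * s⌋₊) (curvePos x.1 x.2.1 x.2.2 s) :=
  (weaklyConverges_etaPos hx s).congr_dist (squeeze_zero (fun _ => norm_nonneg _)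
    (fun n => (h.bdd n).norm_etaPos_sub_node_floor_le (h.pos n) (h.holds n) h0 h1)
    (h.tendsto_div _))

theorem weaklyConverges_velNode_floor (hx : WeaklyConverges (fun n => bc.etaData (p n)) x) {s : ℝ}
    (h0 : 0 ≤ s) (h1 : s < 1) :
    WeaklyConverges (fun n => velNode (p n) (⌊(K n : ℝ) * s⌋₊ + 1)) (curveVel x.2.1 x.2.2 s) :=
  (weaklyConverges_etaVel hx s).congr_dist (squeeze_zero (fun _ => norm_nonneg _)
    (fun n => (h.bdd n).norm_etaVel_sub_velNode_floor_le (h.pos n) (h.holds n) h0 h1)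
    h.tendsto_sqrt)

omit [CompleteSpace V] in
theorem eventually_midIndex_mem {s : ℝ} (h0 : 0 < s) (h1 : s < 1) :
    ∀ᶠ n in atTop, 1 ≤ midIndex (K n) s ∧ midIndex (K n) s ≤ K n - 1 := by
  have hK : Tendsto (fun n => (K n : ℝ)) atTop atTop :=
    tendsto_natCast_atTop_atTop.comp h.tendsto
  filter_upwards [hK.eventually_ge_atTop (1 / s), hK.eventually_ge_atTop (1 / (1 - s))]
    with n hn hn'
  rw [div_le_iff₀ h0] at hn
  rw [div_le_iff₀ (by linarith)] at hn'
  have hpos := h.pos n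
  refine ⟨Nat.le_floor (by push_cast; linarith), ?_⟩
  have : midIndex (K n) s < K n := by
    rw [midIndex, Nat.floor_lt' hpos.ne']
    linarith
  omega

/-- The interpolating curve misses the prescribed value by `O(1/K)` only, hence converges to it in
norm at this time; uniqueness of weak limits concludes. -/
theorem interpolates_limit (hx : WeaklyConverges (fun n => bc.etaData (p n)) x) {J : Type*}
    {t : J → ℝ} {ybar : J → V} (hi : ∀ n, InterpolatesDiscrete t ybar (p n)) (i : J) :
    curvePos x.1 x.2.1 x.2.2 (t i) = ybar i := by
  refine (weaklyConverges_etaPos hx (t i)).unique ?_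
  refine weaklyConverges_of_tendsto (tendsto_iff_norm_sub_tendsto_zero.2
    (squeeze_zero (fun _ => norm_nonneg _) (fun n => ?_) (h.tendsto_div (2 * M))))
  obtain ⟨k, hk, hkt, hy⟩ := hi n i
  have hK0 : (0 : ℝ) < K n := by exact_mod_cast h.pos n
  have e : t i = k / K n := by rw [hkt]; field_simp
  rw [← hy, e]
  exact (h.bdd n).norm_etaPos_div_sub_node_le (h.pos n) (h.holds n) hk

omit h in
theorem midIndex_one {K : ℕ} : midIndex K 1 = K := by
  rw [midIndex, Nat.floor_eq_iff (by positivity)]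
  constructor <;> linarith

omit h in
theorem midIndex_zero {K : ℕ} : midIndex K 0 = 0 := by
  rw [midIndex, Nat.floor_eq_iff (by positivity)]
  constructor <;> norm_num

theorem weaklyConverges_velNode_one (hx : WeaklyConverges (fun n => bc.etaData (p n)) x) :
    WeaklyConverges (fun n => velNode (p n) 1) (curveVel x.2.1 x.2.2 0) := by
  refine (weaklyConverges_etaVel hx 0).congr_dist (squeeze_zero (fun _ => norm_nonneg _)
    (fun n => ?_) h.tendsto_sqrt)
  have := ((h.bdd n).norm_etaVel_sub_velNode_le (h.pos n) (h.holds n) le_rfl zero_le_one).2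
  rw [midIndex_zero] at this
  exact this (h.pos n)

theorem weaklyConverges_velNode_last (hx : WeaklyConverges (fun n => bc.etaData (p n)) x) :
    WeaklyConverges (fun n => velNode (p n) (K n)) (curveVel x.2.1 x.2.2 1) := by
  refine (weaklyConverges_etaVel hx 1).congr_dist (squeeze_zero (fun _ => norm_nonneg _)
    (fun n => ?_) h.tendsto_sqrt)
  have := ((h.bdd n).norm_etaVel_sub_velNode_le (h.pos n) (h.holds n) zero_le_one le_rfl).1
  rw [midIndex_one] at this
  exact this (h.pos n)

theorem holdsFor_limit (hx : WeaklyConverges (fun n => bc.etaData (p n)) x) :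
    bc.HoldsFor (curvePos x.1 x.2.1 x.2.2) (curveVel x.2.1 x.2.2) := by
  have h1 := h.weaklyConverges_velNode_one hx
  have h2 := h.weaklyConverges_velNode_last hx
  have h3 := h.weaklyConverges_node hx le_rfl zero_le_one
  have h4 := h.weaklyConverges_node hx zero_le_one le_rfl
  cases bc with
  | natural => trivial
  | hermite v₀ v₁ =>
    constructor
    · refine h1.unique (weaklyConverges_of_tendsto (tendsto_const_nhds.congr fun n => ?_))
      exact (h.holds n).1.symm
    · refine h2.unique (weaklyConverges_of_tendsto (tendsto_const_nhds.congr fun n => ?_))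
      exact (h.holds n).2.symm
  | periodic =>
    have hper : ∀ n, node (p n) 0 = node (p n) (K n) := h.holds
    constructor
    · simp only [midIndex_zero, midIndex_one, hper] at h3 h4
      exact h3.unique h4
    -- The discrete condition concerns positions only. Periodicity of the limit velocity follows
    -- because `v_1 = v_{K+1}` differs from `v_K` by `K⁻¹ A_K`, which is `O(K^{-1/2})`.
    · refine h1.unique (h2.congr_dist (squeeze_zero (fun _ => norm_nonneg _)
        (fun n => ?_) h.tendsto_sqrt))
      have hK0 : (0 : ℝ) < K n := by exact_mod_cast h.pos n
      have hb := (h.bdd n).norm_smul_extendMid_le (h.pos n) le_rfl (r := (K n : ℝ)⁻¹)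
        (by rw [abs_of_pos (by positivity)])
      have hv : velNode (p n) (K n + 1) = velNode (p n) 1 := by
        simp only [velNode, Nat.add_sub_cancel, node_succ_self (h.pos n), Nat.sub_self, hper]
      simp only [BoundaryCondition.extendMid, (h.pos n).ne', if_false, accNode_eq, hv] at hb
      rw [smul_smul, inv_mul_cancel₀ hK0.ne', one_smul] at hb
      rwa [norm_sub_rev]

end IsBoundedSequence

end Limits

end RiemSpline

namespace RiemSpline

/-! ### Lower semicontinuity of the energies -/

section LiminfInequality

variable {V Y : Type*} [NormedAddCommGroup V] [InnerProductSpace ℝ V] [CompleteSpace V]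
  [NormedAddCommGroup Y] [NormedSpace ℝ Y] {ι : V →L[ℝ] Y} {gc : Y → Y →L[ℝ] Y →L[ℝ] ℝ}
  {Q : V →L[ℝ] V →L[ℝ] ℝ} {bc : BoundaryCondition V} {M : ℝ} {K : ℕ → ℕ}
  {p : ∀ n, Fin (K n + 1) → V} {x : V × V × L2 V}

omit [CompleteSpace V] in
omit [InnerProductSpace ℝ V] in
theorem norm_toLp_le_of_bound {f : ℝ → V} (hf : MemLp f 2 unitMeasure) {C : ℝ} (hC : 0 ≤ C)
    (h : ∀ s ∈ Ioo (0 : ℝ) 1, ‖f s‖ ≤ C) : ‖hf.toLp f‖ ≤ C := by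
  have := Lp.norm_le_of_ae_bound (f := hf.toLp f) hC (by
    filter_upwards [hf.coeFn_toLp, ae_restrict_mem measurableSet_Ioo] with s h1 h2
    rw [h1]
    exact h s h2)
  have h1 : measureUnivNNReal unitMeasure = 1 := by simp [measureUnivNNReal]
  simpa [h1] using this

omit [CompleteSpace V] in
theorem pathQuadrature_eq_integral {K : ℕ} (hK : 0 < K) (p : Fin (K + 1) → V) :
    pathQuadrature ι gc Q p = ∫ s, metric ι gc Q (ι (node p ⌊(K : ℝ) * s⌋₊))
      (velNode p (⌊(K : ℝ) * s⌋₊ + 1)) (velNode p (⌊(K : ℝ) * s⌋₊ + 1)) ∂unitMeasure := by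
  rw [integral_comp_floor hK (fun k => metric ι gc Q (ι (node p k)) (velNode p (k + 1))
    (velNode p (k + 1))), pathQuadrature, sum_Icc_one_eq_sum_range]
  simp only [Nat.add_sub_cancel]

/-- The covariant second derivative of a discrete curve as a step function. -/
noncomputable def BoundaryCondition.covStep (ι : V →L[ℝ] Y) (gc : Y → Y →L[ℝ] Y →L[ℝ] ℝ)
    (Q : V →L[ℝ] V →L[ℝ] ℝ) (bc : BoundaryCondition V) {K : ℕ} (p : Fin (K + 1) → V) (s : ℝ) : V :=
  bc.extendMid K (fun k => christoffel ι gc Q (node p k) (velNode p k) (velNode p k))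
    (midIndex K s)

omit [CompleteSpace V] in
-- In the periodic case the first half cell has base point `y_0` but carries the values of index
-- `K`; the condition `y_0 = y_K` reconciles the two.
theorem splineQuadrature_eq_integral {K : ℕ} (hK : 0 < K) {p : Fin (K + 1) → V}
    (hp : bc.HoldsDiscrete p) :
    splineQuadrature ι gc Q bc p = ∫ s, metric ι gc Q (ι (node p (midIndex K s)))
      (bc.etaAcc p s + bc.covStep ι gc Q p s) (bc.etaAcc p s + bc.covStep ι gc Q p s)
        ∂unitMeasure := by
  rw [splineQuadrature, ← bc.integral_extendMid hK]
  refine setIntegral_congr_fun measurableSet_Ioo fun s hs => ?_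
  have hle : midIndex K s ≤ K := midIndex_le hs.2.le
  simp only [BoundaryCondition.etaAcc, BoundaryCondition.covStep]
  generalize midIndex K s = k at hle
  cases bc with
  | natural =>
    simp only [BoundaryCondition.extendMid]
    split_ifs
    · rfl
    · simp [metric]
  | hermite _ _ =>
    simp only [BoundaryCondition.extendMid]
    split_ifs
    · rfl
    · simp [metric]
  | periodic =>
    simp only [BoundaryCondition.extendMid]
    split_ifs with h
    · have h0 : node p 0 = node p K := hp
      rw [h, h0]; rfl
    · rfl

theorem IsAdmissibleMetric.exists_norm_covStep_le (hg : IsAdmissibleMetric ι gc Q) :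
    ∃ C : ℝ, 0 < C ∧ ∀ (bc : BoundaryCondition V) (M : ℝ) {K : ℕ} (p : Fin (K + 1) → V), 0 < K →
      IsBoundedDiscrete bc M p → ∀ s ∈ Ioo (0 : ℝ) 1, ‖bc.covStep ι gc Q p s‖ ≤ C * M ^ 2 := by
  obtain ⟨C, hC, h⟩ := hg.exists_norm_christoffel_le
  refine ⟨C, hC, fun bc M K p hK hb s hs => ?_⟩
  rw [BoundaryCondition.covStep]
  rcases bc.extendMid_cases (E := V) hK (midIndex_le (K := K) hs.2.le) with h0 | ⟨j, hj, -, h0⟩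
  · rw [h0, norm_zero]; positivity
  · rw [h0]
    refine (h _ _).trans ?_
    have hjK := Finset.Icc_subset_Icc le_rfl (bc.numMid_le K) hj
    gcongr
    exact hb.vel_le j hjK

namespace IsBoundedSequence

variable (h : IsBoundedSequence bc M K p)
include h

omit [CompleteSpace V] in
theorem tendsto_of_weaklyConverges_node (hιc : IsCompactOperator ι) {k : ℕ → ℕ}
    (hk : ∀ n, k n ≤ K n) {l : V} (hl : WeaklyConverges (fun n => node (p n) (k n)) l) :
    Tendsto (fun n => ι (node (p n) (k n))) atTop (𝓝 (ι l)) :=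
  hl.tendsto_of_isCompactOperator hιc (R := M) fun n => (h.bdd n).node_le _ (hk n)

/-- The compact embedding upgrades weak convergence of positions and velocities to norm convergence
in `Y`. The Christoffel operator is continuous in that topology, so the nonlinear part of the
covariant acceleration converges in the norm of `V`. -/
theorem tendsto_covStep (hg : IsAdmissibleMetric ι gc Q) (hιc : IsCompactOperator ι)
    (hx : WeaklyConverges (fun n => bc.etaData (p n)) x) {s : ℝ} (hs : s ∈ Ioo (0 : ℝ) 1) :
    Tendsto (fun n => bc.covStep ι gc Q (p n) s) atTop
      (𝓝 (christoffel ι gc Q (curvePos x.1 x.2.1 x.2.2 s) (curveVel x.2.1 x.2.2 s)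
        (curveVel x.2.1 x.2.2 s))) := by
  have h1 := h.tendsto_of_weaklyConverges_node hιc (fun n => midIndex_le hs.2.le)
    (h.weaklyConverges_node hx hs.1.le hs.2.le)
  have hv := (weaklyConverges_etaVel hx s).tendsto_of_isCompactOperator hιc
    (R := M + √M) fun n => by
      refine ((h.bdd n).norm_etaVel_le (h.pos n) (h.holds n) hs.1.le hs.2.le).trans ?_
      have hK1 : (1 : ℝ) ≤ K n := by exact_mod_cast h.pos n
      have := Real.sqrt_le_sqrt (div_le_self h.nonneg hK1)
      linarith
  have h2 : Tendsto (fun n => ι (velNode (p n) (midIndex (K n) s))) atTop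
      (𝓝 (ι (curveVel x.2.1 x.2.2 s))) := by
    have hd : Tendsto (fun n => velNode (p n) (midIndex (K n) s) - bc.etaVel (p n) s) atTop
        (𝓝 0) := by
      refine squeeze_zero_norm' ?_ h.tendsto_sqrt
      filter_upwards [h.eventually_midIndex_mem hs.1 hs.2] with n hn
      rw [norm_sub_rev]
      exact ((h.bdd n).norm_etaVel_sub_velNode_le (h.pos n) (h.holds n) hs.1.le hs.2.le).1 hn.1
    have h3 := ((ι.continuous.tendsto 0).comp hd).add hv
    rw [map_zero, zero_add] at h3
    refine h3.congr fun n => ?_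
    simp
  refine (hg.tendsto_christoffel h1 h2).congr' ?_
  filter_upwards [h.eventually_midIndex_mem hs.1 hs.2] with n hn
  rw [BoundaryCondition.covStep, bc.extendMid_of_mem _ hn.1 hn.2]

/-- Lower semicontinuity of the spline energy along discrete curves. -/
theorem eventually_splineEnergy_le (hg : IsAdmissibleMetric ι gc Q) (hιc : IsCompactOperator ι)
    (hx : WeaklyConverges (fun n => bc.etaData (p n)) x) {ε : ℝ} (hε : 0 < ε) :
    ∀ᶠ n in atTop, ∫ s, metric ι gc Q (ι (curvePos x.1 x.2.1 x.2.2 s))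
      (x.2.2 s + christoffel ι gc Q (curvePos x.1 x.2.1 x.2.2 s) (curveVel x.2.1 x.2.2 s)
        (curveVel x.2.1 x.2.2 s))
      (x.2.2 s + christoffel ι gc Q (curvePos x.1 x.2.1 x.2.2 s) (curveVel x.2.1 x.2.2 s)
        (curveVel x.2.1 x.2.2 s)) ∂unitMeasure ≤ splineQuadrature ι gc Q bc (p n) + ε := by
  have hcc := continuous_curvePos x.1 x.2.1 (L2_integrable x.2.2)
  have hcv := continuous_curveVel x.2.1 (L2_integrable x.2.2)
  have hΓ : Continuous fun s => christoffel ι gc Q (curvePos x.1 x.2.1 x.2.2 s)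
      (curveVel x.2.1 x.2.2 s) (curveVel x.2.1 x.2.2 s) :=
    hg.continuous_christoffel.comp (hcc.prodMk hcv)
  obtain ⟨C, hC, hCb⟩ := hg.exists_norm_covStep_le
  have hcs : ∀ n, MemLp (bc.covStep ι gc Q (p n)) 2 unitMeasure := fun n =>
    memLp_comp_midIndex (K n) _
  have hΓ2 := memLp_of_continuous hΓ
  have hconv : Tendsto (fun n => (hcs n).toLp (bc.covStep ι gc Q (p n))) atTop
      (𝓝 (hΓ2.toLp _)) := by
    refine tendsto_toLp_of_ae_tendsto hcs hΓ2 (h := fun _ => C * M ^ 2) (memLp_const _)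
      (fun n => ?_) ?_
    · filter_upwards [ae_restrict_mem measurableSet_Ioo] with s hs
      exact hCb bc M (p n) (h.pos n) (h.bdd n) s hs
    · filter_upwards [ae_restrict_mem measurableSet_Ioo] with s hs
      exact h.tendsto_covStep hg hιc hx hs
  have hwk : WeaklyConverges (fun n => ((bc.memLp_etaAcc (p n)).add (hcs n)).toLp
      (bc.etaAcc (p n) + bc.covStep ι gc Q (p n))) (x.2.2 + hΓ2.toLp _) := by
    have h1 := (hx.map (ContinuousLinearMap.snd ℝ V (V × L2 V))).map
      (ContinuousLinearMap.snd ℝ V (L2 V))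
    have h2 := h1.add (weaklyConverges_of_tendsto hconv)
    have e : (fun n => ((bc.memLp_etaAcc (p n)).add (hcs n)).toLp
        (bc.etaAcc (p n) + bc.covStep ι gc Q (p n))) = fun n =>
        (bc.memLp_etaAcc (p n)).toLp _ + (hcs n).toLp _ := funext fun n =>
          MemLp.toLp_add (bc.memLp_etaAcc (p n)) (hcs n)
    rw [e]
    exact h2
  have hR : ∀ n, ‖((bc.memLp_etaAcc (p n)).add (hcs n)).toLp
      (bc.etaAcc (p n) + bc.covStep ι gc Q (p n))‖ ≤ (3 * M + √M) + C * M ^ 2 := by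
    intro n
    rw [MemLp.toLp_add (bc.memLp_etaAcc (p n)) (hcs n)]
    refine (norm_add_le _ _).trans (add_le_add
      ((h.bdd n).norm_etaData_le (h.pos n) (h.holds n)).2.2 ?_)
    exact norm_toLp_le_of_bound (hcs n) (by positivity) (hCb bc M (p n) (h.pos n) (h.bdd n))
  have key := hg.eventually_integral_metric_le (fun n => (bc.memLp_etaAcc (p n)).add (hcs n)) hwk
    hR (y := fun n s => node (p n) (midIndex (K n) s)) (y₀ := curvePos x.1 x.2.1 x.2.2)
    (fun n => (memLp_comp_midIndex (K n) (node (p n))).aestronglyMeasurable)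
    hcc.aestronglyMeasurable ?_ hε
  · filter_upwards [key] with n hn
    rw [splineQuadrature_eq_integral (h.pos n) (h.holds n)]
    refine le_trans (le_of_eq (integral_congr_ae ?_)) hn
    filter_upwards [Lp.coeFn_add x.2.2 (hΓ2.toLp _), hΓ2.coeFn_toLp] with s h1 h2
    rw [h1, Pi.add_apply, h2]
  · filter_upwards [ae_restrict_mem measurableSet_Ioo] with s hs
    exact h.tendsto_of_weaklyConverges_node hιc (fun n => midIndex_le hs.2.le)
      (h.weaklyConverges_node hx hs.1.le hs.2.le)

/-- Lower semicontinuity of the path energy along discrete curves. -/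
theorem eventually_pathEnergy_le (hg : IsAdmissibleMetric ι gc Q) (hιc : IsCompactOperator ι)
    (hx : WeaklyConverges (fun n => bc.etaData (p n)) x) {ε : ℝ} (hε : 0 < ε) :
    ∀ᶠ n in atTop, ∫ s, metric ι gc Q (ι (curvePos x.1 x.2.1 x.2.2 s))
      (curveVel x.2.1 x.2.2 s) (curveVel x.2.1 x.2.2 s) ∂unitMeasure
        ≤ pathQuadrature ι gc Q (p n) + ε := by
  have hcc := continuous_curvePos x.1 x.2.1 (L2_integrable x.2.2)
  have hcv := continuous_curveVel x.2.1 (L2_integrable x.2.2)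
  have hM := h.nonneg
  have hvm : ∀ n, MemLp (fun s => velNode (p n) (⌊(K n : ℝ) * s⌋₊ + 1)) 2 unitMeasure :=
    fun n => memLp_comp_floor (h.pos n) fun k => velNode (p n) (k + 1)
  have hvb : ∀ n, ∀ s ∈ Ioo (0 : ℝ) 1, ‖velNode (p n) (⌊(K n : ℝ) * s⌋₊ + 1)‖ ≤ M :=
    fun n s hs => (h.bdd n).vel_le _ (Finset.mem_Icc.2
      ⟨Nat.le_add_left _ _, floor_mul_lt (h.pos n) hs.2⟩)
  -- Weak convergence at each time together with the uniform bound `M` permits dominated convergence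
  -- in the scalar products.
  have hwk : WeaklyConverges (fun n => (hvm n).toLp _) (toL2 _ hcv) := by
    refine weaklyConverges_of_inner fun z => ?_
    have e1 : ∀ n, inner ℝ z ((hvm n).toLp _) =
        ∫ s, inner ℝ (z s) (velNode (p n) (⌊(K n : ℝ) * s⌋₊ + 1)) ∂unitMeasure := fun n => by
      rw [L2.inner_def]
      refine integral_congr_ae ?_
      filter_upwards [(hvm n).coeFn_toLp] with s hs
      rw [hs]
    have e2 : inner ℝ z (toL2 _ hcv) =
        ∫ s, inner ℝ (z s) (curveVel x.2.1 x.2.2 s) ∂unitMeasure := by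
      rw [L2.inner_def]
      refine integral_congr_ae ?_
      filter_upwards [toL2_coe hcv] with s hs
      rw [hs]
    simp only [e1]
    rw [e2]
    refine tendsto_integral_of_dominated_convergence (fun s => ‖z s‖ * M)
      (fun n => (Lp.memLp z).aestronglyMeasurable.inner (hvm n).aestronglyMeasurable)
      ((L2_integrable z).norm.mul_const M) (fun n => ?_) ?_
    · filter_upwards [ae_restrict_mem measurableSet_Ioo] with s hs
      exact (norm_inner_le_norm _ _).trans (by gcongr; exact hvb n s hs)
    · filter_upwards [ae_restrict_mem measurableSet_Ioo] with s hs
      exact h.weaklyConverges_velNode_floor hx hs.1.le hs.2 (innerSL ℝ (z s))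
  have hR : ∀ n, ‖(hvm n).toLp _‖ ≤ M := fun n => norm_toLp_le_of_bound (hvm n) hM (hvb n)
  have key := hg.eventually_integral_metric_le hvm hwk
    hR (y := fun n s => node (p n) ⌊(K n : ℝ) * s⌋₊) (y₀ := curvePos x.1 x.2.1 x.2.2)
    (fun n => (memLp_comp_floor (h.pos n) (node (p n))).aestronglyMeasurable)
    hcc.aestronglyMeasurable ?_ hε
  · filter_upwards [key] with n hn
    rw [pathQuadrature_eq_integral (h.pos n)]
    refine le_trans (le_of_eq (integral_congr_ae ?_)) hn
    filter_upwards [toL2_coe hcv] with s hs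
    rw [hs]
  · filter_upwards [ae_restrict_mem measurableSet_Ioo] with s hs
    exact h.tendsto_of_weaklyConverges_node hιc (fun n => (floor_mul_lt (h.pos n) hs.2).le)
      (h.weaklyConverges_node_floor hx hs.1.le hs.2)

end IsBoundedSequence

end LiminfInequality

end RiemSpline

namespace RiemSpline

/-! ### Difference quotients of a Sobolev curve -/

section DifferenceQuotients

variable {V : Type*} [NormedAddCommGroup V] [InnerProductSpace ℝ V] [CompleteSpace V]
  (a b : V) {w : ℝ → V} (hw : MemLp w 2 unitMeasure)
include hw

omit [CompleteSpace V] in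
omit [InnerProductSpace ℝ V] in
theorem integrable_norm_sub_sq (x : V) (s t : ℝ) :
    IntervalIntegrable (fun r => ‖(Ioo (0 : ℝ) 1).indicator w r - x‖ ^ 2) volume s t := by
  have h : ∀ s t : ℝ, MemLp (fun r => (Ioo (0 : ℝ) 1).indicator w r - x) 2
      (volume.restrict (Ioc s t)) := fun s t =>
    ((memLp_indicator_unit hw).mono_measure Measure.restrict_le_self).sub (memLp_const x)
  exact ⟨(h s t).integrable_norm_pow (by norm_num), (h t s).integrable_norm_pow (by norm_num)⟩

omit [CompleteSpace V] in
omit [InnerProductSpace ℝ V] in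
theorem integral_norm_sub_sq_mono (x : V) {s t s' t' : ℝ} (h1 : s' ≤ s) (h2 : s ≤ t) (h3 : t ≤ t') :
    ∫ r in s..t, ‖(Ioo (0 : ℝ) 1).indicator w r - x‖ ^ 2 ≤
      ∫ r in s'..t', ‖(Ioo (0 : ℝ) 1).indicator w r - x‖ ^ 2 :=
  intervalIntegral.integral_mono_interval h1 h2 h3 (Eventually.of_forall fun _ => by positivity)
    (integrable_norm_sub_sq hw x _ _)

theorem norm_curveVel_sub_smul_sq_le (x : V) {s t : ℝ} (hst : s ≤ t) :
    ‖curveVel b w t - curveVel b w s - (t - s) • x‖ ^ 2 ≤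
      (t - s) * ∫ r in s..t, ‖(Ioo (0 : ℝ) 1).indicator w r - x‖ ^ 2 := by
  have hi := hw.integrable (by norm_num)
  have e : curveVel b w t - curveVel b w s - (t - s) • x =
      ∫ r in s..t, ((Ioo (0 : ℝ) 1).indicator w r - x) := by
    rw [curveVel_sub b hi, intervalIntegral.integral_sub
      (intervalIntegrable_indicator_unit hi _ _) (by simp), intervalIntegral.integral_const]
  rw [e]
  exact norm_intervalIntegral_sq_le hst
    (((memLp_indicator_unit hw).mono_measure Measure.restrict_le_self).sub (memLp_const x))

/-- Second difference quotients are close to `x` if the second derivative is. -/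
theorem norm_second_difference_sub_sq_le (x : V) (u : ℝ) {τ : ℝ} (hτ : 0 ≤ τ) :
    ‖curvePos a b w (u + 2 * τ) - (2 : ℝ) • curvePos a b w (u + τ) + curvePos a b w u
        - τ ^ 2 • x‖ ^ 2 ≤
      τ ^ 3 * ∫ r in u..u + 2 * τ, ‖(Ioo (0 : ℝ) 1).indicator w r - x‖ ^ 2 := by
  have hi := hw.integrable (by norm_num)
  obtain ⟨S, hS⟩ : ∃ S, S = ∫ r in u..u + 2 * τ, ‖(Ioo (0 : ℝ) 1).indicator w r - x‖ ^ 2 :=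
    ⟨_, rfl⟩
  have hS0 : 0 ≤ S := hS ▸ intervalIntegral.integral_nonneg (by linarith) fun _ _ => by positivity
  have hvc := continuous_curveVel b hi
  have hvc' : Continuous fun r => curveVel b w (r + τ) := hvc.comp (continuous_id.add_const τ)
  have e1 : curvePos a b w (u + 2 * τ) - curvePos a b w (u + τ) =
      ∫ r in u..u + τ, curveVel b w (r + τ) := by
    rw [curvePos_sub a b hi, intervalIntegral.integral_comp_add_right (fun r => curveVel b w r)]
    congr 1
    ring
  -- The second difference is the integral over one step of the velocity increment across one step.
  have e2 : curvePos a b w (u + 2 * τ) - (2 : ℝ) • curvePos a b w (u + τ) + curvePos a b w u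
      - τ ^ 2 • x = ∫ r in u..u + τ, (curveVel b w (r + τ) - curveVel b w r - τ • x) := by
    have hvd : Continuous fun r => curveVel b w (r + τ) - curveVel b w r := hvc'.sub hvc
    rw [intervalIntegral.integral_sub (hvd.intervalIntegrable _ _) (by simp),
      intervalIntegral.integral_sub (hvc'.intervalIntegrable _ _) (hvc.intervalIntegrable _ _),
      ← e1, ← curvePos_sub a b hi, intervalIntegral.integral_const]
    module
  have hb : ∀ r ∈ uIoc u (u + τ), ‖curveVel b w (r + τ) - curveVel b w r - τ • x‖ ≤ √(τ * S) := by
    intro r hr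
    rw [uIoc_of_le (by linarith)] at hr
    refine Real.le_sqrt_of_sq_le ?_
    have h := norm_curveVel_sub_smul_sq_le b hw x (s := r) (t := r + τ) (by linarith)
    rw [add_sub_cancel_left] at h
    refine h.trans ?_
    rw [hS]
    gcongr
    exact integral_norm_sub_sq_mono hw x hr.1.le (by linarith) (by linarith [hr.2])
  rw [e2, ← hS]
  have h := intervalIntegral.norm_integral_le_of_norm_le_const hb
  rw [add_sub_cancel_left, abs_of_nonneg hτ] at h
  calc _ ≤ (√(τ * S) * τ) ^ 2 := by gcongr
    _ = τ ^ 3 * S := by rw [mul_pow, Real.sq_sqrt (by positivity)]; ring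

/-- Difference quotients are close to the velocity. -/
theorem norm_difference_sub_smul_sq_le {u u' τ : ℝ} (h1 : u ≤ u') (h2 : u' ≤ u + τ) :
    ‖curvePos a b w (u + τ) - curvePos a b w u - τ • curveVel b w u'‖ ^ 2 ≤
      τ ^ 3 * ∫ r in u..u + τ, ‖(Ioo (0 : ℝ) 1).indicator w r‖ ^ 2 := by
  have hτ : 0 ≤ τ := by linarith
  have hi := hw.integrable (by norm_num)
  have hmono := fun {s t : ℝ} => integral_norm_sub_sq_mono hw 0 (s := s) (t := t) (s' := u)
    (t' := u + τ)
  simp only [sub_zero] at hmono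
  obtain ⟨S, hS⟩ : ∃ S, S = ∫ r in u..u + τ, ‖(Ioo (0 : ℝ) 1).indicator w r‖ ^ 2 := ⟨_, rfl⟩
  rw [← hS] at hmono
  have hS0 : 0 ≤ S := hS ▸ intervalIntegral.integral_nonneg (by linarith) fun _ _ => by positivity
  have hvc := continuous_curveVel b hi
  have e2 : curvePos a b w (u + τ) - curvePos a b w u - τ • curveVel b w u' =
      ∫ r in u..u + τ, (curveVel b w r - curveVel b w u') := by
    rw [intervalIntegral.integral_sub (hvc.intervalIntegrable _ _) (by simp),
      ← curvePos_sub a b hi, intervalIntegral.integral_const, add_sub_cancel_left]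
  have hb : ∀ r ∈ uIoc u (u + τ), ‖curveVel b w r - curveVel b w u'‖ ≤ √(τ * S) := by
    intro r hr
    rw [uIoc_of_le (by linarith)] at hr
    refine Real.le_sqrt_of_sq_le ?_
    rcases le_total r u' with h | h
    · rw [norm_sub_rev]
      have hm := hmono hr.1.le h h2
      exact (norm_curveVel_sub_sq_le b hw h).trans (mul_le_mul (by linarith [hr.1]) hm
        (intervalIntegral.integral_nonneg h fun _ _ => by positivity) hτ)
    · have hm := hmono h1 h hr.2
      exact (norm_curveVel_sub_sq_le b hw h).trans (mul_le_mul (by linarith [hr.2]) hm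
        (intervalIntegral.integral_nonneg h fun _ _ => by positivity) hτ)
  rw [e2, ← hS]
  have h := intervalIntegral.norm_integral_le_of_norm_le_const hb
  rw [add_sub_cancel_left, abs_of_nonneg hτ] at h
  calc _ ≤ (√(τ * S) * τ) ^ 2 := by gcongr
    _ = τ ^ 3 * S := by rw [mul_pow, Real.sq_sqrt (by positivity)]; ring

end DifferenceQuotients

/-! ### Sampling a curve on the grid -/

section Sampling

variable {V : Type*} [NormedAddCommGroup V] [InnerProductSpace ℝ V] [CompleteSpace V]

omit [CompleteSpace V] [InnerProductSpace ℝ V] in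
omit [NormedAddCommGroup V] in
theorem node_of_nat {K : ℕ} (q : ℕ → V) {k : ℕ} (hk : k ≤ K) :
    node (fun i : Fin (K + 1) => q i) k = q k := by
  have : k < K + 1 := Nat.lt_succ_of_le hk
  simp [node, hk, Fin.ofNat, Nat.mod_eq_of_lt this]

/-- The discrete curve obtained by sampling a curve. -/
noncomputable def sample (K : ℕ) (c : ℝ → V) : Fin (K + 1) → V := fun i => c ((i : ℕ) / K)

omit [CompleteSpace V] [InnerProductSpace ℝ V] in
omit [NormedAddCommGroup V] in
theorem node_sample {K : ℕ} (c : ℝ → V) {k : ℕ} (hk : k ≤ K) : node (sample K c) k = c (k / K) :=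
  node_of_nat (fun i : ℕ => c ((i : ℝ) / K)) hk

variable (a b : V) {w : ℝ → V} (hw : MemLp w 2 unitMeasure)
include hw

theorem norm_accNode_sample_sub_sq_le {K : ℕ} (x : V) {k : ℕ} (hk : 1 ≤ k) (hkK : k ≤ K - 1) :
    ‖accNode (sample K (curvePos a b w)) k - x‖ ^ 2 ≤
      K * ∫ r in ((k : ℝ) - 1) / K..((k : ℝ) + 1) / K, ‖(Ioo (0 : ℝ) 1).indicator w r - x‖ ^ 2 := by
  have hK : 0 < K := by omega
  have hK0 : (0 : ℝ) < K := by exact_mod_cast hK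
  have h := norm_second_difference_sub_sq_le a b hw x (((k : ℝ) - 1) / K) (τ := (K : ℝ)⁻¹)
    (by positivity)
  have e1 : ((k : ℝ) - 1) / K + 2 * (K : ℝ)⁻¹ = ((k : ℝ) + 1) / K := by field_simp; ring
  have e2 : ((k : ℝ) - 1) / K + (K : ℝ)⁻¹ = (k : ℝ) / K := by field_simp; ring
  rw [e1, e2] at h
  have e3 : accNode (sample K (curvePos a b w)) k - x = (K : ℝ) ^ 2 •
      (curvePos a b w (((k : ℝ) + 1) / K) - (2 : ℝ) • curvePos a b w ((k : ℝ) / K)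
        + curvePos a b w (((k : ℝ) - 1) / K) - ((K : ℝ)⁻¹) ^ 2 • x) := by
    rw [accNode, node_sample _ (by omega), node_sample _ (by omega), node_sample _ (by omega),
      smul_sub ((K : ℝ) ^ 2), smul_smul, ← mul_pow, mul_inv_cancel₀ hK0.ne', one_pow, one_smul]
    push_cast [Nat.cast_sub hk]
    rfl
  rw [e3, norm_smul, mul_pow, Real.norm_of_nonneg (by positivity)]
  calc _ ≤ ((K : ℝ) ^ 2) ^ 2 * (((K : ℝ)⁻¹) ^ 3 * _) := by gcongr
    _ = _ := by field_simp

omit hw in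
omit [NormedAddCommGroup V] [InnerProductSpace ℝ V] [CompleteSpace V] in
-- Each window consists of two adjacent cells, and every cell lies in at most two windows.
theorem sum_integral_neighbours_le {K : ℕ} {f : ℝ → ℝ} (hf : ∀ s t, IntervalIntegrable f volume s t)
    (h0 : ∀ s, 0 ≤ f s) :
    ∑ k ∈ Finset.Icc 1 (K - 1), ∫ r in ((k : ℝ) - 1) / K..((k : ℝ) + 1) / K, f r ≤
      2 * ∫ r in (0 : ℝ)..1, f r := by
  rcases Nat.eq_zero_or_pos K with rfl | hK
  · simpa using intervalIntegral.integral_nonneg zero_le_one fun s _ => h0 s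
  have hK0 : (0 : ℝ) < K := by exact_mod_cast hK
  have hs := intervalIntegral.sum_integral_adjacent_intervals (a := fun k : ℕ => (k : ℝ) / K)
    (n := K) (fun k _ => hf _ _)
  simp only [Nat.cast_zero, zero_div, div_self hK0.ne'] at hs
  have hnn : ∀ i : ℕ, 0 ≤ ∫ r in ((i : ℝ) / K)..(((i + 1 : ℕ) : ℝ) / K), f r := fun i =>
    intervalIntegral.integral_nonneg (by gcongr; omega) fun s _ => h0 s
  obtain ⟨n, rfl⟩ : ∃ n, K = n + 1 := ⟨K - 1, by omega⟩
  rw [Nat.add_sub_cancel, sum_Icc_one_eq_sum_range]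
  have e : ∀ k : ℕ, ∫ r in (((k + 1 : ℕ) : ℝ) - 1) / ((n + 1 : ℕ) : ℝ)..
      (((k + 1 : ℕ) : ℝ) + 1) / ((n + 1 : ℕ) : ℝ), f r =
      (∫ r in ((k : ℝ) / ((n + 1 : ℕ) : ℝ))..(((k + 1 : ℕ) : ℝ) / ((n + 1 : ℕ) : ℝ)), f r) +
      ∫ r in (((k + 1 : ℕ) : ℝ) / ((n + 1 : ℕ) : ℝ))..(((k + 1 + 1 : ℕ) : ℝ) / ((n + 1 : ℕ) : ℝ)),
        f r := fun k => by
    rw [intervalIntegral.integral_add_adjacent_intervals (hf _ _) (hf _ _)]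
    congr 1 <;> push_cast <;> ring
  rw [Finset.sum_congr rfl fun k _ => e k, Finset.sum_add_distrib, ← hs, two_mul]
  refine add_le_add ?_ ?_
  · rw [Finset.sum_range_succ]
    exact le_add_of_nonneg_right (hnn n)
  · rw [Finset.sum_range_succ']
    exact le_add_of_nonneg_right (hnn 0)

omit hw in
omit [CompleteSpace V] in
theorem exists_continuous_approx_unit (hw : MemLp w 2 unitMeasure) {ε : ℝ}
    (hε : 0 < ε) :
    ∃ w' : ℝ → V, Continuous w' ∧
      ∫ r in (0 : ℝ)..1, ‖(Ioo (0 : ℝ) 1).indicator w r - w' r‖ ^ 2 ≤ ε := by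
  obtain ⟨g, hg, -⟩ := hw.exists_boundedContinuous_eLpNorm_sub_le (by norm_num)
    (ε := ENNReal.ofReal (√ε)) (by simpa using hε)
  refine ⟨g, g.continuous, ?_⟩
  have hgm : MemLp (fun s => w s - g s) 2 unitMeasure := hw.sub (memLp_of_continuous g.continuous)
  have e1 : ∫ r in (0 : ℝ)..1, ‖(Ioo (0 : ℝ) 1).indicator w r - g r‖ ^ 2 =
      ∫ r, ‖hgm.toLp _ r‖ ^ 2 ∂unitMeasure := by
    rw [← integral_unit_eq]
    refine integral_congr_ae ?_
    filter_upwards [hgm.coeFn_toLp, ae_restrict_mem measurableSet_Ioo] with s h1 h2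
    rw [h1, indicator_of_mem h2]
  rw [e1, ← L2_norm_sq, Lp.norm_toLp]
  have : (eLpNorm (fun s => w s - g s) 2 unitMeasure).toReal ≤ √ε :=
    ENNReal.toReal_le_of_le_ofReal (Real.sqrt_nonneg _) hg
  calc _ ≤ √ε ^ 2 := by gcongr
    _ = ε := Real.sq_sqrt hε.le

end Sampling

end RiemSpline

namespace RiemSpline

/-! ### Convergence of second difference quotients -/

section AccelerationOfSamples

variable {V : Type*} [NormedAddCommGroup V] [InnerProductSpace ℝ V] [CompleteSpace V]
  (a b : V) {w : ℝ → V} (hw : MemLp w 2 unitMeasure)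
include hw

/-- Second difference quotients average `w` over a window of length `2/K`. There `w` is replaced by
`w'` and `w' r` by `w' s`; the modulus of continuity contributes `K · (2/K) · 2ε = 4ε`. -/
theorem norm_etaAcc_sample_sub_sq_le {K : ℕ} (hK : 0 < K) {w' : ℝ → V} (hw' : Continuous w')
    {ε : ℝ} (hmod : ∀ r ∈ Icc (0 : ℝ) 1, ∀ s ∈ Icc (0 : ℝ) 1, |r - s| ≤ 2 / K →
      ‖w' r - w' s‖ ^ 2 ≤ ε) {s : ℝ} (hs : s ∈ Ioo (0 : ℝ) 1) (h1 : 1 ≤ midIndex K s)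
    (h2 : midIndex K s ≤ K - 1) :
    ‖accNode (sample K (curvePos a b w)) (midIndex K s) - w' s‖ ^ 2 ≤
      2 * K * (∫ r in ((midIndex K s : ℝ) - 1) / K..((midIndex K s : ℝ) + 1) / K,
        ‖(Ioo (0 : ℝ) 1).indicator w r - w' r‖ ^ 2) + 4 * ε := by
  have hK0 : (0 : ℝ) < K := by exact_mod_cast hK
  obtain ⟨l1, l2⟩ := halfNode_midIndex hK hs.1.le
  generalize midIndex K s = k at h1 h2 l1 l2
  refine (norm_accNode_sample_sub_sq_le a b hw (w' s) h1 h2).trans ?_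
  have hk1 : (1 : ℝ) ≤ k := by exact_mod_cast h1
  have hkK : (k : ℝ) + 1 ≤ K := by exact_mod_cast (by omega : k + 1 ≤ K)
  rw [halfNode, div_le_iff₀ hK0] at l1
  rw [halfNode, lt_div_iff₀ hK0] at l2
  push_cast at l2
  have hle : ((k : ℝ) - 1) / K ≤ ((k : ℝ) + 1) / K := by gcongr; linarith
  have hii : ∀ s t, IntervalIntegrable (fun r => ‖(Ioo (0 : ℝ) 1).indicator w r - w' r‖ ^ 2)
      volume s t := fun s t => by
    have h : ∀ s t : ℝ, MemLp (fun r => (Ioo (0 : ℝ) 1).indicator w r - w' r) 2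
        (volume.restrict (Ioc s t)) := fun s t => by
      refine ((memLp_indicator_unit hw).mono_measure Measure.restrict_le_self).sub ?_
      obtain ⟨C, hC⟩ := isCompact_Icc.exists_bound_of_continuousOn
        (hw'.continuousOn (s := Icc s t))
      refine MemLp.of_bound hw'.aestronglyMeasurable C ?_
      filter_upwards [ae_restrict_mem measurableSet_Ioc] with r hr
      exact hC r (Ioc_subset_Icc_self hr)
    exact ⟨(h s t).integrable_norm_pow (by norm_num), (h t s).integrable_norm_pow (by norm_num)⟩
  have key : ∫ r in ((k : ℝ) - 1) / K..((k : ℝ) + 1) / K,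
      ‖(Ioo (0 : ℝ) 1).indicator w r - w' s‖ ^ 2 ≤
      ∫ r in ((k : ℝ) - 1) / K..((k : ℝ) + 1) / K,
        (2 * ‖(Ioo (0 : ℝ) 1).indicator w r - w' r‖ ^ 2 + 2 * ε) := by
    refine intervalIntegral.integral_mono_on hle (integrable_norm_sub_sq hw _ _ _)
      (((hii _ _).const_mul 2).add (by simp)) fun r hr => ?_
    have hr1 := (div_le_iff₀ hK0).1 hr.1
    have hr2 := (le_div_iff₀ hK0).1 hr.2
    have hm := hmod r ⟨le_trans (div_nonneg (by linarith) hK0.le) hr.1,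
      hr.2.trans ((div_le_one hK0).2 hkK)⟩ s ⟨hs.1.le, hs.2.le⟩ (by
        rw [le_div_iff₀ hK0, ← abs_of_pos hK0, ← abs_mul, abs_le]
        constructor <;> nlinarith)
    have ht := norm_add_le ((Ioo (0 : ℝ) 1).indicator w r - w' r) (w' r - w' s)
    rw [sub_add_sub_cancel] at ht
    have hsq := pow_le_pow_left₀ (norm_nonneg _) ht 2
    nlinarith [sq_nonneg (‖(Ioo (0 : ℝ) 1).indicator w r - w' r‖ - ‖w' r - w' s‖)]
  rw [intervalIntegral.integral_add ((hii _ _).const_mul 2) (by simp),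
    intervalIntegral.integral_const_mul, intervalIntegral.integral_const, smul_eq_mul] at key
  calc (K : ℝ) * _ ≤ K * (2 * (∫ r in ((k : ℝ) - 1) / K..((k : ℝ) + 1) / K,
        ‖(Ioo (0 : ℝ) 1).indicator w r - w' r‖ ^ 2) +
        (((k : ℝ) + 1) / K - ((k : ℝ) - 1) / K) * (2 * ε)) := by gcongr
    _ = _ := by field_simp; ring

/-- The continuous `w'` serves as intermediary. Of the factor `10`, the part `8` comes from the
doubly counted windows and `2` from the distance of `w` to `w'`; the last integral belongs to the
boundary half cells, where the discrete acceleration is `0`. -/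
theorem integral_norm_etaAcc_sample_sub_sq_le {K : ℕ} (hK : 0 < K) {w' : ℝ → V}
    (hw' : Continuous w') {ε : ℝ} (hε : 0 ≤ ε)
    (hmod : ∀ r ∈ Icc (0 : ℝ) 1, ∀ s ∈ Icc (0 : ℝ) 1, |r - s| ≤ 2 / K →
      ‖w' r - w' s‖ ^ 2 ≤ ε) :
    ∫ s, ‖BoundaryCondition.natural.etaAcc (sample K (curvePos a b w)) s - w s‖ ^ 2 ∂unitMeasure ≤
      10 * (∫ r in (0 : ℝ)..1, ‖(Ioo (0 : ℝ) 1).indicator w r - w' r‖ ^ 2) + 8 * ε +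
      ∫ s, (if 1 ≤ midIndex K s ∧ midIndex K s ≤ K - 1 then 0 else ‖w s‖ ^ 2) ∂unitMeasure := by
  have hK0 : (0 : ℝ) < K := by exact_mod_cast hK
  obtain ⟨Φ, hΦ⟩ : ∃ Φ : ℕ → ℝ, Φ = fun k : ℕ => ∫ r in ((k : ℝ) - 1) / K..((k : ℝ) + 1) / K,
    ‖(Ioo (0 : ℝ) 1).indicator w r - w' r‖ ^ 2 := ⟨_, rfl⟩
  have hdm : MemLp (fun s => w s - w' s) 2 unitMeasure := hw.sub (memLp_of_continuous hw')
  have hwi : Integrable (fun s => ‖w s‖ ^ 2) unitMeasure := hw.integrable_norm_pow (by norm_num)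
  have hset : MeasurableSet {s | 1 ≤ midIndex K s ∧ midIndex K s ≤ K - 1} :=
    (measurable_midIndex K) (measurableSet_Icc (a := 1) (b := K - 1))
  have i1 : Integrable (fun s => BoundaryCondition.natural (V := V) |>.extendMid K
      (fun k => 4 * K * Φ k + 8 * ε) (midIndex K s)) unitMeasure :=
    (memLp_comp_midIndex K _).integrable (by norm_num)
  have i2 : Integrable (fun s => 2 * ‖w s - w' s‖ ^ 2) unitMeasure :=
    (hdm.integrable_norm_pow (by norm_num)).const_mul 2
  have i3 : Integrable (fun s => if 1 ≤ midIndex K s ∧ midIndex K s ≤ K - 1 then 0 else ‖w s‖ ^ 2)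
      unitMeasure := by
    refine (hwi.indicator hset.compl).congr (Eventually.of_forall fun s => ?_)
    by_cases h : 1 ≤ midIndex K s ∧ midIndex K s ≤ K - 1 <;> simp [indicator, h]
  have hle : ∫ s, ‖BoundaryCondition.natural.etaAcc (sample K (curvePos a b w)) s - w s‖ ^ 2
      ∂unitMeasure ≤ ∫ s, ((BoundaryCondition.natural (V := V) |>.extendMid K
      (fun k => 4 * K * Φ k + 8 * ε) (midIndex K s)) + 2 * ‖w s - w' s‖ ^ 2 +
      (if 1 ≤ midIndex K s ∧ midIndex K s ≤ K - 1 then 0 else ‖w s‖ ^ 2)) ∂unitMeasure := by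
    refine integral_mono_ae (((BoundaryCondition.natural.memLp_etaAcc _).sub
      hw).integrable_norm_pow (by norm_num)) ((i1.add i2).add i3) ?_
    filter_upwards [ae_restrict_mem measurableSet_Ioo] with s hs
    simp only [BoundaryCondition.etaAcc, BoundaryCondition.extendMid]
    split_ifs with h
    · have h1 := norm_etaAcc_sample_sub_sq_le a b hw hK hw' hmod hs h.1 h.2
      have ht := norm_sub_le_norm_sub_add_norm_sub
        (accNode (sample K (curvePos a b w)) (midIndex K s)) (w' s) (w s)
      have hsq := pow_le_pow_left₀ (norm_nonneg _) ht 2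
      rw [norm_sub_rev (w' s)] at hsq
      simp only [hΦ]
      nlinarith [sq_nonneg (‖accNode (sample K (curvePos a b w)) (midIndex K s) - w' s‖
        - ‖w s - w' s‖)]
    · simp only [zero_sub, norm_neg, zero_add]
      have : 0 ≤ 2 * ‖w s - w' s‖ ^ 2 := by positivity
      linarith
  have e2 : ∫ s, ‖w s - w' s‖ ^ 2 ∂unitMeasure =
      ∫ r in (0 : ℝ)..1, ‖(Ioo (0 : ℝ) 1).indicator w r - w' r‖ ^ 2 := by
    rw [← integral_unit_eq]
    refine setIntegral_congr_fun measurableSet_Ioo fun s hs => ?_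
    simp only [indicator_of_mem hs]
  have hsum : ∑ k ∈ Finset.Icc 1 (K - 1), Φ k ≤
      2 * ∫ r in (0 : ℝ)..1, ‖(Ioo (0 : ℝ) 1).indicator w r - w' r‖ ^ 2 := by
    rw [hΦ]
    refine sum_integral_neighbours_le (fun s t => ?_) (fun s => by positivity)
    have h : ∀ s t : ℝ, MemLp (fun r => (Ioo (0 : ℝ) 1).indicator w r - w' r) 2
        (volume.restrict (Ioc s t)) := fun s t => by
      refine ((memLp_indicator_unit hw).mono_measure Measure.restrict_le_self).sub ?_
      obtain ⟨C, hC⟩ := isCompact_Icc.exists_bound_of_continuousOn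
        (hw'.continuousOn (s := Icc s t))
      refine MemLp.of_bound hw'.aestronglyMeasurable C ?_
      filter_upwards [ae_restrict_mem measurableSet_Ioc] with r hr
      exact hC r (Ioc_subset_Icc_self hr)
    exact ⟨(h s t).integrable_norm_pow (by norm_num), (h t s).integrable_norm_pow (by norm_num)⟩
  have i12 : Integrable (fun s => (BoundaryCondition.natural (V := V) |>.extendMid K
      (fun k => 4 * K * Φ k + 8 * ε) (midIndex K s)) + 2 * ‖w s - w' s‖ ^ 2) unitMeasure := i1.add i2
  rw [integral_add i12 i3, integral_add i1 i2, integral_const_mul, e2,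
    BoundaryCondition.integral_extendMid _ hK] at hle
  have hlast : (K : ℝ)⁻¹ * ∑ k ∈ Finset.Icc 1 (BoundaryCondition.natural (V := V) |>.numMid K),
      (4 * K * Φ k + 8 * ε) ≤
      8 * (∫ r in (0 : ℝ)..1, ‖(Ioo (0 : ℝ) 1).indicator w r - w' r‖ ^ 2) + 8 * ε := by
    simp only [BoundaryCondition.numMid]
    rw [Finset.sum_add_distrib, ← Finset.mul_sum, Finset.sum_const, Nat.card_Icc, nsmul_eq_mul,
      inv_mul_le_iff₀ hK0]
    have hc : ((K - 1 + 1 - 1 : ℕ) : ℝ) ≤ K := by exact_mod_cast (by omega : K - 1 + 1 - 1 ≤ K)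
    nlinarith [mul_le_mul_of_nonneg_left hsum hK0.le, mul_le_mul_of_nonneg_right hc hε]
  linarith

/-- The second difference quotients of the samples of a curve converge to its second derivative. -/
theorem tendsto_integral_etaAcc_sample {K : ℕ → ℕ} (hK : Tendsto K atTop atTop) :
    Tendsto (fun n => ∫ s, ‖BoundaryCondition.natural.etaAcc (sample (K n) (curvePos a b w)) s
      - w s‖ ^ 2 ∂unitMeasure) atTop (𝓝 0) := by
  have hKr : Tendsto (fun n => (K n : ℝ)) atTop atTop := tendsto_natCast_atTop_atTop.comp hK
  -- Every fixed time in the open interval eventually lies in an interior cell, so the integrand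
  -- tends to `0` pointwise.
  have hedge : Tendsto (fun n => ∫ s, (if 1 ≤ midIndex (K n) s ∧ midIndex (K n) s ≤ K n - 1 then 0
      else ‖w s‖ ^ 2) ∂unitMeasure) atTop (𝓝 0) := by
    have hwi : Integrable (fun s => ‖w s‖ ^ 2) unitMeasure := hw.integrable_norm_pow (by norm_num)
    have := tendsto_integral_of_dominated_convergence (μ := unitMeasure)
      (F := fun n s => if 1 ≤ midIndex (K n) s ∧ midIndex (K n) s ≤ K n - 1 then 0 else ‖w s‖ ^ 2)
      (f := fun _ => 0) (fun s => ‖w s‖ ^ 2) (fun n => ?_) hwi (fun n => ?_) ?_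
    · simpa using this
    · have hset : MeasurableSet {s | 1 ≤ midIndex (K n) s ∧ midIndex (K n) s ≤ K n - 1} :=
        (measurable_midIndex (K n)) (measurableSet_Icc (a := 1) (b := K n - 1))
      refine (hwi.indicator hset.compl).aestronglyMeasurable.congr
        (Eventually.of_forall fun s => ?_)
      by_cases h : 1 ≤ midIndex (K n) s ∧ midIndex (K n) s ≤ K n - 1 <;> simp [indicator, h]
    · refine Eventually.of_forall fun s => ?_
      split_ifs
      · simp
      · rw [Real.norm_of_nonneg (by positivity)]
    · filter_upwards [ae_restrict_mem measurableSet_Ioo] with s hs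
      refine tendsto_const_nhds.congr' ?_
      filter_upwards [hKr.eventually_ge_atTop (1 / s), hKr.eventually_ge_atTop (1 / (1 - s)),
        hK.eventually_gt_atTop 0] with n hn hn' hpos
      have hs1 := hs.2
      rw [div_le_iff₀ hs.1] at hn
      rw [div_le_iff₀ (by linarith)] at hn'
      have h1 : 1 ≤ midIndex (K n) s := Nat.le_floor (by push_cast; linarith)
      have h2 : midIndex (K n) s < K n := by
        rw [midIndex, Nat.floor_lt' hpos.ne']
        linarith
      rw [if_pos ⟨h1, by omega⟩]
  rw [Metric.tendsto_nhds]
  intro ε hε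
  -- The shares `10 ε/40`, `8 ε/40` and `ε/4` add up to less than `ε`.
  obtain ⟨w', hw', hD⟩ := exists_continuous_approx_unit hw (ε := ε / 40) (by positivity)
  have huc := isCompact_Icc.uniformContinuousOn_of_continuous (hw'.continuousOn (s := Icc 0 1))
  rw [Metric.uniformContinuousOn_iff] at huc
  obtain ⟨δ, hδ, hmod⟩ := huc (√(ε / 40)) (by positivity)
  filter_upwards [hedge.eventually (gt_mem_nhds (show (0 : ℝ) < ε / 4 by positivity)),
    hK.eventually_gt_atTop 0, hKr.eventually_gt_atTop (2 / δ)] with n hn hpos hlarge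
  have hK0 : (0 : ℝ) < K n := by exact_mod_cast hpos
  rw [Real.dist_eq, sub_zero, abs_of_nonneg (integral_nonneg fun _ => by positivity)]
  refine (integral_norm_etaAcc_sample_sub_sq_le a b hw hpos hw' (ε := ε / 40) (by positivity)
    fun r hr s hs hrs => ?_).trans_lt (by linarith)
  have h := (hmod r hr s hs (by
    rw [Real.dist_eq]
    refine hrs.trans_lt ?_
    rw [div_lt_iff₀ hδ] at hlarge
    rw [div_lt_iff₀ hK0]
    linarith)).le
  rw [dist_eq_norm] at h
  calc ‖w' r - w' s‖ ^ 2 ≤ √(ε / 40) ^ 2 := by gcongr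
    _ = ε / 40 := Real.sq_sqrt (by positivity)

end AccelerationOfSamples

end RiemSpline

namespace RiemSpline

/-! ### Recovery sequences: sampling with corrected ends -/

section Recovery

variable {V : Type*} [NormedAddCommGroup V] [InnerProductSpace ℝ V] [CompleteSpace V]

namespace BoundaryCondition

/-- The correction of sampled values which enforces Hermite boundary conditions. -/
noncomputable def endCorrection (bc : BoundaryCondition V) (c d : ℝ → V) (K k : ℕ) : V :=
  match bc with
  | .natural => 0
  | .hermite _ _ =>
      -- The end nodes stay put; moving the nodes `1` and `K - 1` makes the first and last
      -- difference quotients equal to the prescribed velocities.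
      if k = 1 then c 0 + (K : ℝ)⁻¹ • d 0 - c (((1 : ℕ) : ℝ) / K)
      else if k = K - 1 then c 1 - (K : ℝ)⁻¹ • d 1 - c (((K - 1 : ℕ) : ℝ) / K) else 0
  | .periodic => 0

/-- The discrete curve approximating a curve `c` with velocity `d`. -/
noncomputable def recovery (bc : BoundaryCondition V) (c d : ℝ → V) (K : ℕ) : Fin (K + 1) → V :=
  fun i => c ((i : ℕ) / K) + bc.endCorrection c d K i

variable {bc : BoundaryCondition V} {c d : ℝ → V} {K : ℕ}

omit [CompleteSpace V] in
theorem node_recovery {k : ℕ} (hk : k ≤ K) :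
    node (bc.recovery c d K) k = c (k / K) + bc.endCorrection c d K k :=
  node_of_nat (fun i : ℕ => c ((i : ℝ) / K) + bc.endCorrection c d K i) hk

omit [CompleteSpace V] in
theorem endCorrection_eq_zero {k : ℕ} (h1 : k ≠ 1) (h2 : k ≠ K - 1) :
    bc.endCorrection c d K k = 0 := by
  cases bc <;> simp [endCorrection, h1, h2]

omit [CompleteSpace V] in
theorem holdsDiscrete_recovery (hK : 3 ≤ K) (h : bc.HoldsFor c d) :
    bc.HoldsDiscrete (bc.recovery c d K) := by
  have hK0 : (K : ℝ) ≠ 0 := by positivity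
  cases bc with
  | natural => trivial
  | hermite v₀ v₁ =>
    obtain ⟨h0, h1⟩ := h
    have n1 : K - 1 ≠ 1 := by omega
    refine ⟨?_, ?_⟩
    · rw [node_recovery (by omega), node_recovery (by omega),
        endCorrection_eq_zero (k := 0) (by omega) (by omega), endCorrection, if_pos rfl, ← h0]
      simp only [Nat.cast_zero, zero_div]
      match_scalars <;> field_simp <;> ring
    · rw [node_recovery (by omega), node_recovery (by omega),
        endCorrection_eq_zero (k := K) (by omega) (by omega), endCorrection, if_neg n1, if_pos rfl,
        ← h1, div_self hK0]
      match_scalars <;> field_simp <;> ring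
  | periodic =>
    show node _ 0 = node _ K
    rw [node_recovery (by omega), node_recovery le_rfl,
      endCorrection_eq_zero (k := 0) (by omega) (by omega),
      endCorrection_eq_zero (k := K) (by omega) (by omega), div_self hK0]
    simpa using h.1

end BoundaryCondition

/-- The energy of `w` near the end points of the unit interval. -/
noncomputable def edgeEnergy (w : ℝ → V) (K : ℕ) : ℝ :=
  (∫ r in (0 : ℝ)..(K : ℝ)⁻¹, ‖(Ioo (0 : ℝ) 1).indicator w r‖ ^ 2) +
    ∫ r in (1 - (K : ℝ)⁻¹)..1, ‖(Ioo (0 : ℝ) 1).indicator w r‖ ^ 2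

omit [CompleteSpace V] [InnerProductSpace ℝ V] in
theorem edgeEnergy_parts_nonneg (w : ℝ → V) (K : ℕ) :
    0 ≤ (∫ r in (0 : ℝ)..(K : ℝ)⁻¹, ‖(Ioo (0 : ℝ) 1).indicator w r‖ ^ 2) ∧
    0 ≤ ∫ r in (1 - (K : ℝ)⁻¹)..1, ‖(Ioo (0 : ℝ) 1).indicator w r‖ ^ 2 := by
  have : (0 : ℝ) ≤ (K : ℝ)⁻¹ := by positivity
  exact ⟨intervalIntegral.integral_nonneg this fun _ _ => by positivity,
    intervalIntegral.integral_nonneg (by linarith) fun _ _ => by positivity⟩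

omit [CompleteSpace V] [InnerProductSpace ℝ V] in
theorem edgeEnergy_nonneg (w : ℝ → V) (K : ℕ) : 0 ≤ edgeEnergy w K :=
  add_nonneg (edgeEnergy_parts_nonneg w K).1 (edgeEnergy_parts_nonneg w K).2

section Estimates

variable (a b : V) {w : ℝ → V} (hw : MemLp w 2 unitMeasure)
include hw

omit [CompleteSpace V] in
omit [InnerProductSpace ℝ V] in
theorem tendsto_edgeEnergy {K : ℕ → ℕ} (hK : Tendsto K atTop atTop) :
    Tendsto (fun n => edgeEnergy w (K n)) atTop (𝓝 0) := by
  have hi : ∀ s t, IntervalIntegrable (fun r => ‖(Ioo (0 : ℝ) 1).indicator w r‖ ^ 2) volume s t :=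
    fun s t => ((memLp_indicator_unit hw).integrable_norm_pow (by norm_num)).intervalIntegrable
  have hinv : Tendsto (fun n => ((K n : ℕ) : ℝ)⁻¹) atTop (𝓝 0) :=
    tendsto_inv_atTop_zero.comp (tendsto_natCast_atTop_atTop.comp hK)
  have h1 := ((intervalIntegral.continuous_primitive hi 0).tendsto 0).comp hinv
  have h2 := ((intervalIntegral.continuous_primitive hi 1).tendsto 1).comp
    (by simpa using hinv.const_sub 1)
  rw [intervalIntegral.integral_same] at h1 h2
  have h3 := h1.add h2.neg
  rw [neg_zero, add_zero] at h3
  refine h3.congr fun n => ?_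
  simp only [edgeEnergy, Function.comp_apply]
  rw [← intervalIntegral.integral_symm]

/-- The energy of `w` near the ends, rather than its full norm, is essential. Squared accelerations
multiply this error by `K⁴`, and the `O(1)` cells concerned have length `1/K`, so all powers of `K`
cancel and only the edge energy tends to `0`. -/
theorem norm_first_step_sub_sq_le {K : ℕ} (hK : 0 < K) :
    ‖curvePos a b w (((1 : ℕ) : ℝ) / K) - curvePos a b w 0 - (K : ℝ)⁻¹ • curveVel b w 0‖ ^ 2 ≤
      ((K : ℝ)⁻¹) ^ 3 * edgeEnergy w K := by
  have h := norm_difference_sub_smul_sq_le a b hw (u := 0) (u' := 0) (τ := (K : ℝ)⁻¹) le_rfl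
    (by positivity)
  rw [zero_add] at h
  rw [Nat.cast_one, one_div]
  refine h.trans ?_
  gcongr
  exact le_add_of_nonneg_right (edgeEnergy_parts_nonneg w K).2

theorem norm_last_step_sub_sq_le {K : ℕ} (hK : 0 < K) :
    ‖curvePos a b w 1 - curvePos a b w (((K - 1 : ℕ) : ℝ) / K) - (K : ℝ)⁻¹ • curveVel b w 1‖ ^ 2 ≤
      ((K : ℝ)⁻¹) ^ 3 * edgeEnergy w K := by
  have hK0 : (0 : ℝ) < K := by exact_mod_cast hK
  have h := norm_difference_sub_smul_sq_le a b hw (u := 1 - (K : ℝ)⁻¹) (u' := 1) (τ := (K : ℝ)⁻¹)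
    (by rw [sub_le_self_iff]; positivity) (by simp)
  have e : ((K - 1 : ℕ) : ℝ) / K = 1 - (K : ℝ)⁻¹ := by
    rw [Nat.cast_sub hK]; field_simp; simp
  rw [sub_add_cancel] at h
  rw [e]
  refine h.trans ?_
  gcongr
  exact le_add_of_nonneg_left (edgeEnergy_parts_nonneg w K).1

theorem norm_endCorrection_le (bc : BoundaryCondition V) {K : ℕ} (hK : 0 < K) (k : ℕ) :
    ‖bc.endCorrection (curvePos a b w) (curveVel b w) K k‖ ≤
      √(((K : ℝ)⁻¹) ^ 3 * edgeEnergy w K) := by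
  have h0 : ‖(0 : V)‖ ≤ √(((K : ℝ)⁻¹) ^ 3 * edgeEnergy w K) := by
    rw [norm_zero]; exact Real.sqrt_nonneg _
  cases bc with
  | natural => exact h0
  | hermite v₀ v₁ =>
    simp only [BoundaryCondition.endCorrection]
    split_ifs with h1 h2
    · refine Real.le_sqrt_of_sq_le (le_of_eq_of_le ?_ (norm_first_step_sub_sq_le a b hw hK))
      rw [← norm_neg]
      congr 2
      abel
    · refine Real.le_sqrt_of_sq_le (le_of_eq_of_le ?_ (norm_last_step_sub_sq_le a b hw hK))
      congr 2
      abel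
    · exact h0
  | periodic => exact h0

/-- The coefficients `1, 2, 1` of a second difference give `16 K = (4 K²)² K⁻³`. At the periodic
seam, where the sampled open curve has no acceleration, matching values and velocities turn `A_K`
into a difference of two one-sided errors of the same size. -/
theorem norm_extendMid_recovery_sub_sq_le {bc : BoundaryCondition V} {K : ℕ} (hK : 3 ≤ K)
    (h : bc.HoldsFor (curvePos a b w) (curveVel b w)) {k : ℕ} (hk : k ≤ K) :
    ‖bc.extendMid K (accNode (bc.recovery (curvePos a b w) (curveVel b w) K)) k -
      (BoundaryCondition.natural (V := V)).extendMid K (accNode (sample K (curvePos a b w))) k‖ ^ 2 ≤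
      16 * K * edgeEnergy w K := by
  have hK0 : (0 : ℝ) < K := by positivity
  have hS := edgeEnergy_nonneg w K
  have hcorr := norm_endCorrection_le a b hw bc (K := K) (by omega)
  have hfirst := Real.le_sqrt_of_sq_le (norm_first_step_sub_sq_le a b hw (K := K) (by omega))
  have hlast := Real.le_sqrt_of_sq_le (norm_last_step_sub_sq_le a b hw (K := K) (by omega))
  have hB2 : √(((K : ℝ)⁻¹) ^ 3 * edgeEnergy w K) ^ 2 = ((K : ℝ)⁻¹) ^ 3 * edgeEnergy w K :=
    Real.sq_sqrt (by positivity)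
  have hB0 : 0 ≤ √(((K : ℝ)⁻¹) ^ 3 * edgeEnergy w K) := Real.sqrt_nonneg _
  generalize √(((K : ℝ)⁻¹) ^ 3 * edgeEnergy w K) = B at *
  have hfin : ∀ x : V, ‖x‖ ≤ (K : ℝ) ^ 2 * (4 * B) → ‖x‖ ^ 2 ≤ 16 * K * edgeEnergy w K :=
    fun x hx => by
    calc ‖x‖ ^ 2 ≤ ((K : ℝ) ^ 2 * (4 * B)) ^ 2 := by gcongr
      _ = 16 * K ^ 4 * B ^ 2 := by ring
      _ = 16 * K * edgeEnergy w K := by rw [hB2]; field_simp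
  have hmid : 1 ≤ k ∧ k ≤ K - 1 →
      ‖accNode (bc.recovery (curvePos a b w) (curveVel b w) K) k -
        accNode (sample K (curvePos a b w)) k‖ ≤ (K : ℝ) ^ 2 * (4 * B) := fun hk => by
    have e : accNode (bc.recovery (curvePos a b w) (curveVel b w) K) k -
        accNode (sample K (curvePos a b w)) k = (K : ℝ) ^ 2 •
        (bc.endCorrection (curvePos a b w) (curveVel b w) K (k + 1) -
          ((2 : ℝ) • bc.endCorrection (curvePos a b w) (curveVel b w) K k -
          bc.endCorrection (curvePos a b w) (curveVel b w) K (k - 1))) := by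
      rw [accNode, accNode, BoundaryCondition.node_recovery (by omega),
        BoundaryCondition.node_recovery (by omega), BoundaryCondition.node_recovery (by omega),
        node_sample _ (by omega), node_sample _ (by omega), node_sample _ (by omega)]
      module
    rw [e, norm_smul, Real.norm_of_nonneg (by positivity)]
    gcongr
    refine (norm_sub_le _ _).trans ?_
    have h2 := norm_sub_le ((2 : ℝ) • bc.endCorrection (curvePos a b w) (curveVel b w) K k)
      (bc.endCorrection (curvePos a b w) (curveVel b w) K (k - 1))
    rw [norm_smul, Real.norm_of_nonneg zero_le_two] at h2
    linarith [hcorr (k + 1), hcorr k, hcorr (k - 1)]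
  by_cases hin : 1 ≤ k ∧ k ≤ K - 1
  · rw [bc.extendMid_of_mem _ hin.1 hin.2,
      (BoundaryCondition.natural (V := V)).extendMid_of_mem _ hin.1 hin.2]
    exact hfin _ (hmid hin)
  · have h0 : ‖(0 : V) - 0‖ ^ 2 ≤ 16 * K * edgeEnergy w K := by
      simpa using by positivity
    cases bc with
    | natural => simpa only [BoundaryCondition.extendMid, if_neg hin] using h0
    | hermite v₀ v₁ => simpa only [BoundaryCondition.extendMid, if_neg hin] using h0
    | periodic =>
      have e : (BoundaryCondition.periodic (V := V)).extendMid K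
          (accNode (BoundaryCondition.periodic.recovery (curvePos a b w) (curveVel b w) K)) k =
          accNode (BoundaryCondition.periodic.recovery (curvePos a b w) (curveVel b w) K) K := by
        simp only [BoundaryCondition.extendMid]
        split_ifs with h0
        · rfl
        · rw [show k = K by omega]
      rw [e, BoundaryCondition.extendMid, if_neg hin, sub_zero]
      obtain ⟨hc, hd⟩ := h
      refine hfin _ ?_
      have e2 : accNode (BoundaryCondition.periodic.recovery (curvePos a b w) (curveVel b w) K) K =
          (K : ℝ) ^ 2 • ((curvePos a b w (((1 : ℕ) : ℝ) / K) - curvePos a b w 0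
            - (K : ℝ)⁻¹ • curveVel b w 0) - (curvePos a b w 1
            - curvePos a b w (((K - 1 : ℕ) : ℝ) / K) - (K : ℝ)⁻¹ • curveVel b w 1)) := by
        rw [accNode, node_succ_self (by omega : 0 < K), BoundaryCondition.node_recovery (by omega),
          BoundaryCondition.node_recovery (by omega), BoundaryCondition.node_recovery (by omega),
          hc, hd, div_self hK0.ne']
        simp only [BoundaryCondition.endCorrection]
        module
      rw [e2, norm_smul, Real.norm_of_nonneg (by positivity)]
      gcongr
      refine (norm_sub_le _ _).trans ?_
      linarith

/-- Corrections at `1` and `K - 1` and the periodic seam affect at most six indices, each with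
weight at most `1/K`; this yields `6 · 16 = 96`. -/
theorem integral_norm_etaAcc_recovery_sub_sq_le {bc : BoundaryCondition V} {K : ℕ} (hK : 3 ≤ K)
    (h : bc.HoldsFor (curvePos a b w) (curveVel b w)) :
    ∫ s, ‖bc.etaAcc (bc.recovery (curvePos a b w) (curveVel b w) K) s -
      BoundaryCondition.natural.etaAcc (sample K (curvePos a b w)) s‖ ^ 2 ∂unitMeasure ≤
      96 * edgeEnergy w K := by
  have hK0 : (0 : ℝ) < K := by positivity
  have hS := edgeEnergy_nonneg w K
  obtain ⟨f, hf⟩ : ∃ f : ℕ → ℝ, f = fun k =>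
    ‖bc.extendMid K (accNode (bc.recovery (curvePos a b w) (curveVel b w) K)) k -
      (BoundaryCondition.natural (V := V)).extendMid K (accNode (sample K (curvePos a b w))) k‖ ^ 2 :=
    ⟨_, rfl⟩
  have hf0 : ∀ k, 0 ≤ f k := fun k => by rw [hf]; positivity
  have hle : ∀ k ≤ K, f k ≤ 16 * K * edgeEnergy w K := fun k hk => by
    rw [hf]
    exact norm_extendMid_recovery_sub_sq_le a b hw hK h hk
  have hzero : ∀ k, 3 ≤ k → k + 3 ≤ K → f k = 0 := fun k h1 h2 => by
    rw [hf]
    simp only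
    rw [bc.extendMid_of_mem _ (by omega) (by omega),
      (BoundaryCondition.natural (V := V)).extendMid_of_mem _ (by omega) (by omega), accNode, accNode,
      BoundaryCondition.node_recovery (by omega),
      BoundaryCondition.node_recovery (by omega), BoundaryCondition.node_recovery (by omega),
      node_sample _ (by omega), node_sample _ (by omega), node_sample _ (by omega),
      BoundaryCondition.endCorrection_eq_zero (by omega) (by omega),
      BoundaryCondition.endCorrection_eq_zero (by omega) (by omega),
      BoundaryCondition.endCorrection_eq_zero (by omega) (by omega)]
    simp
  have hint := integral_midIndex (K := K) (by omega) f
  have e : ∫ s, ‖bc.etaAcc (bc.recovery (curvePos a b w) (curveVel b w) K) s -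
      BoundaryCondition.natural.etaAcc (sample K (curvePos a b w)) s‖ ^ 2 ∂unitMeasure =
      ∫ s, f (midIndex K s) ∂unitMeasure := by rw [hf]; rfl
  rw [e, hint, inv_mul_le_iff₀ hK0]
  have hsum : f 0 / 2 + ∑ k ∈ Finset.Icc 1 (K - 1), f k + f K / 2 ≤
      ∑ k ∈ Finset.range (K + 1), f k := by
    obtain ⟨n, rfl⟩ : ∃ n, K = n + 1 := ⟨K - 1, by omega⟩
    rw [Finset.sum_range_succ, Finset.sum_range_succ', Nat.add_sub_cancel,
      sum_Icc_one_eq_sum_range]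
    linarith [hf0 0, hf0 (n + 1)]
  have hsub : ∑ k ∈ Finset.range (K + 1), f k =
      ∑ k ∈ ({0, 1, 2, K - 2, K - 1, K} : Finset ℕ), f k := by
    symm
    refine Finset.sum_subset (fun k hk => ?_) fun k hk hk' => ?_
    · simp only [Finset.mem_insert, Finset.mem_singleton] at hk
      rw [Finset.mem_range]
      omega
    · simp only [Finset.mem_insert, Finset.mem_singleton, Finset.mem_range] at hk hk'
      exact hzero k (by omega) (by omega)
  have hcard : ∑ k ∈ ({0, 1, 2, K - 2, K - 1, K} : Finset ℕ), f k ≤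
      6 * (16 * K * edgeEnergy w K) := by
    refine (Finset.sum_le_card_nsmul _ _ (16 * K * edgeEnergy w K) fun k hk => hle k ?_).trans ?_
    · simp only [Finset.mem_insert, Finset.mem_singleton] at hk
      omega
    · rw [nsmul_eq_mul]
      gcongr
      exact_mod_cast Finset.card_le_six
  rw [hsub] at hsum
  linarith

theorem tendsto_integral_etaAcc_recovery {bc : BoundaryCondition V}
    (h : bc.HoldsFor (curvePos a b w) (curveVel b w)) {K : ℕ → ℕ} (hK : Tendsto K atTop atTop) :
    Tendsto (fun n => ∫ s, ‖bc.etaAcc (bc.recovery (curvePos a b w) (curveVel b w) (K n)) s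
      - w s‖ ^ 2 ∂unitMeasure) atTop (𝓝 0) := by
  have h1 := ((tendsto_edgeEnergy hw hK).const_mul 192).add
    ((tendsto_integral_etaAcc_sample a b hw hK).const_mul 2)
  simp only [mul_zero, add_zero] at h1
  refine tendsto_of_tendsto_of_tendsto_of_le_of_le' tendsto_const_nhds h1
    (Eventually.of_forall fun n => integral_nonneg fun _ => by positivity) ?_
  filter_upwards [hK.eventually_ge_atTop 3] with n hn
  have h2 := integral_norm_etaAcc_recovery_sub_sq_le a b hw hn h
  have m1 := bc.memLp_etaAcc (bc.recovery (curvePos a b w) (curveVel b w) (K n))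
  have m2 := BoundaryCondition.natural.memLp_etaAcc (sample (K n) (curvePos a b w))
  generalize bc.etaAcc (bc.recovery (curvePos a b w) (curveVel b w) (K n)) = f at *
  generalize BoundaryCondition.natural.etaAcc (sample (K n) (curvePos a b w)) = g at *
  have i1 : Integrable (fun s => 2 * ‖f s - g s‖ ^ 2) unitMeasure :=
    ((m1.sub m2).integrable_norm_pow (p := 2) (by norm_num)).const_mul 2
  have i2 : Integrable (fun s => 2 * ‖g s - w s‖ ^ 2) unitMeasure :=
    ((m2.sub hw).integrable_norm_pow (p := 2) (by norm_num)).const_mul 2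
  have h3 : ∫ s, ‖f s - w s‖ ^ 2 ∂unitMeasure ≤
      ∫ s, (2 * ‖f s - g s‖ ^ 2 + 2 * ‖g s - w s‖ ^ 2) ∂unitMeasure := by
    refine integral_mono ((m1.sub hw).integrable_norm_pow (p := 2) (by norm_num)) (i1.add i2)
      fun s => ?_
    have ht := norm_sub_le_norm_sub_add_norm_sub (f s) (g s) (w s)
    have hsq := pow_le_pow_left₀ (norm_nonneg _) ht 2
    simp only
    nlinarith [sq_nonneg (‖f s - g s‖ - ‖g s - w s‖)]
  rw [integral_add i1 i2, integral_const_mul, integral_const_mul] at h3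
  linarith

/-- Multiplying an error `√(K⁻³ E)` by `K` leaves `√(E/K)`. The first term is the deviation of a
difference quotient from the velocity within the same cell, the second the correction of two nodes.
-/
theorem norm_velNode_recovery_sub_le (bc : BoundaryCondition V) {K : ℕ} {k : ℕ} (hk : 1 ≤ k)
    (hkK : k ≤ K) {s : ℝ} (h1 : ((k - 1 : ℕ) : ℝ) / K ≤ s) (h2 : s ≤ k / K) :
    ‖velNode (bc.recovery (curvePos a b w) (curveVel b w) K) k - curveVel b w s‖ ≤
      √((∫ r, ‖w r‖ ^ 2 ∂unitMeasure) / K) + 2 * √(edgeEnergy w K / K) := by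
  have hKp : 0 < K := by omega
  have hK0 : (0 : ℝ) < K := by exact_mod_cast hKp
  have hcorr := norm_endCorrection_le a b hw bc hKp
  have ek : ((k - 1 : ℕ) : ℝ) / K + (K : ℝ)⁻¹ = k / K := by
    rw [Nat.cast_sub hk]; field_simp; simp
  have hd := norm_difference_sub_smul_sq_le a b hw (τ := (K : ℝ)⁻¹) h1 (by rwa [ek])
  rw [ek] at hd
  have hi := integral_norm_sq_indicator_le hw (s := ((k - 1 : ℕ) : ℝ) / K) (t := k / K)
    (h1.trans h2)
  have hscale : ∀ E : ℝ, (K : ℝ) * √(((K : ℝ)⁻¹) ^ 3 * E) = √(E / K) := fun E => by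
    rw [← Real.sqrt_sq hK0.le, ← Real.sqrt_mul (by positivity), Real.sqrt_sq hK0.le]
    congr 1
    field_simp
  have hd' := Real.le_sqrt_of_sq_le (hd.trans (mul_le_mul_of_nonneg_left hi (by positivity)))
  have e : velNode (bc.recovery (curvePos a b w) (curveVel b w) K) k - curveVel b w s =
      (K : ℝ) • ((curvePos a b w (k / K) - curvePos a b w (((k - 1 : ℕ) : ℝ) / K)
        - (K : ℝ)⁻¹ • curveVel b w s) +
        (bc.endCorrection (curvePos a b w) (curveVel b w) K k -
        bc.endCorrection (curvePos a b w) (curveVel b w) K (k - 1))) := by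
    rw [velNode, BoundaryCondition.node_recovery hkK, BoundaryCondition.node_recovery (by omega)]
    match_scalars <;> field_simp
  rw [e, norm_smul, Real.norm_of_nonneg hK0.le, ← hscale, ← hscale]
  have h3 := norm_add_le (curvePos a b w (k / K) - curvePos a b w (((k - 1 : ℕ) : ℝ) / K)
        - (K : ℝ)⁻¹ • curveVel b w s)
        (bc.endCorrection (curvePos a b w) (curveVel b w) K k -
        bc.endCorrection (curvePos a b w) (curveVel b w) K (k - 1))
  have h4 := norm_sub_le (bc.endCorrection (curvePos a b w) (curveVel b w) K k)
    (bc.endCorrection (curvePos a b w) (curveVel b w) K (k - 1))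
  have h5 := hcorr k
  have h6 := hcorr (k - 1)
  calc _ ≤ (K : ℝ) * (√(((K : ℝ)⁻¹) ^ 3 * ∫ r, ‖w r‖ ^ 2 ∂unitMeasure) +
        2 * √(((K : ℝ)⁻¹) ^ 3 * edgeEnergy w K)) := by
        gcongr
        linarith
    _ = _ := by ring

end Estimates

end Recovery

end RiemSpline

namespace RiemSpline

/-! ### Bounds and norm convergence of recovery sequences -/

section RecoverySequence

variable {V : Type*} [NormedAddCommGroup V] [InnerProductSpace ℝ V] [CompleteSpace V]

/-- The recovery sequence of the curve with data `x`. -/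
noncomputable def BoundaryCondition.recoveryOf (bc : BoundaryCondition V) (x : V × V × L2 V)
    (K : ℕ) : Fin (K + 1) → V :=
  bc.recovery (curvePos x.1 x.2.1 x.2.2) (curveVel x.2.1 x.2.2) K

variable {bc : BoundaryCondition V} {x : V × V × L2 V}

theorem exists_isBoundedDiscrete_recoveryOf
    (hx : bc.HoldsFor (curvePos x.1 x.2.1 x.2.2) (curveVel x.2.1 x.2.2)) {K : ℕ → ℕ}
    (hK : Tendsto K atTop atTop) :
    ∃ M, ∀ᶠ n in atTop, IsBoundedDiscrete bc M (bc.recoveryOf x (K n)) := by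
  have hw : MemLp x.2.2 2 unitMeasure := Lp.memLp x.2.2
  have hi := L2_integrable x.2.2
  obtain ⟨C, hC⟩ := isCompact_Icc.exists_bound_of_continuousOn
    ((continuous_curvePos x.1 x.2.1 hi).continuousOn (s := Icc 0 1))
  obtain ⟨D, hD⟩ := isCompact_Icc.exists_bound_of_continuousOn
    ((continuous_curveVel x.2.1 hi).continuousOn (s := Icc 0 1))
  have hC0 := (norm_nonneg _).trans (hC 0 ⟨le_rfl, zero_le_one⟩)
  have hD0 := (norm_nonneg _).trans (hD 0 ⟨le_rfl, zero_le_one⟩)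
  obtain ⟨E, hE⟩ : ∃ E, E = ∫ r, ‖x.2.2 r‖ ^ 2 ∂unitMeasure := ⟨_, rfl⟩
  have hE0 : 0 ≤ E := hE ▸ integral_nonneg fun _ => by positivity
  refine ⟨C + D + (√E + 2) + 1 + (2 + 2 * E), ?_⟩
  filter_upwards [(tendsto_edgeEnergy hw hK).eventually (gt_mem_nhds one_pos),
    (tendsto_integral_etaAcc_recovery x.1 x.2.1 hw hx hK).eventually (gt_mem_nhds one_pos),
    hK.eventually_gt_atTop 0] with n h1 h2 hpos
  have hS := edgeEnergy_nonneg x.2.2 (K n)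
  have hK0 : (0 : ℝ) < K n := by exact_mod_cast hpos
  have hK1 : (1 : ℝ) ≤ K n := by exact_mod_cast hpos
  have hsE := Real.sqrt_nonneg E
  refine ⟨fun k hk => ?_, fun k hk => ?_, ?_⟩
  · rw [BoundaryCondition.recoveryOf, BoundaryCondition.node_recovery hk]
    have h3 := norm_endCorrection_le x.1 x.2.1 hw bc hpos k
    have h4 : √(((K n : ℝ)⁻¹) ^ 3 * edgeEnergy x.2.2 (K n)) ≤ 1 := by
      rw [Real.sqrt_le_left zero_le_one, one_pow]
      have : ((K n : ℝ)⁻¹) ^ 3 ≤ 1 := pow_le_one₀ (by positivity) (inv_le_one_of_one_le₀ hK1)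
      nlinarith
    have h5 := hC (k / K n) ⟨by positivity, (div_le_one hK0).2 (by exact_mod_cast hk)⟩
    refine (norm_add_le _ _).trans ?_
    linarith
  · rw [Finset.mem_Icc] at hk
    have h3 := norm_velNode_recovery_sub_le x.1 x.2.1 hw bc hk.1 hk.2 (s := k / K n)
      (by gcongr; omega) le_rfl
    have h5 := hD (k / K n) ⟨by positivity, (div_le_one hK0).2 (by exact_mod_cast hk.2)⟩
    rw [← hE] at h3
    have h6 : √(E / K n) ≤ √E := Real.sqrt_le_sqrt (div_le_self hE0 hK1)
    have h7 : √(edgeEnergy x.2.2 (K n) / K n) ≤ 1 := by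
      rw [Real.sqrt_le_left zero_le_one, one_pow]
      exact (div_le_self hS hK1).trans h1.le
    have h8 := norm_le_norm_add_norm_sub' (velNode (bc.recoveryOf x (K n)) k)
      (curveVel x.2.1 x.2.2 (k / K n))
    rw [BoundaryCondition.recoveryOf] at *
    linarith
  · rw [← bc.integral_norm_sq_etaAcc _ hpos]
    have m1 := bc.memLp_etaAcc (bc.recoveryOf x (K n))
    rw [BoundaryCondition.recoveryOf] at *
    generalize bc.etaAcc (bc.recovery (curvePos x.1 x.2.1 x.2.2) (curveVel x.2.1 x.2.2) (K n)) = f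
      at *
    have i1 : Integrable (fun s => 2 * ‖f s - x.2.2 s‖ ^ 2) unitMeasure :=
      ((m1.sub hw).integrable_norm_pow (p := 2) (by norm_num)).const_mul 2
    have i2 : Integrable (fun s => 2 * ‖x.2.2 s‖ ^ 2) unitMeasure :=
      (hw.integrable_norm_pow (p := 2) (by norm_num)).const_mul 2
    have h3 : ∫ s, ‖f s‖ ^ 2 ∂unitMeasure ≤
        ∫ s, (2 * ‖f s - x.2.2 s‖ ^ 2 + 2 * ‖x.2.2 s‖ ^ 2) ∂unitMeasure := by
      refine integral_mono (m1.integrable_norm_pow (p := 2) (by norm_num)) (i1.add i2) fun s => ?_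
      have ht := norm_le_norm_sub_add (f s) (x.2.2 s)
      have hsq := pow_le_pow_left₀ (norm_nonneg _) ht 2
      simp only
      nlinarith [sq_nonneg (‖f s - x.2.2 s‖ - ‖x.2.2 s‖)]
    rw [integral_add i1 i2, integral_const_mul, integral_const_mul, ← hE] at h3
    linarith

theorem exists_isBoundedSequence_recoveryOf
    (hx : bc.HoldsFor (curvePos x.1 x.2.1 x.2.2) (curveVel x.2.1 x.2.2)) {K : ℕ → ℕ}
    (hK : Tendsto K atTop atTop) :
    ∃ M N, IsBoundedSequence bc M (fun n => K (n + N)) fun n => bc.recoveryOf x (K (n + N)) := by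
  obtain ⟨M, hM⟩ := exists_isBoundedDiscrete_recoveryOf hx hK
  obtain ⟨N, hN⟩ := eventually_atTop.1 (hM.and (hK.eventually_ge_atTop 3))
  have hge : ∀ n, 3 ≤ K (n + N) := fun n => (hN _ (Nat.le_add_left _ _)).2
  exact ⟨M, N, hK.comp (tendsto_add_atTop_nat N), fun n => by have := hge n; omega,
    fun n => BoundaryCondition.holdsDiscrete_recovery (hge n) hx,
    fun n => (hN _ (Nat.le_add_left _ _)).1⟩

/-- Convergence in norm, not merely weak convergence, since the energy is only lower semicontinuous
under the latter. -/
theorem tendsto_etaData_recoveryOf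
    (hx : bc.HoldsFor (curvePos x.1 x.2.1 x.2.2) (curveVel x.2.1 x.2.2)) {K : ℕ → ℕ} {M : ℝ}
    (h : IsBoundedSequence bc M K fun n => bc.recoveryOf x (K n)) :
    Tendsto (fun n => bc.etaData (bc.recoveryOf x (K n))) atTop (𝓝 x) := by
  have hw : MemLp x.2.2 2 unitMeasure := Lp.memLp x.2.2
  have hm0 : ∀ n, midIndex (K n) 0 = 0 := fun n => by
    rw [midIndex]; norm_num
  have hKr : Tendsto (fun n => (K n : ℝ)) atTop atTop := tendsto_natCast_atTop_atTop.comp h.tendsto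
  refine Tendsto.prodMk_nhds ?_ (Tendsto.prodMk_nhds ?_ ?_)
  · refine tendsto_iff_norm_sub_tendsto_zero.2 (squeeze_zero' (Eventually.of_forall fun _ =>
      norm_nonneg _) ?_ (h.tendsto_div (2 * M)))
    filter_upwards [h.tendsto.eventually_ge_atTop 3] with n hn
    have h1 := (h.bdd n).norm_etaPos_sub_node_le (h.pos n) (h.holds n) le_rfl zero_le_one
    rw [hm0, BoundaryCondition.etaPos, curvePos_zero, BoundaryCondition.recoveryOf,
      BoundaryCondition.node_recovery (by omega),
      BoundaryCondition.endCorrection_eq_zero (by omega) (by omega)] at h1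
    simpa [BoundaryCondition.recoveryOf] using h1
  · have hS := tendsto_edgeEnergy hw h.tendsto
    have h1 : Tendsto (fun n => √(M / K n) + (√((∫ r, ‖x.2.2 r‖ ^ 2 ∂unitMeasure) / K n) +
        2 * √(edgeEnergy x.2.2 (K n) / K n))) atTop (𝓝 0) := by
      have h2 := (Real.continuous_sqrt.tendsto 0).comp
        ((tendsto_const_nhds (x := ∫ r, ‖x.2.2 r‖ ^ 2 ∂unitMeasure)).div_atTop hKr)
      have h3 := (Real.continuous_sqrt.tendsto 0).comp (hS.div_atTop hKr)
      have h4 := h.tendsto_sqrt.add (h2.add (h3.const_mul 2))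
      simpa using h4
    refine tendsto_iff_norm_sub_tendsto_zero.2 (squeeze_zero' (Eventually.of_forall fun _ =>
      norm_nonneg _) (Eventually.of_forall fun n => ?_) h1)
    have h2 := ((h.bdd n).norm_etaVel_sub_velNode_le (h.pos n) (h.holds n) le_rfl zero_le_one).2
      (by rw [hm0]; exact h.pos n)
    have h3 := norm_velNode_recovery_sub_le x.1 x.2.1 hw bc (K := K n) le_rfl (h.pos n) (s := 0)
      (by simp) (by positivity)
    rw [hm0, BoundaryCondition.etaVel, curveVel_zero] at h2
    rw [curveVel_zero] at h3
    exact (norm_sub_le_norm_sub_add_norm_sub _ _ _).trans (add_le_add h2 h3)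
  · have h1 := tendsto_integral_etaAcc_recovery x.1 x.2.1 hw hx h.tendsto
    have h2 := (Real.continuous_sqrt.tendsto 0).comp h1
    rw [Real.sqrt_zero] at h2
    refine tendsto_iff_norm_sub_tendsto_zero.2 (h2.congr fun n => ?_)
    rw [Function.comp_apply, eq_comm, ← Real.sqrt_sq (norm_nonneg _), L2_norm_sq]
    congr 1
    refine integral_congr_ae ?_
    filter_upwards [Lp.coeFn_sub ((bc.memLp_etaAcc (bc.recoveryOf x (K n))).toLp _) x.2.2,
      (bc.memLp_etaAcc (bc.recoveryOf x (K n))).coeFn_toLp] with s h1 h2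
    rw [h1, Pi.sub_apply, h2]
    rfl

omit [CompleteSpace V] in
-- A fixed interior time eventually satisfies `1 < K t_i < K - 1`, and the times `0`, `1` have the
-- indices `0`, `K`; hence the corrected nodes never carry an interpolation value.
theorem eventually_interpolatesDiscrete_recoveryOf {J : Type*} [Finite J] {t : J → ℝ}
    (ht : ∀ i, t i ∈ Icc (0 : ℝ) 1) {ybar : J → V}
    (hx : ∀ i, curvePos x.1 x.2.1 x.2.2 (t i) = ybar i) {K : ℕ → ℕ} (hK : Tendsto K atTop atTop)
    (hKt : ∀ n, CompatibleSteps t (K n)) :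
    ∀ᶠ n in atTop, InterpolatesDiscrete t ybar (bc.recoveryOf x (K n)) := by
  have hKr : Tendsto (fun n => (K n : ℝ)) atTop atTop := tendsto_natCast_atTop_atTop.comp hK
  refine eventually_all.2 fun i => ?_
  -- For `t i = 0` or `t i = 1` one threshold is `1 / 0 = 0` and carries no information; these cases
  -- are treated separately below.
  filter_upwards [hKr.eventually_gt_atTop (1 / t i), hKr.eventually_gt_atTop (1 / (1 - t i)),
    hK.eventually_ge_atTop 2] with n h0 h1 h2
  obtain ⟨k, hk⟩ := (hKt n).2 i
  have hK0 : (0 : ℝ) < K n := by exact_mod_cast (hKt n).1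
  have hkK : k ≤ K n := by
    have : (k : ℝ) ≤ K n := by rw [hk]; exact mul_le_of_le_one_right hK0.le (ht i).2
    exact_mod_cast this
  have n1 : k ≠ 1 := by
    rintro rfl
    rcases (ht i).1.eq_or_lt with h | h
    · rw [← h] at hk; simp at hk
    · rw [div_lt_iff₀ h, ← hk] at h0; simp at h0
  have n2 : k ≠ K n - 1 := by
    intro h
    have hk' : (k : ℝ) = K n - 1 := by rw [h, Nat.cast_sub (by omega)]; simp
    rcases (ht i).2.eq_or_lt with h | h
    · rw [h] at hk; linarith
    · rw [div_lt_iff₀ (by linarith)] at h1; nlinarith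
  refine ⟨k, hkK, hk, ?_⟩
  rw [BoundaryCondition.recoveryOf, BoundaryCondition.node_recovery hkK,
    BoundaryCondition.endCorrection_eq_zero n1 n2, ← hx i, hk, mul_div_cancel_left₀ _ hK0.ne',
    add_zero]

end RecoverySequence

end RiemSpline

namespace RiemSpline

/-! ### Upper estimates along norm convergent sequences -/

section LimsupInequality

variable {V Y : Type*} [NormedAddCommGroup V] [InnerProductSpace ℝ V] [CompleteSpace V]
  [NormedAddCommGroup Y] [NormedSpace ℝ Y]
  {ι : V →L[ℝ] Y} {gc : Y → Y →L[ℝ] Y →L[ℝ] ℝ} {Q : V →L[ℝ] V →L[ℝ] ℝ}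

namespace IsAdmissibleMetric

variable (hg : IsAdmissibleMetric ι gc Q)
include hg

omit [CompleteSpace V] in
theorem tendsto_integral_metric {F : ℝ → V} (hF : MemLp F 2 unitMeasure) {y : ℕ → ℝ → V}
    {y₀ : ℝ → V} (hy : ∀ n, AEStronglyMeasurable (y n) unitMeasure)
    (hlim : ∀ᵐ s ∂unitMeasure, Tendsto (fun n => ι (y n s)) atTop (𝓝 (ι (y₀ s)))) :
    Tendsto (fun n => ∫ s, metric ι gc Q (ι (y n s)) (F s) (F s) ∂unitMeasure) atTop
      (𝓝 (∫ s, metric ι gc Q (ι (y₀ s)) (F s) (F s) ∂unitMeasure)) := by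
  obtain ⟨c, Λ, L, hc, hΛ, hL, hcoer, hup, -⟩ := hg.exists_bounds
  refine tendsto_integral_of_dominated_convergence (fun s => Λ * ‖F s‖ ^ 2)
    (fun n => (hg.integrable_metric (hy n) hF hF).aestronglyMeasurable)
    ((hF.integrable_norm_pow (p := 2) (by norm_num)).const_mul Λ)
    (fun n => Eventually.of_forall fun s => ?_) ?_
  · rw [Real.norm_eq_abs, sq, ← mul_assoc]
    exact hup _ _ _
  · filter_upwards [hlim] with s hs
    exact ((hg.continuous_metric continuous_id continuous_const
      continuous_const).tendsto (ι (y₀ s))).comp hs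

omit [CompleteSpace V] in
/-- Upper semicontinuity of the quadratic functional along strongly converging sequences. -/
theorem eventually_integral_metric_ge {f : ℕ → ℝ → V} (hf : ∀ n, MemLp (f n) 2 unitMeasure)
    {F : L2 V} (hlimf : Tendsto (fun n => (hf n).toLp (f n)) atTop (𝓝 F)) {y : ℕ → ℝ → V}
    {y₀ : ℝ → V} (hy : ∀ n, AEStronglyMeasurable (y n) unitMeasure)
    (hlim : ∀ᵐ s ∂unitMeasure, Tendsto (fun n => ι (y n s)) atTop (𝓝 (ι (y₀ s)))) {ε : ℝ}
    (hε : 0 < ε) :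
    ∀ᶠ n in atTop, ∫ s, metric ι gc Q (ι (y n s)) (f n s) (f n s) ∂unitMeasure ≤
      ∫ s, metric ι gc Q (ι (y₀ s)) (F s) (F s) ∂unitMeasure + ε := by
  obtain ⟨c, Λ, L, hc, hΛ, hL, hcoer, hup, -⟩ := hg.exists_bounds
  have hFm : MemLp F 2 unitMeasure := Lp.memLp F
  obtain ⟨A, hA⟩ : ∃ A, A = ∫ s, metric ι gc Q (ι (y₀ s)) (F s) (F s) ∂unitMeasure := ⟨_, rfl⟩
  have hA0 : 0 ≤ A := hA ▸ integral_nonneg fun s => hg.metric_self_nonneg _ _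
  -- In Young's inequality the weight `1 + δ` on the limit may cost only a fraction of `ε`; the
  -- large weight `1 + δ⁻¹` multiplies a term tending to `0`.
  obtain ⟨δ, hδ, hδA⟩ : ∃ δ : ℝ, 0 < δ ∧ δ * A ≤ ε / 4 :=
    ⟨ε / (4 * (A + 1)), by positivity, by
      rw [div_mul_eq_mul_div, div_le_div_iff₀ (by positivity) (by positivity)]
      nlinarith⟩
  have h1 := ((hg.tendsto_integral_metric hFm hy hlim).const_mul (1 + δ)).add
    (((tendsto_iff_norm_sub_tendsto_zero.1 hlimf).pow 2).const_mul ((1 + δ⁻¹) * Λ))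
  rw [← hA] at h1
  have hlt := h1.eventually (gt_mem_nhds
    (show (1 + δ) * A + (1 + δ⁻¹) * Λ * 0 ^ 2 < A + ε by
      rw [zero_pow two_ne_zero, mul_zero]; linarith))
  rw [← hA]
  filter_upwards [hlt] with n hn
  refine le_trans ?_ hn.le
  have hD : MemLp (fun s => f n s - F s) 2 unitMeasure := (hf n).sub hFm
  have iF := hg.integrable_metric (hy n) hFm hFm
  have iD : Integrable (fun s => ‖f n s - F s‖ ^ 2) unitMeasure :=
    hD.integrable_norm_pow (p := 2) (by norm_num)
  have e : ‖(hf n).toLp (f n) - F‖ ^ 2 = ∫ s, ‖f n s - F s‖ ^ 2 ∂unitMeasure := by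
    rw [L2_norm_sq]
    refine integral_congr_ae ?_
    filter_upwards [Lp.coeFn_sub ((hf n).toLp (f n)) F, (hf n).coeFn_toLp] with s h1 h2
    rw [h1, Pi.sub_apply, h2]
  rw [e, ← integral_const_mul, ← integral_const_mul,
    ← integral_add (iF.const_mul _) (iD.const_mul _)]
  refine integral_mono (hg.integrable_metric (hy n) (hf n) (hf n))
    ((iF.const_mul _).add (iD.const_mul _)) fun s => ?_
  have h2 := hg.metric_add_self_le (ι (y n s)) (F s) (f n s - F s) hδ
  rw [add_sub_cancel] at h2
  have h3 := le_trans (le_abs_self _) (hup (ι (y n s)) (f n s - F s) (f n s - F s))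
  have h4 : 0 < 1 + δ⁻¹ := by positivity
  have h5 := mul_le_mul_of_nonneg_left h3 h4.le
  simp only
  linarith

end IsAdmissibleMetric

namespace IsBoundedSequence

variable {bc : BoundaryCondition V} {M : ℝ} {K : ℕ → ℕ} {p : ∀ n, Fin (K n + 1) → V}
  {x : V × V × L2 V} (h : IsBoundedSequence bc M K p)
include h

theorem eventually_splineQuadrature_le (hg : IsAdmissibleMetric ι gc Q)
    (hιc : IsCompactOperator ι) (hx : Tendsto (fun n => bc.etaData (p n)) atTop (𝓝 x)) {ε : ℝ}
    (hε : 0 < ε) :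
    ∀ᶠ n in atTop, splineQuadrature ι gc Q bc (p n) ≤
      ∫ s, metric ι gc Q (ι (curvePos x.1 x.2.1 x.2.2 s))
      (x.2.2 s + christoffel ι gc Q (curvePos x.1 x.2.1 x.2.2 s) (curveVel x.2.1 x.2.2 s)
        (curveVel x.2.1 x.2.2 s))
      (x.2.2 s + christoffel ι gc Q (curvePos x.1 x.2.1 x.2.2 s) (curveVel x.2.1 x.2.2 s)
        (curveVel x.2.1 x.2.2 s)) ∂unitMeasure + ε := by
  have hxw : WeaklyConverges (fun n => bc.etaData (p n)) x := fun f =>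
    (f.continuous.tendsto x).comp hx
  have hΓ : Continuous fun s => christoffel ι gc Q (curvePos x.1 x.2.1 x.2.2 s)
      (curveVel x.2.1 x.2.2 s) (curveVel x.2.1 x.2.2 s) :=
    hg.continuous_christoffel.comp ((continuous_curvePos x.1 x.2.1 (L2_integrable x.2.2)).prodMk
      (continuous_curveVel x.2.1 (L2_integrable x.2.2)))
  obtain ⟨C, hC, hCb⟩ := hg.exists_norm_covStep_le
  have hcs : ∀ n, MemLp (bc.covStep ι gc Q (p n)) 2 unitMeasure := fun n =>
    memLp_comp_midIndex (K n) _
  have hΓ2 := memLp_of_continuous hΓ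
  have hconv : Tendsto (fun n => (hcs n).toLp (bc.covStep ι gc Q (p n))) atTop
      (𝓝 (hΓ2.toLp _)) := by
    refine tendsto_toLp_of_ae_tendsto hcs hΓ2 (h := fun _ => C * M ^ 2) (memLp_const _)
      (fun n => ?_) ?_
    · filter_upwards [ae_restrict_mem measurableSet_Ioo] with s hs
      exact hCb bc M (p n) (h.pos n) (h.bdd n) s hs
    · filter_upwards [ae_restrict_mem measurableSet_Ioo] with s hs
      exact h.tendsto_covStep hg hιc hxw hs
  have hsum : Tendsto (fun n => ((bc.memLp_etaAcc (p n)).add (hcs n)).toLp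
      (bc.etaAcc (p n) + bc.covStep ι gc Q (p n))) atTop (𝓝 (x.2.2 + hΓ2.toLp _)) := by
    have h1 : Tendsto (fun n => (bc.etaData (p n)).2.2) atTop (𝓝 x.2.2) :=
      ((continuous_snd.comp continuous_snd).tendsto x).comp hx
    have e : (fun n => ((bc.memLp_etaAcc (p n)).add (hcs n)).toLp
        (bc.etaAcc (p n) + bc.covStep ι gc Q (p n))) = fun n =>
        (bc.memLp_etaAcc (p n)).toLp _ + (hcs n).toLp _ := funext fun n =>
          MemLp.toLp_add (bc.memLp_etaAcc (p n)) (hcs n)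
    rw [e]
    exact h1.add hconv
  have key := hg.eventually_integral_metric_ge (fun n => (bc.memLp_etaAcc (p n)).add (hcs n)) hsum
    (y := fun n s => node (p n) (midIndex (K n) s)) (y₀ := curvePos x.1 x.2.1 x.2.2)
    (fun n => (memLp_comp_midIndex (K n) (node (p n))).aestronglyMeasurable) ?_ hε
  · filter_upwards [key] with n hn
    rw [splineQuadrature_eq_integral (h.pos n) (h.holds n)]
    refine hn.trans_eq (congrArg (· + ε) (integral_congr_ae ?_))
    filter_upwards [Lp.coeFn_add x.2.2 (hΓ2.toLp _), hΓ2.coeFn_toLp] with s h1 h2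
    rw [h1, Pi.add_apply, h2]
  · filter_upwards [ae_restrict_mem measurableSet_Ioo] with s hs
    exact h.tendsto_of_weaklyConverges_node hιc (fun n => midIndex_le hs.2.le)
      (h.weaklyConverges_node hxw hs.1.le hs.2.le)

theorem eventually_pathQuadrature_le (hg : IsAdmissibleMetric ι gc Q)
    (hιc : IsCompactOperator ι) (hx : Tendsto (fun n => bc.etaData (p n)) atTop (𝓝 x)) {ε : ℝ}
    (hε : 0 < ε) :
    ∀ᶠ n in atTop, pathQuadrature ι gc Q (p n) ≤
      ∫ s, metric ι gc Q (ι (curvePos x.1 x.2.1 x.2.2 s))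
      (curveVel x.2.1 x.2.2 s) (curveVel x.2.1 x.2.2 s) ∂unitMeasure + ε := by
  have hxw : WeaklyConverges (fun n => bc.etaData (p n)) x := fun f =>
    (f.continuous.tendsto x).comp hx
  have hcv := continuous_curveVel x.2.1 (L2_integrable x.2.2)
  have hvm : ∀ n, MemLp (fun s => velNode (p n) (⌊(K n : ℝ) * s⌋₊ + 1)) 2 unitMeasure :=
    fun n => memLp_comp_floor (h.pos n) fun k => velNode (p n) (k + 1)
  have hst : Tendsto (fun n => (hvm n).toLp _) atTop (𝓝 (toL2 _ hcv)) := by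
    refine tendsto_toLp_of_ae_tendsto hvm (memLp_of_continuous hcv) (h := fun _ => M)
      (memLp_const _) (fun n => ?_) ?_
    · filter_upwards [ae_restrict_mem measurableSet_Ioo] with s hs
      exact (h.bdd n).vel_le _ (Finset.mem_Icc.2
        ⟨Nat.le_add_left _ _, floor_mul_lt (h.pos n) hs.2⟩)
    · filter_upwards [ae_restrict_mem measurableSet_Ioo] with s hs
      have h1 : Tendsto (fun n => bc.etaVel (p n) s) atTop (𝓝 (curveVel x.2.1 x.2.2 s)) := by
        have := ((evalVel V s).continuous.tendsto x).comp hx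
        simpa only [Function.comp_def, evalVel_apply, BoundaryCondition.curveVel_etaData] using this
      have h2 : Tendsto (fun n => velNode (p n) (⌊(K n : ℝ) * s⌋₊ + 1) - bc.etaVel (p n) s) atTop
          (𝓝 0) := by
        refine squeeze_zero_norm (fun n => ?_) h.tendsto_sqrt
        rw [norm_sub_rev]
        exact (h.bdd n).norm_etaVel_sub_velNode_floor_le (h.pos n) (h.holds n) hs.1.le hs.2
      have h3 := h2.add h1
      rw [zero_add] at h3
      exact h3.congr fun n => sub_add_cancel _ _
  have key := hg.eventually_integral_metric_ge hvm hst
    (y := fun n s => node (p n) ⌊(K n : ℝ) * s⌋₊) (y₀ := curvePos x.1 x.2.1 x.2.2)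
    (fun n => (memLp_comp_floor (h.pos n) (node (p n))).aestronglyMeasurable) ?_ hε
  · filter_upwards [key] with n hn
    rw [pathQuadrature_eq_integral (h.pos n)]
    refine hn.trans_eq (congrArg (· + ε) (integral_congr_ae ?_))
    filter_upwards [toL2_coe hcv] with s hs
    rw [hs]
  · filter_upwards [ae_restrict_mem measurableSet_Ioo] with s hs
    exact h.tendsto_of_weaklyConverges_node hιc (fun n => (floor_mul_lt (h.pos n) hs.2).le)
      (h.weaklyConverges_node_floor hxw hs.1.le hs.2)

end IsBoundedSequence

end LimsupInequality

end RiemSpline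

namespace RiemSpline

/-! ### Existence of a feasible curve -/

section FeasibleCurve

variable {V : Type*} [NormedAddCommGroup V] [NormedSpace ℝ V]

/-- Hermite interpolation by smooth curves. -/
theorem exists_contDiff_interpolating (S : Finset ℝ) (A B : ℝ → V) :
    ∃ c : ℝ → V, ContDiff ℝ 2 c ∧ ∀ s ∈ S, c s = A s ∧ deriv c s = B s := by
  induction S using Finset.induction_on with
  | empty => exact ⟨0, contDiff_const, by simp⟩
  | insert x S hx ih =>
    obtain ⟨c, hc, h⟩ := ih
    obtain ⟨P, hP⟩ : ∃ P : ℝ → ℝ, P = fun s => ∏ i ∈ S, (s - i) := ⟨_, rfl⟩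
    have hPc : ContDiff ℝ 2 P := by
      rw [hP]
      exact contDiff_prod fun i _ => contDiff_id.sub contDiff_const
    have hPS : ∀ s ∈ S, P s = 0 := fun s hs => by
      rw [hP]
      exact Finset.prod_eq_zero hs (sub_self s)
    have hPx : P x ≠ 0 := by
      rw [hP]
      exact Finset.prod_ne_zero_iff.2 fun i hi => sub_ne_zero.2 fun e => hx (e ▸ hi)
    have hd : ∀ (u v : V) (s : ℝ), HasDerivAt (fun s => c s + P s ^ 2 • (u + (s - x) • v))
        (deriv c s + (P s ^ 2 • v + (2 * P s * deriv P s) • (u + (s - x) • v))) s := by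
      intro u v s
      have h1 := ((hPc.differentiable (by norm_num)) s).hasDerivAt.pow 2
      have h2 : HasDerivAt (fun s : ℝ => u + (s - x) • v) v s := by
        simpa using (((hasDerivAt_id s).sub_const x).smul_const v).const_add u
      have h3 := ((hc.differentiable (by norm_num)) s).hasDerivAt.add (h1.smul h2)
      refine HasDerivAt.congr_deriv (f := fun s => c s + P s ^ 2 • (u + (s - x) • v)) h3 ?_
      simp
    -- As in Newton interpolation, the new term carries `P²`, which vanishes to second order at the
    -- old points. `u` corrects the value at `x`, and the vector multiplying `s - x` then corrects
    -- the derivative.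
    obtain ⟨u, hu⟩ : ∃ u, u = (P x ^ 2)⁻¹ • (A x - c x) := ⟨_, rfl⟩
    refine ⟨fun s => c s + P s ^ 2 • (u + (s - x) •
      ((P x ^ 2)⁻¹ • (B x - deriv c x - (2 * P x * deriv P x) • u))), ?_, fun s hs => ?_⟩
    · exact hc.add ((hPc.pow 2).smul (contDiff_const.add
        ((contDiff_id.sub contDiff_const).smul contDiff_const)))
    · rw [(hd _ _ s).deriv]
      rcases Finset.mem_insert.1 hs with rfl | hs
      · have h2 : P s ^ 2 ≠ 0 := pow_ne_zero _ hPx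
        constructor
        · simp only
          rw [sub_self, zero_smul, add_zero, hu, smul_inv_smul₀ h2, add_sub_cancel]
        · rw [sub_self, zero_smul, add_zero, smul_inv_smul₀ h2]
          abel
      · obtain ⟨h1, h2⟩ := h s hs
        constructor
        · simp [hPS s hs, h1]
        · simp [hPS s hs, h2]

end FeasibleCurve

section Feasible

variable {V : Type*} [NormedAddCommGroup V] [InnerProductSpace ℝ V] [CompleteSpace V]

theorem exists_data_of_contDiff {c : ℝ → V} (hc : ContDiff ℝ 2 c) :
    ∃ x : V × V × L2 V, (∀ s ∈ Icc (0 : ℝ) 1, curvePos x.1 x.2.1 x.2.2 s = c s) ∧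
      ∀ s ∈ Icc (0 : ℝ) 1, curveVel x.2.1 x.2.2 s = deriv c s := by
  have hc1 : ContDiff ℝ 1 (deriv c) := hc.deriv'
  have hw : Continuous (deriv (deriv c)) := hc1.continuous_deriv le_rfl
  have hvel : ∀ s ∈ Icc (0 : ℝ) 1, curveVel (deriv c 0) (deriv (deriv c)) s = deriv c s := by
    intro s hs
    have h1 : ∫ r in (0 : ℝ)..s, (Ioo (0 : ℝ) 1).indicator (deriv (deriv c)) r =
        ∫ r in (0 : ℝ)..s, deriv (deriv c) r := by
      rw [intervalIntegral.integral_of_le hs.1, intervalIntegral.integral_of_le hs.1,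
        integral_Ioc_eq_integral_Ioo, integral_Ioc_eq_integral_Ioo]
      refine setIntegral_congr_fun measurableSet_Ioo fun r hr => ?_
      rw [indicator_of_mem (mem_Ioo.2 ⟨hr.1, hr.2.trans_le hs.2⟩)]
    rw [curveVel, h1, intervalIntegral.integral_deriv_eq_sub
      (fun r _ => hc1.differentiable (by norm_num) r) (hw.intervalIntegrable _ _), add_sub_cancel]
  have hpos : ∀ s ∈ Icc (0 : ℝ) 1, curvePos (c 0) (deriv c 0) (deriv (deriv c)) s = c s := by
    intro s hs
    have h1 : ∫ r in (0 : ℝ)..s, curveVel (deriv c 0) (deriv (deriv c)) r =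
        ∫ r in (0 : ℝ)..s, deriv c r := by
      refine intervalIntegral.integral_congr fun r hr => ?_
      rw [uIcc_of_le hs.1] at hr
      exact hvel r ⟨hr.1, hr.2.trans hs.2⟩
    rw [curvePos, h1, intervalIntegral.integral_deriv_eq_sub
      (fun r _ => hc.differentiable (by norm_num) r) (hc1.continuous.intervalIntegrable _ _),
      add_sub_cancel]
  refine ⟨(c 0, deriv c 0, toL2 _ hw), fun s hs => ?_, fun s hs => ?_⟩
  · rw [curvePos_congr _ _ (toL2_coe hw), hpos s hs]
  · rw [curveVel_congr _ (toL2_coe hw), hvel s hs]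

theorem exists_feasible {N : ℕ} {t : Fin (N + 1) → ℝ} (ht : StrictMono t)
    (ht01 : ∀ i, t i ∈ Icc (0 : ℝ) 1) (ybar : Fin (N + 1) → V) {bc : BoundaryCondition V}
    (hbc : bc.Compatible t) :
    ∃ x : V × V × L2 V, (∀ i, curvePos x.1 x.2.1 x.2.2 (t i) = ybar i) ∧
      bc.HoldsFor (curvePos x.1 x.2.1 x.2.2) (curveVel x.2.1 x.2.2) := by
  -- All constraints concern values and derivatives at finitely many times, so it is enough to
  -- prescribe these consistently and interpolate.
  suffices h : ∃ A B : ℝ → V, (∀ i, A (t i) = ybar i) ∧ bc.HoldsFor A B by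
    obtain ⟨A, B, hA, hAB⟩ := h
    obtain ⟨c, hc, hS⟩ := exists_contDiff_interpolating
      (insert 0 (insert 1 (Finset.univ.image t))) A B
    obtain ⟨x, hx1, hx2⟩ := exists_data_of_contDiff hc
    have m0 : (0 : ℝ) ∈ Icc (0 : ℝ) 1 := ⟨le_rfl, zero_le_one⟩
    have m1 : (1 : ℝ) ∈ Icc (0 : ℝ) 1 := ⟨zero_le_one, le_rfl⟩
    have s0 := hS 0 (by simp)
    have s1 := hS 1 (by simp)
    refine ⟨x, fun i => ?_, ?_⟩
    · rw [hx1 _ (ht01 i), (hS (t i) (by simp)).1, hA]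
    · cases bc with
      | natural => trivial
      | hermite v₀ v₁ =>
        exact ⟨((hx2 0 m0).trans s0.2).trans hAB.1, ((hx2 1 m1).trans s1.2).trans hAB.2⟩
      | periodic =>
        exact ⟨((hx1 0 m0).trans s0.1).trans (hAB.1.trans ((hx1 1 m1).trans s1.1).symm),
          ((hx2 0 m0).trans s0.2).trans (hAB.2.trans ((hx2 1 m1).trans s1.2).symm)⟩
  have hval := ht.injective.extend_apply ybar 0
  cases bc with
  | natural => exact ⟨Function.extend t ybar 0, 0, hval, trivial⟩
  | hermite v₀ v₁ =>
    exact ⟨Function.extend t ybar 0, fun s => if s = 0 then v₀ else v₁, hval, by simp, by simp⟩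
  | periodic =>
    -- At most one of `0` and `1` is an interpolation time, and the extended data vanish at other
    -- times, so the sum is the value to be taken at both ends.
    refine ⟨fun s => if s = 0 ∨ s = 1 then Function.extend t ybar 0 0 + Function.extend t ybar 0 1
      else Function.extend t ybar 0 s, 0, fun i => ?_, by simp, rfl⟩
    have hnot : ¬ ((∃ i, t i = 0) ∧ ∃ j, t j = 1) := by
      rintro ⟨⟨i, hi⟩, j, hj⟩
      have h0 : t 0 = 0 := le_antisymm (hi ▸ ht.monotone (Fin.zero_le i)) (ht01 0).1
      have h1 : t (Fin.last N) = 1 :=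
        le_antisymm (ht01 _).2 (hj ▸ ht.monotone (Fin.le_last j))
      exact hbc.elim (fun h => h h0) fun h => h h1
    simp only
    split_ifs with h
    · rcases h with h | h
      · have : ¬ ∃ j, t j = 1 := fun h' => hnot ⟨⟨i, h⟩, h'⟩
        rw [Function.extend_apply' _ _ _ this, ← h, hval, Pi.zero_apply, add_zero]
      · have : ¬ ∃ j, t j = 0 := fun h' => hnot ⟨h', ⟨i, h⟩⟩
        rw [Function.extend_apply' _ _ _ this, ← h, hval, Pi.zero_apply, zero_add]
    · exact hval i

end Feasible

end RiemSpline

namespace RiemSpline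

/-! ### Continuous energy in terms of the data, liminf and limsup -/

section Energies

variable {V Y : Type*} [NormedAddCommGroup V] [InnerProductSpace ℝ V] [CompleteSpace V]
  [NormedAddCommGroup Y] [NormedSpace ℝ Y]
  {ι : V →L[ℝ] Y} {gc : Y → Y →L[ℝ] Y →L[ℝ] ℝ} {Q : V →L[ℝ] V →L[ℝ] ℝ}

variable (ι gc Q) in
/-- The regularized spline energy of the curve with data `x`. -/
noncomputable def curveEnergy (σ : ℝ) (x : V × V × L2 V) : ℝ :=
  ∫ s, metric ι gc Q (ι (curvePos x.1 x.2.1 x.2.2 s))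
    (x.2.2 s + christoffel ι gc Q (curvePos x.1 x.2.1 x.2.2 s) (curveVel x.2.1 x.2.2 s)
      (curveVel x.2.1 x.2.2 s))
    (x.2.2 s + christoffel ι gc Q (curvePos x.1 x.2.1 x.2.2 s) (curveVel x.2.1 x.2.2 s)
      (curveVel x.2.1 x.2.2 s)) ∂unitMeasure +
  σ * ∫ s, metric ι gc Q (ι (curvePos x.1 x.2.1 x.2.2 s))
    (curveVel x.2.1 x.2.2 s) (curveVel x.2.1 x.2.2 s) ∂unitMeasure

omit [CompleteSpace V] in
theorem curveEnergy_nonneg (hg : IsAdmissibleMetric ι gc Q) {σ : ℝ} (hσ : 0 ≤ σ)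
    (x : V × V × L2 V) : 0 ≤ curveEnergy ι gc Q σ x :=
  add_nonneg (integral_nonneg fun _ => hg.metric_self_nonneg _ _)
    (mul_nonneg hσ (integral_nonneg fun _ => hg.metric_self_nonneg _ _))

/-- The continuous functional in terms of the data of a feasible curve. -/
theorem continuousFunctional_sobolevOf (hg : IsAdmissibleMetric ι gc Q) {σ : ℝ} (hσ : 0 ≤ σ)
    {J : Type*} {t : J → ℝ} {ybar : J → V} (ht : ∀ i, t i ∈ Icc (0 : ℝ) 1)
    {bc : BoundaryCondition V} {x : V × V × L2 V}
    (hi : ∀ i, curvePos x.1 x.2.1 x.2.2 (t i) = ybar i)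
    (hx : bc.HoldsFor (curvePos x.1 x.2.1 x.2.2) (curveVel x.2.1 x.2.2)) :
    continuousFunctional ι gc Q σ t ybar bc (sobolevOf x) =
      ENNReal.ofReal (curveEnergy ι gc Q σ x) := by
  have hcc := continuous_curvePos x.1 x.2.1 (L2_integrable x.2.2)
  have hcv := continuous_curveVel x.2.1 (L2_integrable x.2.2)
  have hΓ : Continuous fun s => christoffel ι gc Q (curvePos x.1 x.2.1 x.2.2 s)
      (curveVel x.2.1 x.2.2 s) (curveVel x.2.1 x.2.2 s) :=
    hg.continuous_christoffel.comp (hcc.prodMk hcv)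
  have hcov : MemLp (fun s => x.2.2 s + christoffel ι gc Q (curvePos x.1 x.2.1 x.2.2 s)
      (curveVel x.2.1 x.2.2 s) (curveVel x.2.1 x.2.2 s)) 2 unitMeasure :=
    (Lp.memLp x.2.2).add (memLp_of_continuous hΓ)
  have e1 : pathEnergy ι gc Q (sobolevOf x) = ENNReal.ofReal
      (∫ s, metric ι gc Q (ι (curvePos x.1 x.2.1 x.2.2 s))
        (curveVel x.2.1 x.2.2 s) (curveVel x.2.1 x.2.2 s) ∂unitMeasure) := by
    rw [ofReal_integral_eq_lintegral_ofReal (hg.integrable_metric hcc.aestronglyMeasurable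
      (memLp_of_continuous hcv) (memLp_of_continuous hcv))
      (Eventually.of_forall fun s => hg.metric_self_nonneg _ _), pathEnergy]
    refine lintegral_congr_ae ?_
    filter_upwards [pos_sobolevOf x, vel_sobolevOf x] with s h1 h2
    rw [h1, h2]
  have e2 : splineEnergy ι gc Q (sobolevOf x) = ENNReal.ofReal
      (∫ s, metric ι gc Q (ι (curvePos x.1 x.2.1 x.2.2 s))
        (x.2.2 s + christoffel ι gc Q (curvePos x.1 x.2.1 x.2.2 s) (curveVel x.2.1 x.2.2 s)
          (curveVel x.2.1 x.2.2 s))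
        (x.2.2 s + christoffel ι gc Q (curvePos x.1 x.2.1 x.2.2 s) (curveVel x.2.1 x.2.2 s)
          (curveVel x.2.1 x.2.2 s)) ∂unitMeasure) := by
    rw [ofReal_integral_eq_lintegral_ofReal (hg.integrable_metric hcc.aestronglyMeasurable
      hcov hcov) (Eventually.of_forall fun s => hg.metric_self_nonneg _ _), splineEnergy]
    refine lintegral_congr_ae ?_
    filter_upwards [pos_sobolevOf x, vel_sobolevOf x] with s h1 h2
    rw [covAcc, h1, h2, acc_sobolevOf]
  have h0 : Interpolates t ybar (sobolevOf x) ∧ bc.Holds (sobolevOf x) :=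
    ⟨(interpolates_sobolevOf_iff ht ybar x).2 hi, (holds_sobolevOf_iff bc x).2 hx⟩
  rw [continuousFunctional, e1, e2, constraint, if_pos h0, add_zero,
    ← ENNReal.ofReal_mul hσ, ← ENNReal.ofReal_add, curveEnergy]
  · exact integral_nonneg fun _ => hg.metric_self_nonneg _ _
  · exact mul_nonneg hσ (integral_nonneg fun _ => hg.metric_self_nonneg _ _)

/-- Curves of finite energy are feasible. -/
theorem exists_data_of_continuousFunctional_ne_top {σ : ℝ} {J : Type*} {t : J → ℝ} {ybar : J → V}
    (ht : ∀ i, t i ∈ Icc (0 : ℝ) 1) {bc : BoundaryCondition V} {z : W22 V}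
    (hz : continuousFunctional ι gc Q σ t ybar bc z ≠ ⊤) :
    ∃ x, z = sobolevOf x ∧ (∀ i, curvePos x.1 x.2.1 x.2.2 (t i) = ybar i) ∧
      bc.HoldsFor (curvePos x.1 x.2.1 x.2.2) (curveVel x.2.1 x.2.2) := by
  obtain ⟨a, b, e⟩ := exists_eq_sobolevOf z
  have h : Interpolates t ybar z ∧ bc.Holds z := by
    by_contra hn
    rw [continuousFunctional, constraint, if_neg hn, add_top] at hz
    exact hz rfl
  rw [e] at h
  exact ⟨_, e, (interpolates_sobolevOf_iff ht ybar _).1 h.1, (holds_sobolevOf_iff bc _).1 h.2⟩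

variable {Wc : V × V → ℝ} {W : V → V → ℝ}

namespace IsBoundedSequence

variable {bc : BoundaryCondition V} {M : ℝ} {K : ℕ → ℕ} {p : ∀ n, Fin (K n + 1) → V}
  {x : V × V × L2 V} (h : IsBoundedSequence bc M K p) {mid : ℕ → ℕ → V}
include h

theorem eventually_energy_sub_le (hg : IsAdmissibleMetric ι gc Q)
    (hW : IsAdmissibleEnergy ι gc Q Wc W) {σ : ℝ} (hσ : 0 < σ)
    (hmid : ∀ n, ∀ k ∈ Finset.Icc 1 (bc.numMid (K n)),
      IsMidpoint W (node (p n) (k - 1)) (node (p n) (k + 1)) (mid n k)) {ε : ℝ} (hε : 0 < ε) :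
    ∀ᶠ n in atTop, |(splineEnergyDiscrete bc W (p n) (mid n) + σ * pathEnergyDiscrete W (p n)) -
      (splineQuadrature ι gc Q bc (p n) + σ * pathQuadrature ι gc Q (p n))| ≤ ε := by
  -- The consistency estimates ask for a positive bound, while `M` may be `0`.
  have hM : 0 < M + 1 := by have := h.nonneg; linarith
  have hb : ∀ n, IsBoundedDiscrete bc (M + 1) (p n) := fun n =>
    ⟨fun k hk => ((h.bdd n).node_le k hk).trans (by linarith),
      fun k hk => ((h.bdd n).vel_le k hk).trans (by linarith), (h.bdd n).acc_le.trans (by linarith)⟩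
  obtain ⟨K₁, h1⟩ := hW.pathEnergyDiscrete_consistent hg hM (ε := ε / (2 * σ)) (by positivity)
  obtain ⟨K₂, h2⟩ := hW.splineEnergyDiscrete_consistent hg hM (ε := ε / 2) (by positivity)
  filter_upwards [h.tendsto.eventually_ge_atTop K₁, h.tendsto.eventually_ge_atTop K₂] with n n1 n2
  have a1 := h1 (K n) n1 bc (p n) (hb n)
  have a2 := h2 (K n) n2 bc (p n) (mid n) (hb n) (hmid n)
  have a3 := mul_le_mul_of_nonneg_left a1 hσ.le
  have e : σ * (ε / (2 * σ)) = ε / 2 := by field_simp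
  rw [e, ← abs_of_pos hσ, ← abs_mul] at a3
  rw [abs_le] at *
  constructor <;> linarith [a2.1, a2.2, a3.1, a3.2]

/-- The liminf inequality. -/
theorem eventually_curveEnergy_le (hg : IsAdmissibleMetric ι gc Q) (hιc : IsCompactOperator ι)
    (hW : IsAdmissibleEnergy ι gc Q Wc W) {σ : ℝ} (hσ : 0 < σ)
    (hmid : ∀ n, ∀ k ∈ Finset.Icc 1 (bc.numMid (K n)),
      IsMidpoint W (node (p n) (k - 1)) (node (p n) (k + 1)) (mid n k))
    (hx : WeaklyConverges (fun n => bc.etaData (p n)) x) {ε : ℝ} (hε : 0 < ε) :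
    ∀ᶠ n in atTop, curveEnergy ι gc Q σ x ≤
      splineEnergyDiscrete bc W (p n) (mid n) + σ * pathEnergyDiscrete W (p n) + ε := by
  filter_upwards [h.eventually_energy_sub_le hg hW hσ hmid (show 0 < ε / 3 by positivity),
    h.eventually_splineEnergy_le hg hιc hx (show 0 < ε / 3 by positivity),
    h.eventually_pathEnergy_le hg hιc hx (show 0 < ε / (3 * σ) by positivity)] with n h1 h2 h3
  have h4 := mul_le_mul_of_nonneg_left h3 hσ.le
  have e : σ * (ε / (3 * σ)) = ε / 3 := by field_simp
  rw [mul_add, e] at h4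
  rw [abs_le] at h1
  rw [curveEnergy]
  linarith [h1.1, h1.2]

/-- The limsup inequality. -/
theorem eventually_le_curveEnergy (hg : IsAdmissibleMetric ι gc Q) (hιc : IsCompactOperator ι)
    (hW : IsAdmissibleEnergy ι gc Q Wc W) {σ : ℝ} (hσ : 0 < σ)
    (hmid : ∀ n, ∀ k ∈ Finset.Icc 1 (bc.numMid (K n)),
      IsMidpoint W (node (p n) (k - 1)) (node (p n) (k + 1)) (mid n k))
    (hx : Tendsto (fun n => bc.etaData (p n)) atTop (𝓝 x)) {ε : ℝ} (hε : 0 < ε) :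
    ∀ᶠ n in atTop, splineEnergyDiscrete bc W (p n) (mid n) + σ * pathEnergyDiscrete W (p n) ≤
      curveEnergy ι gc Q σ x + ε := by
  filter_upwards [h.eventually_energy_sub_le hg hW hσ hmid (show 0 < ε / 3 by positivity),
    h.eventually_splineQuadrature_le hg hιc hx (show 0 < ε / 3 by positivity),
    h.eventually_pathQuadrature_le hg hιc hx (show 0 < ε / (3 * σ) by positivity)] with n h1 h2 h3
  have h4 := mul_le_mul_of_nonneg_left h3 hσ.le
  have e : σ * (ε / (3 * σ)) = ε / 3 := by field_simp
  rw [mul_add, e] at h4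
  rw [abs_le] at h1
  rw [curveEnergy]
  linarith [h1.1, h1.2]

end IsBoundedSequence

end Energies

/-! ### Reduction of the lifted functionals to one discrete curve -/

section DiscreteFunctional

variable {V : Type*} [NormedAddCommGroup V] [InnerProductSpace ℝ V] [CompleteSpace V]
  {bc : BoundaryCondition V} {K : ℕ} {u : W22 V} {p : Fin (K + 1) → V}

omit [CompleteSpace V] in
-- Injectivity of the interpolation leaves a single discrete curve in the infimum, so that energy
-- and constraint are evaluated at the same one.
theorem liftDiscrete_eq (hK : 2 ≤ K) (hu : pos u =ᵐ[unitMeasure] bc.eta p)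
    (G : (Fin (K + 1) → V) → ℝ≥0∞) : liftDiscrete bc G u = G p := by
  refine le_antisymm (iInf₂_le p hu) (le_iInf₂ fun q hq => ?_)
  rw [bc.eta_injective hK (hu.symm.trans hq)]

variable {J : Type*} {t : J → ℝ} {ybar : J → V} {W : V → V → ℝ} {σ : ℝ}
  {m : (K : ℕ) → (Fin (K + 1) → V) → ℕ → V}

theorem discreteFunctional_eq (hK : 2 ≤ K) (hu : pos u =ᵐ[unitMeasure] bc.eta p)
    (hi : InterpolatesDiscrete t ybar p) (hp : bc.HoldsDiscrete p) :
    discreteFunctional t ybar bc W σ m K u =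
      ENNReal.ofReal (splineEnergyDiscrete bc W p (m K p) + σ * pathEnergyDiscrete W p) := by
  rw [discreteFunctional, liftDiscrete_eq hK hu, liftDiscrete_eq hK hu, constraintDiscrete,
    if_pos ⟨hi, hp⟩, add_zero, regSplineEnergyDiscrete]

omit [CompleteSpace V] in
theorem exists_of_discreteFunctional_ne_top
    (hu : discreteFunctional t ybar bc W σ m K u ≠ ⊤) :
    ∃ p : Fin (K + 1) → V, pos u =ᵐ[unitMeasure] bc.eta p ∧ InterpolatesDiscrete t ybar p ∧
      bc.HoldsDiscrete p := by
  have h : liftDiscrete bc (constraintDiscrete (K := K) t ybar bc) u ≠ ⊤ := fun h => by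
    rw [discreteFunctional, h, add_top] at hu
    exact hu rfl
  by_contra! hn
  refine h (iInf₂_eq_top.2 fun p hp => if_neg fun hc => ?_)
  exact hn p hp hc.1 hc.2

end DiscreteFunctional

end RiemSpline

namespace RiemSpline

/-! ### Equicoercivity and convergence of minimizers -/

section Equicoercivity

variable {V Y : Type*} [NormedAddCommGroup V] [InnerProductSpace ℝ V] [CompleteSpace V]
  [NormedAddCommGroup Y] [NormedSpace ℝ Y]
  {ι : V →L[ℝ] Y} {gc : Y → Y →L[ℝ] Y →L[ℝ] ℝ} {Q : V →L[ℝ] V →L[ℝ] ℝ}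
  {Wc : V × V → ℝ} {W : V → V → ℝ} {σ : ℝ} {N : ℕ} {t : Fin (N + 1) → ℝ} {ybar : Fin (N + 1) → V}
  {bc : BoundaryCondition V} {m : (K : ℕ) → (Fin (K + 1) → V) → ℕ → V} {K : ℕ → ℕ}

/-- Sequences with bounded energy stem from discrete curves with a uniform `W^{2,2}` bound. -/
theorem exists_isBoundedSequence (hg : IsAdmissibleMetric ι gc Q)
    (hW : IsAdmissibleEnergy ι gc Q Wc W) (hσ : 0 < σ) (hm : IsMidpointChoice bc W m)
    (hK : Tendsto K atTop atTop) {y : ℕ → W22 V} {C : ℝ}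
    (hy : ∀ᶠ n in atTop, discreteFunctional t ybar bc W σ m (K n) (y n) ≤ ENNReal.ofReal C) :
    ∃ M n₀, ∃ p : ∀ n, Fin (K (n + n₀) + 1) → V,
      IsBoundedSequence bc M (fun n => K (n + n₀)) p ∧
      (∀ n, InterpolatesDiscrete t ybar (p n)) ∧
      (∀ n, y (n + n₀) = sobolevOf (bc.etaData (p n))) ∧
      ∀ n, discreteFunctional t ybar bc W σ m (K (n + n₀)) (y (n + n₀)) =
        ENNReal.ofReal (splineEnergyDiscrete bc W (p n) (m _ (p n)) +
          σ * pathEnergyDiscrete W (p n)) := by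
  -- The first interpolation condition provides the one node whose norm must be known in advance.
  obtain ⟨M, hM, K₀, hb⟩ := hW.exists_isBoundedDiscrete hg hσ (max C ‖ybar 0‖)
  obtain ⟨n₀, hn₀⟩ := eventually_atTop.1
    (hy.and ((hK.eventually_ge_atTop 2).and (hK.eventually_ge_atTop K₀)))
  have hn := fun n => hn₀ (n + n₀) (Nat.le_add_left _ _)
  choose p hp hi hh using fun n => exists_of_discreteFunctional_ne_top
    (ne_top_of_le_ne_top ENNReal.ofReal_ne_top (hn n).1)
  have hF := fun n => discreteFunctional_eq (W := W) (σ := σ) (m := m) (hn n).2.1 (hp n) (hi n)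
    (hh n)
  have hpos : ∀ n, 0 < K (n + n₀) := fun n => by have := (hn n).2.1; omega
  refine ⟨M, n₀, p, ⟨hK.comp (tendsto_add_atTop_nat n₀), hpos, hh, fun n => ?_⟩, hi,
    fun n => BoundaryCondition.eq_sobolevOf_etaData (hpos n) (hh n) (hp n), hF⟩
  refine hb _ (hn n).2.2 bc (p n) (m _ (p n)) (hm _ (p n)) (hh n) ?_ ?_
  · obtain ⟨k, hk, -, e⟩ := hi n 0
    exact ⟨k, hk, by rw [e]; exact le_max_right _ _⟩
  · have h0 : 0 ≤ splineEnergyDiscrete bc W (p n) (m _ (p n)) + σ * pathEnergyDiscrete W (p n) :=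
      add_nonneg (hW.splineEnergyDiscrete_nonneg hg _ _ _)
        (mul_nonneg hσ.le (hW.pathEnergyDiscrete_nonneg hg _))
    have h1 := (hn n).1
    rw [hF] at h1
    -- `C` may be negative; the truncation in `ENNReal.ofReal` then leaves the case of a nonpositive
    -- energy.
    rcases ENNReal.ofReal_le_ofReal_iff'.1 h1 with h | h
    · exact h.trans (le_max_left _ _)
    · exact h.trans ((norm_nonneg _).trans (le_max_right _ _))

/-- The discrete functionals are asymptotically bounded along recovery sequences. -/
theorem eventually_exists_discreteFunctional_le (hg : IsAdmissibleMetric ι gc Q)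
    (hιc : IsCompactOperator ι) (hW : IsAdmissibleEnergy ι gc Q Wc W) (hσ : 0 < σ)
    (hm : IsMidpointChoice bc W m) (ht01 : ∀ i, t i ∈ Icc (0 : ℝ) 1) (hK : Tendsto K atTop atTop)
    (hKt : ∀ n, CompatibleSteps t (K n)) {x : V × V × L2 V}
    (hi : ∀ i, curvePos x.1 x.2.1 x.2.2 (t i) = ybar i)
    (hx : bc.HoldsFor (curvePos x.1 x.2.1 x.2.2) (curveVel x.2.1 x.2.2)) {ε : ℝ} (hε : 0 < ε) :
    ∀ᶠ n in atTop, ∃ u, discreteFunctional t ybar bc W σ m (K n) u ≤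
      ENNReal.ofReal (curveEnergy ι gc Q σ x + ε) := by
  obtain ⟨M, n₀, h⟩ := exists_isBoundedSequence_recoveryOf hx hK
  have h1 := h.eventually_le_curveEnergy hg hιc hW hσ
    (mid := fun n => m (K (n + n₀)) (bc.recoveryOf x (K (n + n₀)))) (fun n => hm _ _)
    (tendsto_etaData_recoveryOf hx h) hε
  have h2 := (tendsto_add_atTop_nat n₀).eventually
    (eventually_interpolatesDiscrete_recoveryOf (bc := bc) ht01 hi hK hKt)
  have key : ∀ᶠ n in atTop, ∃ u, discreteFunctional t ybar bc W σ m (K (n + n₀)) u ≤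
      ENNReal.ofReal (curveEnergy ι gc Q σ x + ε) := by
    filter_upwards [h1, h2, h.tendsto.eventually_ge_atTop 2] with n h1 h2 h3
    refine ⟨sobolevOf (bc.etaData (bc.recoveryOf x (K (n + n₀)))), ?_⟩
    rw [discreteFunctional_eq h3 (BoundaryCondition.pos_sobolevOf_etaData (h.pos n) (h.holds n)) h2
      (h.holds n)]
    exact ENNReal.ofReal_le_ofReal h1
  obtain ⟨n₁, hn₁⟩ := eventually_atTop.1 key
  -- The recovery sequence is known to be bounded only after an index shift `n₀`, which is undone
  -- here.
  refine eventually_atTop.2 ⟨n₁ + n₀, fun n hn => ?_⟩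
  have := hn₁ (n - n₀) (by omega)
  rwa [Nat.sub_add_cancel (by omega)] at this

variable [TopologicalSpace.SeparableSpace V]

/-- Weak limits are taken for the data triples and transported by the bounded linear map `sobolevL`.
The discrete curves are retained because the liminf inequality refers to them. -/
theorem exists_subseq_weaklyConverges_of_bounded (hg : IsAdmissibleMetric ι gc Q)
    (hW : IsAdmissibleEnergy ι gc Q Wc W) (hσ : 0 < σ) (hm : IsMidpointChoice bc W m)
    (hK : Tendsto K atTop atTop) {y : ℕ → W22 V} {C : ℝ}
    (hy : ∀ᶠ n in atTop, discreteFunctional t ybar bc W σ m (K n) (y n) ≤ ENNReal.ofReal C) :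
    ∃ φ : ℕ → ℕ, StrictMono φ ∧ ∃ M, ∃ p : ∀ n, Fin (K (φ n) + 1) → V, ∃ x,
      IsBoundedSequence bc M (fun n => K (φ n)) p ∧
      WeaklyConverges (fun n => bc.etaData (p n)) x ∧
      WeaklyConverges (fun n => y (φ n)) (sobolevOf x) ∧
      (∀ n, InterpolatesDiscrete t ybar (p n)) ∧
      ∀ n, discreteFunctional t ybar bc W σ m (K (φ n)) (y (φ n)) =
        ENNReal.ofReal (splineEnergyDiscrete bc W (p n) (m _ (p n)) +
          σ * pathEnergyDiscrete W (p n)) := by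
  obtain ⟨M, n₀, p, h, hi, hyp, hF⟩ := exists_isBoundedSequence hg hW hσ hm hK hy
  obtain ⟨φ, hφ, x, hx⟩ := h.exists_subseq
  refine ⟨fun n => φ n + n₀, fun a b hab => Nat.add_lt_add_right (hφ hab) n₀, M,
    fun n => p (φ n), x, h.comp hφ, hx, ?_, fun n => hi _, fun n => hF _⟩
  have := hx.map (sobolevL V)
  simpa only [sobolevL_apply, ← hyp] using this

/-- Weak limits of minimizers of the discrete functionals minimize the continuous functional. -/
theorem exists_subseq_minimizers (hg : IsAdmissibleMetric ι gc Q) (hιc : IsCompactOperator ι)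
    (hW : IsAdmissibleEnergy ι gc Q Wc W) (hσ : 0 < σ) (hm : IsMidpointChoice bc W m)
    (ht : StrictMono t) (ht01 : ∀ i, t i ∈ Icc (0 : ℝ) 1) (hbc : bc.Compatible t)
    (hK : Tendsto K atTop atTop) (hKt : ∀ n, CompatibleSteps t (K n)) {y : ℕ → W22 V}
    (hy : ∀ n, IsMinimizer (discreteFunctional t ybar bc W σ m (K n)) (y n)) :
    ∃ φ : ℕ → ℕ, StrictMono φ ∧ ∃ y₀ : W22 V, WeaklyConverges (fun n => y (φ n)) y₀ ∧
      IsMinimizer (continuousFunctional ι gc Q σ t ybar bc) y₀ := by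
  have hup : ∀ {x : V × V × L2 V}, (∀ i, curvePos x.1 x.2.1 x.2.2 (t i) = ybar i) →
      bc.HoldsFor (curvePos x.1 x.2.1 x.2.2) (curveVel x.2.1 x.2.2) → ∀ {ε : ℝ}, 0 < ε →
      ∀ᶠ n in atTop, discreteFunctional t ybar bc W σ m (K n) (y n) ≤
        ENNReal.ofReal (curveEnergy ι gc Q σ x + ε) := fun {x} hi hx {ε} hε => by
    filter_upwards [eventually_exists_discreteFunctional_le hg hιc hW hσ hm ht01 hK hKt hi hx hε]
      with n ⟨u, hu⟩
    exact (hy n u).trans hu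
  -- The recovery sequence of any feasible curve bounds the minimal values, which makes the
  -- compactness statement applicable to the minimizers.
  obtain ⟨x₀, hi₀, hx₀⟩ := exists_feasible ht ht01 ybar hbc
  obtain ⟨φ, hφ, M, p, x, h, hx, hyx, hi, hF⟩ :=
    exists_subseq_weaklyConverges_of_bounded hg hW hσ hm hK (hup hi₀ hx₀ one_pos)
  refine ⟨φ, hφ, sobolevOf x, hyx, fun z => ?_⟩
  rw [continuousFunctional_sobolevOf hg hσ.le ht01 (h.interpolates_limit hx hi)
    (h.holdsFor_limit hx)]
  by_cases hz : continuousFunctional ι gc Q σ t ybar bc z = ⊤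
  · rw [hz]; exact le_top
  obtain ⟨x', rfl, hi', hx'⟩ := exists_data_of_continuousFunctional_ne_top ht01 hz
  rw [continuousFunctional_sobolevOf hg hσ.le ht01 hi' hx']
  refine ENNReal.ofReal_le_ofReal (le_of_forall_pos_le_add fun ε hε => ?_)
  -- The liminf inequality along the subsequence and the upper bound by the competitor `x'` hold
  -- simultaneously for some index, each at the cost of `ε / 2`.
  have h1 := h.eventually_curveEnergy_le hg hιc hW hσ (mid := fun n => m _ (p n))
    (fun n => hm _ _) hx (half_pos hε)
  obtain ⟨n, h1, h2⟩ := (h1.and (hφ.tendsto_atTop.eventually (hup hi' hx' (half_pos hε)))).exists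
  rw [hF, ENNReal.ofReal_le_ofReal_iff
    (add_nonneg (curveEnergy_nonneg hg hσ.le x') (half_pos hε).le)] at h2
  linarith

end Equicoercivity

end RiemSpline

theorem theorem4p7
    {V Y : Type*} [NormedAddCommGroup V] [InnerProductSpace ℝ V] [CompleteSpace V]
    [TopologicalSpace.SeparableSpace V]
    [NormedAddCommGroup Y] [NormedSpace ℝ Y] [CompleteSpace Y]
    -- the admissible manifold: `V` compactly embedded in `Y`
    (ι : V →L[ℝ] Y) (hι : Function.Injective ι) (hιc : IsCompactOperator ι)
    -- the admissible metric and the admissible energy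
    (gc : Y → Y →L[ℝ] Y →L[ℝ] ℝ) (Q : V →L[ℝ] V →L[ℝ] ℝ)
    (hg : RiemSpline.IsAdmissibleMetric ι gc Q)
    (Wc : V × V → ℝ) (W : V → V → ℝ) (hW : RiemSpline.IsAdmissibleEnergy ι gc Q Wc W)
    (σ : ℝ) (hσ : 0 < σ)
    -- interpolation data and boundary condition
    {N : ℕ} (t : Fin (N + 1) → ℝ) (ht : StrictMono t) (ht01 : ∀ i, t i ∈ Set.Icc (0 : ℝ) 1)
    (ybar : Fin (N + 1) → V) (bc : RiemSpline.BoundaryCondition V) (hbc : bc.Compatible t)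
    -- any choice of the auxiliary points among the minimizers
    (m : (K : ℕ) → (Fin (K + 1) → V) → ℕ → V) (hm : RiemSpline.IsMidpointChoice bc W m)
    -- integers tending to infinity for which all `K tᵢ` are integers
    (K : ℕ → ℕ) (hK : Filter.Tendsto K Filter.atTop Filter.atTop)
    (hKt : ∀ n, RiemSpline.CompatibleSteps t (K n)) :
    (∀ y : ℕ → RiemSpline.W22 V,
      (∃ C : NNReal, ∀ n, RiemSpline.discreteFunctional t ybar bc W σ m (K n) (y n) ≤ C) →
      ∃ φ : ℕ → ℕ, StrictMono φ ∧ ∃ y₀ : RiemSpline.W22 V,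
        RiemSpline.WeaklyConverges (fun n => y (φ n)) y₀) ∧
    (∀ y : ℕ → RiemSpline.W22 V,
      (∀ n, RiemSpline.IsMinimizer
        (RiemSpline.discreteFunctional t ybar bc W σ m (K n)) (y n)) →
      ∃ φ : ℕ → ℕ, StrictMono φ ∧ ∃ y₀ : RiemSpline.W22 V,
        RiemSpline.WeaklyConverges (fun n => y (φ n)) y₀ ∧
        RiemSpline.IsMinimizer
          (RiemSpline.continuousFunctional ι gc Q σ t ybar bc) y₀) := by
  refine ⟨fun y ⟨C, hC⟩ => ?_, fun y hy => RiemSpline.exists_subseq_minimizers hg hιc hW hσ hm ht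
    ht01 hbc hK hKt hy⟩
  obtain ⟨φ, hφ, -, -, x, -, -, hx, -⟩ := RiemSpline.exists_subseq_weaklyConverges_of_bounded
    hg hW hσ hm hK (C := C) (Filter.Eventually.of_forall fun n => (hC n).trans_eq
      (ENNReal.ofReal_coe_nnreal).symm)
  exact ⟨φ, hφ, _, hx⟩
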